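/- Let $n\ge 1$ and identify $\mathbb{C}^n$ with $\mathbb{R}^{2n}$, $z=x+iy\leftrightarrow(x,y)$. For $\lambda\in\mathbb{R}$ and $1\le j\le n$ put $$X_j(\lambda)=\frac{\partial}{\partial x_j}+\frac{i\lambda}{2}y_j,\qquad Y_j(\lambda)=\frac{\partial}{\partial y_j}-\frac{i\lambda}{2}x_j .$$ For a non-zero drift vector $\nu=(a,b)\in\mathbb{R}^n\times\mathbb{R}^n$ let $d\mu_\nu(x,y)=e^{2(a\cdot x+b\cdot y)}\,dx\,dy$ and $$L_{\nu,\lambda}=\sum_{j=1}^n\bigl(X_j(\lambda)^2+Y_j(\lambda)^2\bigr)+2\sum_{j=1}^n\bigl(a_jX_j(\lambda)+b_jY_j(\lambda)\bigr).$$ For $\lambda\ne0$ the closure in $L^2(\mathbb{C}^n,d\mu_\nu)$ of $-L_{\nu,\lambda}$, initially defined on $C_c^\infty(\mathbb{C}^n)$, is a positive self-adjoint operator with a bounded inverse, and $(-L_{\nu,\lambda})^{-k/2}$ is defined by the functional calculus. For a monomial $P_k(\lambda)=\theta_1(\lambda)\cdots\theta_k(\lambda)$ with each $\theta_l(\lambda)\in\{X_1(\lambda),\dots,X_n(\lambda),Y_1(\lambda),\dots,Y_n(\lambda)\}$,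 let $\mathcal{R}_{k,\nu,\lambda}=P_k(\lambda)(-L_{\nu,\lambda})^{-k/2}$ be the corresponding Riesz transform of order $k$, where $P_k(\lambda)$ acts in the sense of distributions. **Theorem.** For every $M>0$ and every $k\ge3$ there is a constant $C_{M,k}>0$ (depending only on $M$, $k$ and $n$) such that for all $\lambda\in\mathbb{R}$ and all $\nu\ne0$ with $|\lambda|/|\nu|^2\ge M$, and for all monomials $P_k(\lambda)$ of degree $k$ as above, the Riesz transform $\mathcal{R}_{k,\nu,\lambda}$, defined on $L^1(\mathbb{C}^n,d\mu_\nu)\cap L^2(\mathbb{C}^n,d\mu_\nu)$, extends to a linear operator from $L^1(\mathbb{C}^n,d\mu_\nu)$ to the (classes of) measurable functions on $\mathbb{C}^n$ that satisfies $$\alpha\,\mu_\nu\{z:|\mathcal{R}_{k,\nu,\lambda}f(z)|>\alpha\}\le C_{M,k}\int_{\mathbb{C}^n}|f|\,d\mu_\nu$$ for all $f\in L^1(\mathbb{C}^n,d\mu_\nu)$ and all $\alpha>0$. -/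

import Mathlib

open MeasureTheory
open scoped ENNReal ContDiff ComplexConjugate

noncomputable section

namespace TwistedDrift

/-- `ℂⁿ`, identified with `ℝ²ⁿ` with its Euclidean norm and Lebesgue measure: for `z = x + i y` the
coordinate `x_j` is `z (Sum.inl j)` and the coordinate `y_j` is `z (Sum.inr j)`. A drift vector
`ν = (a, b)` is a vector of the same space. -/
abbrev Space (n : ℕ) : Type := EuclideanSpace ℝ (Fin n ⊕ Fin n)

/-- The measure `dμ_ν(x, y) = e^{2 (a · x + b · y)} dx dy`. -/
def driftMeasure {n : ℕ} (ν : Space n) : Measure (Space n) :=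
  volume.withDensity fun z => ENNReal.ofReal (Real.exp (2 * inner ℝ ν z))

/-- The partial derivative in the `i`-th real coordinate. -/
def partialDeriv {n : ℕ} (i : Fin n ⊕ Fin n) (F : Space n → ℂ) (z : Space n) : ℂ :=
  fderiv ℝ F z (EuclideanSpace.single i (1 : ℝ))

/-- The first order fields: index `Sum.inl j` is `X_j(λ) = ∂/∂x_j + (iλ/2) y_j`,
index `Sum.inr j` is `Y_j(λ) = ∂/∂y_j - (iλ/2) x_j`. -/
def field {n : ℕ} (lam : ℝ) : Fin n ⊕ Fin n → (Space n → ℂ) → Space n → ℂ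
  | Sum.inl j, F, z =>
      partialDeriv (Sum.inl j) F z + Complex.I * lam / 2 * (z (Sum.inr j) : ℂ) * F z
  | Sum.inr j, F, z =>
      partialDeriv (Sum.inr j) F z - Complex.I * lam / 2 * (z (Sum.inl j) : ℂ) * F z

/-- The monomial `θ₁(λ) θ₂(λ) ⋯ θ_k(λ)` given by the word `[θ₁, …, θ_k]`; `θ_k(λ)` acts first. -/
def monomial {n : ℕ} (lam : ℝ) (w : List (Fin n ⊕ Fin n)) (F : Space n → ℂ) : Space n → ℂ :=
  w.foldr (field lam) F

/-- The twisted Laplacian with drift,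
`L_{ν,λ} = ∑_j (X_j(λ)² + Y_j(λ)²) + 2 ∑_j (a_j X_j(λ) + b_j Y_j(λ))`. -/
def driftLaplacian {n : ℕ} (ν : Space n) (lam : ℝ) (F : Space n → ℂ) (z : Space n) : ℂ :=
  (∑ i, field lam i (field lam i F) z) + 2 * ∑ i, (ν i : ℂ) * field lam i F z

/-- Membership in `C_c^∞(ℂⁿ)`. -/
def IsTestFunction {n : ℕ} (φ : Space n → ℂ) : Prop :=
  ContDiff ℝ ∞ φ ∧ HasCompactSupport φ

/-- The Hilbert space `L²(ℂⁿ, dμ_ν)`. -/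
abbrev L2 {n : ℕ} (ν : Space n) : Type := Lp ℂ 2 (driftMeasure ν)

/-- The set of all pairs `(-L_{ν,λ} φ, φ)` in `L² × L²`, with `φ ∈ C_c^∞(ℂⁿ)`: the graph of
`-L_{ν,λ}` on `C_c^∞(ℂⁿ)` with the two coordinates exchanged. -/
def inverseGraph {n : ℕ} (ν : Space n) (lam : ℝ) : Set (L2 ν × L2 ν) :=
  {p | ∃ φ : Space n → ℂ, IsTestFunction φ ∧
    p.1 =ᵐ[driftMeasure ν] (fun z => -driftLaplacian ν lam φ z) ∧ p.2 =ᵐ[driftMeasure ν] φ}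

/-- `B` is the bounded positive inverse of the closure in `L²(ℂⁿ, dμ_ν)` of the operator
`-L_{ν,λ}` with domain `C_c^∞(ℂⁿ)`. The second condition determines `B`. -/
structure IsInverse {n : ℕ} (ν : Space n) (lam : ℝ) (B : L2 ν →L[ℂ] L2 ν) : Prop where
  isPositive : B.IsPositive
  graph_eq : {p : L2 ν × L2 ν | B p.1 = p.2} = closure (inverseGraph ν lam)

/-- The power `B ^ s` (for `s > 0`) of a bounded positive operator `B` on a complex Hilbert space,
in the sense of the continuous functional calculus. -/
def power {H : Type*} [NormedAddCommGroup H] [InnerProductSpace ℂ H] [CompleteSpace H]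
    (B : H →L[ℂ] H) (s : ℝ) : H →L[ℂ] H :=
  B ^ s

/-- `S = (-L_{ν,λ})^{-s}` (for `s > 0`) in the sense of the functional calculus: `S` is the power
with exponent `s` of the bounded positive operator `(-L_{ν,λ})⁻¹`. -/
def IsNegPower {n : ℕ} (ν : Space n) (lam s : ℝ) (S : L2 ν →L[ℂ] L2 ν) : Prop :=
  ∃ B : L2 ν →L[ℂ] L2 ν, IsInverse ν lam B ∧ S = power B s

/-- `g = θ₁(λ) ⋯ θ_k(λ) u` in the sense of distributions. The sign and the reversed order come from
`∫ (θ(λ) u) conj φ = - ∫ u conj (θ(λ) φ)` for each of the fields `θ(λ)`. -/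
def IsWeakMonomial {n : ℕ} (lam : ℝ) (w : List (Fin n ⊕ Fin n)) (u g : Space n → ℂ) : Prop :=
  LocallyIntegrable u volume ∧ LocallyIntegrable g volume ∧
    ∀ φ : Space n → ℂ, IsTestFunction φ →
      ∫ z, g z * conj (φ z) =
        (-1) ^ w.length * ∫ z, u z * conj (monomial lam w.reverse φ z)

/-- `g` is `R f = P_k(λ) (-L_{ν,λ})^{-k/2} f` for `f ∈ L²(ℂⁿ, dμ_ν)`, where `P_k(λ)` is the monomial
given by a word of length `k`. -/
def IsRieszTransform {n : ℕ} (ν : Space n) (lam : ℝ) (w : List (Fin n ⊕ Fin n)) (f : L2 ν)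
    (g : Space n → ℂ) : Prop :=
  ∃ S : L2 ν →L[ℂ] L2 ν, IsNegPower ν lam ((w.length : ℝ) / 2) S ∧ IsWeakMonomial lam w (S f) g

end TwistedDrift

end

open Set Filter Topology

noncomputable section

namespace TwistedDrift

section

variable {n : ℕ}

/-! ### The symplectic rotation and the fields -/

/-! Completing the square gives `L = ∑ (X_i + ν_i)² - |ν|²`. The operators `X_i + ν_i` are
skew-symmetric in `L²(μ_ν)` and satisfy the same Heisenberg commutation relations as the fields,
because multiplication by `e^{ν·z}` carries the problem unitarily to the twisted Laplacian on
`L²(dx)`. Three things follow from this structure.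

The heat semigroup is explicit: `e^{tL}` is twisted convolution with the Mehler-type Gaussian
`heatKernel`, whose quadratic coefficient is `(λ/4) coth(λt)`. It is a symmetric contraction
semigroup of norm at most `e^{-|ν|²t}`. The integral of the semigroup over `t > 0` is the inverse of
the closure of `-L` on test functions (`isInverse_laplaceInv`); test functions suffice because
dilated cutoffs commute with `L` up to vanishing errors. The Gamma integrals of the semigroup are
the fractional powers, and they agree with the functional calculus because nonnegative square roots
are unique (`negPower_half`).

`L²` boundedness is algebraic. If `H = -L`, then `‖P u‖² ≤ C ⟨u, H^k u⟩` for every word `P` of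
length `k`, with `C` depending on `n` and `k` only (`IsSkewSystem.norm_word_sq_le`). The letters are
combined into ladder operators, which pass through powers of `H` at the price of shifting `H` by
`±2λ`, and the shift is harmless because `H ≥ |λ|`. Taking `u = H^{-k/2} f` bounds the Riesz
transform.

Weak type `(1, 1)` uses the scale `|λ|^{-1/2}`. The assumption `|λ| ≥ M|ν|²` has two effects. The
Gaussian decay of the heat kernel dominates the weight `e^{2|ν||u|}`, so the Riesz kernels satisfy
Calderón–Zygmund size and gradient bounds with an additional factor `e^{-|λ||u|²/16}`
(`exists_monomial_heatKernel_le`, `exists_powerKernel_le`). At scales up to `|λ|^{-1/2}` the density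
of `μ_ν` is constant up to a factor depending on `M` and `n`, so `μ_ν`, although it grows
exponentially, may be treated as Lebesgue measure on small cubes. This permits a local
Calderón–Zygmund decomposition with dyadic cubes of side at most `|λ|^{-1/2}`
(`IsLocalCZKernel.weakType`). On smaller stopping cubes the cancellation is taken against the phase
of the twisted convolution; on stopping cubes of the largest size none is needed, since the Gaussian
factor makes the kernel integrable away from them.

All kernel computations are made for the operators composed with `e^{εL}`, whose kernels
`powerKernel` are smooth and rapidly decreasing, with the decisive bounds uniform in `ε`. The limit
`ε → 0` exists strongly in `L²` (`exists_rieszOp`). Weak type bounds survive almost everywhere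
limits, and `exists_extension_of_weakType` extends the operators from `L¹ ∩ L²` to `L¹`. -/

/-- The rotation `(x, y) ↦ (y, -x)`. -/
def rot : Space n →L[ℝ] Space n :=
  LinearMap.toContinuousLinearMap
    { toFun := fun z => WithLp.toLp 2 (Sum.elim (fun j => z (Sum.inr j)) fun j => -z (Sum.inl j))
      map_add' := fun z w => by
        ext i; rcases i with j | j <;> simp [add_comm]
      map_smul' := fun c z => by
        ext i; rcases i with j | j <;> simp }

@[simp] lemma rot_inl (z : Space n) (j : Fin n) : rot z (Sum.inl j) = z (Sum.inr j) := rfl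

@[simp] lemma rot_inr (z : Space n) (j : Fin n) : rot z (Sum.inr j) = -z (Sum.inl j) := rfl

lemma inner_eq_sum (z w : Space n) : inner ℝ z w = ∑ i, z i * w i := by
  simp [PiLp.inner_apply, mul_comm]

lemma inner_rot_left (z w : Space n) : inner ℝ (rot z) w = -inner ℝ z (rot w) := by
  simp only [inner_eq_sum, Fintype.sum_sum_type, rot_inl, rot_inr, neg_mul, mul_neg,
    Finset.sum_neg_distrib]
  ring

lemma inner_rot_self (z : Space n) : inner ℝ (rot z) z = 0 := by
  have h := inner_rot_left z z
  rw [real_inner_comm (rot z) z] at h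
  linarith

lemma rot_rot (z : Space n) : rot (rot z) = -z := by
  ext i; rcases i with j | j <;> simp

@[simp] lemma norm_rot (z : Space n) : ‖rot z‖ = ‖z‖ := by
  have h : inner ℝ (rot z) (rot z) = inner ℝ z z := by
    rw [inner_rot_left, rot_rot, inner_neg_right, neg_neg]
  rw [real_inner_self_eq_norm_sq, real_inner_self_eq_norm_sq] at h
  exact (sq_eq_sq₀ (norm_nonneg _) (norm_nonneg _)).1 h

lemma abs_inner_rot_le (z w : Space n) : |inner ℝ (rot z) w| ≤ ‖z‖ * ‖w‖ := by
  simpa using abs_real_inner_le_norm (rot z) w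

/-- The standard basis vectors. -/
abbrev basisVec (i : Fin n ⊕ Fin n) : Space n := EuclideanSpace.single i (1 : ℝ)

lemma inner_basisVec (z : Space n) (i : Fin n ⊕ Fin n) : inner ℝ z (basisVec i) = z i := by
  simp [basisVec, EuclideanSpace.inner_single_right]

lemma inner_rot_basisVec (w : Space n) (i : Fin n ⊕ Fin n) :
    inner ℝ (rot (basisVec i)) w = -rot w i := by
  rw [inner_rot_left, real_inner_comm, inner_basisVec]

lemma eq_sum_basisVec (y : Space n) : y = ∑ i, y i • basisVec i := by
  ext j
  rcases j with j | j <;> simp [basisVec, Finset.sum_apply, Pi.single_apply]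

lemma abs_apply_le_norm (z : Space n) (i : Fin n ⊕ Fin n) : |z i| ≤ ‖z‖ := by
  simpa using PiLp.norm_apply_le z i

/-- The rotation merges the two cases of `field`, so that all later computations treat `X_j` and
`Y_j` together. -/
lemma field_eq (lam : ℝ) (i : Fin n ⊕ Fin n) (F : Space n → ℂ) (z : Space n) :
    field lam i F z = partialDeriv i F z + Complex.I * lam / 2 * (rot z i : ℂ) * F z := by
  rcases i with j | j
  · simp [field]
  · simp [field, sub_eq_add_neg]

lemma fderiv_apply_eq_sum (F : Space n → ℂ) (z y : Space n) :
    fderiv ℝ F z y = ∑ i, y i • partialDeriv i F z := by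
  conv_lhs => rw [eq_sum_basisVec y]
  simp [partialDeriv, map_sum]

lemma norm_fderiv_le_sum (F : Space n → ℂ) (z : Space n) :
    ‖fderiv ℝ F z‖ ≤ ∑ i, ‖partialDeriv i F z‖ := by
  refine ContinuousLinearMap.opNorm_le_bound _ (by positivity) fun y => ?_
  rw [fderiv_apply_eq_sum, Finset.sum_mul]
  refine (norm_sum_le _ _).trans (Finset.sum_le_sum fun i _ => ?_)
  rw [norm_smul, mul_comm, Real.norm_eq_abs]
  gcongr
  exact abs_apply_le_norm y i

lemma partialDeriv_eq (lam : ℝ) (i : Fin n ⊕ Fin n) (F : Space n → ℂ) (z : Space n) :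
    partialDeriv i F z = field lam i F z - Complex.I * lam / 2 * (rot z i : ℂ) * F z := by
  rw [field_eq]; ring

lemma contDiff_apply_coord (L : Space n →L[ℝ] Space n) (i : Fin n ⊕ Fin n) :
    ContDiff ℝ ∞ fun z : Space n => ((L z i : ℝ) : ℂ) :=
  Complex.ofRealCLM.contDiff.comp
    ((contDiff_piLp_apply (p := 2) (i := i)).comp L.contDiff)

lemma contDiff_rot_coord (i : Fin n ⊕ Fin n) :
    ContDiff ℝ ∞ fun z : Space n => ((rot z i : ℝ) : ℂ) := contDiff_apply_coord rot i

lemma contDiff_partialDeriv {F : Space n → ℂ} (hF : ContDiff ℝ ∞ F) (i : Fin n ⊕ Fin n) :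
    ContDiff ℝ ∞ (partialDeriv i F) :=
  (hF.fderiv_right (m := ∞) (by simp)).clm_apply contDiff_const

lemma contDiff_field {F : Space n → ℂ} (hF : ContDiff ℝ ∞ F) (lam : ℝ) (i : Fin n ⊕ Fin n) :
    ContDiff ℝ ∞ (field lam i F) := by
  have : field lam i F = fun z => partialDeriv i F z + Complex.I * lam / 2 * (rot z i : ℂ) * F z :=
    funext fun z => field_eq lam i F z
  rw [this]
  exact (contDiff_partialDeriv hF i).add ((contDiff_const.mul (contDiff_rot_coord i)).mul hF)

lemma contDiff_monomial {F : Space n → ℂ} (hF : ContDiff ℝ ∞ F) (lam : ℝ)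
    (w : List (Fin n ⊕ Fin n)) : ContDiff ℝ ∞ (monomial lam w F) := by
  induction w with
  | nil => exact hF
  | cons i w ih => exact contDiff_field ih lam i

/-- A family of differentiable functions which is stable under the fields consists of smooth
functions. -/
theorem contDiff_of_field_mem (lam : ℝ) (S : Set (Space n → ℂ))
    (hd : ∀ F ∈ S, Differentiable ℝ F) (hS : ∀ F ∈ S, ∀ i, field lam i F ∈ S) :
    ∀ F ∈ S, ContDiff ℝ ∞ F := by
  -- Induction on the order of smoothness: a partial derivative is a field minus a smooth multiple
  -- of `F`, and both the field and `F` lie in the family, hence are `C^m` by induction.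
  have key : ∀ m : ℕ, ∀ F ∈ S, ContDiff ℝ m F := by
    intro m
    induction m with
    | zero => exact fun F hF => contDiff_zero.2 (hd F hF).continuous
    | succ m ih =>
      intro F hF
      push_cast
      rw [contDiff_succ_iff_fderiv]
      refine ⟨hd F hF, by simp, ?_⟩
      rw [contDiff_clm_apply_iff]
      intro y
      simp only [fderiv_apply_eq_sum]
      refine ContDiff.sum fun i _ => ContDiff.const_smul _ ?_
      have : partialDeriv i F = fun z =>
          field lam i F z - Complex.I * lam / 2 * (rot z i : ℂ) * F z :=
        funext fun z => partialDeriv_eq lam i F z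
      rw [this]
      refine (ih _ (hS F hF i)).sub ((contDiff_const.mul ?_).mul (ih F hF))
      exact (contDiff_rot_coord i).of_le (by exact_mod_cast le_top)
  exact fun F hF => contDiff_infty.2 fun m => key m F hF

lemma partialDeriv_mul {F G : Space n → ℂ} {z : Space n} (i : Fin n ⊕ Fin n)
    (hF : DifferentiableAt ℝ F z) (hG : DifferentiableAt ℝ G z) :
    partialDeriv i (fun z => F z * G z) z = partialDeriv i F z * G z + F z * partialDeriv i G z := by
  unfold partialDeriv
  rw [fderiv_fun_mul hF hG]
  simp; ring

lemma partialDeriv_add {F G : Space n → ℂ} {z : Space n} (i : Fin n ⊕ Fin n)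
    (hF : DifferentiableAt ℝ F z) (hG : DifferentiableAt ℝ G z) :
    partialDeriv i (fun z => F z + G z) z = partialDeriv i F z + partialDeriv i G z := by
  unfold partialDeriv
  rw [fderiv_fun_add hF hG]
  simp

lemma partialDeriv_const (c : ℂ) (i : Fin n ⊕ Fin n) (z : Space n) :
    partialDeriv i (fun _ => c) z = 0 := by
  simp [partialDeriv]

lemma partialDeriv_const_mul {F : Space n → ℂ} {z : Space n} (c : ℂ) (i : Fin n ⊕ Fin n)
    (hF : DifferentiableAt ℝ F z) :
    partialDeriv i (fun z => c * F z) z = c * partialDeriv i F z := by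
  rw [partialDeriv_mul i (differentiableAt_const c) hF, partialDeriv_const]; ring

lemma partialDeriv_conj {F : Space n → ℂ} {z : Space n} (i : Fin n ⊕ Fin n)
    (hF : DifferentiableAt ℝ F z) :
    partialDeriv i (fun z => conj (F z)) z = conj (partialDeriv i F z) := by
  unfold partialDeriv
  have := (Complex.conjCLE.toContinuousLinearMap.hasFDerivAt (x := F z)).comp z hF.hasFDerivAt
  have h2 := this.fderiv
  change fderiv ℝ (fun z => conj (F z)) z = _ at h2
  rw [h2]; rfl

lemma partialDeriv_apply_coord (L : Space n →L[ℝ] Space n) (k i : Fin n ⊕ Fin n) (z : Space n) :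
    partialDeriv k (fun z => ((L z i : ℝ) : ℂ)) z = ((L (basisVec k) i : ℝ) : ℂ) := by
  unfold partialDeriv
  have : (fun z : Space n => ((L z i : ℝ) : ℂ)) =
      (Complex.ofRealCLM.comp ((EuclideanSpace.proj i).comp L) : Space n →L[ℝ] ℂ) := rfl
  rw [this, ContinuousLinearMap.fderiv]; rfl

lemma field_mul_left {F G : Space n → ℂ} {z : Space n} (lam : ℝ) (i : Fin n ⊕ Fin n)
    (hF : DifferentiableAt ℝ F z) (hG : DifferentiableAt ℝ G z) :
    field lam i (fun z => F z * G z) z = partialDeriv i F z * G z + F z * field lam i G z := by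
  rw [field_eq, field_eq, partialDeriv_mul i hF hG]; ring

lemma field_add {F G : Space n → ℂ} {z : Space n} (lam : ℝ) (i : Fin n ⊕ Fin n)
    (hF : DifferentiableAt ℝ F z) (hG : DifferentiableAt ℝ G z) :
    field lam i (fun z => F z + G z) z = field lam i F z + field lam i G z := by
  rw [field_eq, field_eq, field_eq, partialDeriv_add i hF hG]; ring

lemma field_const_mul {F : Space n → ℂ} {z : Space n} (lam : ℝ) (i : Fin n ⊕ Fin n) (c : ℂ)
    (hF : DifferentiableAt ℝ F z) :
    field lam i (fun z => c * F z) z = c * field lam i F z := by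
  rw [field_eq, field_eq, partialDeriv_const_mul c i hF]; ring

lemma partialDeriv_comm {F : Space n → ℂ} (hF : ContDiff ℝ ∞ F) (i j : Fin n ⊕ Fin n)
    (z : Space n) : partialDeriv i (partialDeriv j F) z = partialDeriv j (partialDeriv i F) z := by
  have hs : IsSymmSndFDerivAt ℝ F z := hF.contDiffAt.isSymmSndFDerivAt (by
    rw [minSmoothness_of_isRCLikeNormedField]; exact WithTop.coe_le_coe.2 le_top)
  have hd : DifferentiableAt ℝ (fderiv ℝ F) z :=
    ((hF.fderiv_right (m := ∞) (by simp)).differentiable (by simp)) z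
  have key : ∀ i j, partialDeriv i (partialDeriv j F) z =
      fderiv ℝ (fderiv ℝ F) z (basisVec i) (basisVec j) := by
    intro i j
    unfold partialDeriv
    rw [fderiv_clm_apply hd (differentiableAt_const _)]
    simp
  rw [key, key, hs]

/-- The commutator of two fields. -/
lemma field_comm {F : Space n → ℂ} (hF : ContDiff ℝ ∞ F) (lam : ℝ) (i j : Fin n ⊕ Fin n)
    (z : Space n) : field lam i (field lam j F) z - field lam j (field lam i F) z =
      Complex.I * lam * (rot (basisVec i) j : ℂ) * F z := by
  have hd : ∀ z, DifferentiableAt ℝ F z := fun z => hF.differentiable (by simp) z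
  have hp : ∀ i z, DifferentiableAt ℝ (partialDeriv i F) z := fun i z =>
    (contDiff_partialDeriv hF i).differentiable (by simp) z
  have hr : ∀ i z, DifferentiableAt ℝ (fun z : Space n => ((rot z i : ℝ) : ℂ)) z := fun i z =>
    (contDiff_rot_coord i).differentiable (by simp) z
  have e1 : ∀ i, field lam i F = fun z => partialDeriv i F z +
      (Complex.I * lam / 2) * ((rot z i : ℂ) * F z) := fun i => funext fun z => by
    rw [field_eq]; ring
  have key : ∀ i j, field lam i (field lam j F) z = partialDeriv i (partialDeriv j F) z +
      (Complex.I * lam / 2) * ((rot (basisVec i) j : ℂ) * F z + (rot z j : ℂ) * partialDeriv i F z) +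
      Complex.I * lam / 2 * (rot z i : ℂ) *
        (partialDeriv j F z + Complex.I * lam / 2 * ((rot z j : ℂ) * F z)) := by
    intro i j
    rw [field_eq, e1 j, partialDeriv_add i (hp j z) (((hr j z).fun_mul (hd z)).const_mul _),
      partialDeriv_const_mul _ i ((hr j z).fun_mul (hd z)), partialDeriv_mul i (hr j z) (hd z),
      partialDeriv_apply_coord]
  -- Antisymmetry of the rotation: the two mixed zeroth order terms add up instead of cancelling,
  -- which produces the full `iλ`.
  have e2 : (rot (basisVec j) i : ℝ) = -rot (basisVec i) j := by
    have := inner_rot_basisVec (basisVec i) j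
    rw [inner_basisVec] at this
    exact this
  rw [key, key, partialDeriv_comm hF i j, e2]
  push_cast
  ring

/-! ### Test functions -/

lemma IsTestFunction.field {φ : Space n → ℂ} (h : IsTestFunction φ) (lam : ℝ)
    (i : Fin n ⊕ Fin n) : IsTestFunction (field lam i φ) := by
  refine ⟨contDiff_field h.1 lam i, ?_⟩
  refine h.2.mono' fun z hz => ?_
  by_contra hzs
  apply hz
  have h1 : φ =ᶠ[𝓝 z] fun _ => 0 := notMem_tsupport_iff_eventuallyEq.1 hzs
  rw [field_eq, partialDeriv, h1.fderiv_eq, h1.eq_of_nhds]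
  simp

lemma IsTestFunction.monomial {φ : Space n → ℂ} (h : IsTestFunction φ) (lam : ℝ)
    (w : List (Fin n ⊕ Fin n)) : IsTestFunction (monomial lam w φ) := by
  induction w with
  | nil => exact h
  | cons i w ih => exact ih.field lam i

lemma monomial_append (lam : ℝ) (v w : List (Fin n ⊕ Fin n)) (F : Space n → ℂ) :
    monomial lam (v ++ w) F = monomial lam v (monomial lam w F) := by
  simp [monomial, List.foldr_append]

/-! ### The measure -/

/-- The density of the drift measure. -/
def dens (ν z : Space n) : ℝ := Real.exp (2 * inner ℝ ν z)

lemma dens_pos (ν z : Space n) : 0 < dens ν z := Real.exp_pos _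

lemma continuous_dens (ν : Space n) : Continuous (dens ν) := by
  unfold dens; fun_prop

lemma measurable_ofReal_dens (ν : Space n) :
    Measurable fun z => ENNReal.ofReal (dens ν z) :=
  (continuous_dens ν).measurable.ennreal_ofReal

lemma driftMeasure_eq (ν : Space n) :
    driftMeasure ν = volume.withDensity fun z => ENNReal.ofReal (dens ν z) := rfl

lemma driftMeasure_ac (ν : Space n) : driftMeasure ν ≪ volume :=
  withDensity_absolutelyContinuous _ _

lemma volume_ac (ν : Space n) : (volume : Measure (Space n)) ≪ driftMeasure ν :=
  withDensity_absolutelyContinuous' (measurable_ofReal_dens ν).aemeasurable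
    (Eventually.of_forall fun z => (ENNReal.ofReal_pos.2 (dens_pos ν z)).ne')

lemma ae_driftMeasure_iff (ν : Space n) {p : Space n → Prop} :
    (∀ᵐ z ∂(driftMeasure ν), p z) ↔ ∀ᵐ z, p z :=
  ⟨fun h => (volume_ac ν).ae_le h, fun h => (driftMeasure_ac ν).ae_le h⟩

lemma ae_driftMeasure_eq (ν : Space n) : ae (driftMeasure ν) = ae volume :=
  le_antisymm (driftMeasure_ac ν).ae_le (volume_ac ν).ae_le

lemma lintegral_driftMeasure (ν : Space n) (f : Space n → ℝ≥0∞) :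
    ∫⁻ z, f z ∂(driftMeasure ν) = ∫⁻ z, ENNReal.ofReal (dens ν z) * f z := by
  rw [driftMeasure_eq, lintegral_withDensity_eq_lintegral_mul_non_measurable _
    (measurable_ofReal_dens ν) (Eventually.of_forall fun z => ENNReal.ofReal_lt_top)]
  rfl

lemma integral_driftMeasure (ν : Space n) (f : Space n → ℂ) :
    ∫ z, f z ∂(driftMeasure ν) = ∫ z, (dens ν z : ℂ) * f z := by
  rw [driftMeasure_eq, integral_withDensity_eq_integral_toReal_smul (measurable_ofReal_dens ν)
    (Eventually.of_forall fun z => ENNReal.ofReal_lt_top)]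
  refine integral_congr_ae (Eventually.of_forall fun z => ?_)
  simp only
  rw [ENNReal.toReal_ofReal (dens_pos ν z).le, Complex.real_smul]

lemma integrable_driftMeasure_iff (ν : Space n) (f : Space n → ℂ) :
    Integrable f (driftMeasure ν) ↔ Integrable fun z => (dens ν z : ℂ) * f z := by
  rw [driftMeasure_eq, integrable_withDensity_iff_integrable_smul' (measurable_ofReal_dens ν)
    (Eventually.of_forall fun z => ENNReal.ofReal_lt_top)]
  refine integrable_congr (Eventually.of_forall fun z => ?_)
  simp only
  rw [ENNReal.toReal_ofReal (dens_pos ν z).le, Complex.real_smul]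

instance (ν : Space n) : SigmaFinite (driftMeasure ν) := by
  rw [driftMeasure_eq]
  exact SigmaFinite.withDensity_ofReal fun z => dens ν z

instance (ν : Space n) : IsLocallyFiniteMeasure (driftMeasure ν) := by
  rw [driftMeasure_eq]
  exact IsLocallyFiniteMeasure.withDensity_ofReal (continuous_dens ν)

lemma aestronglyMeasurable_driftMeasure_iff (ν : Space n) {f : Space n → ℂ} :
    AEStronglyMeasurable f (driftMeasure ν) ↔ AEStronglyMeasurable f volume :=
  ⟨fun h => h.mono_ac (volume_ac ν), fun h => h.mono_ac (driftMeasure_ac ν)⟩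

/-- Square integrable functions are locally integrable. -/
lemma locallyIntegrable_of_memLp {ν : Space n} {p : ℝ≥0∞} (hp : 1 ≤ p) {f : Space n → ℂ}
    (hf : MemLp f p (driftMeasure ν)) : LocallyIntegrable f volume := by
  have h1 : LocallyIntegrable f (driftMeasure ν) := hf.locallyIntegrable hp
  rw [locallyIntegrable_iff] at h1 ⊢
  intro K hK
  have h2 := h1 K hK
  rw [← integrable_indicator_iff hK.measurableSet, integrable_driftMeasure_iff] at h2
  have h3 : IntegrableOn (fun z => (dens ν z : ℂ) * f z) K := by
    rw [← integrable_indicator_iff hK.measurableSet]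
    refine h2.congr (Eventually.of_forall fun z => ?_)
    by_cases hz : z ∈ K <;> simp [hz]
  have h4 : ContinuousOn (fun z => ((dens ν z : ℂ))⁻¹) K := by
    refine ContinuousOn.inv₀ (Complex.continuous_ofReal.comp (continuous_dens ν)).continuousOn ?_
    intro z _; exact_mod_cast (dens_pos ν z).ne'
  refine (h3.continuousOn_mul h4 hK).congr (Eventually.of_forall fun z => ?_)
  have : (dens ν z : ℂ) ≠ 0 := by exact_mod_cast (dens_pos ν z).ne'
  simp only
  rw [inv_mul_cancel_left₀ this]

/-! ### Integration by parts -/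

/-- The zeroth order part of a field is multiplication by an imaginary function, so it drops out of
the derivative of `u conj v`; what remains is the vanishing of the integral of a total derivative.
-/
lemma integral_field_mul_conj (lam : ℝ) (i : Fin n ⊕ Fin n) {u v : Space n → ℂ}
    (hu : Differentiable ℝ u) (hv : Differentiable ℝ v)
    (h1 : Integrable fun z => field lam i u z * conj (v z))
    (h2 : Integrable fun z => u z * conj (field lam i v z))
    (h3 : Integrable fun z => u z * conj (v z)) :
    ∫ z, field lam i u z * conj (v z) = -∫ z, u z * conj (field lam i v z) := by
  have hc : Differentiable ℝ fun z => conj (v z) := fun z =>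
    (Complex.conjCLE.toContinuousLinearMap.hasFDerivAt.comp z (hv z).hasFDerivAt).differentiableAt
  have e : ∀ z, fderiv ℝ (fun z => u z * conj (v z)) z (basisVec i) =
      field lam i u z * conj (v z) + u z * conj (field lam i v z) := by
    intro z
    change partialDeriv i (fun z => u z * conj (v z)) z = _
    rw [partialDeriv_mul i (hu z) (hc z), partialDeriv_conj i (hv z), field_eq, field_eq]
    simp only [map_add, map_mul, map_div₀, Complex.conj_I, Complex.conj_ofReal, map_ofNat]
    ring
  have key := integral_mul_fderiv_eq_neg_fderiv_mul_of_integrable (μ := volume) (𝕜 := ℂ)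
    (f := fun _ : Space n => (1 : ℂ)) (g := fun z => u z * conj (v z)) (v := basisVec i)
    (by simp) (by simp only [e, one_mul]; exact h1.add h2) (by simpa using h3)
    (fun _ _ => differentiableAt_const _) (fun z _ => (hu z).mul (hc z))
  simp only [e, one_mul, fderiv_fun_const, Pi.zero_apply, _root_.zero_apply, zero_mul,
    integral_zero, neg_zero] at key
  rw [integral_add h1 h2] at key
  exact eq_neg_of_add_eq_zero_left key

end

section

/-! ### Energy estimates for words in skew-symmetric operators with Heisenberg commutators -/

section Energy

variable {V E : Type*} [AddCommGroup V] [Module ℂ V] [NormedAddCommGroup E] [InnerProductSpace ℂ E]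

/-- Skew-symmetric operators `D i` on a space `V` of vectors of `E` whose commutators are those of
the fields `X_j(λ)`, `Y_j(λ)`. -/
structure IsSkewSystem {n : ℕ} (e : V →ₗ[ℂ] E) (D : Fin n ⊕ Fin n → Module.End ℂ V) (lam : ℝ) :
    Prop where
  skew : ∀ i u v, inner ℂ (e (D i u)) (e v) = -inner ℂ (e u) (e (D i v))
  comm_inl : ∀ j k, Commute (D (Sum.inl j)) (D (Sum.inl k))
  comm_inr : ∀ j k, Commute (D (Sum.inr j)) (D (Sum.inr k))
  comm_ne : ∀ j k, j ≠ k → Commute (D (Sum.inl j)) (D (Sum.inr k))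
  comm_self : ∀ j, D (Sum.inl j) * D (Sum.inr j) - D (Sum.inr j) * D (Sum.inl j) =
    (-(Complex.I * lam)) • (1 : Module.End ℂ V)

/-- The operator `-∑ D_i² + c`. -/
def hamiltonian {n : ℕ} (D : Fin n ⊕ Fin n → Module.End ℂ V) (c : ℝ) : Module.End ℂ V :=
  -∑ i, D i * D i + (c : ℂ) • (1 : Module.End ℂ V)

/-- The quadratic form `Re ⟪u, T u⟫`. -/
def qform (e : V →ₗ[ℂ] E) (T : Module.End ℂ V) (u : V) : ℝ :=
  (inner ℂ (e u) (e (T u))).re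

lemma qform_add_add_qform_sub (e : V →ₗ[ℂ] E) (T : Module.End ℂ V) (u v : V) :
    qform e T (u + v) + qform e T (u - v) = 2 * qform e T u + 2 * qform e T v := by
  simp only [qform, map_add, map_sub, inner_add_left, inner_add_right, inner_sub_left,
    inner_sub_right, Complex.add_re, Complex.sub_re]
  ring

lemma qform_smul (e : V →ₗ[ℂ] E) (T : Module.End ℂ V) (c : ℂ) (u : V) :
    qform e T (c • u) = ‖c‖ ^ 2 * qform e T u := by
  simp only [qform, map_smul, inner_smul_left, inner_smul_right]
  rw [← mul_assoc, Complex.mul_conj, Complex.re_ofReal_mul,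
    Complex.normSq_eq_norm_sq]

/-- `T` is symmetric with respect to the form of `E`. -/
def IsSymm (e : V →ₗ[ℂ] E) (T : Module.End ℂ V) : Prop :=
  ∀ u v, inner ℂ (e (T u)) (e v) = inner ℂ (e u) (e (T v))

lemma IsSymm.pow {e : V →ₗ[ℂ] E} {T : Module.End ℂ V} (h : IsSymm e T) (m : ℕ) :
    IsSymm e (T ^ m) := by
  induction m with
  | zero => intro u v; simp
  | succ m ih =>
    intro u v
    rw [pow_succ', Module.End.mul_apply, h, ih, ← Module.End.mul_apply, ← pow_succ, pow_succ']

lemma IsSymm.inner_eq {e : V →ₗ[ℂ] E} {T : Module.End ℂ V} (h : IsSymm e T) (u : V) :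
    inner ℂ (e u) (e (T u)) = (qform e T u : ℂ) := by
  apply (Complex.conj_eq_iff_re.1 ?_).symm
  rw [inner_conj_symm, h]

lemma IsSymm.qform_pow_add {e : V →ₗ[ℂ] E} {T : Module.End ℂ V} (h : IsSymm e T) (p m : ℕ) (u : V) :
    qform e (T ^ (p + m + p)) u = qform e (T ^ m) ((T ^ p) u) := by
  unfold qform
  rw [(h.pow p) u, ← Module.End.mul_apply, ← Module.End.mul_apply, ← pow_add, ← pow_add]

/-- Lower bounds for `T` propagate along the powers of `T`. -/
lemma IsSymm.mul_qform_pow_le {e : V →ₗ[ℂ] E} {T : Module.End ℂ V} (h : IsSymm e T) {κ : ℝ}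
    (hκ : 0 ≤ κ) (hgap : ∀ u, κ * ‖e u‖ ^ 2 ≤ qform e T u) (m : ℕ) (u : V) :
    0 ≤ qform e (T ^ m) u ∧ κ * qform e (T ^ m) u ≤ qform e (T ^ (m + 1)) u := by
  have hpos : ∀ v, 0 ≤ qform e T v := fun v => le_trans (by positivity) (hgap v)
  have h0 : ∀ v, qform e (T ^ 0) v = ‖e v‖ ^ 2 := fun v => by
    simp only [qform, pow_zero, Module.End.one_apply]
    exact inner_self_eq_norm_sq (𝕜 := ℂ) (e v)
  -- Cauchy–Schwarz gives `q(v)² ≤ ‖v‖² ‖T v‖²`, and `κ‖v‖² ≤ q(v)` allows one factor `q(v)` to be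
  -- cancelled.
  have h2 : ∀ v, κ * qform e T v ≤ ‖e (T v)‖ ^ 2 := by
    intro v
    have h1 : qform e T v ≤ ‖e v‖ * ‖e (T v)‖ :=
      (Complex.re_le_norm _).trans (norm_inner_le_norm _ _)
    have h3 := hgap v
    rcases (hpos v).eq_or_lt with h4 | h4
    · rw [← h4]; simp only [mul_zero]; positivity
    · have h5 : qform e T v * (κ * qform e T v) ≤ qform e T v * ‖e (T v)‖ ^ 2 := by
        calc qform e T v * (κ * qform e T v) = κ * (qform e T v) ^ 2 := by ring
          _ ≤ κ * (‖e v‖ * ‖e (T v)‖) ^ 2 := by gcongr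
          _ = (κ * ‖e v‖ ^ 2) * ‖e (T v)‖ ^ 2 := by ring
          _ ≤ _ := by gcongr
      exact le_of_mul_le_mul_left h5 h4
  -- Half of the power is moved to the left entry. Even `m` then reduces to the lower bound at `T ^
  -- p u`, odd `m` to `h2` at the same vector.
  rcases Nat.even_or_odd' m with ⟨p, rfl | rfl⟩
  · have e1 : 2 * p = p + 0 + p := by ring
    have e2 : 2 * p + 1 = p + 1 + p := by ring
    rw [e2, h.qform_pow_add, e1, h.qform_pow_add, h0, pow_one]
    exact ⟨by positivity, hgap _⟩
  · have e1 : 2 * p + 1 = p + 1 + p := by ring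
    have e2 : 2 * p + 1 + 1 = (p + 1) + 0 + (p + 1) := by ring
    rw [e2, h.qform_pow_add, e1, h.qform_pow_add, h0, pow_one, pow_succ' T,
      Module.End.mul_apply]
    exact ⟨hpos _, h2 _⟩

variable {n : ℕ} {e : V →ₗ[ℂ] E} {D : Fin n ⊕ Fin n → Module.End ℂ V} {lam : ℝ}

lemma IsSkewSystem.isSymm_hamiltonian (h : IsSkewSystem e D lam) (c : ℝ) :
    IsSymm e (hamiltonian D c) := by
  intro u v
  simp only [hamiltonian, LinearMap.add_apply, LinearMap.neg_apply, LinearMap.sum_apply,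
    LinearMap.smul_apply, Module.End.mul_apply, Module.End.one_apply, map_add, map_neg, map_sum,
    map_smul, inner_add_left, inner_add_right, inner_neg_left, inner_neg_right, sum_inner,
    inner_sum, inner_smul_left, inner_smul_right, Complex.conj_ofReal]
  congr 2
  refine Finset.sum_congr rfl fun i _ => ?_
  rw [h.skew, h.skew, neg_neg]

lemma IsSkewSystem.qform_hamiltonian (h : IsSkewSystem e D lam) (c : ℝ) (u : V) :
    qform e (hamiltonian D c) u = ∑ i, ‖e (D i u)‖ ^ 2 + c * ‖e u‖ ^ 2 := by
  have h1 : ∀ i, (inner ℂ (e u) (e (D i (D i u)))).re = -‖e (D i u)‖ ^ 2 := fun i => by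
    have := h.skew i u (D i u)
    rw [neg_eq_iff_eq_neg.symm.trans neg_eq_iff_eq_neg] at this
    rw [← neg_eq_iff_eq_neg.mpr this, Complex.neg_re]
    congr 1
    exact inner_self_eq_norm_sq (𝕜 := ℂ) _
  simp only [qform, hamiltonian, LinearMap.add_apply, LinearMap.neg_apply, LinearMap.sum_apply,
    LinearMap.smul_apply, Module.End.mul_apply, Module.End.one_apply, map_add, map_neg, map_sum,
    map_smul, inner_add_right, inner_neg_right, inner_sum, inner_smul_right, Complex.add_re,
    Complex.neg_re, Complex.re_sum, h1, Complex.re_ofReal_mul]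
  rw [Finset.sum_neg_distrib, neg_neg]
  congr 2
  exact inner_self_eq_norm_sq (𝕜 := ℂ) _

/-- The ladder operators `D_{x_j} + i s D_{y_j}`. -/
def ladder (D : Fin n ⊕ Fin n → Module.End ℂ V) (s : ℝ) (j : Fin n) : Module.End ℂ V :=
  D (Sum.inl j) + (Complex.I * s) • D (Sum.inr j)

/-- The cross terms combine into the commutator, which is scalar. This is the factorization of the
harmonic oscillator. -/
lemma IsSkewSystem.ladder_mul_ladder (h : IsSkewSystem e D lam) {s : ℝ} (hs : s * s = 1)
    (j : Fin n) : ladder D (-s) j * ladder D s j =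
      D (Sum.inl j) * D (Sum.inl j) + D (Sum.inr j) * D (Sum.inr j) +
        ((s * lam : ℝ) : ℂ) • (1 : Module.End ℂ V) := by
  have hs' : (s : ℂ) * s = 1 := by exact_mod_cast hs
  have h1 := h.comm_self j
  have e1 : D (Sum.inl j) * D (Sum.inr j) = D (Sum.inr j) * D (Sum.inl j) +
      (-(Complex.I * lam)) • (1 : Module.End ℂ V) := by rw [← h1]; abel
  simp only [ladder, mul_add, add_mul, smul_mul_assoc, mul_smul_comm, e1, smul_add, smul_smul]
  have e2 : Complex.I * ((-s : ℝ) : ℂ) * (Complex.I * s) = 1 := by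
    push_cast; linear_combination (-s * s : ℂ) * Complex.I_sq + hs'
  have e2' : Complex.I * (s : ℂ) * (Complex.I * ((-s : ℝ) : ℂ)) = 1 := by
    push_cast; linear_combination (-s * s : ℂ) * Complex.I_sq + hs'
  have e3 : Complex.I * (s : ℂ) * -(Complex.I * lam) = ((s * lam : ℝ) : ℂ) := by
    push_cast; linear_combination (-s * lam : ℂ) * Complex.I_sq
  have e4 : Complex.I * ((-s : ℝ) : ℂ) = -(Complex.I * s) := by push_cast; ring
  simp only [e2', e3, one_smul]
  simp only [e4, neg_smul]
  abel

/-- Ladder operators are eigenvectors of the commutator with the Hamiltonian. Unlike the single `D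
i`, they can be moved through any power of it exactly, which is why the energy estimate is made for
them. -/
lemma IsSkewSystem.hamiltonian_mul_ladder (h : IsSkewSystem e D lam) {s : ℝ} (hs : s * s = 1)
    (c : ℝ) (j : Fin n) : hamiltonian D c * ladder D s j =
      ladder D s j * (hamiltonian D c - ((2 * s * lam : ℝ) : ℂ) • (1 : Module.End ℂ V)) := by
  have hs' : (s : ℂ) * s = 1 := by exact_mod_cast hs
  have h1 := h.comm_self j
  have e1 : D (Sum.inl j) * D (Sum.inr j) = D (Sum.inr j) * D (Sum.inl j) +
      (-(Complex.I * lam)) • (1 : Module.End ℂ V) := by rw [← h1]; abel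
  -- The squares in the other pairs of coordinates commute with the ladder operator; only the pair
  -- with index `j` contributes to the shift.
  have comm : ∀ i, i ≠ Sum.inl j → i ≠ Sum.inr j → Commute (D i * D i) (ladder D s j) := by
    rintro (k | k) hk1 hk2
    · have hne : k ≠ j := fun hkj => hk1 (by rw [hkj])
      have := (h.comm_inl k j).add_right ((h.comm_ne k j hne).smul_right (Complex.I * (s : ℂ)))
      exact this.mul_left this
    · have hne : j ≠ k := fun hkj => hk2 (by rw [hkj])
      have := ((h.comm_ne j k hne).symm).add_right ((h.comm_inr k j).smul_right (Complex.I * (s : ℂ)))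
      exact this.mul_left this
  have key : (D (Sum.inl j) * D (Sum.inl j) + D (Sum.inr j) * D (Sum.inr j)) * ladder D s j =
      ladder D s j * (D (Sum.inl j) * D (Sum.inl j) + D (Sum.inr j) * D (Sum.inr j)) +
        ((2 * s * lam : ℝ) : ℂ) • ladder D s j := by
    have h2 : D (Sum.inl j) * D (Sum.inl j) * D (Sum.inr j) = D (Sum.inr j) *
        (D (Sum.inl j) * D (Sum.inl j)) + (-(2 * (Complex.I * lam))) • D (Sum.inl j) := by
      rw [mul_assoc, e1, mul_add, ← mul_assoc, e1]
      simp only [add_mul, smul_mul_assoc, one_mul, mul_smul_comm, mul_one, mul_assoc]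
      rw [add_assoc, ← add_smul]; congr 2; ring
    have h3 : D (Sum.inl j) * (D (Sum.inr j) * D (Sum.inr j)) = D (Sum.inr j) * D (Sum.inr j) *
        D (Sum.inl j) + (-(2 * (Complex.I * lam))) • D (Sum.inr j) := by
      rw [← mul_assoc, e1, add_mul, mul_assoc, e1]
      simp only [mul_add, smul_mul_assoc, one_mul, mul_smul_comm, mul_one, mul_assoc]
      rw [add_assoc, ← add_smul]; congr 2; ring
    simp only [ladder, mul_add, add_mul, smul_mul_assoc, mul_smul_comm, h2, h3, smul_add, smul_smul]
    have e3 : Complex.I * (s : ℂ) * -(2 * (Complex.I * lam)) = ((2 * s * lam : ℝ) : ℂ) := by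
      push_cast; linear_combination (-2 * s * lam : ℂ) * Complex.I_sq
    have e5 : ((2 * s * lam : ℝ) : ℂ) * (Complex.I * (s : ℂ)) = 2 * (Complex.I * lam) := by
      push_cast; linear_combination (2 * lam * Complex.I : ℂ) * hs'
    simp only [e3, e5]
    simp only [neg_smul, mul_assoc]
    abel
  have hsum : (∑ i, D i * D i) * ladder D s j = ladder D s j * (∑ i, D i * D i) +
        ((2 * s * lam : ℝ) : ℂ) • ladder D s j := by
    have hne : Sum.inl j ∈ (Finset.univ.erase (Sum.inr j) : Finset (Fin n ⊕ Fin n)) := by simp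
    rw [← Finset.add_sum_erase _ _ (Finset.mem_univ (Sum.inr j)),
      ← Finset.add_sum_erase _ _ hne, ← add_assoc,
      add_comm (D (Sum.inr j) * D (Sum.inr j)), add_mul, key, mul_add]
    have : (∑ x ∈ (Finset.univ.erase (Sum.inr j)).erase (Sum.inl j), D x * D x) * ladder D s j =
        ladder D s j * ∑ x ∈ (Finset.univ.erase (Sum.inr j)).erase (Sum.inl j), D x * D x := by
      apply Commute.sum_left
      intro i hi
      simp only [Finset.mem_erase, Finset.mem_univ, and_true] at hi
      exact comm i hi.1 hi.2
    rw [this]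
    simp only [mul_add]
    abel
  simp only [hamiltonian, add_mul, neg_mul, hsum, mul_sub, mul_add, mul_neg, smul_mul_assoc,
    one_mul, mul_smul_comm, mul_one]
  abel

lemma IsSkewSystem.pow_mul_ladder (h : IsSkewSystem e D lam) {s : ℝ} (hs : s * s = 1)
    (c : ℝ) (j : Fin n) (m : ℕ) : hamiltonian D c ^ m * ladder D s j =
      ladder D s j * (hamiltonian D c - ((2 * s * lam : ℝ) : ℂ) • (1 : Module.End ℂ V)) ^ m := by
  induction m with
  | zero => simp
  | succ m ih =>
    rw [pow_succ, mul_assoc, h.hamiltonian_mul_ladder hs, ← mul_assoc, ih, mul_assoc, ← pow_succ]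

lemma IsSkewSystem.inner_ladder (h : IsSkewSystem e D lam) (s : ℝ) (j : Fin n) (u v : V) :
    inner ℂ (e (ladder D s j u)) (e v) = -inner ℂ (e u) (e (ladder D (-s) j v)) := by
  simp only [ladder, LinearMap.add_apply, LinearMap.smul_apply, map_add, map_smul, inner_add_left,
    inner_add_right, inner_smul_left, inner_smul_right, h.skew, map_mul, Complex.conj_I,
    Complex.conj_ofReal, Complex.ofReal_neg]
  ring

/-- Nonnegativity of `‖ladder u‖²` for a single index `j` gives `s λ ‖u‖² ≤ ‖D_x u‖² + ‖D_y u‖²`;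
the sign `s` is chosen to be that of `λ`. One pair of coordinates is needed, hence `0 < n`. -/
lemma IsSkewSystem.gap (h : IsSkewSystem e D lam) (hn : 0 < n) (c : ℝ) (hc : 0 ≤ c) (u : V) :
    |lam| * ‖e u‖ ^ 2 ≤ qform e (hamiltonian D c) u := by
  have key : ∀ s : ℝ, s * s = 1 → s * lam * ‖e u‖ ^ 2 ≤ qform e (hamiltonian D c) u := by
    intro s hs
    set j : Fin n := ⟨0, hn⟩
    have h1 := h.inner_ladder s j u (ladder D s j u)
    rw [← Module.End.mul_apply, h.ladder_mul_ladder hs] at h1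
    have h2 : (inner ℂ (e (ladder D s j u)) (e (ladder D s j u))).re =
        ‖e (ladder D s j u)‖ ^ 2 := inner_self_eq_norm_sq (𝕜 := ℂ) _
    have h3 : (inner ℂ (e u) (e u)).re = ‖e u‖ ^ 2 := inner_self_eq_norm_sq (𝕜 := ℂ) _
    have hD : ∀ i, inner ℂ (e u) (e (D i (D i u))) = -inner ℂ (e (D i u)) (e (D i u)) := fun i => by
      rw [h.skew, neg_neg]
    have h4 : ∀ i, (inner ℂ (e (D i u)) (e (D i u))).re = ‖e (D i u)‖ ^ 2 :=
      fun i => inner_self_eq_norm_sq (𝕜 := ℂ) _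
    have h5 := congrArg Complex.re h1
    simp only [LinearMap.add_apply, Module.End.mul_apply, LinearMap.smul_apply,
      Module.End.one_apply, map_add, map_smul, inner_add_right, inner_smul_right, hD,
      Complex.neg_re, Complex.add_re, h4, Complex.re_ofReal_mul, h3, h2] at h5
    rw [h.qform_hamiltonian]
    have h6 : ‖e (D (Sum.inl j) u)‖ ^ 2 + ‖e (D (Sum.inr j) u)‖ ^ 2 ≤ ∑ i, ‖e (D i u)‖ ^ 2 := by
      rw [Fintype.sum_sum_type]
      exact add_le_add (Finset.single_le_sum (f := fun i => ‖e (D (Sum.inl i) u)‖ ^ 2)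
        (fun i _ => by positivity) (Finset.mem_univ j))
        (Finset.single_le_sum (f := fun i => ‖e (D (Sum.inr i) u)‖ ^ 2)
        (fun i _ => by positivity) (Finset.mem_univ j))
    have h7 : 0 ≤ ‖e (ladder D s j u)‖ ^ 2 := by positivity
    have h8 : 0 ≤ c * ‖e u‖ ^ 2 := by positivity
    linarith
  rcases abs_cases lam with ⟨h1, _⟩ | ⟨h1, _⟩
  · rw [h1]; simpa using key 1 (by norm_num)
  · rw [h1]; simpa using key (-1) (by norm_num)

/-- The shifted factors are expanded one at a time. The scalar `2sλ` costs `2|λ|`, which the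
spectral gap converts into two more copies of the next power of the Hamiltonian, so every factor
costs `1 + 2 = 3`. -/
lemma IsSkewSystem.norm_inner_shift_le (h : IsSkewSystem e D lam) (hn : 0 < n) (c : ℝ) (hc : 0 ≤ c)
    {s : ℝ} (hs : |s| = 1) (m a : ℕ) (u : V) :
    ‖inner ℂ (e u) (e ((hamiltonian D c ^ a *
      (hamiltonian D c - ((2 * s * lam : ℝ) : ℂ) • (1 : Module.End ℂ V)) ^ m) u))‖ ≤
      3 ^ m * qform e (hamiltonian D c ^ (a + m)) u := by
  have hS := h.isSymm_hamiltonian c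
  have hE := hS.mul_qform_pow_le (abs_nonneg lam) (h.gap hn c hc)
  induction m generalizing a with
  | zero =>
    rw [pow_zero, mul_one, (hS.pow a).inner_eq, Complex.norm_real, Real.norm_of_nonneg (hE _ _).1]
    simp
  | succ m ih =>
    set H := hamiltonian D c
    set K := H - ((2 * s * lam : ℝ) : ℂ) • (1 : Module.End ℂ V) with hK
    have e1 : H ^ a * K ^ (m + 1) = H ^ (a + 1) * K ^ m -
        ((2 * s * lam : ℝ) : ℂ) • (H ^ a * K ^ m) := by
      rw [pow_succ', ← mul_assoc, show H ^ a * K = H ^ (a + 1) - ((2 * s * lam : ℝ) : ℂ) • H ^ a by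
        rw [hK, mul_sub, pow_succ]; simp, sub_mul, smul_mul_assoc]
    rw [e1, LinearMap.sub_apply, LinearMap.smul_apply, map_sub, map_smul, inner_sub_right,
      inner_smul_right]
    refine (norm_sub_le _ _).trans ?_
    rw [norm_mul, Complex.norm_real, Real.norm_eq_abs, abs_mul, abs_mul, hs, abs_two]
    have h1 := ih (a + 1)
    have h2 := ih a
    have h3 := (hE (a + m) u).2
    have e2 : a + 1 + m = a + m + 1 := by ring
    rw [e2] at h1
    have h4 : (0 : ℝ) ≤ 3 ^ m := by positivity
    calc _ ≤ 3 ^ m * qform e (H ^ (a + m + 1)) u + 2 * 1 * |lam| * (3 ^ m * qform e (H ^ (a + m)) u) := by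
          gcongr
      _ = 3 ^ m * qform e (H ^ (a + m + 1)) u + 2 * 3 ^ m * (|lam| * qform e (H ^ (a + m)) u) := by ring
      _ ≤ 3 ^ m * qform e (H ^ (a + m + 1)) u + 2 * 3 ^ m * qform e (H ^ (a + m + 1)) u := by gcongr
      _ = _ := by rw [pow_succ 3, ← add_assoc]; ring

/-- Once a ladder operator has passed through `H ^ m` it meets its adjoint. Summed over `j`, these
products become `H - (c + n s λ)`, a function of `H`; no individual product has this property. The
terms `H`, `c` and `n|λ|` are each controlled by the next power of `H`, whence `1 + 1 + n`. -/
lemma IsSkewSystem.sum_qform_ladder_le (h : IsSkewSystem e D lam) (hn : 0 < n) (c : ℝ) (hc : 0 ≤ c)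
    {s : ℝ} (hs : |s| = 1) (m : ℕ) (u : V) :
    ∑ j, qform e (hamiltonian D c ^ m) (ladder D s j u) ≤
      (n + 2) * 3 ^ m * qform e (hamiltonian D c ^ (m + 1)) u := by
  have hss : s * s = 1 := by rw [← abs_mul_abs_self, hs, one_mul]
  have hS := h.isSymm_hamiltonian c
  have hE := hS.mul_qform_pow_le (abs_nonneg lam) (h.gap hn c hc)
  have hEc := hS.mul_qform_pow_le hc (fun u => by
    rw [h.qform_hamiltonian]
    have : 0 ≤ ∑ i, ‖e (D i u)‖ ^ 2 := by positivity
    linarith)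
  set H := hamiltonian D c with hH
  set K := H - ((2 * s * lam : ℝ) : ℂ) • (1 : Module.End ℂ V) with hK
  have h1 : ∀ j, qform e (H ^ m) (ladder D s j u) =
      (-inner ℂ (e u) (e ((ladder D (-s) j * ladder D s j) ((K ^ m) u)))).re := by
    intro j
    unfold qform
    rw [← Module.End.mul_apply (H ^ m), h.pow_mul_ladder hss, Module.End.mul_apply, h.inner_ladder,
      ← Module.End.mul_apply]
  have h2 : -∑ j, ladder D (-s) j * ladder D s j =
      H - ((c + n * (s * lam) : ℝ) : ℂ) • (1 : Module.End ℂ V) := by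
    simp only [h.ladder_mul_ladder hss, Finset.sum_add_distrib, Finset.sum_const, Finset.card_univ,
      Fintype.card_fin, hH, hamiltonian, Fintype.sum_sum_type]
    rw [← Nat.cast_smul_eq_nsmul ℂ, smul_smul]
    push_cast
    rw [add_smul]
    abel
  have h3 : ∑ j, qform e (H ^ m) (ladder D s j u) =
      (inner ℂ (e u) (e ((H ^ 1 * K ^ m - ((c + n * (s * lam) : ℝ) : ℂ) • (H ^ 0 * K ^ m)) u))).re := by
    have : H ^ 1 * K ^ m - ((c + n * (s * lam) : ℝ) : ℂ) • (H ^ 0 * K ^ m) =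
        (-∑ j, ladder D (-s) j * ladder D s j) * K ^ m := by
      rw [h2, sub_mul, pow_one, pow_zero, smul_mul_assoc]
    rw [this]
    simp only [h1, ← Complex.re_sum, Finset.sum_neg_distrib, Module.End.mul_apply,
      LinearMap.neg_apply, LinearMap.sum_apply, map_neg, map_sum, inner_neg_right, inner_sum]
  rw [h3]
  refine (Complex.re_le_norm _).trans ?_
  rw [LinearMap.sub_apply, LinearMap.smul_apply, map_sub, map_smul, inner_sub_right,
      inner_smul_right]
  refine (norm_sub_le _ _).trans ?_
  have n1 := h.norm_inner_shift_le hn c hc hs m 1 u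
  have n2 := h.norm_inner_shift_le hn c hc hs m 0 u
  rw [← hH, ← hK] at n1 n2
  rw [norm_mul, Complex.norm_real, Real.norm_eq_abs]
  have h4 : |c + n * (s * lam)| ≤ c + n * |lam| := by
    refine (abs_add_le _ _).trans ?_
    rw [abs_of_nonneg hc, abs_mul, abs_mul, hs, one_mul, Nat.abs_cast]
  have h5 := (hE m u)
  have h6 := (hEc m u).2
  have e1 : 1 + m = m + 1 := by ring
  rw [e1] at n1
  rw [zero_add] at n2
  have h7 : (0:ℝ) ≤ 3 ^ m := by positivity
  calc _ ≤ 3 ^ m * qform e (H ^ (m + 1)) u + (c + n * |lam|) * (3 ^ m * qform e (H ^ m) u) :=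
        add_le_add n1 (mul_le_mul h4 n2 (norm_nonneg _) (by positivity))
    _ = 3 ^ m * (qform e (H ^ (m + 1)) u + c * qform e (H ^ m) u +
          n * (|lam| * qform e (H ^ m) u)) := by ring
    _ ≤ 3 ^ m * (qform e (H ^ (m + 1)) u + qform e (H ^ (m + 1)) u +
          n * qform e (H ^ (m + 1)) u) := by gcongr; exact h5.2
    _ = _ := by ring

/-- One step: shifting a field to the power of the Hamiltonian. -/
lemma IsSkewSystem.qform_sub_le (h : IsSkewSystem e D lam) (hn : 0 < n) (c : ℝ) (hc : 0 ≤ c)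
    (m : ℕ) (i : Fin n ⊕ Fin n) (b : ℝ) (hb : b ^ 2 ≤ c) (u : V) :
    qform e (hamiltonian D c ^ m) (D i u - (b : ℂ) • u) ≤
      2 * (n + 3) * 3 ^ m * qform e (hamiltonian D c ^ (m + 1)) u := by
  have hS := h.isSymm_hamiltonian c
  have hE := hS.mul_qform_pow_le (abs_nonneg lam) (h.gap hn c hc)
  have hEc := hS.mul_qform_pow_le hc (fun u => by
    rw [h.qform_hamiltonian]
    have : 0 ≤ ∑ i, ‖e (D i u)‖ ^ 2 := by positivity
    linarith)
  have hpos : ∀ v, 0 ≤ qform e (hamiltonian D c ^ m) v := fun v => (hE m v).1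
  have key : ∀ j, qform e (hamiltonian D c ^ m) (D (Sum.inl j) u) +
      qform e (hamiltonian D c ^ m) (D (Sum.inr j) u) ≤
      (n + 2) * 3 ^ m * qform e (hamiltonian D c ^ (m + 1)) u := by
    intro j
    have a1 := h.sum_qform_ladder_le hn c hc (s := 1) (by simp) m u
    have a2 := h.sum_qform_ladder_le hn c hc (s := -1) (by simp) m u
    have b1 := (Finset.single_le_sum (f := fun j => qform e (hamiltonian D c ^ m) (ladder D 1 j u))
      (fun i _ => hpos _) (Finset.mem_univ j)).trans a1
    have b2 := (Finset.single_le_sum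
      (f := fun j => qform e (hamiltonian D c ^ m) (ladder D (-1) j u))
      (fun i _ => hpos _) (Finset.mem_univ j)).trans a2
    -- Parallelogram law: the forms of the two ladder operators `s = ±1` add up to twice the forms
    -- of `D_x u` and `D_y u`.
    have p := qform_add_add_qform_sub e (hamiltonian D c ^ m) (D (Sum.inl j) u)
      (Complex.I • D (Sum.inr j) u)
    rw [qform_smul, Complex.norm_I] at p
    have c1 : ladder D 1 j u = D (Sum.inl j) u + Complex.I • D (Sum.inr j) u := by simp [ladder]
    have c2 : ladder D (-1) j u = D (Sum.inl j) u - Complex.I • D (Sum.inr j) u := by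
      simp [ladder, sub_eq_add_neg]
    simp only [c1, c2] at b1 b2
    linarith
  have hDi : qform e (hamiltonian D c ^ m) (D i u) ≤
      (n + 2) * 3 ^ m * qform e (hamiltonian D c ^ (m + 1)) u := by
    rcases i with j | j
    · linarith [key j, hpos (D (Sum.inr j) u)]
    · linarith [key j, hpos (D (Sum.inl j) u)]
  -- The same law removes the shift by `b`, whose square is at most `c` and hence is absorbed by the
  -- Hamiltonian.
  have p := qform_add_add_qform_sub e (hamiltonian D c ^ m) (D i u) ((b : ℂ) • u)
  rw [qform_smul, Complex.norm_real, Real.norm_eq_abs, sq_abs] at p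
  have q1 := hpos (D i u + (b : ℂ) • u)
  have q2 : b ^ 2 * qform e (hamiltonian D c ^ m) u ≤ qform e (hamiltonian D c ^ (m + 1)) u :=
    (mul_le_mul_of_nonneg_right hb (hpos u)).trans (hEc m u).2
  have q3 : (1 : ℝ) ≤ 3 ^ m := one_le_pow₀ (by norm_num)
  have q4 := (hE (m + 1) u).1
  have q5 : qform e (hamiltonian D c ^ (m + 1)) u ≤
    3 ^ m * qform e (hamiltonian D c ^ (m + 1)) u := le_mul_of_one_le_left q4 q3
  nlinarith

/-- The constant in the energy estimate for words of length `k`. -/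
def wordConst (n : ℕ) : ℕ → ℕ → ℝ
  | _, 0 => 1
  | m, k + 1 => 2 * (n + 3) * 3 ^ m * wordConst n (m + 1) k

lemma wordConst_pos (n m k : ℕ) : 0 < wordConst n m k := by
  induction k generalizing m with
  | zero => simp [wordConst]
  | succ k ih => have := ih (m + 1); simp only [wordConst]; positivity

/-- The letters are removed from the outside, each raising the power of the Hamiltonian by one. The
exponent `m` is kept free to make this induction possible. -/
lemma IsSkewSystem.qform_word_le (h : IsSkewSystem e D lam) (hn : 0 < n) (c : ℝ) (hc : 0 ≤ c)
    (b : Fin n ⊕ Fin n → ℝ) (hb : ∀ i, b i ^ 2 ≤ c) (w : List (Fin n ⊕ Fin n)) (m : ℕ) (u : V) :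
    qform e (hamiltonian D c ^ m) (w.foldr (fun i v => D i v - (b i : ℂ) • v) u) ≤
      wordConst n m w.length * qform e (hamiltonian D c ^ (m + w.length)) u := by
  induction w generalizing m with
  | nil => simp [wordConst]
  | cons i w ih =>
    simp only [List.foldr_cons, List.length_cons, wordConst]
    refine (h.qform_sub_le hn c hc m i (b i) (hb i) _).trans ?_
    have := ih (m + 1)
    rw [add_assoc m 1, add_comm 1] at this
    calc _ ≤ 2 * (n + 3) * 3 ^ m * (wordConst n (m + 1) w.length *
          qform e (hamiltonian D c ^ (m + (w.length + 1))) u) := by gcongr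
      _ = _ := by ring

/-- Words of length `k` are controlled by the `k`-th power of the Hamiltonian. -/
theorem IsSkewSystem.norm_word_sq_le (h : IsSkewSystem e D lam) (hn : 0 < n) (c : ℝ) (hc : 0 ≤ c)
    (b : Fin n ⊕ Fin n → ℝ) (hb : ∀ i, b i ^ 2 ≤ c) (w : List (Fin n ⊕ Fin n)) (u : V) :
    ‖e (w.foldr (fun i v => D i v - (b i : ℂ) • v) u)‖ ^ 2 ≤
      wordConst n 0 w.length * qform e (hamiltonian D c ^ w.length) u := by
  have := h.qform_word_le hn c hc b hb w 0 u
  rw [zero_add] at this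
  refine le_trans (le_of_eq ?_) this
  simp only [qform, pow_zero, Module.End.one_apply]
  exact (inner_self_eq_norm_sq (𝕜 := ℂ) _).symm

end Energy

end

section

/-! ### Fractional powers of the generator of a symmetric semigroup -/

section Semigroup

variable {H : Type*} [NormedAddCommGroup H] [InnerProductSpace ℂ H]

/-- A symmetric strongly continuous semigroup with exponential decay. -/
structure IsSymmSemigroup (T : ℝ → H →L[ℂ] H) (δ : ℝ) : Prop where
  pos : 0 < δ
  add : ∀ s t, 0 < s → 0 < t → ∀ x, T (s + t) x = T s (T t x)
  symm : ∀ t, 0 < t → ∀ x y, inner ℂ (T t x) y = inner ℂ x (T t y)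
  norm_le : ∀ t, 0 < t → ‖T t‖ ≤ Real.exp (-δ * t)
  tendsto : ∀ x, Tendsto (fun t => T t x) (𝓝[>] 0) (𝓝 x)

variable {T : ℝ → H →L[ℂ] H} {δ : ℝ}

lemma IsSymmSemigroup.norm_apply_le (h : IsSymmSemigroup T δ) {t : ℝ} (ht : 0 < t) (x : H) :
    ‖T t x‖ ≤ Real.exp (-δ * t) * ‖x‖ :=
  (T t).le_of_opNorm_le (h.norm_le t ht) x

lemma IsSymmSemigroup.norm_apply_le' (h : IsSymmSemigroup T δ) {t : ℝ} (ht : 0 < t) (x : H) :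
    ‖T t x‖ ≤ ‖x‖ := by
  refine (h.norm_apply_le ht x).trans (mul_le_of_le_one_left (norm_nonneg _) ?_)
  rw [Real.exp_le_one_iff]
  nlinarith [h.pos]

/-- For `a < b` one has `T_b x - T_a x = T_a (T_{b-a} x - x)`. As `T_a` is a contraction, continuity
at zero gives a modulus depending only on `b - a`, so both one-sided limits are covered. -/
lemma IsSymmSemigroup.continuousOn (h : IsSymmSemigroup T δ) (x : H) :
    ContinuousOn (fun t => T t x) (Ioi 0) := by
  intro t ht
  rw [Metric.continuousWithinAt_iff]
  intro ε hε
  have h1 := h.tendsto x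
  rw [Metric.tendsto_nhdsWithin_nhds] at h1
  obtain ⟨η, hη, h2⟩ := h1 ε hε
  refine ⟨η, hη, fun s hs hst => ?_⟩
  have key : ∀ a b : ℝ, 0 < a → a < b → b - a < η → dist (T b x) (T a x) < ε := by
    intro a b ha hab hd
    have e : T b x = T a (T (b - a) x) := by
      rw [← h.add _ _ ha (sub_pos.2 hab)]; congr 2; ring
    rw [e, dist_eq_norm, ← map_sub]
    refine (h.norm_apply_le' ha _).trans_lt ?_
    rw [← dist_eq_norm]
    exact h2 (sub_pos.2 hab) (by rw [Real.dist_eq, sub_zero, abs_of_pos (sub_pos.2 hab)]; exact hd)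
  rw [Real.dist_eq] at hst
  rcases lt_trichotomy s t with h3 | h3 | h3
  · rw [dist_comm]
    exact key s t hs h3 (by rwa [abs_sub_comm, abs_of_pos (sub_pos.2 h3)] at hst)
  · rw [h3, dist_self]; exact hε
  · exact key t s ht h3 (by rwa [abs_of_pos (sub_pos.2 h3)] at hst)

lemma integrableOn_rpow_mul_exp {s δ : ℝ} (hs : 0 < s) (hδ : 0 < δ) :
    IntegrableOn (fun t : ℝ => t ^ (s - 1) * Real.exp (-δ * t)) (Ioi 0) := by
  have := integrableOn_rpow_mul_exp_neg_mul_rpow (s := s - 1) (p := 1) (b := δ) (by linarith)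
    one_pos hδ
  simpa using this

lemma IsSymmSemigroup.integrableOn (h : IsSymmSemigroup T δ) {s : ℝ} (hs : 0 < s) (x : H) :
    IntegrableOn (fun t : ℝ => t ^ (s - 1) • T t x) (Ioi 0) := by
  refine Integrable.mono' ((integrableOn_rpow_mul_exp hs h.pos).mul_const ‖x‖) ?_ ?_
  · refine ContinuousOn.aestronglyMeasurable ?_ measurableSet_Ioi
    have hc : ContinuousOn (fun t : ℝ => t ^ (s - 1)) (Ioi 0) := fun t ht =>
      (Real.continuousAt_rpow_const _ _ (Or.inl (ne_of_gt ht))).continuousWithinAt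
    exact hc.smul (h.continuousOn x)
  · refine (ae_restrict_iff' measurableSet_Ioi).2 (Eventually.of_forall fun t ht => ?_)
    have ht' : 0 < t := ht
    rw [norm_smul, Real.norm_of_nonneg (by positivity), mul_assoc]
    gcongr
    exact h.norm_apply_le ht x

/-- The power `A^{-s} = Γ(s)⁻¹ ∫₀^∞ t^{s-1} T_t dt` of the generator. -/
def negPower (h : IsSymmSemigroup T δ) (s : ℝ) (hs : 0 < s) : H →L[ℂ] H :=
  LinearMap.mkContinuous
    { toFun := fun x => (Real.Gamma s)⁻¹ • ∫ t in Ioi (0 : ℝ), t ^ (s - 1) • T t x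
      map_add' := fun x y => by
        simp only [map_add, smul_add]
        rw [integral_add (h.integrableOn hs x) (h.integrableOn hs y), smul_add]
      map_smul' := fun c x => by
        simp only [map_smul, RingHom.id_apply]
        simp_rw [smul_comm _ c]
        rw [integral_smul, smul_comm] }
    ((Real.Gamma s)⁻¹ * ∫ t in Ioi (0 : ℝ), t ^ (s - 1) * Real.exp (-δ * t)) (fun x => by
      simp only [LinearMap.coe_mk, AddHom.coe_mk]
      rw [norm_smul, norm_inv, Real.norm_of_nonneg (Real.Gamma_pos_of_pos hs).le, mul_assoc]
      have := Real.Gamma_pos_of_pos hs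
      gcongr
      rw [← integral_mul_const]
      refine norm_integral_le_of_norm_le ((integrableOn_rpow_mul_exp hs h.pos).mul_const _) ?_
      refine (ae_restrict_iff' measurableSet_Ioi).2 (Eventually.of_forall fun t ht => ?_)
      have ht' : 0 < t := ht
      rw [norm_smul, Real.norm_of_nonneg (by positivity), mul_assoc]
      gcongr
      exact h.norm_apply_le ht x)

lemma negPower_apply (h : IsSymmSemigroup T δ) {s : ℝ} (hs : 0 < s) (x : H) :
    negPower h s hs x = (Real.Gamma s)⁻¹ • ∫ t in Ioi (0 : ℝ), t ^ (s - 1) • T t x := rfl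

variable [CompleteSpace H]

lemma inner_negPower (h : IsSymmSemigroup T δ) {s : ℝ} (hs : 0 < s) (x y : H) :
    inner ℂ y (negPower h s hs x) =
      ((Real.Gamma s)⁻¹ : ℝ) * ∫ t in Ioi (0 : ℝ), (t ^ (s - 1) : ℝ) * inner ℂ y (T t x) := by
  rw [negPower_apply, ← Complex.coe_smul, inner_smul_right]
  congr 1
  rw [← integral_inner (𝕜 := ℂ) (h.integrableOn hs x) y]
  refine integral_congr_ae (Eventually.of_forall fun t => ?_)
  simp only
  rw [← Complex.coe_smul, inner_smul_right]

lemma negPower_symm (h : IsSymmSemigroup T δ) {s : ℝ} (hs : 0 < s) (x y : H) :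
    inner ℂ (negPower h s hs x) y = inner ℂ x (negPower h s hs y) := by
  rw [← inner_conj_symm, inner_negPower, inner_negPower, map_mul, Complex.conj_ofReal,
    ← integral_conj]
  congr 1
  refine setIntegral_congr_fun measurableSet_Ioi fun t ht => ?_
  rw [map_mul, Complex.conj_ofReal, inner_conj_symm, h.symm t ht]

lemma integral_rpow_mul_sub_rpow {s r a : ℝ} (hs : 0 < s) (hr : 0 < r) (ha : 0 < a) :
    ∫ t in (0 : ℝ)..a, ((t ^ (s - 1) * (a - t) ^ (r - 1) : ℝ) : ℂ) =
      ((a ^ (s + r - 1) * (Real.Gamma s * Real.Gamma r / Real.Gamma (s + r)) : ℝ) : ℂ) := by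
  have h1 := Complex.betaIntegral_scaled s r ha
  have h2 := Complex.Gamma_mul_Gamma_eq_betaIntegral (s := s) (t := r) (by simpa) (by simpa)
  have h3 : Complex.betaIntegral s r =
      ((Real.Gamma s * Real.Gamma r / Real.Gamma (s + r) : ℝ) : ℂ) := by
    have : Complex.Gamma (s + r) ≠ 0 := by
      rw [← Complex.ofReal_add, Complex.Gamma_ofReal]
      exact_mod_cast (Real.Gamma_pos_of_pos (by positivity)).ne'
    push_cast
    rw [← Complex.Gamma_ofReal, ← Complex.Gamma_ofReal, ← Complex.Gamma_ofReal,
      Complex.ofReal_add, h2]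
    field_simp
  rw [h3] at h1
  rw [Complex.ofReal_mul, Complex.ofReal_cpow ha.le]
  push_cast at h1 ⊢
  rw [← h1]
  refine intervalIntegral.integral_congr fun t ht => ?_
  rw [uIcc_of_le ha.le] at ht
  rw [Complex.ofReal_cpow ht.1, Complex.ofReal_cpow (sub_nonneg.2 ht.2)]
  push_cast
  rfl

/-- The pairing of two Gamma integrals is the integral over `τ` of their convolution. By symmetry
and the semigroup law its integrand involves only `T_τ`, and the remaining power weights form a Beta
integral. -/
lemma inner_negPower_negPower (h : IsSymmSemigroup T δ) {s r : ℝ} (hs : 0 < s) (hr : 0 < r)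
    (x y : H) : inner ℂ (negPower h s hs y) (negPower h r hr x) =
      inner ℂ y (negPower h (s + r) (add_pos hs hr) x) := by
  have key := integral_posConvolution (μ := volume) (ν := volume) (h.integrableOn hs y)
    (h.integrableOn hr x)
    (IsBoundedBilinearMap.toContinuousLinearMap (isBoundedBilinearMap_inner (𝕜 := ℂ) (E := H)))
  have hG1 := (Real.Gamma_pos_of_pos hs).ne'
  have hG2 := (Real.Gamma_pos_of_pos hr).ne'
  have hG3 := (Real.Gamma_pos_of_pos (add_pos hs hr)).ne'
  rw [inner_negPower h (add_pos hs hr), negPower_apply, negPower_apply, ← Complex.coe_smul,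
    ← Complex.coe_smul, inner_smul_left, inner_smul_right, Complex.conj_ofReal]
  change _ = inner ℂ _ _ at key
  rw [← key]
  have e1 : ∀ τ ∈ Ioi (0 : ℝ), (∫ t in (0 : ℝ)..τ, inner ℂ (t ^ (s - 1) • T t y)
      ((τ - t) ^ (r - 1) • T (τ - t) x)) = ((τ ^ (s + r - 1) *
        (Real.Gamma s * Real.Gamma r / Real.Gamma (s + r)) : ℝ) : ℂ) * inner ℂ y (T τ x) := by
    intro τ hτ
    rw [← integral_rpow_mul_sub_rpow hs hr hτ, ← intervalIntegral.integral_mul_const]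
    refine intervalIntegral.integral_congr_ae ?_
    -- The endpoint is discarded because nothing is assumed about `T 0`.
    have : ∀ᵐ t : ℝ, t ≠ τ := by simp [ae_iff]
    filter_upwards [this] with t htτ ht
    have hτ' : 0 < τ := hτ
    rw [uIoc_of_le hτ'.le] at ht
    have h1 : 0 < τ - t := sub_pos.2 (lt_of_le_of_ne ht.2 htτ)
    rw [← Complex.coe_smul, ← Complex.coe_smul, inner_smul_left, inner_smul_right,
      h.symm t ht.1, ← h.add t _ ht.1 h1, Complex.conj_ofReal]
    push_cast
    rw [add_sub_cancel, mul_assoc]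
  change ((Real.Gamma s)⁻¹ : ℝ) * (((Real.Gamma r)⁻¹ : ℝ) * ∫ τ in Ioi (0 : ℝ),
    (∫ t in (0 : ℝ)..τ, inner ℂ (t ^ (s - 1) • T t y) ((τ - t) ^ (r - 1) • T (τ - t) x)) : ℂ) = _
  rw [setIntegral_congr_fun measurableSet_Ioi e1, ← integral_const_mul, ← integral_const_mul,
    ← integral_const_mul]
  refine integral_congr_ae (Eventually.of_forall fun t => ?_)
  simp only
  push_cast
  have hG1' : (Real.Gamma s : ℂ) ≠ 0 := by exact_mod_cast hG1
  have hG2' : (Real.Gamma r : ℂ) ≠ 0 := by exact_mod_cast hG2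
  field_simp

lemma negPower_mul (h : IsSymmSemigroup T δ) {s r : ℝ} (hs : 0 < s) (hr : 0 < r) :
    negPower h s hs * negPower h r hr = negPower h (s + r) (by positivity) := by
  ext x
  refine ext_inner_left ℂ fun y => ?_
  rw [mul_apply_eq_comp, ← negPower_symm, inner_negPower_negPower]

lemma negPower_pow (h : IsSymmSemigroup T δ) (k : ℕ) (hk : 0 < k) :
    negPower h 1 one_pos ^ k = negPower h k (by positivity) := by
  induction k, hk using Nat.le_induction with
  | base => simp
  | succ k hk ih =>
    rw [pow_succ, ih, negPower_mul]
    congr 1; push_cast; rfl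

/-- The power is the square of the symmetric half power. -/
lemma negPower_isPositive (h : IsSymmSemigroup T δ) {s : ℝ} (hs : 0 < s) :
    (negPower h s hs).IsPositive := by
  have h2 : 0 < s / 2 := by positivity
  have e : negPower h s hs = negPower h (s / 2) h2 * negPower h (s / 2) h2 := by
    rw [negPower_mul]; congr 1; ring
  rw [ContinuousLinearMap.isPositive_def]
  refine ⟨fun x y => negPower_symm h hs x y, fun x => ?_⟩
  rw [ContinuousLinearMap.reApplyInnerSelf_apply, e, mul_apply_eq_comp, negPower_symm]
  exact inner_self_nonneg

/-- The half-integral powers given by the semigroup are those of the functional calculus. -/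
theorem negPower_half (h : IsSymmSemigroup T δ) (k : ℕ) (hk : 0 < (k : ℝ) / 2) :
    negPower h ((k : ℝ) / 2) hk = power (negPower h 1 one_pos) ((k : ℝ) / 2) := by
  have hk' : 0 < k := by
    rcases Nat.eq_zero_or_pos k with rfl | h; · simp at hk
    exact h
  have hpos : ∀ s hs, 0 ≤ negPower h s hs := fun s hs =>
    (ContinuousLinearMap.nonneg_iff_isPositive _).2 (negPower_isPositive h hs)
  -- Both sides are nonnegative square roots of the `k`-th power of the inverse, and such a root is
  -- unique.
  have e1 := CFC.sqrt_rpow_nnreal (a := negPower h 1 one_pos) (x := (k : NNReal))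
  rw [NNReal.coe_natCast, CFC.rpow_natCast _ _ (hpos _ _), negPower_pow h k hk'] at e1
  rw [power, ← e1]
  symm
  refine CFC.sqrt_unique ?_ (hpos _ _)
  rw [negPower_mul]
  congr 1; ring

/-- Composition with `T_ε` moves the integrand away from the singular time zero; this is the
regularization used for all kernels. -/
lemma negPower_comp_eq (h : IsSymmSemigroup T δ) {s ε : ℝ} (hs : 0 < s) (hε : 0 < ε) (x y : H) :
    inner ℂ y (negPower h s hs (T ε x)) = ((Real.Gamma s)⁻¹ : ℝ) *
      ∫ t in Ioi (0 : ℝ), (t ^ (s - 1) : ℝ) * inner ℂ y (T (t + ε) x) := by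
  rw [inner_negPower]
  congr 1
  refine setIntegral_congr_fun measurableSet_Ioi fun t ht => ?_
  rw [← h.add t ε ht hε]

end Semigroup

end

section

/-! ### Extension of operators of weak type `(1, 1)` -/

section WeakType

variable {α : Type*} [MeasurableSpace α] {μ : Measure α}

/-- Superlevel sets along an almost everywhere convergent sequence. -/
lemma measure_lt_norm_le_of_tendsto {F : ℕ → α → ℂ} {G : α → ℂ}
    (h : ∀ᵐ z ∂μ, Tendsto (fun j => F j z) atTop (𝓝 (G z))) {a : ℝ} {b : ℕ → ℝ≥0∞} {b' : ℝ≥0∞}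
    (hb : Tendsto b atTop (𝓝 b')) (hF : ∀ j, μ {z | a < ‖F j z‖} ≤ b j) :
    μ {z | a < ‖G z‖} ≤ b' := by
  -- The inequality `a < ‖G z‖` is open, so it holds for all late terms; the sets `A N` increase to
  -- cover the limiting superlevel set.
  set A : ℕ → Set α := fun N => {z | ∀ j ≥ N, a < ‖F j z‖}
  have hA : Monotone A := fun N M hNM z hz j hj => hz j (hNM.trans hj)
  have h1 : μ {z | a < ‖G z‖} ≤ μ (⋃ N, A N) := by
    refine measure_mono_ae ?_
    filter_upwards [h] with z hz hza
    have := hz.norm.eventually (lt_mem_nhds (a := a) hza)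
    obtain ⟨N, hN⟩ := eventually_atTop.1 this
    exact mem_iUnion.2 ⟨N, fun j hj => hN j hj⟩
  refine h1.trans ?_
  rw [hA.measure_iUnion]
  refine iSup_le fun N => ge_of_tendsto hb ?_
  filter_upwards [eventually_ge_atTop N] with j hj
  exact (measure_mono fun z (hz : z ∈ A N) => hz j hj).trans (hF j)

variable {D : Submodule ℂ (Lp ℂ 1 μ)} {R₀ : D →ₗ[ℂ] (α →ₘ[μ] ℂ)} {C : ℝ}

/-- Borel–Cantelli: the weak bound at height `2^{-j}` for a vector of norm `K 4^{-j}` gives measure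
at most `C K 2^{-j}`, which is summable. -/
lemma ae_eventually_norm_le_of_weakType (hC : 0 ≤ C)
    (hR : ∀ d a, 0 < a → ENNReal.ofReal a * μ {z | a < ‖R₀ d z‖} ≤ ENNReal.ofReal (C * ‖d‖))
    {e : ℕ → D} {K : ℝ} (he : ∀ j, ‖e j‖ ≤ K * (1 / 4) ^ j) :
    ∀ᵐ z ∂μ, ∀ᶠ j in atTop, ‖R₀ (e j) z‖ ≤ (1 / 2) ^ j := by
  have hK : 0 ≤ K := by simpa using (norm_nonneg _).trans (he 0)
  have hb : ∀ j : ℕ, μ {z | (1 / 2 : ℝ) ^ j < ‖R₀ (e j) z‖} ≤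
      ENNReal.ofReal (C * K * (1 / 2) ^ j) := by
    intro j
    have hp : (0 : ℝ) < (1 / 2) ^ j := by positivity
    have h1 := (hR (e j) _ hp).trans (ENNReal.ofReal_le_ofReal
      (mul_le_mul_of_nonneg_left (he j) hC))
    have h2 : C * (K * (1 / 4 : ℝ) ^ j) = (1 / 2) ^ j * (C * K * (1 / 2) ^ j) := by
      rw [show (1 / 4 : ℝ) = (1 / 2) * (1 / 2) by norm_num, mul_pow]; ring
    rw [h2, ENNReal.ofReal_mul hp.le] at h1
    exact (ENNReal.mul_le_mul_iff_right (by simp) ENNReal.ofReal_ne_top).1 h1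
  have hs : ∑' j, μ {z | (1 / 2 : ℝ) ^ j < ‖R₀ (e j) z‖} ≠ ⊤ := by
    refine ne_top_of_le_ne_top ?_ (ENNReal.tsum_le_tsum hb)
    have : Summable fun j : ℕ => C * K * (1 / 2 : ℝ) ^ j :=
      (summable_geometric_of_lt_one (by norm_num) (by norm_num)).mul_left _
    rw [← ENNReal.ofReal_tsum_of_nonneg (fun j => by positivity) this]
    exact ENNReal.ofReal_ne_top
  filter_upwards [ae_eventually_notMem hs] with z hz
  filter_upwards [hz] with j hj
  simpa using hj

lemma ae_tendsto_zero_of_weakType (hC : 0 ≤ C)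
    (hR : ∀ d a, 0 < a → ENNReal.ofReal a * μ {z | a < ‖R₀ d z‖} ≤ ENNReal.ofReal (C * ‖d‖))
    {e : ℕ → D} {K : ℝ} (he : ∀ j, ‖e j‖ ≤ K * (1 / 4) ^ j) :
    ∀ᵐ z ∂μ, Tendsto (fun j => R₀ (e j) z) atTop (𝓝 0) := by
  filter_upwards [ae_eventually_norm_le_of_weakType hC hR he] with z hz
  exact squeeze_zero_norm' hz (tendsto_pow_atTop_nhds_zero_of_lt_one (by norm_num) (by norm_num))

/-- Consecutive differences of the approximating sequence have norm at most `2 · 4^{-j}`, so almost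
everywhere the increments of the images are eventually below `2^{-j}` and the sequence is Cauchy. -/
lemma ae_exists_tendsto_of_weakType (hC : 0 ≤ C)
    (hR : ∀ d a, 0 < a → ENNReal.ofReal a * μ {z | a < ‖R₀ d z‖} ≤ ENNReal.ofReal (C * ‖d‖))
    {d : ℕ → D} {f : Lp ℂ 1 μ} (hd : ∀ j, ‖f - d j‖ ≤ (1 / 4) ^ j) :
    ∀ᵐ z ∂μ, ∃ l, Tendsto (fun j => R₀ (d j) z) atTop (𝓝 l) := by
  have he : ∀ j, ‖d (j + 1) - d j‖ ≤ 2 * (1 / 4) ^ j := by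
    intro j
    have e1 : ((d (j + 1) - d j : D) : Lp ℂ 1 μ) = (f - d j) - (f - d (j + 1)) := by
      simp
    have h2 : (1 / 4 : ℝ) ^ (j + 1) ≤ (1 / 4) ^ j :=
      pow_le_pow_of_le_one (by norm_num) (by norm_num) (Nat.le_succ j)
    calc ‖d (j + 1) - d j‖ = ‖(f - d j) - (f - d (j + 1))‖ := by rw [← e1]; rfl
      _ ≤ ‖f - d j‖ + ‖f - d (j + 1)‖ := norm_sub_le _ _
      _ ≤ _ := by linarith [hd j, hd (j + 1)]
  have hdiff : ∀ᵐ z ∂μ, ∀ j, R₀ (d (j + 1) - d j) z = R₀ (d (j + 1)) z - R₀ (d j) z := by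
    rw [ae_all_iff]
    intro j
    rw [map_sub]
    exact AEEqFun.coeFn_sub _ _
  filter_upwards [ae_eventually_norm_le_of_weakType hC hR he, hdiff] with z hz hz2
  apply cauchySeq_tendsto_of_complete
  apply cauchySeq_of_summable_dist
  have : Summable fun j : ℕ => R₀ (d (j + 1) - d j) z := by
    refine Summable.of_norm_bounded_eventually_nat
      (summable_geometric_of_lt_one (r := (1 / 2 : ℝ)) (by norm_num) (by norm_num)) hz
  refine this.norm.congr fun j => ?_
  rw [hz2, dist_comm, dist_eq_norm]

/-- An operator of weak type `(1, 1)` on a dense subspace of `L¹` extends to `L¹`. -/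
theorem exists_extension_of_weakType (hD : Dense (D : Set (Lp ℂ 1 μ))) (hC : 0 ≤ C)
    (hR : ∀ d a, 0 < a → ENNReal.ofReal a * μ {z | a < ‖R₀ d z‖} ≤ ENNReal.ofReal (C * ‖d‖)) :
    ∃ R : Lp ℂ 1 μ →ₗ[ℂ] (α →ₘ[μ] ℂ), (∀ d : D, R d = R₀ d) ∧
      ∀ f a, 0 < a → ENNReal.ofReal a * μ {z | a < ‖R f z‖} ≤ ENNReal.ofReal (C * ‖f‖) := by
  -- The rate `4^{-j}` is fast enough for almost everywhere convergence along the whole sequence.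
  have hex : ∀ f : Lp ℂ 1 μ, ∃ d : ℕ → D, ∀ j, ‖f - d j‖ ≤ (1 / 4) ^ j := by
    intro f
    have : ∀ j : ℕ, ∃ d : D, ‖f - d‖ ≤ (1 / 4) ^ j := fun j => by
      obtain ⟨y, hy, hd⟩ := hD.exists_dist_lt f (ε := (1 / 4) ^ j) (by positivity)
      exact ⟨⟨y, hy⟩, by rw [← dist_eq_norm]; exact hd.le⟩
    choose d hd using this
    exact ⟨d, hd⟩
  choose d hd using hex
  have hlim := fun f => ae_exists_tendsto_of_weakType hC hR (hd f)
  have hmeas : ∀ f, ∃ g : α →ₘ[μ] ℂ, ∀ᵐ z ∂μ, Tendsto (fun j => R₀ (d f j) z) atTop (𝓝 (g z)) := by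
    intro f
    have h1 : ∀ᵐ z ∂μ, Tendsto (fun j => R₀ (d f j) z) atTop
        (𝓝 (limUnder atTop fun j => R₀ (d f j) z)) := by
      filter_upwards [hlim f] with z hz
      exact tendsto_nhds_limUnder hz
    have h2 : AEStronglyMeasurable (fun z => limUnder atTop fun j => R₀ (d f j) z) μ :=
      aestronglyMeasurable_of_tendsto_ae atTop (fun j => (R₀ (d f j)).aestronglyMeasurable) h1
    refine ⟨AEEqFun.mk _ h2, ?_⟩
    filter_upwards [h1, AEEqFun.coeFn_mk _ h2] with z hz hz2
    rw [hz2]; exact hz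
  choose R hRlim using hmeas
  refine ⟨{ toFun := R, map_add' := fun f g => ?_, map_smul' := fun c f => ?_ }, fun f => ?_,
    fun f a ha => ?_⟩
  -- The approximations are chosen independently, so additivity is not automatic; but the defect
  -- tends to zero at the rate `4^{-j}`, hence so does its image almost everywhere.
  · have he : ∀ j, ‖d (f + g) j - d f j - d g j‖ ≤ 3 * (1 / 4) ^ j := by
      intro j
      have e1 : ((d (f + g) j - d f j - d g j : D) : Lp ℂ 1 μ) =
          (f - d f j) + (g - d g j) - (f + g - d (f + g) j) := by
        simp only [Submodule.coe_sub]; abel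
      calc ‖d (f + g) j - d f j - d g j‖ = ‖(f - d f j) + (g - d g j) - (f + g - d (f + g) j)‖ := by
            rw [← e1]; rfl
        _ ≤ ‖f - d f j‖ + ‖g - d g j‖ + ‖f + g - d (f + g) j‖ :=
            (norm_sub_le _ _).trans (by gcongr; exact norm_add_le _ _)
        _ ≤ _ := by linarith [hd f j, hd g j, hd (f + g) j]
    have hdiff : ∀ᵐ z ∂μ, ∀ j, R₀ (d (f + g) j - d f j - d g j) z =
        R₀ (d (f + g) j) z - R₀ (d f j) z - R₀ (d g j) z := by
      rw [ae_all_iff]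
      intro j
      rw [map_sub, map_sub]
      filter_upwards [AEEqFun.coeFn_sub (R₀ (d (f + g) j) - R₀ (d f j)) (R₀ (d g j)),
        AEEqFun.coeFn_sub (R₀ (d (f + g) j)) (R₀ (d f j))] with z h1 h2
      rw [h1, Pi.sub_apply, h2, Pi.sub_apply]
    refine AEEqFun.ext ?_
    filter_upwards [AEEqFun.coeFn_add (R f) (R g), hRlim f, hRlim g, hRlim (f + g), hdiff,
      ae_tendsto_zero_of_weakType hC hR he] with z h1 h2 h3 h4 h5 h6
    rw [h1, Pi.add_apply]
    simp only [h5] at h6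
    have h7 := tendsto_nhds_unique h6 ((h4.sub h2).sub h3)
    linear_combination -h7
  · have he : ∀ j, ‖d (c • f) j - c • d f j‖ ≤ (1 + ‖c‖) * (1 / 4) ^ j := by
      intro j
      have e1 : ((d (c • f) j - c • d f j : D) : Lp ℂ 1 μ) =
          c • (f - d f j) - (c • f - d (c • f) j) := by
        simp only [Submodule.coe_sub, Submodule.coe_smul, smul_sub]; abel
      calc ‖d (c • f) j - c • d f j‖ = ‖c • (f - d f j) - (c • f - d (c • f) j)‖ := by
            rw [← e1]; rfl
        _ ≤ ‖c‖ * ‖f - d f j‖ + ‖c • f - d (c • f) j‖ :=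
            (norm_sub_le _ _).trans (by rw [norm_smul])
        _ ≤ ‖c‖ * (1 / 4) ^ j + (1 / 4) ^ j := by gcongr; exacts [hd f j, hd (c • f) j]
        _ = _ := by ring
    have hdiff : ∀ᵐ z ∂μ, ∀ j, R₀ (d (c • f) j - c • d f j) z =
        R₀ (d (c • f) j) z - c * R₀ (d f j) z := by
      rw [ae_all_iff]
      intro j
      rw [map_sub, map_smul]
      filter_upwards [AEEqFun.coeFn_sub (R₀ (d (c • f) j)) (c • R₀ (d f j)),
        AEEqFun.coeFn_smul c (R₀ (d f j))] with z h1 h2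
      rw [h1, Pi.sub_apply, h2, Pi.smul_apply, smul_eq_mul]
    refine AEEqFun.ext ?_
    rw [RingHom.id_apply]
    filter_upwards [AEEqFun.coeFn_smul c (R f), hRlim f, hRlim (c • f), hdiff,
      ae_tendsto_zero_of_weakType hC hR he] with z h1 h2 h4 h5 h6
    rw [h1, Pi.smul_apply, smul_eq_mul]
    simp only [h5] at h6
    have h7 := tendsto_nhds_unique h6 (h4.sub (h2.const_mul c))
    linear_combination -h7
  -- The same argument shows that the extension does not change the operator on `D`.
  · have he : ∀ j, ‖f - d f j‖ ≤ 1 * (1 / 4) ^ j := by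
      intro j; rw [one_mul]; exact hd f j
    have hdiff : ∀ᵐ z ∂μ, ∀ j, R₀ (f - d f j) z = R₀ f z - R₀ (d f j) z := by
      rw [ae_all_iff]
      intro j
      rw [map_sub]
      exact AEEqFun.coeFn_sub _ _
    refine AEEqFun.ext ?_
    filter_upwards [hRlim f, hdiff, ae_tendsto_zero_of_weakType hC hR he] with z h2 h5 h6
    simp only [h5] at h6
    have h7 := tendsto_nhds_unique h6 (tendsto_const_nhds.sub h2)
    change R f z = R₀ f z
    linear_combination h7
  · rw [mul_comm, ← ENNReal.le_div_iff_mul_le (by simp [ha]) (by simp)]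
    have hn : Tendsto (fun j => ‖d f j‖) atTop (𝓝 ‖f‖) := by
      have h1 : Tendsto (fun j => (d f j : Lp ℂ 1 μ)) atTop (𝓝 f) := by
        rw [tendsto_iff_norm_sub_tendsto_zero]
        refine squeeze_zero (fun j => norm_nonneg _) (fun j => ?_)
          (tendsto_pow_atTop_nhds_zero_of_lt_one (r := (1 / 4 : ℝ)) (by norm_num) (by norm_num))
        rw [norm_sub_rev]; exact hd f j
      exact h1.norm
    refine measure_lt_norm_le_of_tendsto (hRlim f) (b := fun j => ENNReal.ofReal (C * ‖d f j‖) /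
      ENNReal.ofReal a) ?_ fun j => ?_
    · exact ENNReal.Tendsto.div_const ((ENNReal.continuous_ofReal.tendsto _).comp
        (hn.const_mul C)) (Or.inr (by simp [ha]))
    · rw [ENNReal.le_div_iff_mul_le (by simp [ha]) (by simp), mul_comm]
      exact hR _ _ ha

end WeakType

end

section

variable {n : ℕ}

/-! ### Dyadic cubes -/

/-- The index of the dyadic cube of side `s / 2 ^ j` that contains `z`. -/
def cell (s : ℝ) (j : ℕ) (z : Space n) : Fin n ⊕ Fin n → ℤ := fun i => ⌊z i * 2 ^ j / s⌋

/-- The dyadic cube with a given generation and index. -/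
def cube (s : ℝ) (p : ℕ × (Fin n ⊕ Fin n → ℤ)) : Set (Space n) := {z | cell s p.1 z = p.2}

/-- A bound for the diameter of the dyadic cubes of generation `j`. -/
def rad (n : ℕ) (s : ℝ) (j : ℕ) : ℝ := √(2 * n) * (s / 2 ^ j)

lemma measurable_cell (s : ℝ) (j : ℕ) : Measurable (cell (n := n) s j) := by
  refine measurable_pi_lambda _ fun i => ?_
  refine Int.measurable_floor.comp ?_
  fun_prop

lemma measurableSet_cube (s : ℝ) (p : ℕ × (Fin n ⊕ Fin n → ℤ)) :
    MeasurableSet (cube s p) :=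
  measurable_cell s p.1 (measurableSet_singleton p.2)

lemma mem_cube_iff {s : ℝ} (hs : 0 < s) {p : ℕ × (Fin n ⊕ Fin n → ℤ)} {z : Space n} :
    z ∈ cube s p ↔ ∀ i, z i ∈ Ico (p.2 i * (s / 2 ^ p.1)) ((p.2 i + 1) * (s / 2 ^ p.1)) := by
  have h2 : (0 : ℝ) < 2 ^ p.1 := by positivity
  simp only [cube, cell, mem_ofPred_eq, funext_iff, Int.floor_eq_iff, mem_Ico]
  refine forall_congr' fun i => and_congr ?_ ?_
  · rw [le_div_iff₀ hs, ← mul_div_assoc, div_le_iff₀ h2]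
  · rw [div_lt_iff₀ hs, ← mul_div_assoc, lt_div_iff₀ h2]

lemma volume_cube {s : ℝ} (hs : 0 < s) (p : ℕ × (Fin n ⊕ Fin n → ℤ)) :
    volume (cube s p) = ENNReal.ofReal ((s / 2 ^ p.1) ^ (2 * n)) := by
  have h0 : 0 < s / 2 ^ p.1 := by positivity
  have e : cube s p = (WithLp.ofLp : Space n → Fin n ⊕ Fin n → ℝ) ⁻¹'
      (Set.pi univ fun i => Ico (p.2 i * (s / 2 ^ p.1)) ((p.2 i + 1) * (s / 2 ^ p.1))) := by
    ext z
    simp only [mem_cube_iff hs, mem_preimage, Set.mem_pi, mem_univ, true_imp_iff]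
  rw [e, (PiLp.volume_preserving_ofLp (Fin n ⊕ Fin n)).measure_preimage
    (MeasurableSet.univ_pi fun i => measurableSet_Ico).nullMeasurableSet, Real.volume_pi_Ico]
  have : ∀ i : Fin n ⊕ Fin n, ((p.2 i : ℝ) + 1) * (s / 2 ^ p.1) - p.2 i * (s / 2 ^ p.1) =
    s / 2 ^ p.1 := fun i => by ring
  simp only [this, Finset.prod_const, Finset.card_univ, Fintype.card_sum, Fintype.card_fin]
  rw [ENNReal.ofReal_pow h0.le, two_mul]

lemma norm_sub_le_rad {s : ℝ} (hs : 0 < s) {p : ℕ × (Fin n ⊕ Fin n → ℤ)} {z w : Space n}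
    (hz : z ∈ cube s p) (hw : w ∈ cube s p) : ‖z - w‖ ≤ rad n s p.1 := by
  have h0 : 0 < s / 2 ^ p.1 := by positivity
  rw [mem_cube_iff hs] at hz hw
  rw [EuclideanSpace.norm_eq, rad, Real.sqrt_le_left (by positivity), mul_pow,
    Real.sq_sqrt (by positivity)]
  have : ∀ i ∈ (Finset.univ : Finset (Fin n ⊕ Fin n)), ‖(z - w) i‖ ^ 2 ≤ (s / 2 ^ p.1) ^ 2 := by
    intro i _
    have h1 := hz i
    have h2 := hw i
    rw [Real.norm_eq_abs, sq_abs, sq_le_sq, abs_of_pos h0, abs_le]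
    simp only [PiLp.sub_apply]
    constructor <;> nlinarith [h1.1, h1.2, h2.1, h2.2]
  refine (Finset.sum_le_sum this).trans (le_of_eq ?_)
  simp [two_mul]

/-- The dyadic grid is nested: the index of the parent is the integer half of the index of the
child. -/
lemma cell_eq_of_succ {s : ℝ} {j : ℕ} {z w : Space n} (h : cell s (j + 1) z = cell s (j + 1) w) :
    cell s j z = cell s j w := by
  have key : ∀ z : Space n, ∀ i, cell s j z i = cell s (j + 1) z i / 2 := by
    intro z i
    have e : z i * 2 ^ j / s = (z i * 2 ^ (j + 1) / s) / 2 := by rw [pow_succ]; ring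
    simp only [cell, e]
    have := Int.floor_div_natCast (z i * 2 ^ (j + 1) / s) 2
    simpa only [Nat.cast_ofNat] using this
  funext i
  rw [key, key, h]

lemma cell_eq_of_le {s : ℝ} {i j : ℕ} (hij : i ≤ j) {z w : Space n}
    (h : cell s j z = cell s j w) : cell s i z = cell s i w := by
  induction j, hij using Nat.le_induction with
  | base => exact h
  | succ j _ ih => exact ih (cell_eq_of_succ h)

lemma mem_cube_cell (s : ℝ) (j : ℕ) (z : Space n) : z ∈ cube s (j, cell s j z) := rfl

/-! ### Comparison of the drift measure with Lebesgue measure -/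

/-- On a set whose diameter is at most `K / ‖ν‖` the density is constant up to the factor `e^{2K}`.
This replaces the doubling property, which fails at large scales. -/
lemma dens_le {ν z w : Space n} {K : ℝ} (h : ‖ν‖ * ‖z - w‖ ≤ K) :
    dens ν z ≤ Real.exp (2 * K) * dens ν w := by
  unfold dens
  rw [← Real.exp_add, Real.exp_le_exp]
  have h1 := (le_abs_self _).trans (abs_real_inner_le_norm ν (z - w))
  rw [inner_sub_right] at h1
  linarith

lemma setLIntegral_driftMeasure (ν : Space n) {S : Set (Space n)} (hS : MeasurableSet S)
    (f : Space n → ℝ≥0∞) :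
    ∫⁻ z in S, f z ∂(driftMeasure ν) = ∫⁻ z in S, ENNReal.ofReal (dens ν z) * f z := by
  rw [driftMeasure_eq, setLIntegral_withDensity_eq_setLIntegral_mul_non_measurable _
    (measurable_ofReal_dens ν) f hS (Eventually.of_forall fun z => ENNReal.ofReal_lt_top)]
  rfl

lemma ofReal_dens_mul_setLIntegral_le {ν c : Space n} {K : ℝ} {S : Set (Space n)}
    (hS : MeasurableSet S) (hc : ∀ w ∈ S, ‖ν‖ * ‖c - w‖ ≤ K) (h : Space n → ℝ≥0∞) :
    ENNReal.ofReal (dens ν c) * ∫⁻ w in S, h w ≤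
      ENNReal.ofReal (Real.exp (2 * K)) * ∫⁻ w in S, h w ∂(driftMeasure ν) := by
  rw [setLIntegral_driftMeasure ν hS, ← lintegral_const_mul' _ _ ENNReal.ofReal_ne_top,
    ← lintegral_const_mul' _ _ ENNReal.ofReal_ne_top]
  refine setLIntegral_mono' hS fun w hw => ?_
  rw [← mul_assoc, ← ENNReal.ofReal_mul (by positivity)]
  gcongr
  exact dens_le (hc w hw)

lemma setLIntegral_driftMeasure_le {ν c : Space n} {K : ℝ} {S : Set (Space n)}
    (hS : MeasurableSet S) (hc : ∀ w ∈ S, ‖ν‖ * ‖w - c‖ ≤ K) (h : Space n → ℝ≥0∞) :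
    ∫⁻ w in S, h w ∂(driftMeasure ν) ≤
      ENNReal.ofReal (Real.exp (2 * K)) * (ENNReal.ofReal (dens ν c) * ∫⁻ w in S, h w) := by
  rw [setLIntegral_driftMeasure ν hS, ← lintegral_const_mul' _ _ ENNReal.ofReal_ne_top,
    ← lintegral_const_mul' _ _ ENNReal.ofReal_ne_top]
  refine setLIntegral_mono' hS fun w hw => ?_
  rw [← mul_assoc, ← ENNReal.ofReal_mul (by positivity)]
  gcongr
  exact dens_le (hc w hw)

/-! ### The stopping cubes -/

/-- The mean of `‖f‖` over the cube exceeds the height `a`. -/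
def Heavy (s : ℝ) (f : Space n → ℂ) (a : ℝ) (p : ℕ × (Fin n ⊕ Fin n → ℤ)) : Prop :=
  ENNReal.ofReal a * volume (cube s p) < ∫⁻ w in cube s p, ‖f w‖ₑ

/-- The first heavy dyadic cube containing `z` has generation `j`. -/
def Stops (s : ℝ) (f : Space n → ℂ) (a : ℝ) (j : ℕ) (z : Space n) : Prop :=
  Heavy s f a (j, cell s j z) ∧ ∀ i < j, ¬Heavy s f a (i, cell s i z)

/-- The maximal heavy dyadic cubes. -/
def stopping (s : ℝ) (f : Space n → ℂ) (a : ℝ) : Set (ℕ × (Fin n ⊕ Fin n → ℤ)) :=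
  {p | ∃ z ∈ cube s p, Stops s f a p.1 z}

/-- A point of the cube. -/
def ctr (s : ℝ) (p : ℕ × (Fin n ⊕ Fin n → ℤ)) : Space n :=
  open Classical in if h : (cube s p).Nonempty then h.some else 0

section Stopping

variable {s a : ℝ} {f : Space n → ℂ} {p q : ℕ × (Fin n ⊕ Fin n → ℤ)} {z w : Space n}

lemma Stops.congr {j : ℕ} (h : Stops s f a j z) (hzw : cell s j z = cell s j w) :
    Stops s f a j w := by
  refine ⟨hzw ▸ h.1, fun i hi => ?_⟩
  rw [← cell_eq_of_le hi.le hzw]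
  exact h.2 i hi

lemma stops_of_mem (hp : p ∈ stopping s f a) (hz : z ∈ cube s p) : Stops s f a p.1 z := by
  obtain ⟨w, hw, h⟩ := hp
  exact h.congr ((show cell s p.1 w = p.2 from hw).trans (show cell s p.1 z = p.2 from hz).symm)

lemma Stops.unique {i j : ℕ} (hi : Stops s f a i z) (hj : Stops s f a j z) : i = j := by
  by_contra h
  rcases lt_or_gt_of_ne h with h | h
  · exact hj.2 i h hi.1
  · exact hi.2 j h hj.1

lemma Stops.mem_stopping {j : ℕ} (h : Stops s f a j z) : (j, cell s j z) ∈ stopping s f a :=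
  ⟨z, mem_cube_cell s j z, h⟩

lemma ctr_mem (hp : p ∈ stopping s f a) : ctr s p ∈ cube s p := by
  have h : (cube s p).Nonempty := ⟨_, hp.choose_spec.1⟩
  rw [ctr, dif_pos h]
  exact h.some_mem

lemma heavy_of_mem (hp : p ∈ stopping s f a) : Heavy s f a p := by
  obtain ⟨w, hw, h⟩ := hp
  have : p = (p.1, cell s p.1 w) := by rw [show cell s p.1 w = p.2 from hw]
  rw [this]; exact h.1

lemma eq_of_mem_of_mem (hp : p ∈ stopping s f a) (hq : q ∈ stopping s f a) (hzp : z ∈ cube s p)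
    (hzq : z ∈ cube s q) : p = q := by
  have h1 := (stops_of_mem hp hzp).unique (stops_of_mem hq hzq)
  refine Prod.ext h1 ?_
  rw [← show cell s p.1 z = p.2 from hzp, ← show cell s q.1 z = q.2 from hzq, h1]

lemma pairwise_disjoint_stopping (s : ℝ) (f : Space n → ℂ) (a : ℝ) :
    Pairwise (Function.onFun Disjoint fun p : stopping s f a => cube s p.1) := by
  intro p q hpq
  refine Set.disjoint_left.2 fun z hp hq => hpq (Subtype.ext ?_)
  exact eq_of_mem_of_mem p.2 q.2 hp hq

/-- The union of the stopping cubes. -/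
def badSet (s : ℝ) (f : Space n → ℂ) (a : ℝ) : Set (Space n) :=
  ⋃ p : stopping s f a, cube s p.1

lemma measurableSet_badSet : MeasurableSet (badSet s f a) :=
  MeasurableSet.iUnion fun _ => measurableSet_cube _ _

/-- If some cube around `z` were heavy, the first such generation would give a stopping cube
containing `z`. -/
lemma not_heavy_of_notMem (hz : z ∉ badSet s f a) (j : ℕ) : ¬Heavy s f a (j, cell s j z) := by
  classical
  intro h
  have hex : ∃ j, Heavy s f a (j, cell s j z) := ⟨j, h⟩
  have : Stops s f a (Nat.find hex) z := ⟨Nat.find_spec hex, fun i hi => Nat.find_min hex hi⟩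
  exact hz (mem_iUnion.2 ⟨⟨_, this.mem_stopping⟩, mem_cube_cell s _ z⟩)

/-- Off the stopping cubes the function is bounded by the height. -/
lemma ae_norm_le_of_notMem (hs : 0 < s) (ha : 0 ≤ a) (hf : LocallyIntegrable f volume) :
    ∀ᵐ z, z ∉ badSet s f a → ‖f z‖ ≤ a := by
  filter_upwards [IsUnifLocDoublingMeasure.ae_tendsto_average_norm_sub
    (μ := (volume : Measure (Space n))) hf 0] with z hz hzb
  -- For `n = 0` the space is a point and the radii vanish, so the differentiation theorem says
  -- nothing; the cube of generation zero is used directly.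
  rcases Nat.eq_zero_or_pos n with rfl | hn
  · have h0 := not_heavy_of_notMem hzb 0
    have hu : ∀ S : Set (Space 0), S.Nonempty → S = univ := fun S hS =>
      Subsingleton.eq_univ_of_nonempty hS
    have e1 := hu _ ⟨z, mem_cube_cell s 0 z⟩
    have e2 := volume_cube hs (0, cell s 0 z)
    simp only [Heavy, e1, not_lt, Measure.restrict_univ] at h0 e2
    have e3 : ∀ w, f w = f z := fun w => by rw [Subsingleton.elim w z]
    simp only [e3, lintegral_const, e2] at h0
    simp only [mul_zero, pow_zero, ENNReal.ofReal_one, mul_one] at h0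
    rw [← ofReal_norm] at h0
    exact (ENNReal.ofReal_le_ofReal_iff ha).1 h0
  set δ : ℕ → ℝ := fun j => rad n s j with hδ
  have hn' : (0 : ℝ) < n := by exact_mod_cast hn
  have hδpos : ∀ j, 0 < δ j := fun j => by simp only [hδ, rad]; positivity
  have hδlim : Tendsto δ atTop (𝓝[>] 0) := by
    rw [tendsto_nhdsWithin_iff]
    refine ⟨?_, Eventually.of_forall fun j => hδpos j⟩
    have h1 : Tendsto (fun j : ℕ => √(2 * n) * s * (1 / 2 : ℝ) ^ j) atTop (𝓝 (√(2 * n) * s * 0)) :=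
      (tendsto_pow_atTop_nhds_zero_of_lt_one (by norm_num) (by norm_num)).const_mul _
    rw [mul_zero] at h1
    refine h1.congr fun j => ?_
    simp only [hδ, rad, one_div, inv_pow]; ring
  have h1 := hz (fun _ : ℕ => z) δ hδlim (Eventually.of_forall fun j => by simp)
  set V : ℝ := (volume : Measure (Space n)).real (Metric.ball 0 1) with hV
  -- `Cn` is the ratio of the volumes of the ball of radius `rad n s j` and of the cube of
  -- generation `j`. It is independent of `j`, so averages over the cubes inherit the Lebesgue point
  -- property from the balls.
  set Cn : ℝ := √(2 * n) ^ (2 * n) * V with hCn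
  have hvolcube : ∀ j, volume.real (cube s (j, cell s j z)) = (s / 2 ^ j) ^ (2 * n) := fun j => by
    rw [Measure.real, volume_cube hs, ENNReal.toReal_ofReal (by positivity)]
  have hvolball : ∀ j, volume.real (Metric.closedBall z (δ j)) = Cn * (s / 2 ^ j) ^ (2 * n) := by
    intro j
    have hfr : Module.finrank ℝ (Space n) = 2 * n := by simp [two_mul]
    rw [Measure.addHaar_real_closedBall _ _ (hδpos j).le, hfr, hCn]
    simp only [hδ, rad]
    rw [mul_pow]; ring
  have key : ∀ j, ‖f z‖ ≤ a + Cn * ⨍ y in Metric.closedBall z (δ j), ‖f y - f z‖ := by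
    intro j
    set Q := cube s (j, cell s j z) with hQ
    have hQB : Q ⊆ Metric.closedBall z (δ j) := fun w hw => by
      rw [Metric.mem_closedBall, dist_eq_norm]
      exact norm_sub_le_rad hs hw (mem_cube_cell s j z)
    have hB : IntegrableOn f (Metric.closedBall z (δ j)) :=
      hf.integrableOn_isCompact (isCompact_closedBall _ _)
    have hBf : IntegrableOn (fun y => ‖f y - f z‖) (Metric.closedBall z (δ j)) :=
      (hB.sub (integrableOn_const (by exact measure_closedBall_lt_top.ne))).norm
    have hq : 0 < volume.real Q := by rw [hvolcube]; positivity
    have hheavy := not_heavy_of_notMem hzb j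
    rw [Heavy, not_lt] at hheavy
    have hI : ∫ w in Q, ‖f w‖ ≤ a * volume.real Q := by
      rw [integral_norm_eq_lintegral_enorm (hB.mono_set hQB).aestronglyMeasurable]
      refine ENNReal.toReal_le_of_le_ofReal (by positivity) (hheavy.trans (le_of_eq ?_))
      rw [ENNReal.ofReal_mul ha, Measure.real, ENNReal.ofReal_toReal]
      rw [volume_cube hs]; exact ENNReal.ofReal_ne_top
    have hmain : ‖f z‖ * volume.real Q ≤ a * volume.real Q +
        ∫ w in Metric.closedBall z (δ j), ‖f w - f z‖ := by
      calc ‖f z‖ * volume.real Q = ∫ w in Q, ‖f z‖ := by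
            rw [setIntegral_const, smul_eq_mul, mul_comm]
        _ ≤ ∫ w in Q, (‖f w‖ + ‖f w - f z‖) := by
            refine setIntegral_mono_on ?_ ?_ (measurableSet_cube _ _) fun w _ => ?_
            · exact integrableOn_const (by rw [volume_cube hs]; exact ENNReal.ofReal_ne_top)
            · exact (hB.mono_set hQB).norm.add (hBf.mono_set hQB)
            · have := norm_sub_norm_le (f z) (f w)
              rw [norm_sub_rev] at this; linarith
        _ = (∫ w in Q, ‖f w‖) + ∫ w in Q, ‖f w - f z‖ :=
            integral_add (hB.mono_set hQB).norm (hBf.mono_set hQB)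
        _ ≤ _ := by
            refine add_le_add hI ?_
            exact setIntegral_mono_set hBf (Eventually.of_forall fun w => norm_nonneg _)
              hQB.eventuallyLE
    rw [setAverage_eq, smul_eq_mul, hvolball]
    have hV0 : 0 < V := by
      rw [hV, Measure.real, ENNReal.toReal_pos_iff]
      exact ⟨Metric.measure_ball_pos _ _ one_pos, measure_ball_lt_top⟩
    have hC0 : 0 < Cn := by rw [hCn]; positivity
    rw [hvolcube] at hmain hq
    have e1 : Cn * ((Cn * (s / 2 ^ j) ^ (2 * n))⁻¹ *
        ∫ y in Metric.closedBall z (δ j), ‖f y - f z‖) = ((s / 2 ^ j) ^ (2 * n))⁻¹ *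
        ∫ y in Metric.closedBall z (δ j), ‖f y - f z‖ := by
      rw [mul_inv, ← mul_assoc, ← mul_assoc, mul_inv_cancel₀ hC0.ne', one_mul]
    rw [e1]
    have := div_le_div_of_nonneg_right hmain hq.le
    rw [mul_div_cancel_right₀ _ hq.ne', add_div, mul_div_cancel_right₀ _ hq.ne'] at this
    rwa [inv_mul_eq_div]
  have hlim : Tendsto (fun j => a + Cn * ⨍ y in Metric.closedBall z (δ j), ‖f y - f z‖) atTop
      (𝓝 (a + Cn * 0)) := (h1.const_mul Cn).const_add a
  rw [mul_zero, add_zero] at hlim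
  exact ge_of_tendsto' hlim key

end Stopping

end

section

variable {n : ℕ}

/-! ### Local Calderón–Zygmund theory for the drift measure -/

/-- Size and smoothness conditions, at scales up to `s`, for a kernel with respect to Lebesgue
measure. The cancellation is measured against the unimodular functions `m c`. -/
structure IsLocalCZKernel (ν : Space n) (s A : ℝ) (N m : Space n → Space n → ℂ) : Prop where
  meas : Measurable (Function.uncurry N)
  meas_mod : ∀ c, Measurable (m c)
  norm_mod : ∀ c w, ‖m c w‖ = 1
  far : ∀ c w, ‖w - c‖ ≤ rad n s 0 →
    ∫⁻ z in {z | 2 * rad n s 0 ≤ ‖z - c‖}, ‖N z w‖ₑ ∂(driftMeasure ν) ≤ ENNReal.ofReal (A * dens ν w)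
  near : ∀ c w j, ‖w - c‖ ≤ rad n s j →
    ∫⁻ z in {z | 2 * rad n s j ≤ ‖z - c‖}, ‖N z w * m c w - N z c‖ₑ ∂(driftMeasure ν) ≤
      ENNReal.ofReal (A * dens ν w)

section Decomposition

/-- The twisted mean of `f` over a cube. -/
def twistedMean (m : Space n → Space n → ℂ) (s : ℝ) (f : Space n → ℂ)
    (p : ℕ × (Fin n ⊕ Fin n → ℤ)) : ℂ :=
  (((volume : Measure (Space n)).real (cube s p))⁻¹ : ℝ) *
    ∫ w in cube s p, conj (m (ctr s p) w) * f w

/-- The good part of `f` on a stopping cube. -/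
def goodOn (m : Space n → Space n → ℂ) (s : ℝ) (f : Space n → ℂ)
    (p : ℕ × (Fin n ⊕ Fin n → ℤ)) (w : Space n) : ℂ :=
  -- A stopping cube of generation zero has no parent that would bound its mean, so all of `f` is
  -- put into the bad part there. The mean value zero is given up; the `far` condition on the kernel
  -- compensates for this.
  if p.1 = 0 then 0 else m (ctr s p) w * twistedMean m s f p

/-- The good part of `f` at height `a`. -/
def good (m : Space n → Space n → ℂ) (s : ℝ) (f : Space n → ℂ) (a : ℝ) (w : Space n) : ℂ :=
  open Classical in
  if h : ∃ j, Stops s f a j w then goodOn m s f (h.choose, cell s h.choose w) w else f w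

variable {m : Space n → Space n → ℂ} {s a : ℝ} {f : Space n → ℂ}
  {p : ℕ × (Fin n ⊕ Fin n → ℤ)} {z : Space n}

lemma good_of_mem (hp : p ∈ stopping s f a) (hz : z ∈ cube s p) :
    good m s f a z = goodOn m s f p z := by
  have h : ∃ j, Stops s f a j z := ⟨_, stops_of_mem hp hz⟩
  rw [good, dif_pos h]
  congr 1
  exact eq_of_mem_of_mem h.choose_spec.mem_stopping hp (mem_cube_cell s _ z) hz

lemma good_of_notMem (hz : z ∉ badSet s f a) : good m s f a z = f z := by
  have h : ¬∃ j, Stops s f a j z := by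
    rintro ⟨j, hj⟩
    exact not_heavy_of_notMem hz j hj.1
  rw [good, dif_neg h]

lemma volume_cube_ne_top (hs : 0 < s) (p : ℕ × (Fin n ⊕ Fin n → ℤ)) :
    volume (cube s p) ≠ ⊤ := by
  rw [volume_cube hs]; exact ENNReal.ofReal_ne_top

lemma volume_cube_ne_zero (hs : 0 < s) (p : ℕ × (Fin n ⊕ Fin n → ℤ)) :
    volume (cube s p) ≠ 0 := by
  rw [volume_cube hs]
  have : 0 < (s / 2 ^ p.1) ^ (2 * n) := by positivity
  simpa using this

lemma enorm_twistedMean_mul_le (hs : 0 < s) (hm : ∀ c w, ‖m c w‖ = 1) :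
    ‖twistedMean m s f p‖ₑ * volume (cube s p) ≤ ∫⁻ w in cube s p, ‖f w‖ₑ := by
  have h1 : ‖(((volume : Measure (Space n)).real (cube s p))⁻¹ : ℝ)‖ₑ * volume (cube s p) = 1 := by
    have h0 : 0 < (volume : Measure (Space n)).real (cube s p) :=
      ENNReal.toReal_pos (volume_cube_ne_zero hs p) (volume_cube_ne_top hs p)
    rw [Real.enorm_eq_ofReal (by positivity), ENNReal.ofReal_inv_of_pos h0, Measure.real,
      ENNReal.ofReal_toReal (volume_cube_ne_top hs p)]
    exact ENNReal.inv_mul_cancel (volume_cube_ne_zero hs p) (volume_cube_ne_top hs p)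
  have h2 : ‖((((volume : Measure (Space n)).real (cube s p))⁻¹ : ℝ) : ℂ)‖ₑ =
      ‖(((volume : Measure (Space n)).real (cube s p))⁻¹ : ℝ)‖ₑ := by
    rw [← ofReal_norm, ← ofReal_norm, Complex.norm_real]
  rw [twistedMean, enorm_mul, h2, mul_right_comm, h1, one_mul]
  refine (enorm_integral_le_lintegral_enorm _).trans (le_of_eq ?_)
  refine lintegral_congr fun w => ?_
  have : ‖conj (m (ctr s p) w)‖ₑ = 1 := by
    rw [← ofReal_norm, RCLike.norm_conj, hm]; simp
  rw [enorm_mul, this, one_mul]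

/-- The parent of a stopping cube of positive generation is not heavy, and its volume is `2^{2n}`
times larger. -/
lemma enorm_twistedMean_le (hs : 0 < s) (hm : ∀ c w, ‖m c w‖ = 1)
    (hp : p ∈ stopping s f a) (hp0 : p.1 ≠ 0) :
    ‖twistedMean m s f p‖ₑ ≤ ENNReal.ofReal (2 ^ (2 * n)) * ENNReal.ofReal a := by
  obtain ⟨j, hj⟩ := Nat.exists_eq_succ_of_ne_zero hp0
  have hc := ctr_mem hp
  have hst := stops_of_mem hp hc
  have hnot := hst.2 j (by omega)
  rw [Heavy, not_lt] at hnot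
  have hsub : cube s p ⊆ cube s (j, cell s j (ctr s p)) := by
    intro w hw
    have : cell s p.1 w = cell s p.1 (ctr s p) :=
      (show cell s p.1 w = p.2 from hw).trans (show cell s p.1 (ctr s p) = p.2 from hc).symm
    exact cell_eq_of_le (by omega) this
  have hvol : volume (cube s (j, cell s j (ctr s p))) =
      ENNReal.ofReal (2 ^ (2 * n)) * volume (cube s p) := by
    rw [volume_cube hs, volume_cube hs, ← ENNReal.ofReal_mul (by positivity), ← mul_pow]
    congr 2
    rw [hj]; simp only [Nat.succ_eq_add_one, pow_succ]; field_simp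
  have h1 := (enorm_twistedMean_mul_le (f := f) (p := p) hs hm).trans
    ((lintegral_mono_set hsub).trans hnot)
  rw [hvol, ← mul_assoc, mul_comm (ENNReal.ofReal a)] at h1
  exact (ENNReal.mul_le_mul_iff_left (volume_cube_ne_zero hs p) (volume_cube_ne_top hs p)).1 h1

lemma enorm_goodOn_le (hm : ∀ c w, ‖m c w‖ = 1) (w : Space n) :
    ‖goodOn m s f p w‖ₑ ≤ ‖twistedMean m s f p‖ₑ := by
  unfold goodOn
  split_ifs
  · simp
  · have : ‖m (ctr s p) w‖ₑ = 1 := by rw [← ofReal_norm, hm]; simp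
    rw [enorm_mul, this, one_mul]

variable {ν : Space n} {K : ℝ}

lemma rad_le (hs : 0 < s) (j : ℕ) : rad n s j ≤ rad n s 0 := by
  unfold rad
  gcongr
  · norm_num
  · omega

/-- The density is frozen at a point of the cube. Each passage between the drift measure and
Lebesgue measure costs `e^{2K}`, and there are two of them. -/
lemma lintegral_goodOn_le (hs : 0 < s) (hm : ∀ c w, ‖m c w‖ = 1) (hK : ‖ν‖ * rad n s 0 ≤ K)
    (hp : p ∈ stopping s f a) :
    ∫⁻ w in cube s p, ‖goodOn m s f p w‖ₑ ∂(driftMeasure ν) ≤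
      ENNReal.ofReal (Real.exp (4 * K)) * ∫⁻ w in cube s p, ‖f w‖ₑ ∂(driftMeasure ν) := by
  have hc := ctr_mem hp
  have hd : ∀ w ∈ cube s p, ‖ν‖ * ‖w - ctr s p‖ ≤ K := fun w hw =>
    (mul_le_mul_of_nonneg_left ((norm_sub_le_rad hs hw hc).trans (rad_le hs _))
      (norm_nonneg _)).trans hK
  calc ∫⁻ w in cube s p, ‖goodOn m s f p w‖ₑ ∂(driftMeasure ν)
      ≤ ∫⁻ w in cube s p, ‖twistedMean m s f p‖ₑ ∂(driftMeasure ν) :=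
        lintegral_mono fun w => enorm_goodOn_le hm w
    _ ≤ ENNReal.ofReal (Real.exp (2 * K)) * (ENNReal.ofReal (dens ν (ctr s p)) *
          ∫⁻ w in cube s p, ‖twistedMean m s f p‖ₑ) :=
        setLIntegral_driftMeasure_le (measurableSet_cube s p) hd _
    _ ≤ ENNReal.ofReal (Real.exp (2 * K)) * (ENNReal.ofReal (dens ν (ctr s p)) *
          ∫⁻ w in cube s p, ‖f w‖ₑ) := by
        refine mul_le_mul_right (mul_le_mul_right ?_ _) _
        rw [setLIntegral_const]
        exact enorm_twistedMean_mul_le hs hm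
    _ ≤ ENNReal.ofReal (Real.exp (2 * K)) * (ENNReal.ofReal (Real.exp (2 * K)) *
          ∫⁻ w in cube s p, ‖f w‖ₑ ∂(driftMeasure ν)) := by
        refine mul_le_mul_right ?_ _
        refine ofReal_dens_mul_setLIntegral_le (measurableSet_cube s p) (fun w hw => ?_) _
        rw [norm_sub_rev]; exact hd w hw
    _ = _ := by
        rw [← mul_assoc, ← ENNReal.ofReal_mul (by positivity), ← Real.exp_add]; ring_nf

lemma lintegral_split (s : ℝ) (f : Space n → ℂ) (a : ℝ) (μ : Measure (Space n))
    (h : Space n → ℝ≥0∞) : ∫⁻ w, h w ∂μ =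
      (∑' p : stopping s f a, ∫⁻ w in cube s p.1, h w ∂μ) + ∫⁻ w in (badSet s f a)ᶜ, h w ∂μ := by
  rw [← lintegral_add_compl h (measurableSet_badSet (s := s) (f := f) (a := a)), badSet,
    lintegral_iUnion (fun p : stopping s f a => measurableSet_cube s p.1) (pairwise_disjoint_stopping s f a)]

lemma lintegral_good_le (hs : 0 < s) (hm : ∀ c w, ‖m c w‖ = 1) (hK : ‖ν‖ * rad n s 0 ≤ K)
    (hK0 : 0 ≤ K) : ∫⁻ w, ‖good m s f a w‖ₑ ∂(driftMeasure ν) ≤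
      ENNReal.ofReal (Real.exp (4 * K)) * ∫⁻ w, ‖f w‖ₑ ∂(driftMeasure ν) := by
  rw [lintegral_split s f a _ fun w => ‖good m s f a w‖ₑ,
    lintegral_split s f a _ fun w => ‖f w‖ₑ, mul_add, ← ENNReal.tsum_mul_left]
  refine add_le_add (ENNReal.tsum_le_tsum fun p => ?_) ?_
  · rw [setLIntegral_congr_fun (measurableSet_cube s p.1)
      (fun w hw => by simp only [good_of_mem p.2 hw] :
        EqOn (fun w => ‖good m s f a w‖ₑ) (fun w => ‖goodOn m s f p.1 w‖ₑ) (cube s p.1))]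
    exact lintegral_goodOn_le hs hm hK p.2
  · rw [setLIntegral_congr_fun measurableSet_badSet.compl
      (fun w hw => by simp only [good_of_notMem hw] :
        EqOn (fun w => ‖good m s f a w‖ₑ) (fun w => ‖f w‖ₑ) (badSet s f a)ᶜ)]
    refine le_mul_of_one_le_left (by positivity) ?_
    rw [ENNReal.one_le_ofReal, Real.one_le_exp_iff]; positivity

lemma aestronglyMeasurable_good (hmm : ∀ c, Measurable (m c))
    (hf : AEStronglyMeasurable f volume) : AEStronglyMeasurable (good m s f a) volume := by
  rw [← Measure.restrict_univ (μ := (volume : Measure (Space n))),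
    ← union_compl_self (badSet s f a), aestronglyMeasurable_union_iff]
  constructor
  · rw [badSet, aestronglyMeasurable_iUnion_iff]
    intro p
    have h1 : Measurable (goodOn m s f p.1) := by
      unfold goodOn
      split_ifs
      · exact measurable_const
      · exact (hmm _).mul_const _
    refine h1.aestronglyMeasurable.congr ?_
    filter_upwards [ae_restrict_mem (measurableSet_cube s p.1)] with w hw
    rw [good_of_mem p.2 hw]
  · refine hf.restrict.congr ?_
    filter_upwards [ae_restrict_mem measurableSet_badSet.compl] with w hw
    rw [good_of_notMem hw]

lemma ae_enorm_good_le (hs : 0 < s) (ha : 0 ≤ a) (hm : ∀ c w, ‖m c w‖ = 1)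
    (hf : LocallyIntegrable f volume) :
    ∀ᵐ w, ‖good m s f a w‖ₑ ≤ ENNReal.ofReal (2 ^ (2 * n)) * ENNReal.ofReal a := by
  filter_upwards [ae_norm_le_of_notMem hs ha hf] with w hw
  by_cases hb : w ∈ badSet s f a
  · obtain ⟨p, hp⟩ := mem_iUnion.1 hb
    rw [good_of_mem p.2 hp]
    by_cases h0 : p.1.1 = 0
    · simp [goodOn, h0]
    · exact (enorm_goodOn_le hm w).trans (enorm_twistedMean_le hs hm p.2 h0)
  · rw [good_of_notMem hb, ← ofReal_norm]
    refine (ENNReal.ofReal_le_ofReal (hw hb)).trans ?_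
    refine le_mul_of_one_le_left (by positivity) ?_
    rw [ENNReal.one_le_ofReal]
    exact one_le_pow₀ (by norm_num)

/-- The doubled stopping cubes are controlled by the integral of `‖f‖`. -/
lemma mul_driftMeasure_ball_le (hn : 0 < n) (hs : 0 < s) (hK : ‖ν‖ * rad n s 0 ≤ K)
    (hp : p ∈ stopping s f a) :
    ENNReal.ofReal a * driftMeasure ν (Metric.ball (ctr s p) (2 * rad n s p.1)) ≤
      ENNReal.ofReal (Real.exp (6 * K)) * ENNReal.ofReal ((2 * √(2 * n)) ^ (2 * n)) *
        volume (Metric.ball (0 : Space n) 1) * ∫⁻ w in cube s p, ‖f w‖ₑ ∂(driftMeasure ν) := by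
  have hc := ctr_mem hp
  set c := ctr s p
  set B := Metric.ball c (2 * rad n s p.1)
  -- The doubled ball has twice the radius, so freezing the density costs `e^{4K}` on it and
  -- `e^{2K}` on the cube, together `e^{6K}`.
  have hd : ∀ w ∈ B, ‖ν‖ * ‖w - c‖ ≤ 2 * K := fun w hw => by
    have h1 : ‖w - c‖ ≤ 2 * rad n s p.1 := by
      rw [← dist_eq_norm]; exact (Metric.mem_ball.1 hw).le
    have h2 := rad_le (n := n) hs p.1
    calc ‖ν‖ * ‖w - c‖ ≤ ‖ν‖ * (2 * rad n s 0) := by gcongr; linarith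
      _ ≤ _ := by linarith
  have hn' : (0 : ℝ) < n := by exact_mod_cast hn
  have hr : 0 < 2 * rad n s p.1 := by unfold rad; positivity
  have hvol : volume B = ENNReal.ofReal ((2 * √(2 * n)) ^ (2 * n)) * volume (cube s p) *
      volume (Metric.ball (0 : Space n) 1) := by
    have hfr : Module.finrank ℝ (Space n) = 2 * n := by simp [two_mul]
    rw [Measure.addHaar_ball_of_pos _ _ hr, hfr, volume_cube hs, ← ENNReal.ofReal_mul (by positivity),
      ← mul_pow]
    congr 3
    unfold rad; ring
  have h1 : driftMeasure ν B ≤ ENNReal.ofReal (Real.exp (2 * (2 * K))) *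
      (ENNReal.ofReal (dens ν c) * volume B) := by
    have := setLIntegral_driftMeasure_le (Metric.isOpen_ball.measurableSet : MeasurableSet B) hd
      (fun _ => 1)
    simpa using this
  have h2 := (heavy_of_mem hp).le
  have h3 : ENNReal.ofReal (dens ν c) * ∫⁻ w in cube s p, ‖f w‖ₑ ≤
      ENNReal.ofReal (Real.exp (2 * K)) * ∫⁻ w in cube s p, ‖f w‖ₑ ∂(driftMeasure ν) := by
    refine ofReal_dens_mul_setLIntegral_le (measurableSet_cube s p) (fun w hw => ?_) _
    exact (mul_le_mul_of_nonneg_left ((norm_sub_le_rad hs hc hw).trans (rad_le hs _))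
      (norm_nonneg _)).trans hK
  have he : ENNReal.ofReal (Real.exp (6 * K)) = ENNReal.ofReal (Real.exp (2 * (2 * K))) *
      ENNReal.ofReal (Real.exp (2 * K)) := by
    rw [← ENNReal.ofReal_mul (by positivity), ← Real.exp_add]; ring_nf
  calc ENNReal.ofReal a * driftMeasure ν B
      ≤ ENNReal.ofReal a * (ENNReal.ofReal (Real.exp (2 * (2 * K))) *
          (ENNReal.ofReal (dens ν c) * volume B)) := by gcongr
    _ = ENNReal.ofReal (Real.exp (2 * (2 * K))) * ENNReal.ofReal ((2 * √(2 * n)) ^ (2 * n)) *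
          volume (Metric.ball (0 : Space n) 1) * (ENNReal.ofReal (dens ν c) *
            (ENNReal.ofReal a * volume (cube s p))) := by rw [hvol]; ring
    _ ≤ ENNReal.ofReal (Real.exp (2 * (2 * K))) * ENNReal.ofReal ((2 * √(2 * n)) ^ (2 * n)) *
          volume (Metric.ball (0 : Space n) 1) * (ENNReal.ofReal (dens ν c) *
            ∫⁻ w in cube s p, ‖f w‖ₑ) := by gcongr
    _ ≤ ENNReal.ofReal (Real.exp (2 * (2 * K))) * ENNReal.ofReal ((2 * √(2 * n)) ^ (2 * n)) *
          volume (Metric.ball (0 : Space n) 1) * (ENNReal.ofReal (Real.exp (2 * K)) *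
            ∫⁻ w in cube s p, ‖f w‖ₑ ∂(driftMeasure ν)) := by gcongr
    _ = _ := by rw [he]; ring

variable {A : ℝ} {N : Space n → Space n → ℂ}

/-- Kernels here are integrated against Lebesgue measure in `w`. After Tonelli, the factor `dens ν
w` in the kernel bound restores the drift measure. -/
lemma setLIntegral_lintegral_mul_le {k : Space n → Space n → ℂ}
    (hk : Measurable (Function.uncurry k)) {S F : Set (Space n)} (hS : MeasurableSet S)
    {b : Space n → ℂ} (hb : AEStronglyMeasurable b volume)
    (h : ∀ w ∈ S, ∫⁻ z in F, ‖k z w‖ₑ ∂(driftMeasure ν) ≤ ENNReal.ofReal (A * dens ν w))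
    (hA : 0 ≤ A) :
    ∫⁻ z in F, (∫⁻ w in S, ‖k z w‖ₑ * ‖b w‖ₑ) ∂(driftMeasure ν) ≤
      ENNReal.ofReal A * ∫⁻ w in S, ‖b w‖ₑ ∂(driftMeasure ν) := by
  rw [lintegral_lintegral_swap]
  · rw [setLIntegral_driftMeasure ν hS, ← lintegral_const_mul' _ _ ENNReal.ofReal_ne_top]
    refine setLIntegral_mono' hS fun w hw => ?_
    rw [lintegral_mul_const'' _ ?_, ← mul_assoc, ← ENNReal.ofReal_mul hA]
    · gcongr
      exact h w hw
    · exact (hk.comp (measurable_id.prodMk measurable_const)).enorm.aemeasurable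
  · refine AEMeasurable.mul hk.enorm.aemeasurable ?_
    exact (hb.restrict.enorm).comp_snd

/-- The bad part on one stopping cube, away from the doubled cube. -/
lemma IsLocalCZKernel.lintegral_bad_le (hN : IsLocalCZKernel ν s A N m) (hs : 0 < s) (hA : 0 ≤ A)
    (hfint : IntegrableOn f (cube s p) volume)
    (hp : p ∈ stopping s f a)
    {b : Space n → ℂ} (hb : ∀ w ∈ cube s p, b w = f w - goodOn m s f p w)
    (hbm : AEStronglyMeasurable b volume)
    (hNb : ∀ᵐ z ∂(driftMeasure ν), IntegrableOn (fun w => N z w * b w) (cube s p)) :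
    ∫⁻ z in (Metric.ball (ctr s p) (2 * rad n s p.1))ᶜ,
      ‖∫ w in cube s p, N z w * b w‖ₑ ∂(driftMeasure ν) ≤
      ENNReal.ofReal A * ∫⁻ w in cube s p, ‖b w‖ₑ ∂(driftMeasure ν) := by
  have hc := ctr_mem hp
  have hQ := measurableSet_cube s p
  have hset : (Metric.ball (ctr s p) (2 * rad n s p.1))ᶜ = {z | 2 * rad n s p.1 ≤ ‖z - ctr s p‖} := by
    ext z; simp [dist_eq_norm]
  -- Largest cubes: no cancellation is available, and the size of the kernel away from the doubled
  -- cube suffices.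
  by_cases h0 : p.1 = 0
  · refine le_trans (lintegral_mono fun z => (enorm_integral_le_lintegral_enorm _).trans
      (le_of_eq (lintegral_congr fun w => enorm_mul _ _))) ?_
    refine setLIntegral_lintegral_mul_le hN.meas hQ hbm (fun w hw => ?_) hA
    rw [hset, h0]
    exact hN.far _ _ (by simpa [h0] using norm_sub_le_rad hs hw hc)
  · set c := ctr s p with hcdef
    have hmn : ∀ w, conj (m c w) * m c w = 1 := fun w => by
      rw [Complex.conj_mul', hN.norm_mod]; simp
    have hmf : IntegrableOn (fun w => conj (m c w) * f w) (cube s p) := by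
      refine Integrable.bdd_mul (c := 1) hfint ?_ ?_
      · exact (Complex.continuous_conj.measurable.comp (hN.meas_mod c)).aestronglyMeasurable
      · exact Eventually.of_forall fun w => by rw [RCLike.norm_conj, hN.norm_mod]
    have hmean : ∫ w in cube s p, conj (m c w) * b w = 0 := by
      have e1 : ∀ w ∈ cube s p, conj (m c w) * b w = conj (m c w) * f w - twistedMean m s f p := by
        intro w hw
        rw [hb w hw, goodOn, if_neg h0, mul_sub, ← mul_assoc, hmn, one_mul]
      rw [setIntegral_congr_fun hQ e1, integral_sub hmf
        (integrableOn_const (volume_cube_ne_top hs p)), setIntegral_const, twistedMean]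
      have h0 : (volume : Measure (Space n)).real (cube s p) ≠ 0 :=
        (ENNReal.toReal_pos (volume_cube_ne_zero hs p) (volume_cube_ne_top hs p)).ne'
      have h0' : ((volume : Measure (Space n)).real (cube s p) : ℂ) ≠ 0 := by exact_mod_cast h0
      rw [Complex.real_smul, ← mul_assoc]
      push_cast
      rw [mul_inv_cancel₀ h0', one_mul, sub_self]
    have hmb : IntegrableOn (fun w => conj (m c w) * b w) (cube s p) := by
      have : IntegrableOn (fun w => conj (m c w) * f w - twistedMean m s f p) (cube s p) :=
        hmf.sub (integrableOn_const (volume_cube_ne_top hs p))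
      refine this.congr_fun (fun w hw => ?_) hQ
      simp only
      rw [hb w hw, goodOn, if_neg h0, mul_sub, ← mul_assoc, hmn, one_mul]
    -- Since the bad part has mean zero against `conj (m c)`, the constant `N z c` may be subtracted
    -- from the untwisted kernel.
    have hint : ∀ᵐ z ∂(driftMeasure ν), ∫ w in cube s p, N z w * b w =
        ∫ w in cube s p, (N z w * m c w - N z c) * (conj (m c w) * b w) := by
      filter_upwards [hNb] with z hz
      have e2 : ∀ w, (N z w * m c w - N z c) * (conj (m c w) * b w) =
          N z w * b w - N z c * (conj (m c w) * b w) := fun w => by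
        linear_combination (N z w * b w) * hmn w
      simp only [e2]
      rw [integral_sub hz (hmb.const_mul _), integral_const_mul, hmean, mul_zero, sub_zero]
    have hk : Measurable (Function.uncurry fun z w => N z w * m c w - N z c) := by
      refine Measurable.sub (hN.meas.mul ((hN.meas_mod c).comp measurable_snd)) ?_
      exact hN.meas.comp (measurable_fst.prodMk measurable_const)
    calc _ ≤ ∫⁻ z in (Metric.ball c (2 * rad n s p.1))ᶜ, (∫⁻ w in cube s p,
          ‖N z w * m c w - N z c‖ₑ * ‖b w‖ₑ) ∂(driftMeasure ν) := by
          refine lintegral_mono_ae ?_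
          filter_upwards [ae_restrict_of_ae hint] with z hz
          rw [hz]
          refine (enorm_integral_le_lintegral_enorm _).trans (le_of_eq (lintegral_congr fun w => ?_))
          have : ‖conj (m c w)‖ₑ = 1 := by
            rw [← ofReal_norm, RCLike.norm_conj, hN.norm_mod]; simp
          rw [enorm_mul, enorm_mul, this, one_mul]
      _ ≤ _ := by
          refine setLIntegral_lintegral_mul_le hk hQ hbm (fun w hw => ?_) hA
          rw [hset]
          exact hN.near _ _ _ (norm_sub_le_rad hs hw hc)

set_option maxHeartbeats 1000000 in
/-- **Weak type `(1, 1)`** for integral operators that are bounded on `L²` and have a local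
Calderón–Zygmund kernel. -/
theorem IsLocalCZKernel.weakType (hN : IsLocalCZKernel ν s A N m) (hn : 0 < n) (hs : 0 < s)
    (hA : 0 ≤ A) (hK : ‖ν‖ * rad n s 0 ≤ K) (hK0 : 0 ≤ K)
    (hint : ∀ h : Space n → ℂ, MemLp h 2 (driftMeasure ν) →
      ∀ᵐ z ∂(driftMeasure ν), Integrable fun w => N z w * h w)
    (hL2 : ∀ h : Space n → ℂ, MemLp h 2 (driftMeasure ν) →
      ∫⁻ z, ‖∫ w, N z w * h w‖ₑ ^ 2 ∂(driftMeasure ν) ≤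
        ENNReal.ofReal A * ∫⁻ w, ‖h w‖ₑ ^ 2 ∂(driftMeasure ν))
    (hf1 : MemLp f 1 (driftMeasure ν)) (hf2 : MemLp f 2 (driftMeasure ν)) (ha : 0 < a) :
    ENNReal.ofReal a * driftMeasure ν {z | a < ‖∫ w, N z w * f w‖} ≤
      ENNReal.ofReal (4 * A * 2 ^ (2 * n) * Real.exp (4 * K) +
        Real.exp (6 * K) * (2 * √(2 * n)) ^ (2 * n) * volume.real (Metric.ball (0 : Space n) 1) +
        2 * A * (1 + Real.exp (4 * K))) * ∫⁻ w, ‖f w‖ₑ ∂(driftMeasure ν) := by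
  set μ := driftMeasure ν with hμ
  set I := ∫⁻ w, ‖f w‖ₑ ∂μ with hI
  have hfloc : LocallyIntegrable f volume := locallyIntegrable_of_memLp le_rfl hf1
  have hfm : AEStronglyMeasurable f volume :=
    (aestronglyMeasurable_driftMeasure_iff ν).1 hf1.aestronglyMeasurable
  set g := good m s f a with hg
  set b : Space n → ℂ := fun w => f w - g w with hb
  have hgm : AEStronglyMeasurable g volume := aestronglyMeasurable_good hN.meas_mod hfm
  have hbm : AEStronglyMeasurable b volume := hfm.sub hgm
  have hg1 : ∫⁻ w, ‖g w‖ₑ ∂μ ≤ ENNReal.ofReal (Real.exp (4 * K)) * I :=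
    lintegral_good_le hs hN.norm_mod hK hK0
  have hgb := ae_enorm_good_le (m := m) hs ha.le hN.norm_mod hfloc
  -- The good part is at most `2^{2n} a` almost everywhere, so its `L²` norm is controlled by its
  -- `L¹` norm.
  have hg2 : ∫⁻ w, ‖g w‖ₑ ^ 2 ∂μ ≤ ENNReal.ofReal (2 ^ (2 * n)) * ENNReal.ofReal a *
      (ENNReal.ofReal (Real.exp (4 * K)) * I) := by
    calc ∫⁻ w, ‖g w‖ₑ ^ 2 ∂μ ≤ ∫⁻ w, ENNReal.ofReal (2 ^ (2 * n)) * ENNReal.ofReal a * ‖g w‖ₑ ∂μ := by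
          refine lintegral_mono_ae ?_
          filter_upwards [(ae_driftMeasure_iff ν).2 hgb] with w hw
          rw [sq]; gcongr
      _ = ENNReal.ofReal (2 ^ (2 * n)) * ENNReal.ofReal a * ∫⁻ w, ‖g w‖ₑ ∂μ :=
          lintegral_const_mul' _ _ (by finiteness)
      _ ≤ _ := by gcongr
  have hIfin : I ≠ ⊤ := by
    have := hf1.eLpNorm_ne_top
    rwa [eLpNorm_one_eq_lintegral_enorm] at this
  have hgL2 : MemLp g 2 μ := by
    refine ⟨(aestronglyMeasurable_driftMeasure_iff ν).2 hgm, ?_⟩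
    rw [eLpNorm_lt_top_iff_lintegral_rpow_enorm_lt_top (by norm_num) (by norm_num)]
    have : ∫⁻ w, ‖g w‖ₑ ^ (2 : ℝ≥0∞).toReal ∂μ = ∫⁻ w, ‖g w‖ₑ ^ 2 ∂μ := by
      refine lintegral_congr fun w => ?_
      rw [ENNReal.toReal_ofNat]; exact_mod_cast ENNReal.rpow_natCast _ 2
    rw [this]
    exact hg2.trans_lt (by finiteness)
  have hbL2 : MemLp b 2 μ := hf2.sub hgL2
  set Tg : Space n → ℂ := fun z => ∫ w, N z w * g w
  set Tb : Space n → ℂ := fun z => ∫ w, N z w * b w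
  have hmeasT : ∀ h : Space n → ℂ, AEStronglyMeasurable h volume → ∀ S : Set (Space n),
      AEStronglyMeasurable (fun z => ∫ w in S, N z w * h w) μ := by
    intro h hh S
    have : AEStronglyMeasurable (Function.uncurry fun z w => N z w * h w)
        (μ.prod (volume.restrict S)) := by
      refine AEStronglyMeasurable.mul hN.meas.aestronglyMeasurable ?_
      exact hh.restrict.comp_snd
    exact this.integral_prod_right'
  have hsplit : {z | a < ‖∫ w, N z w * f w‖} ≤ᵐ[μ]
      ({z | a / 2 < ‖Tg z‖} ∪ {z | a / 2 < ‖Tb z‖} : Set (Space n)) := by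
    filter_upwards [hint g hgL2, hint b hbL2] with z h1 h2 (h3 : a < ‖∫ w, N z w * f w‖)
    have e : ∫ w, N z w * f w = Tg z + Tb z := by
      rw [← integral_add h1 h2]
      refine integral_congr_ae (Eventually.of_forall fun w => ?_)
      simp only [hb]; ring
    rw [e] at h3
    by_contra hcon
    have hcon' : ¬(a / 2 < ‖Tg z‖ ∨ a / 2 < ‖Tb z‖) := hcon
    push Not at hcon'
    linarith [norm_add_le (Tg z) (Tb z), hcon'.1, hcon'.2]
  have hTg : ENNReal.ofReal a * μ {z | a / 2 < ‖Tg z‖} ≤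
      ENNReal.ofReal (4 * A * 2 ^ (2 * n) * Real.exp (4 * K)) * I := by
    -- Chebyshev's inequality at height `a / 2`, combined with the `L²` bound: one power of `a` from
    -- `hg2` cancels one of the two powers here.
    have h1 : ENNReal.ofReal (a / 2) ^ 2 * μ {z | ENNReal.ofReal (a / 2) ^ 2 ≤ ‖Tg z‖ₑ ^ 2} ≤
        ∫⁻ z, ‖Tg z‖ₑ ^ 2 ∂μ := by
      refine mul_meas_ge_le_lintegral₀ ?_ _
      have := hmeasT g hgm univ
      rw [Measure.restrict_univ] at this
      exact this.enorm.pow_const 2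
    have h2 : μ {z | a / 2 < ‖Tg z‖} ≤ μ {z | ENNReal.ofReal (a / 2) ^ 2 ≤ ‖Tg z‖ₑ ^ 2} := by
      refine measure_mono fun z (hz : a / 2 < ‖Tg z‖) => ?_
      change ENNReal.ofReal (a / 2) ^ 2 ≤ ‖Tg z‖ₑ ^ 2
      gcongr
      rw [← ofReal_norm]
      exact ENNReal.ofReal_le_ofReal hz.le
    have h3 := (hL2 g hgL2).trans (mul_le_mul_right hg2 _)
    have h4 : ENNReal.ofReal (a / 2) ^ 2 * μ {z | a / 2 < ‖Tg z‖} ≤ ENNReal.ofReal A *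
        (ENNReal.ofReal (2 ^ (2 * n)) * ENNReal.ofReal a *
          (ENNReal.ofReal (Real.exp (4 * K)) * I)) :=
      (mul_le_mul_right h2 _).trans (h1.trans h3)
    have e1 : ENNReal.ofReal (a / 2) ^ 2 * μ {z | a / 2 < ‖Tg z‖} = ENNReal.ofReal (a / 4) *
        (ENNReal.ofReal a * μ {z | a / 2 < ‖Tg z‖}) := by
      rw [← mul_assoc, ← ENNReal.ofReal_mul (by positivity), ← ENNReal.ofReal_pow (by positivity)]
      congr 2; ring
    have e2 : ENNReal.ofReal A * (ENNReal.ofReal (2 ^ (2 * n)) * ENNReal.ofReal a *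
          (ENNReal.ofReal (Real.exp (4 * K)) * I)) = ENNReal.ofReal (a / 4) *
          (ENNReal.ofReal (4 * A * 2 ^ (2 * n) * Real.exp (4 * K)) * I) := by
      rw [← mul_assoc, ← mul_assoc, ← mul_assoc, ← mul_assoc, ← ENNReal.ofReal_mul (by positivity),
        ← ENNReal.ofReal_mul (by positivity), ← ENNReal.ofReal_mul (by positivity),
        ← ENNReal.ofReal_mul (by positivity)]
      congr 2; ring
    rw [e1, e2] at h4
    have h5 : ENNReal.ofReal (a / 4) ≠ 0 := by
      have : 0 < a / 4 := by positivity
      simpa using this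
    exact (ENNReal.mul_le_mul_iff_right h5 ENNReal.ofReal_ne_top).1 h4
  set O : Set (Space n) :=
    ⋃ p : stopping s f a, Metric.ball (ctr s p.1) (2 * rad n s p.1.1) with hO
  have hOm : MeasurableSet O := MeasurableSet.iUnion fun p => Metric.isOpen_ball.measurableSet
  have hμO : ENNReal.ofReal a * μ O ≤ ENNReal.ofReal (Real.exp (6 * K) * (2 * √(2 * n)) ^ (2 * n) *
      volume.real (Metric.ball (0 : Space n) 1)) * I := by
    calc ENNReal.ofReal a * μ O ≤ ENNReal.ofReal a * ∑' p : stopping s f a,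
          μ (Metric.ball (ctr s p.1) (2 * rad n s p.1.1)) := by
          gcongr; exact measure_iUnion_le _
      _ = ∑' p : stopping s f a, ENNReal.ofReal a *
          μ (Metric.ball (ctr s p.1) (2 * rad n s p.1.1)) := ENNReal.tsum_mul_left.symm
      _ ≤ ∑' p : stopping s f a, ENNReal.ofReal (Real.exp (6 * K)) *
          ENNReal.ofReal ((2 * √(2 * n)) ^ (2 * n)) * volume (Metric.ball (0 : Space n) 1) *
          ∫⁻ w in cube s p.1, ‖f w‖ₑ ∂μ :=
          ENNReal.tsum_le_tsum fun p => mul_driftMeasure_ball_le hn hs hK p.2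
      _ = ENNReal.ofReal (Real.exp (6 * K)) * ENNReal.ofReal ((2 * √(2 * n)) ^ (2 * n)) *
          volume (Metric.ball (0 : Space n) 1) * ∑' p : stopping s f a,
          ∫⁻ w in cube s p.1, ‖f w‖ₑ ∂μ := ENNReal.tsum_mul_left
      _ ≤ _ := by
          rw [ENNReal.ofReal_mul (by positivity), ENNReal.ofReal_mul (by positivity), Measure.real,
            ENNReal.ofReal_toReal measure_ball_lt_top.ne]
          gcongr
          rw [hI, lintegral_split s f a]
          exact le_self_add
  -- Outside the doubled cubes the `L¹` norm of the image of the bad part is estimated cube by cube,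
  -- and Chebyshev's inequality concludes.
  have hTb : ENNReal.ofReal a * μ ({z | a / 2 < ‖Tb z‖} ∩ Oᶜ) ≤
      ENNReal.ofReal (2 * A * (1 + Real.exp (4 * K))) * I := by
    have hbsupp : ∀ w, w ∉ badSet s f a → b w = 0 := fun w hw => by
      simp only [hb, hg, good_of_notMem hw, sub_self]
    have hptw : ∀ᵐ z ∂μ, ‖Tb z‖ₑ ≤ ∑' p : stopping s f a, ‖∫ w in cube s p.1, N z w * b w‖ₑ := by
      filter_upwards [hint b hbL2] with z hz
      have e1 : Tb z = ∫ w in badSet s f a, N z w * b w :=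
        (setIntegral_eq_integral_of_forall_compl_eq_zero fun w hw => by
          rw [hbsupp w hw, mul_zero]).symm
      rw [e1, badSet, integral_iUnion (fun p : stopping s f a => measurableSet_cube s p.1)
        (pairwise_disjoint_stopping s f a) hz.integrableOn]
      exact enorm_tsum_le_tsum_enorm
    have hcube : ∀ p : stopping s f a, ∫⁻ z in Oᶜ, ‖∫ w in cube s p.1, N z w * b w‖ₑ ∂μ ≤
        ENNReal.ofReal A * ∫⁻ w in cube s p.1, ‖b w‖ₑ ∂μ := by
      intro p
      have hsub : Oᶜ ⊆ (Metric.ball (ctr s p.1) (2 * rad n s p.1.1))ᶜ :=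
        compl_subset_compl.2 (subset_iUnion
          (fun p : stopping s f a => Metric.ball (ctr s p.1) (2 * rad n s p.1.1)) p)
      refine (lintegral_mono_set hsub).trans ?_
      refine hN.lintegral_bad_le hs hA ?_ p.2 (fun w hw => ?_) hbm ?_
      · refine (hfloc.integrableOn_isCompact
          (isCompact_closedBall (ctr s p.1) (rad n s p.1.1))).mono_set fun w hw => ?_
        rw [Metric.mem_closedBall, dist_eq_norm]
        exact norm_sub_le_rad hs hw (ctr_mem p.2)
      · simp only [hb, hg, good_of_mem p.2 hw]
      · filter_upwards [hint b hbL2] with z hz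
        exact hz.integrableOn
    have hsum : ∫⁻ z in Oᶜ, ‖Tb z‖ₑ ∂μ ≤ ENNReal.ofReal (A * (1 + Real.exp (4 * K))) * I := by
      calc ∫⁻ z in Oᶜ, ‖Tb z‖ₑ ∂μ
          ≤ ∫⁻ z in Oᶜ, (∑' p : stopping s f a, ‖∫ w in cube s p.1, N z w * b w‖ₑ) ∂μ :=
            lintegral_mono_ae (ae_restrict_of_ae hptw)
        _ = ∑' p : stopping s f a, ∫⁻ z in Oᶜ, ‖∫ w in cube s p.1, N z w * b w‖ₑ ∂μ :=
            lintegral_tsum fun p => (hmeasT b hbm _).enorm.restrict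
        _ ≤ ∑' p : stopping s f a, ENNReal.ofReal A * ∫⁻ w in cube s p.1, ‖b w‖ₑ ∂μ :=
            ENNReal.tsum_le_tsum hcube
        _ = ENNReal.ofReal A * ∑' p : stopping s f a, ∫⁻ w in cube s p.1, ‖b w‖ₑ ∂μ :=
            ENNReal.tsum_mul_left
        _ ≤ ENNReal.ofReal A * ∫⁻ w, ‖b w‖ₑ ∂μ := by
            gcongr
            rw [lintegral_split s f a]
            exact le_self_add
        _ ≤ ENNReal.ofReal A * (I + ENNReal.ofReal (Real.exp (4 * K)) * I) := by
            gcongr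
            calc ∫⁻ w, ‖b w‖ₑ ∂μ ≤ ∫⁻ w, (‖f w‖ₑ + ‖g w‖ₑ) ∂μ :=
                  lintegral_mono fun w => enorm_sub_le
              _ = I + ∫⁻ w, ‖g w‖ₑ ∂μ := lintegral_add_left' hf1.aestronglyMeasurable.enorm _
              _ ≤ _ := by gcongr
        _ = _ := by
            rw [ENNReal.ofReal_mul hA, ENNReal.ofReal_add (by norm_num) (by positivity),
              ENNReal.ofReal_one]
            ring
    have h1 : ENNReal.ofReal (a / 2) * (μ.restrict Oᶜ) {z | ENNReal.ofReal (a / 2) ≤ ‖Tb z‖ₑ} ≤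
        ∫⁻ z in Oᶜ, ‖Tb z‖ₑ ∂μ := by
      refine mul_meas_ge_le_lintegral₀ ?_ _
      have := hmeasT b hbm univ
      rw [Measure.restrict_univ] at this
      exact this.enorm.restrict
    have h2 : μ ({z | a / 2 < ‖Tb z‖} ∩ Oᶜ) ≤
        (μ.restrict Oᶜ) {z | ENNReal.ofReal (a / 2) ≤ ‖Tb z‖ₑ} := by
      rw [Measure.restrict_apply' hOm.compl]
      refine measure_mono (inter_subset_inter_left _ fun z (hz : a / 2 < ‖Tb z‖) => ?_)
      change ENNReal.ofReal (a / 2) ≤ ‖Tb z‖ₑ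
      rw [← ofReal_norm]
      exact ENNReal.ofReal_le_ofReal hz.le
    have e1 : ENNReal.ofReal a = 2 * ENNReal.ofReal (a / 2) := by
      rw [show (2 : ℝ≥0∞) = ENNReal.ofReal 2 by simp, ← ENNReal.ofReal_mul (by norm_num)]
      congr 1; ring
    calc _ = 2 * (ENNReal.ofReal (a / 2) * μ ({z | a / 2 < ‖Tb z‖} ∩ Oᶜ)) := by
          rw [e1, mul_assoc]
      _ ≤ 2 * (ENNReal.ofReal (A * (1 + Real.exp (4 * K))) * I) := by
          refine mul_le_mul_right ?_ _
          exact (mul_le_mul_right h2 _).trans (h1.trans hsum)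
      _ = _ := by
          rw [← mul_assoc, show (2 : ℝ≥0∞) = ENNReal.ofReal 2 by simp,
            ← ENNReal.ofReal_mul (by norm_num)]
          congr 2; ring
  have hfinal : μ {z | a < ‖∫ w, N z w * f w‖} ≤ μ {z | a / 2 < ‖Tg z‖} + (μ O +
      μ ({z | a / 2 < ‖Tb z‖} ∩ Oᶜ)) := by
    refine (measure_mono_ae hsplit).trans ((measure_union_le _ _).trans ?_)
    gcongr
    refine (measure_mono fun z hz => ?_).trans (measure_union_le _ _)
    by_cases hzO : z ∈ O
    · exact Or.inl hzO
    · exact Or.inr ⟨hz, hzO⟩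
  calc ENNReal.ofReal a * μ {z | a < ‖∫ w, N z w * f w‖}
      ≤ ENNReal.ofReal a * (μ {z | a / 2 < ‖Tg z‖} + (μ O +
          μ ({z | a / 2 < ‖Tb z‖} ∩ Oᶜ))) := by gcongr
    _ = ENNReal.ofReal a * μ {z | a / 2 < ‖Tg z‖} + (ENNReal.ofReal a * μ O +
          ENNReal.ofReal a * μ ({z | a / 2 < ‖Tb z‖} ∩ Oᶜ)) := by ring
    _ ≤ _ := add_le_add hTg (add_le_add hμO hTb)
    _ = _ := by
        rw [ENNReal.ofReal_add (by positivity) (by positivity),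
          ENNReal.ofReal_add (by positivity) (by positivity)]
        ring

end Decomposition

end

section

variable {n : ℕ}

/-! ### The coefficients of the heat kernel -/

/-- The coefficient `(λ / 4) coth (λ t)`. -/
def heatA (lam t : ℝ) : ℝ := lam / 4 * (Real.cosh (lam * t) / Real.sinh (lam * t))

/-- The normalization `(λ / (4 π sinh (λ t))) ^ n`. -/
def heatC (n : ℕ) (lam t : ℝ) : ℝ := (lam / (4 * Real.pi * Real.sinh (lam * t))) ^ n

lemma heatA_abs (lam t : ℝ) : heatA |lam| t = heatA lam t := by
  rcases abs_cases lam with ⟨h, _⟩ | ⟨h, _⟩ <;> rw [h]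
  simp only [heatA, neg_mul, Real.cosh_neg, Real.sinh_neg, div_neg, mul_neg, neg_div, neg_neg]

lemma sinh_le_mul_cosh {x : ℝ} (hx : 0 ≤ x) : Real.sinh x ≤ x * Real.cosh x := by
  have h : MonotoneOn (fun x => x * Real.cosh x - Real.sinh x) (Ici 0) := by
    refine monotoneOn_of_deriv_nonneg (convex_Ici 0) (by fun_prop) (by fun_prop) fun y hy => ?_
    rw [interior_Ici, mem_Ioi] at hy
    have : HasDerivAt (fun x => x * Real.cosh x - Real.sinh x)
        (1 * Real.cosh y + y * Real.sinh y - Real.cosh y) y :=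
      ((hasDerivAt_id y).mul (Real.hasDerivAt_cosh y)).sub (Real.hasDerivAt_sinh y)
    rw [this.deriv]
    have := Real.sinh_pos_iff.2 hy
    nlinarith
  have := h (mem_Ici.2 le_rfl) (mem_Ici.2 hx) hx
  simp only [zero_mul, Real.sinh_zero, sub_zero] at this
  linarith

/-- With `sinh_le_mul_cosh` this yields `1 ≤ x coth x ≤ 1 + x`, the source of all bounds on `heatA`.
-/
lemma mul_cosh_le {x : ℝ} (hx : 0 ≤ x) : x * Real.cosh x ≤ (1 + x) * Real.sinh x := by
  have h1 : Real.cosh x - Real.sinh x = Real.exp (-x) := Real.cosh_sub_sinh x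
  have h2 : Real.exp (-x) ≤ 1 := Real.exp_le_one_iff.2 (by linarith)
  have h3 : x ≤ Real.sinh x := Real.self_le_sinh_iff.2 hx
  nlinarith

section Coefficients

variable {lam t : ℝ} (hl : lam ≠ 0) (ht : 0 < t)
include hl ht

lemma sinh_abs_mul_pos : 0 < Real.sinh (|lam| * t) :=
  Real.sinh_pos_iff.2 (mul_pos (abs_pos.2 hl) ht)

lemma sinh_mul_ne_zero : Real.sinh (lam * t) ≠ 0 := by
  rw [Real.sinh_ne_zero]; positivity

/-- Together with the two estimates that follow: `4 heatA` lies between `max(|λ|, 1/t)` and `|λ| +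
1/t`. Passing to `|λ|` is harmless since the coefficient is even in `λ`. -/
lemma abs_le_four_heatA : |lam| ≤ 4 * heatA lam t := by
  rw [← heatA_abs]
  have h := sinh_abs_mul_pos hl ht
  have : 1 ≤ Real.cosh (|lam| * t) / Real.sinh (|lam| * t) := by
    rw [one_le_div h]; exact (Real.sinh_lt_cosh _).le
  unfold heatA
  nlinarith [abs_nonneg lam]

lemma one_le_four_mul_heatA : 1 ≤ 4 * t * heatA lam t := by
  rw [← heatA_abs]
  have h := sinh_abs_mul_pos hl ht
  have h1 := sinh_le_mul_cosh (x := |lam| * t) (by positivity)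
  unfold heatA
  have : 4 * t * (|lam| / 4 * (Real.cosh (|lam| * t) / Real.sinh (|lam| * t))) =
    (|lam| * t * Real.cosh (|lam| * t)) / Real.sinh (|lam| * t) := by ring
  rw [this, one_le_div h]; exact h1

lemma four_mul_heatA_le : 4 * t * heatA lam t ≤ 1 + |lam| * t := by
  rw [← heatA_abs]
  have h := sinh_abs_mul_pos hl ht
  have h1 := mul_cosh_le (x := |lam| * t) (by positivity)
  unfold heatA
  have : 4 * t * (|lam| / 4 * (Real.cosh (|lam| * t) / Real.sinh (|lam| * t))) =
    (|lam| * t * Real.cosh (|lam| * t)) / Real.sinh (|lam| * t) := by ring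
  rw [this, div_le_iff₀ h]; exact h1

lemma heatA_pos : 0 < heatA lam t := by
  have := abs_le_four_heatA hl ht
  have := abs_pos.2 hl
  linarith

lemma heatC_eq (n : ℕ) : heatC n lam t = (heatA lam t / (Real.pi * Real.cosh (lam * t))) ^ n := by
  unfold heatC heatA
  have h1 := sinh_mul_ne_zero hl ht
  have h2 := (Real.cosh_pos (lam * t)).ne'
  congr 1
  field_simp

lemma heatC_pos (n : ℕ) : 0 < heatC n lam t := by
  rw [heatC_eq hl ht]
  have := heatA_pos hl ht
  have := Real.cosh_pos (lam * t)
  positivity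

/-- A Riccati equation; its right-hand side is the coefficient of `|u|²` that the Laplacian
produces. -/
lemma hasDerivAt_heatA :
    HasDerivAt (fun t => heatA lam t) (-4 * (heatA lam t ^ 2 - lam ^ 2 / 16)) t := by
  have h1 := sinh_mul_ne_zero hl ht
  have hm : HasDerivAt (fun t => lam * t) lam t := by
    simpa using (hasDerivAt_id t).const_mul lam
  have h2 := (hm.cosh.div hm.sinh h1).const_mul (lam / 4)
  refine h2.congr_deriv ?_
  have h3 := Real.cosh_sq (lam * t)
  unfold heatA
  field_simp
  rw [h3]; ring

lemma hasDerivAt_heatC (n : ℕ) :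
    HasDerivAt (fun t => heatC n lam t) (-4 * n * heatA lam t * heatC n lam t) t := by
  have h1 := sinh_mul_ne_zero hl ht
  have hm : HasDerivAt (fun t => lam * t) lam t := by
    simpa using (hasDerivAt_id t).const_mul lam
  have h0 : 4 * Real.pi * Real.sinh (lam * t) ≠ 0 :=
    mul_ne_zero (mul_ne_zero (by norm_num) Real.pi_ne_zero) h1
  have h2 := (((hasDerivAt_const t lam).div (hm.sinh.const_mul (4 * Real.pi)) h0).pow n)
  refine h2.congr_deriv ?_
  unfold heatC heatA
  rcases Nat.eq_zero_or_pos n with rfl | hn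
  · simp
  · obtain ⟨k, rfl⟩ := Nat.exists_eq_succ_of_ne_zero hn.ne'
    simp only [Nat.succ_eq_add_one, Nat.add_sub_cancel, pow_succ, Pi.div_apply]
    field_simp
    ring

end Coefficients

/-- Addition theorem of the hyperbolic cotangent. The term `λ²/16` is what the Fourier transform of
the product Gaussian contributes when two heat kernels are convolved. -/
lemma heatA_add {lam s t : ℝ} (hl : lam ≠ 0) (hs : 0 < s) (ht : 0 < t) :
    (heatA lam s * heatA lam t + lam ^ 2 / 16) / (heatA lam s + heatA lam t) = heatA lam (s + t) := by
  have h1 := sinh_mul_ne_zero hl hs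
  have h2 := sinh_mul_ne_zero hl ht
  have h3 := sinh_mul_ne_zero hl (add_pos hs ht)
  have h4 : heatA lam s + heatA lam t ≠ 0 := (add_pos (heatA_pos hl hs) (heatA_pos hl ht)).ne'
  rw [div_eq_iff h4]
  unfold heatA
  rw [mul_add, Real.sinh_add] at h3
  rw [mul_add lam s t, Real.sinh_add, Real.cosh_add]
  field_simp
  ring

lemma heatC_add {lam s t : ℝ} (n : ℕ) (hl : lam ≠ 0) (hs : 0 < s) (ht : 0 < t) :
    heatC n lam s * heatC n lam t * (Real.pi / (heatA lam s + heatA lam t)) ^ n =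
      heatC n lam (s + t) := by
  have h1 := sinh_mul_ne_zero hl hs
  have h2 := sinh_mul_ne_zero hl ht
  have h3 := sinh_mul_ne_zero hl (add_pos hs ht)
  have h4 : heatA lam s + heatA lam t ≠ 0 := (add_pos (heatA_pos hl hs) (heatA_pos hl ht)).ne'
  unfold heatC
  rw [← mul_pow, ← mul_pow]
  congr 1
  have e : heatA lam s + heatA lam t = lam / 4 * Real.sinh (lam * (s + t)) /
      (Real.sinh (lam * s) * Real.sinh (lam * t)) := by
    unfold heatA
    rw [mul_add, Real.sinh_add]
    field_simp
    ring
  rw [e]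
  field_simp

/-! ### The heat kernel -/

/-- The exponent of the heat kernel. -/
def heatExp (ν : Space n) (lam t : ℝ) (u : Space n) : ℝ :=
  -heatA lam t * ‖u‖ ^ 2 - inner ℝ ν u - ‖ν‖ ^ 2 * t

/-- The heat kernel of the twisted Laplacian with drift. -/
def heatKernel (ν : Space n) (lam t : ℝ) (u : Space n) : ℂ :=
  ((heatC n lam t * Real.exp (heatExp ν lam t u) : ℝ) : ℂ)

lemma hasFDerivAt_heatExp (ν : Space n) (lam t : ℝ) (u : Space n) :
    HasFDerivAt (heatExp ν lam t) (-heatA lam t • (2 • innerSL ℝ u) - innerSL ℝ ν) u := by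
  have h1 := ((hasStrictFDerivAt_norm_sq u).hasFDerivAt).const_mul (-heatA lam t)
  have h2 := (innerSL ℝ ν).hasFDerivAt (x := u)
  exact (h1.sub h2).sub_const (‖ν‖ ^ 2 * t)

lemma hasFDerivAt_heatKernel (ν : Space n) (lam t : ℝ) (u : Space n) :
    HasFDerivAt (heatKernel ν lam t) (heatKernel ν lam t u •
      (Complex.ofRealCLM.comp (-heatA lam t • (2 • innerSL ℝ u) - innerSL ℝ ν))) u := by
  have h1 := ((hasFDerivAt_heatExp ν lam t u).exp).const_mul (heatC n lam t)
  have h2 := Complex.ofRealCLM.hasFDerivAt.comp u h1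
  refine h2.congr_fderiv ?_
  ext y
  simp [heatKernel]
  ring

lemma contDiff_heatKernel (ν : Space n) (lam t : ℝ) : ContDiff ℝ ∞ (heatKernel ν lam t) := by
  unfold heatKernel heatExp
  refine Complex.ofRealCLM.contDiff.comp (contDiff_const.mul (Real.contDiff_exp.comp ?_))
  refine ((contDiff_const.mul (contDiff_norm_sq ℝ)).sub ?_).sub contDiff_const
  exact (innerSL ℝ ν).contDiff

lemma differentiable_heatKernel (ν : Space n) (lam t : ℝ) :
    Differentiable ℝ (heatKernel ν lam t) := fun u =>
  (hasFDerivAt_heatKernel ν lam t u).differentiableAt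

/-- The factor by which the fields act on the heat kernel. -/
def heatFactor (ν : Space n) (lam t : ℝ) (i : Fin n ⊕ Fin n) (u : Space n) : ℂ :=
  ((-2 * heatA lam t * u i - ν i : ℝ) : ℂ) + Complex.I * lam / 2 * (rot u i : ℂ)

lemma field_heatKernel (ν : Space n) (lam t : ℝ) (i : Fin n ⊕ Fin n) (u : Space n) :
    field lam i (heatKernel ν lam t) u = heatFactor ν lam t i u * heatKernel ν lam t u := by
  rw [field_eq, partialDeriv, (hasFDerivAt_heatKernel ν lam t u).fderiv]
  have e : (-heatA lam t • (2 • innerSL ℝ u) - innerSL ℝ ν) (basisVec i) =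
      -2 * heatA lam t * u i - ν i := by
    simp only [_root_.sub_apply, _root_.smul_apply, innerSL_apply_apply, inner_basisVec]
    simp; ring
  change heatKernel ν lam t u • (((-heatA lam t • (2 • innerSL ℝ u) - innerSL ℝ ν)
    (basisVec i) : ℝ) : ℂ) + _ = _
  rw [e, heatFactor, smul_eq_mul]
  ring

lemma rot_basisVec_self (i : Fin n ⊕ Fin n) : rot (basisVec i) i = 0 := by
  have := inner_rot_self (basisVec i)
  rwa [inner_basisVec] at this

lemma partialDeriv_heatFactor (ν : Space n) (lam t : ℝ) (i : Fin n ⊕ Fin n) (u : Space n) :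
    partialDeriv i (heatFactor ν lam t i) u = ((-2 * heatA lam t : ℝ) : ℂ) := by
  have e : heatFactor ν lam t i = fun u => (((-2 * heatA lam t : ℝ) : ℂ) *
      ((ContinuousLinearMap.id ℝ (Space n) u i : ℝ) : ℂ) +
        (Complex.I * lam / 2 * ((rot u i : ℝ) : ℂ))) + (-ν i : ℂ) := by
    funext u; simp only [heatFactor]; push_cast; simp; ring
  have h1 : ∀ z, DifferentiableAt ℝ (fun u : Space n =>
      ((ContinuousLinearMap.id ℝ (Space n) u i : ℝ) : ℂ)) z := fun z =>
    (contDiff_apply_coord _ i).differentiable (by simp) z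
  have h2 : ∀ z, DifferentiableAt ℝ (fun u : Space n => ((rot u i : ℝ) : ℂ)) z := fun z =>
    (contDiff_rot_coord i).differentiable (by simp) z
  rw [e, partialDeriv_add i (((h1 u).const_mul _).fun_add ((h2 u).const_mul _))
    (differentiableAt_const _), partialDeriv_add i ((h1 u).const_mul _) ((h2 u).const_mul _),
    partialDeriv_const_mul _ i (h1 u), partialDeriv_const_mul _ i (h2 u), partialDeriv_const,
    partialDeriv_apply_coord, partialDeriv_apply_coord, rot_basisVec_self]
  simp [basisVec]

lemma differentiable_heatFactor (ν : Space n) (lam t : ℝ) (i : Fin n ⊕ Fin n) :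
    Differentiable ℝ (heatFactor ν lam t i) := by
  unfold heatFactor
  have h1 : Differentiable ℝ (fun u : Space n => ((rot u i : ℝ) : ℂ)) :=
    (contDiff_rot_coord i).differentiable (by simp)
  have h2 : Differentiable ℝ (fun u : Space n => (u i : ℝ)) :=
    (contDiff_piLp_apply (p := 2) (i := i) (n := 1)).differentiable (by simp)
  refine Differentiable.add ?_ (h1.const_mul _)
  exact Complex.ofRealCLM.differentiable.comp ((h2.const_mul _).sub_const _)

/-- Each field multiplies the Gaussian by an affine factor. The terms linear in `ν` cancel against
the drift term of `L`, and the imaginary cross terms sum to zero because `rot u` is orthogonal to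
`u`. -/
lemma driftLaplacian_heatKernel (ν : Space n) (lam t : ℝ) (u : Space n) :
    driftLaplacian ν lam (heatKernel ν lam t) u =
      (((4 * heatA lam t ^ 2 - lam ^ 2 / 4) * ‖u‖ ^ 2 - ‖ν‖ ^ 2 - 4 * n * heatA lam t : ℝ) : ℂ) *
        heatKernel ν lam t u := by
  have e1 : ∀ i, field lam i (heatKernel ν lam t) =
      fun u => heatFactor ν lam t i u * heatKernel ν lam t u :=
    fun i => funext fun u => field_heatKernel ν lam t i u
  have e2 : ∀ i, field lam i (field lam i (heatKernel ν lam t)) u =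
      (((-2 * heatA lam t : ℝ) : ℂ) + heatFactor ν lam t i u ^ 2) * heatKernel ν lam t u := by
    intro i
    rw [e1, field_mul_left lam i (differentiable_heatFactor ν lam t i u)
      (differentiable_heatKernel ν lam t u), partialDeriv_heatFactor, field_heatKernel]
    ring
  unfold driftLaplacian
  simp only [e2, field_heatKernel]
  rw [Finset.mul_sum, ← Finset.sum_add_distrib]
  have e3 : ∀ i, (((-2 * heatA lam t : ℝ) : ℂ) + heatFactor ν lam t i u ^ 2) *
      heatKernel ν lam t u + 2 * ((ν i : ℂ) * (heatFactor ν lam t i u * heatKernel ν lam t u)) =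
      (((-2 * heatA lam t + 4 * heatA lam t ^ 2 * (u i * u i) - ν i * ν i -
        lam ^ 2 / 4 * (rot u i * rot u i) : ℝ) : ℂ) +
        (-2 * Complex.I * lam * heatA lam t) * ((rot u i * u i : ℝ) : ℂ)) *
        heatKernel ν lam t u := by
    intro i
    unfold heatFactor
    push_cast
    linear_combination (lam ^ 2 / 4 * (rot u i : ℂ) ^ 2 * heatKernel ν lam t u) * Complex.I_sq
  simp only [e3]
  rw [← Finset.sum_mul]
  congr 1
  rw [Finset.sum_add_distrib, ← Finset.mul_sum, ← Complex.ofReal_sum, ← Complex.ofReal_sum]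
  have s1 : ∑ i, rot u i * u i = 0 := by rw [← inner_eq_sum, inner_rot_self]
  have s2 : ∑ i, u i * u i = ‖u‖ ^ 2 := by rw [← inner_eq_sum, real_inner_self_eq_norm_sq]
  have s3 : ∑ i, ν i * ν i = ‖ν‖ ^ 2 := by rw [← inner_eq_sum, real_inner_self_eq_norm_sq]
  have s4 : ∑ i, rot u i * rot u i = ‖u‖ ^ 2 := by
    rw [← inner_eq_sum, real_inner_self_eq_norm_sq, norm_rot]
  have s5 : ∑ i, (-2 * heatA lam t + 4 * heatA lam t ^ 2 * (u i * u i) - ν i * ν i -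
      lam ^ 2 / 4 * (rot u i * rot u i)) =
      (4 * heatA lam t ^ 2 - lam ^ 2 / 4) * ‖u‖ ^ 2 - ‖ν‖ ^ 2 - 4 * n * heatA lam t := by
    rw [Finset.sum_sub_distrib, Finset.sum_sub_distrib, Finset.sum_add_distrib, s3,
      ← Finset.mul_sum (a := 4 * heatA lam t ^ 2), ← Finset.mul_sum (a := lam ^ 2 / 4), s2, s4]
    simp only [Finset.sum_const, Finset.card_univ, Fintype.card_sum, Fintype.card_fin, nsmul_eq_mul]
    push_cast
    ring
  rw [s1, s5]
  simp

/-- The heat equation. -/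
lemma hasDerivAt_heatKernel (ν : Space n) {lam t : ℝ} (hl : lam ≠ 0) (ht : 0 < t) (u : Space n) :
    HasDerivAt (fun t => heatKernel ν lam t u) (driftLaplacian ν lam (heatKernel ν lam t) u) t := by
  have hA := hasDerivAt_heatA hl ht
  have hC := hasDerivAt_heatC hl ht n
  have hE : HasDerivAt (fun t => heatExp ν lam t u)
      (4 * (heatA lam t ^ 2 - lam ^ 2 / 16) * ‖u‖ ^ 2 - ‖ν‖ ^ 2) t := by
    have h1 := ((hA.neg.mul_const (‖u‖ ^ 2)).sub_const (inner ℝ ν u)).sub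
      ((hasDerivAt_id t).const_mul (‖ν‖ ^ 2))
    refine h1.congr_deriv ?_
    ring
  have h2 := (hC.mul hE.exp).ofReal_comp
  rw [driftLaplacian_heatKernel]
  refine h2.congr_deriv ?_
  unfold heatKernel
  push_cast
  ring

end

section

variable {n : ℕ}

/-! ### Derivatives of the heat kernel -/

/-- Polynomials in a real parameter, a vector parameter and a vector variable. -/
inductive IsSymbol : (ℝ → Space n → Space n → ℂ) → Prop
  | const (c : ℂ) : IsSymbol fun _ _ _ => c
  | param : IsSymbol fun b _ _ => (b : ℂ)
  | vecParam (i : Fin n ⊕ Fin n) : IsSymbol fun _ η _ => (η i : ℂ)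
  | coord (i : Fin n ⊕ Fin n) : IsSymbol fun _ _ v => (v i : ℂ)
  | add {Φ Ψ} : IsSymbol Φ → IsSymbol Ψ → IsSymbol fun b η v => Φ b η v + Ψ b η v
  | mul {Φ Ψ} : IsSymbol Φ → IsSymbol Ψ → IsSymbol fun b η v => Φ b η v * Ψ b η v

lemma IsSymbol.continuous {Φ : ℝ → Space n → Space n → ℂ} (h : IsSymbol Φ) :
    Continuous fun p : ℝ × Space n × Space n => Φ p.1 p.2.1 p.2.2 := by
  induction h with
  | const c => exact continuous_const
  | param => exact Complex.continuous_ofReal.comp continuous_fst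
  | vecParam i => fun_prop
  | coord i => fun_prop
  | add _ _ h1 h2 => exact h1.add h2
  | mul _ _ h1 h2 => exact h1.mul h2

lemma IsSymbol.differentiable {Φ : ℝ → Space n → Space n → ℂ} (h : IsSymbol Φ) (b : ℝ)
    (η : Space n) : Differentiable ℝ (Φ b η) := by
  induction h with
  | const c => exact differentiable_const _
  | param => exact differentiable_const _
  | vecParam i => exact differentiable_const _
  | coord i => exact (contDiff_apply_coord (ContinuousLinearMap.id ℝ _) i).differentiable (by simp)
  | add _ _ h1 h2 => exact h1.fun_add h2
  | mul _ _ h1 h2 => exact h1.fun_mul h2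

lemma IsSymbol.exists_partialDeriv {Φ : ℝ → Space n → Space n → ℂ} (h : IsSymbol Φ)
    (i : Fin n ⊕ Fin n) :
    ∃ Ψ, IsSymbol Ψ ∧ ∀ b η v, partialDeriv i (Φ b η) v = Ψ b η v := by
  induction h with
  | const c => exact ⟨_, .const 0, fun b η v => partialDeriv_const _ i v⟩
  | param => exact ⟨_, .const 0, fun b η v => partialDeriv_const _ i v⟩
  | vecParam j => exact ⟨_, .const 0, fun b η v => partialDeriv_const _ i v⟩
  | coord j => exact ⟨_, .const _, fun b η v =>
      partialDeriv_apply_coord (ContinuousLinearMap.id ℝ _) i j v⟩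
  | add h1 h2 ih1 ih2 =>
    obtain ⟨Ψ1, hs1, e1⟩ := ih1
    obtain ⟨Ψ2, hs2, e2⟩ := ih2
    refine ⟨_, hs1.add hs2, fun b η v => ?_⟩
    rw [partialDeriv_add i (h1.differentiable b η v) (h2.differentiable b η v), e1, e2]
  | mul h1 h2 ih1 ih2 =>
    obtain ⟨Ψ1, hs1, e1⟩ := ih1
    obtain ⟨Ψ2, hs2, e2⟩ := ih2
    refine ⟨_, (hs1.mul h2).add (h1.mul hs2), fun b η v => ?_⟩
    rw [partialDeriv_mul i (h1.differentiable b η v) (h2.differentiable b η v), e1, e2]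

lemma IsSymbol.exists_bound {Φ : ℝ → Space n → Space n → ℂ} (h : IsSymbol Φ) :
    ∃ C : ℝ, 0 ≤ C ∧ ∃ p : ℕ, ∀ b η v, ‖Φ b η v‖ ≤ C * (1 + |b| + ‖η‖ + ‖v‖) ^ p := by
  induction h with
  | const c => exact ⟨‖c‖, norm_nonneg _, 0, fun b η v => by simp⟩
  | param => exact ⟨1, zero_le_one, 1, fun b η v => by
      simp only [Complex.norm_real, Real.norm_eq_abs, pow_one, one_mul]
      linarith [norm_nonneg η, norm_nonneg v]⟩
  | vecParam i => exact ⟨1, zero_le_one, 1, fun b η v => by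
      simp only [Complex.norm_real, Real.norm_eq_abs, pow_one, one_mul]
      linarith [abs_apply_le_norm η i, norm_nonneg v, abs_nonneg b]⟩
  | coord i => exact ⟨1, zero_le_one, 1, fun b η v => by
      simp only [Complex.norm_real, Real.norm_eq_abs, pow_one, one_mul]
      linarith [abs_apply_le_norm v i, norm_nonneg η, abs_nonneg b]⟩
  | add _ _ ih1 ih2 =>
    obtain ⟨C1, hC1, p1, b1⟩ := ih1
    obtain ⟨C2, hC2, p2, b2⟩ := ih2
    refine ⟨C1 + C2, by positivity, p1 + p2, fun b η v => ?_⟩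
    have h1 : (1 : ℝ) ≤ 1 + |b| + ‖η‖ + ‖v‖ := by
      linarith [norm_nonneg η, norm_nonneg v, abs_nonneg b]
    refine (norm_add_le _ _).trans ?_
    rw [add_mul]
    refine add_le_add ((b1 b η v).trans ?_) ((b2 b η v).trans ?_)
    · exact mul_le_mul_of_nonneg_left (pow_le_pow_right₀ h1 (by omega)) hC1
    · exact mul_le_mul_of_nonneg_left (pow_le_pow_right₀ h1 (by omega)) hC2
  | mul _ _ ih1 ih2 =>
    obtain ⟨C1, hC1, p1, b1⟩ := ih1
    obtain ⟨C2, hC2, p2, b2⟩ := ih2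
    refine ⟨C1 * C2, by positivity, p1 + p2, fun b η v => ?_⟩
    rw [norm_mul, pow_add, mul_mul_mul_comm]
    exact mul_le_mul (b1 b η v) (b2 b η v) (norm_nonneg _) (by positivity)

lemma isSymbol_rot (i : Fin n ⊕ Fin n) :
    IsSymbol fun (_ : ℝ) (_ v : Space n) => ((rot v i : ℝ) : ℂ) := by
  rcases i with j | j
  · exact IsSymbol.coord (Sum.inr j)
  · have h := (IsSymbol.const (n := n) (-1)).mul (IsSymbol.coord (Sum.inl j))
    convert h using 4
    simp

lemma partialDeriv_comp_smul {F : Space n → ℂ} (hF : Differentiable ℝ F) (i : Fin n ⊕ Fin n)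
    (s : ℝ) (u : Space n) :
    partialDeriv i (fun u => F (s • u)) u = s * partialDeriv i F (s • u) := by
  unfold partialDeriv
  have h := (hF (s • u)).hasFDerivAt.comp u ((hasFDerivAt_id (𝕜 := ℝ) u).const_smul s)
  rw [show (fun u => F (s • u)) = F ∘ (fun u => s • id u) from rfl]
  erw [h.fderiv]
  simp

/-- The scaled symbol of a monomial acting on the heat kernel. -/
theorem exists_symbol (w : List (Fin n ⊕ Fin n)) :
    ∃ Φ : ℝ → Space n → Space n → ℂ, IsSymbol Φ ∧ ∀ (ν : Space n) (lam t : ℝ), 0 < heatA lam t →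
      ∀ u, monomial lam w (heatKernel ν lam t) u = (√(heatA lam t) : ℂ) ^ w.length *
        Φ (lam / heatA lam t) ((√(heatA lam t))⁻¹ • ν) (√(heatA lam t) • u) *
          heatKernel ν lam t u := by
  induction w with
  | nil => exact ⟨_, .const 1, fun ν lam t _ u => by simp [monomial]⟩
  | cons i w ih =>
    obtain ⟨Φ, hΦ, e⟩ := ih
    obtain ⟨Ψ, hΨ, eΨ⟩ := hΦ.exists_partialDeriv i
    -- With `√A` factored out, the new letter differentiates the old symbol and multiplies it by the
    -- rescaled field factor `-2 v_i - η_i + (i b / 2)(rot v)_i`.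
    refine ⟨_, hΨ.add (hΦ.mul ((((IsSymbol.const (-2)).mul (.coord i)).add
      ((IsSymbol.const (-1)).mul (.vecParam i))).add (((IsSymbol.const (Complex.I / 2)).mul
        .param).mul (isSymbol_rot i)))), fun ν lam t hA u => ?_⟩
    have hs : 0 < √(heatA lam t) := Real.sqrt_pos.2 hA
    have hs2 : (heatA lam t : ℂ) = (√(heatA lam t) : ℂ) ^ 2 := by
      rw [← Complex.ofReal_pow, Real.sq_sqrt hA.le]
    have hd := hΦ.differentiable (lam / heatA lam t) ((√(heatA lam t))⁻¹ • ν)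
    have hd' : Differentiable ℝ fun u : Space n =>
        Φ (lam / heatA lam t) ((√(heatA lam t))⁻¹ • ν) (√(heatA lam t) • u) :=
      hd.comp (by fun_prop)
    have e' : monomial lam w (heatKernel ν lam t) = fun u => ((√(heatA lam t) : ℂ) ^ w.length *
        Φ (lam / heatA lam t) ((√(heatA lam t))⁻¹ • ν) (√(heatA lam t) • u)) *
          heatKernel ν lam t u := funext fun u => e ν lam t hA u
    change field lam i (monomial lam w (heatKernel ν lam t)) u = _
    rw [e', field_mul_left lam i ((hd' u).const_mul _) (differentiable_heatKernel ν lam t u),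
      partialDeriv_const_mul _ i (hd' u), partialDeriv_comp_smul hd, eΨ, field_heatKernel]
    unfold heatFactor
    have hne : (√(heatA lam t) : ℂ) ≠ 0 := by exact_mod_cast hs.ne'
    simp only [map_smul, PiLp.smul_apply, smul_eq_mul, List.length_cons, Complex.ofReal_mul,
      Complex.ofReal_inv, Complex.ofReal_div, Complex.ofReal_sub, Complex.ofReal_neg,
      Complex.ofReal_ofNat]
    rw [hs2, pow_succ]
    field_simp
    ring

end

/-! ### Gaussian bounds for monomials of the heat kernel. -/

section

variable {n : ℕ}

/-- From `(p + K) x ≤ (p + K)² + x²/4`: polynomial and exponential growth is paid for with a quarter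
of the Gaussian. -/
lemma one_add_pow_mul_exp_le (p : ℕ) (K : ℝ) {x : ℝ} (hx : 0 ≤ x) :
    (1 + x) ^ p * Real.exp (K * x) ≤ Real.exp ((p + K) ^ 2) * Real.exp (x ^ 2 / 4) := by
  have h1 : (1 + x) ^ p ≤ Real.exp (p * x) := by
    rw [Real.exp_nat_mul]
    exact pow_le_pow_left₀ (by positivity) (by linarith [Real.add_one_le_exp x]) p
  calc (1 + x) ^ p * Real.exp (K * x) ≤ Real.exp (p * x) * Real.exp (K * x) := by gcongr
    _ ≤ _ := by
      rw [← Real.exp_add, ← Real.exp_add, Real.exp_le_exp]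
      nlinarith [sq_nonneg ((p + K) - x / 2)]

/-- Used with `y = |λ| t`: powers of `1 + |λ| t` are paid for with half of the decay `e^{-|λ|t}`. -/
lemma one_add_pow_le_exp (m : ℕ) {y : ℝ} (hy : 0 ≤ y) :
    (1 + y) ^ m ≤ (2 * (m + 1)) ^ m * Real.exp (y / 2) := by
  have hm : (0 : ℝ) < 2 * (m + 1) := by positivity
  have h1 : 1 + y ≤ 2 * (m + 1) * Real.exp (y / (2 * (m + 1))) := by
    have := Real.add_one_le_exp (y / (2 * (m + 1)))
    calc 1 + y ≤ 2 * (m + 1) * (y / (2 * (m + 1)) + 1) := by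
          rw [mul_add, mul_div_cancel₀ _ hm.ne']
          have : (0 : ℝ) ≤ m := by positivity
          linarith
      _ ≤ _ := by gcongr
  calc (1 + y) ^ m ≤ (2 * (m + 1) * Real.exp (y / (2 * (m + 1)))) ^ m :=
        pow_le_pow_left₀ (by positivity) h1 m
    _ = (2 * (m + 1)) ^ m * Real.exp (m * (y / (2 * (m + 1)))) := by
        rw [mul_pow, ← Real.exp_nat_mul]
    _ ≤ _ := by
        gcongr
        rw [mul_div_assoc', div_le_div_iff₀ hm two_pos]
        nlinarith

lemma inv_cosh_le (x : ℝ) : (Real.cosh x)⁻¹ ≤ 2 * Real.exp (-|x|) := by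
  rw [← Real.cosh_abs, Real.exp_neg, ← div_eq_mul_inv, inv_le_comm₀ (Real.cosh_pos _) (by positivity),
    inv_div, Real.cosh_eq]
  have := Real.exp_pos (-|x|)
  linarith

/-- The factor `cosh^{-n}` supplies `e^{-n|λ|t}`, of which one exponential is kept; this uses `1 ≤
n`. -/
lemma heatC_le (hn : 1 ≤ n) {lam t : ℝ} (hl : lam ≠ 0) (ht : 0 < t) :
    heatC n lam t ≤ 2 ^ n * √(heatA lam t) ^ (2 * n) * Real.exp (-(|lam| * t)) := by
  have hA := heatA_pos hl ht
  have h1 : heatA lam t / (Real.pi * Real.cosh (lam * t)) ≤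
      2 * heatA lam t * Real.exp (-(|lam| * t)) := by
    have h2 := inv_cosh_le (lam * t)
    rw [abs_mul, abs_of_pos ht] at h2
    have h3 : heatA lam t / (Real.pi * Real.cosh (lam * t)) ≤
        heatA lam t * (Real.cosh (lam * t))⁻¹ := by
      rw [← div_eq_mul_inv]
      refine div_le_div_of_nonneg_left hA.le (Real.cosh_pos _) ?_
      nlinarith [Real.pi_gt_three, Real.cosh_pos (lam * t)]
    nlinarith
  rw [heatC_eq hl ht, pow_mul, Real.sq_sqrt hA.le, ← mul_pow]
  have hc := Real.cosh_pos (lam * t)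
  refine (pow_le_pow_left₀ (by positivity) h1 n).trans ?_
  rw [mul_pow, ← Real.exp_nat_mul]
  gcongr
  have : (1 : ℝ) ≤ n := by exact_mod_cast hn
  have : 0 ≤ |lam| * t := by positivity
  nlinarith

/-- Gaussian bounds for the derivatives of the heat kernel. -/
theorem exists_monomial_heatKernel_le (hn : 1 ≤ n) {M : ℝ} (hM : 0 < M)
    (w : List (Fin n ⊕ Fin n)) :
    ∃ C : ℝ, 0 < C ∧ ∀ (ν : Space n) (lam t : ℝ), lam ≠ 0 → M * ‖ν‖ ^ 2 ≤ |lam| → 0 < t →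
      ∀ u, ‖monomial lam w (heatKernel ν lam t) u‖ * Real.exp (2 * ‖ν‖ * ‖u‖) ≤
        C * (√t)⁻¹ ^ (2 * n + w.length) * Real.exp (-(|lam| * t / 2)) *
          Real.exp (-(|lam| * ‖u‖ ^ 2 / 16)) * Real.exp (-(‖u‖ ^ 2 / (16 * t))) := by
  obtain ⟨Φ, hΦ, e⟩ := exists_symbol w
  obtain ⟨C, hC, p, hb⟩ := hΦ.exists_bound
  -- From `√M ‖ν‖ ≤ √|λ| ≤ 2 √A`: the drift is at most `K` in units of the width of the Gaussian.
  -- Here the assumption relating `λ` and `ν` enters.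
  set K : ℝ := 2 / √M with hK
  have hK0 : 0 ≤ K := by positivity
  set m := 2 * n + w.length with hm
  refine ⟨(C + 1) * (5 + K) ^ p * Real.exp ((p + 3 * K) ^ 2) * 2 ^ n * (2 * (m + 1)) ^ m,
    by positivity, fun ν lam t hl hν ht u => ?_⟩
  have hA := heatA_pos hl ht
  have hCp := heatC_pos hl ht n
  set A := heatA lam t with hAdef
  have hs : 0 < √A := Real.sqrt_pos.2 hA
  set x := √A * ‖u‖ with hx
  have hx0 : 0 ≤ x := by positivity
  have hx2 : x ^ 2 = A * ‖u‖ ^ 2 := by rw [hx, mul_pow, Real.sq_sqrt hA.le]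
  have hlA := abs_le_four_heatA hl ht
  have htA := one_le_four_mul_heatA hl ht
  have hAt := four_mul_heatA_le hl ht
  rw [← hAdef] at hlA htA hAt
  have hνK : ‖ν‖ ≤ K * √A := by
    have h1 : √M * ‖ν‖ ≤ 2 * √A := by
      rw [← abs_of_nonneg (norm_nonneg ν), ← Real.sqrt_sq_eq_abs, ← Real.sqrt_mul hM.le,
        show (2 : ℝ) = √4 by rw [show (4 : ℝ) = 2 ^ 2 by norm_num, Real.sqrt_sq zero_le_two],
        ← Real.sqrt_mul (by norm_num)]
      exact Real.sqrt_le_sqrt (hν.trans hlA)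
    rw [hK, div_mul_eq_mul_div, le_div_iff₀ (Real.sqrt_pos.2 hM), mul_comm]
    exact h1
  -- Both parameters of the symbol are bounded, by `4` and `K`, so it grows only polynomially in `x
  -- = √A ‖u‖`.
  have hΦb : ‖Φ (lam / A) ((√A)⁻¹ • ν) (√A • u)‖ ≤ C * ((5 + K) ^ p * (1 + x) ^ p) := by
    refine (hb _ _ _).trans (mul_le_mul_of_nonneg_left ?_ hC)
    rw [← mul_pow]
    refine pow_le_pow_left₀ (by positivity) ?_ p
    have h1 : |lam / A| ≤ 4 := by
      rw [abs_div, abs_of_pos hA, div_le_iff₀ hA]; exact hlA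
    have h2 : ‖(√A)⁻¹ • ν‖ ≤ K := by
      rw [norm_smul, norm_inv, Real.norm_of_nonneg hs.le, inv_mul_le_iff₀ hs, mul_comm]
      exact hνK
    have h3 : ‖√A • u‖ = x := by rw [norm_smul, Real.norm_of_nonneg hs.le]
    rw [h3]
    nlinarith
  -- The weight contributes `2‖ν‖‖u‖` to the exponent and the drift part of the kernel at most
  -- `‖ν‖‖u‖`, in total `3 K x`.
  have hker : ‖heatKernel ν lam t u‖ * Real.exp (2 * ‖ν‖ * ‖u‖) ≤
      heatC n lam t * (Real.exp (3 * K * x) * Real.exp (-x ^ 2)) := by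
    unfold heatKernel
    rw [Complex.norm_real, Real.norm_of_nonneg (by positivity), mul_assoc, ← Real.exp_add,
      ← Real.exp_add]
    refine mul_le_mul_of_nonneg_left (Real.exp_le_exp.2 ?_) hCp.le
    unfold heatExp
    have h1 : -inner ℝ ν u ≤ ‖ν‖ * ‖u‖ := by
      have := abs_real_inner_le_norm ν u
      have := neg_le_abs (inner ℝ ν u)
      linarith
    have h2 : ‖ν‖ * ‖u‖ ≤ K * x := by
      rw [hx, ← mul_assoc]; exact mul_le_mul_of_nonneg_right hνK (norm_nonneg _)
    have h3 : 0 ≤ ‖ν‖ ^ 2 * t := by positivity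
    rw [hx2]
    linarith
  have hsA : √A ≤ (1 + |lam| * t) * (√t)⁻¹ := by
    have h1 : √A * √t ≤ 1 + |lam| * t := by
      rw [← Real.sqrt_mul hA.le]
      refine Real.sqrt_le_iff.2 ⟨by positivity, ?_⟩
      have : 0 ≤ |lam| * t := by positivity
      nlinarith
    rw [← div_eq_mul_inv, le_div_iff₀ (Real.sqrt_pos.2 ht)]
    exact h1
  -- Since `√A ≤ (1 + |λ|t)/√t`, powers of `√A` become inverse powers of `√t`; half of `e^{-|λ|t}`
  -- absorbs the growing factor.
  have hpow : √A ^ m * Real.exp (-(|lam| * t)) ≤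
      (2 * (m + 1)) ^ m * (√t)⁻¹ ^ m * Real.exp (-(|lam| * t / 2)) := by
    have h1 : √A ^ m ≤ (1 + |lam| * t) ^ m * (√t)⁻¹ ^ m := by
      rw [← mul_pow]; exact pow_le_pow_left₀ hs.le hsA m
    have h2 := one_add_pow_le_exp m (y := |lam| * t) (by positivity)
    have h3 : Real.exp (-(|lam| * t / 2)) = Real.exp (|lam| * t / 2) * Real.exp (-(|lam| * t)) := by
      rw [← Real.exp_add]; congr 1; ring
    rw [h3]
    calc √A ^ m * Real.exp (-(|lam| * t))
        ≤ ((2 * (m + 1)) ^ m * Real.exp (|lam| * t / 2)) * (√t)⁻¹ ^ m *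
            Real.exp (-(|lam| * t)) := by
          refine mul_le_mul_of_nonneg_right (h1.trans ?_) (Real.exp_nonneg _)
          exact mul_le_mul_of_nonneg_right h2 (by positivity)
      _ = _ := by ring
  -- The remaining exponent `-3x²/4` is more than enough for two quarters, one bounded by means of
  -- `4A ≥ |λ|` and the other by means of `4A ≥ 1/t`.
  have hgauss : Real.exp (-x ^ 2) * Real.exp (x ^ 2 / 4) ≤
      Real.exp (-(|lam| * ‖u‖ ^ 2 / 16)) * Real.exp (-(‖u‖ ^ 2 / (16 * t))) := by
    rw [← Real.exp_add, ← Real.exp_add, Real.exp_le_exp, hx2]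
    have h1 : |lam| * ‖u‖ ^ 2 / 16 ≤ A * ‖u‖ ^ 2 / 4 := by
      have := mul_le_mul_of_nonneg_right hlA (sq_nonneg ‖u‖)
      linarith
    have h2 : ‖u‖ ^ 2 / (16 * t) ≤ A * ‖u‖ ^ 2 / 4 := by
      rw [div_le_iff₀ (by positivity)]
      have := mul_le_mul_of_nonneg_right htA (sq_nonneg ‖u‖)
      linarith
    have : 0 ≤ A * ‖u‖ ^ 2 := by positivity
    linarith
  have hpx := one_add_pow_mul_exp_le p (3 * K) hx0
  have hcc := heatC_le hn hl ht
  rw [← hAdef] at hcc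
  rw [e ν lam t hA u, norm_mul, norm_mul, norm_pow, Complex.norm_real, Real.norm_of_nonneg hs.le]
  calc √A ^ w.length * ‖Φ (lam / A) ((√A)⁻¹ • ν) (√A • u)‖ * ‖heatKernel ν lam t u‖ *
        Real.exp (2 * ‖ν‖ * ‖u‖)
      = √A ^ w.length * ‖Φ (lam / A) ((√A)⁻¹ • ν) (√A • u)‖ * (‖heatKernel ν lam t u‖ *
        Real.exp (2 * ‖ν‖ * ‖u‖)) := by ring
    _ ≤ √A ^ w.length * ((C + 1) * ((5 + K) ^ p * (1 + x) ^ p)) *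
        ((2 ^ n * √A ^ (2 * n) * Real.exp (-(|lam| * t))) *
          (Real.exp (3 * K * x) * Real.exp (-x ^ 2))) := by
        refine mul_le_mul (mul_le_mul_of_nonneg_left (hΦb.trans ?_) (by positivity))
          (hker.trans ?_) (by positivity) (by positivity)
        · exact mul_le_mul_of_nonneg_right (by linarith) (by positivity)
        · exact mul_le_mul_of_nonneg_right hcc (by positivity)
    _ = ((C + 1) * (5 + K) ^ p * 2 ^ n) * (√A ^ m * Real.exp (-(|lam| * t))) *
        (((1 + x) ^ p * Real.exp (3 * K * x)) * Real.exp (-x ^ 2)) := by rw [hm, pow_add]; ring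
    _ ≤ ((C + 1) * (5 + K) ^ p * 2 ^ n) * ((2 * (m + 1)) ^ m * (√t)⁻¹ ^ m *
        Real.exp (-(|lam| * t / 2))) * ((Real.exp ((p + 3 * K) ^ 2) * Real.exp (x ^ 2 / 4)) *
          Real.exp (-x ^ 2)) := by
        refine mul_le_mul (mul_le_mul_of_nonneg_left hpow (by positivity))
          (mul_le_mul_of_nonneg_right hpx (Real.exp_nonneg _)) (by positivity) (by positivity)
    _ = ((C + 1) * (5 + K) ^ p * Real.exp ((p + 3 * K) ^ 2) * 2 ^ n * (2 * (m + 1)) ^ m) *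
        ((√t)⁻¹ ^ m * Real.exp (-(|lam| * t / 2))) * (Real.exp (-x ^ 2) * Real.exp (x ^ 2 / 4)) := by
        ring
    _ ≤ ((C + 1) * (5 + K) ^ p * Real.exp ((p + 3 * K) ^ 2) * 2 ^ n * (2 * (m + 1)) ^ m) *
        ((√t)⁻¹ ^ m * Real.exp (-(|lam| * t / 2))) *
        (Real.exp (-(|lam| * ‖u‖ ^ 2 / 16)) * Real.exp (-(‖u‖ ^ 2 / (16 * t)))) :=
        mul_le_mul_of_nonneg_left hgauss (by positivity)
    _ = _ := by ring

/-- Derivatives of the heat kernel depend continuously on all variables. -/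
lemma continuousOn_monomial_heatKernel (ν : Space n) {lam : ℝ} (hl : lam ≠ 0)
    (w : List (Fin n ⊕ Fin n)) : ContinuousOn
      (fun p : ℝ × Space n => monomial lam w (heatKernel ν lam p.1) p.2) (Ioi 0 ×ˢ univ) := by
  obtain ⟨Φ, hΦ, e⟩ := exists_symbol w
  have hA : ContinuousOn (fun p : ℝ × Space n => heatA lam p.1) (Ioi 0 ×ˢ univ) :=
    fun p hp => ((hasDerivAt_heatA hl hp.1).continuousAt.comp
      (x := p) continuousAt_fst).continuousWithinAt
  have hC : ContinuousOn (fun p : ℝ × Space n => heatC n lam p.1) (Ioi 0 ×ˢ univ) :=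
    fun p hp => ((hasDerivAt_heatC hl hp.1 n).continuousAt.comp
      (x := p) continuousAt_fst).continuousWithinAt
  have hsA : ContinuousOn (fun p : ℝ × Space n => √(heatA lam p.1)) (Ioi 0 ×ˢ univ) :=
    Real.continuous_sqrt.comp_continuousOn hA
  have hq : ContinuousOn (fun p : ℝ × Space n => heatKernel ν lam p.1 p.2) (Ioi 0 ×ˢ univ) := by
    unfold heatKernel heatExp
    refine Complex.continuous_ofReal.comp_continuousOn (hC.mul
      (Real.continuous_exp.comp_continuousOn (((hA.neg.mul ?_).sub ?_).sub ?_)))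
    all_goals exact Continuous.continuousOn (by fun_prop)
  have hpos : ∀ p ∈ (Ioi 0 ×ˢ univ : Set (ℝ × Space n)), 0 < heatA lam p.1 := fun p hp =>
    heatA_pos hl hp.1
  refine ContinuousOn.congr (f := fun p : ℝ × Space n => (√(heatA lam p.1) : ℂ) ^ w.length *
        Φ (lam / heatA lam p.1) ((√(heatA lam p.1))⁻¹ • ν) (√(heatA lam p.1) • p.2) *
          heatKernel ν lam p.1 p.2) ?_ fun p hp => e ν lam p.1 (hpos p hp) p.2
  refine (((Complex.continuous_ofReal.comp_continuousOn hsA).pow _).mul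
    (hΦ.continuous.comp_continuousOn (f := fun p : ℝ × Space n =>
      (lam / heatA lam p.1, (√(heatA lam p.1))⁻¹ • ν, √(heatA lam p.1) • p.2)) ?_)).mul hq
  refine (continuousOn_const.div hA fun p hp => (hpos p hp).ne').prodMk
    (ContinuousOn.prodMk ?_ ?_)
  · exact (hsA.inv₀ fun p hp => (Real.sqrt_pos.2 (hpos p hp)).ne').smul continuousOn_const
  · exact hsA.smul continuousOn_snd

end

section

variable {n : ℕ}

/-! ### The twisting factor -/

/-- The factor `exp ((iλ/2) ⟨J z, w⟩)` of the twisted convolution. -/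
def twist (lam : ℝ) (z w : Space n) : ℂ :=
  Complex.exp (((lam / 2 * inner ℝ (rot z) w : ℝ) : ℂ) * Complex.I)

@[simp] lemma norm_twist (lam : ℝ) (z w : Space n) : ‖twist lam z w‖ = 1 :=
  Complex.norm_exp_ofReal_mul_I _

lemma twist_add_left (lam : ℝ) (z z' w : Space n) :
    twist lam (z + z') w = twist lam z w * twist lam z' w := by
  unfold twist
  rw [← Complex.exp_add, map_add, inner_add_left]; push_cast; ring_nf

lemma twist_add_right (lam : ℝ) (z w w' : Space n) :
    twist lam z (w + w') = twist lam z w * twist lam z w' := by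
  unfold twist
  rw [← Complex.exp_add, inner_add_right]; push_cast; ring_nf

lemma twist_self (lam : ℝ) (z : Space n) : twist lam z z = 1 := by
  simp [twist, inner_rot_self]

lemma twist_swap (lam : ℝ) (z w : Space n) : twist lam w z = conj (twist lam z w) := by
  unfold twist
  rw [← Complex.exp_conj, inner_rot_left, real_inner_comm, map_mul, Complex.conj_ofReal,
    Complex.conj_I]
  push_cast; ring_nf

@[simp] lemma twist_zero_right (lam : ℝ) (z : Space n) : twist lam z 0 = 1 := by simp [twist]

lemma conj_twist_mul_self (lam : ℝ) (z w : Space n) : conj (twist lam z w) * twist lam z w = 1 := by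
  rw [mul_comm, Complex.mul_conj, Complex.normSq_eq_norm_sq, norm_twist]; simp

lemma twist_neg_right (lam : ℝ) (z w : Space n) : twist lam z (-w) = conj (twist lam z w) := by
  unfold twist
  rw [← Complex.exp_conj, inner_neg_right, map_mul, Complex.conj_ofReal, Complex.conj_I]
  push_cast; ring_nf

lemma continuous_twist (lam : ℝ) : Continuous fun p : Space n × Space n => twist lam p.1 p.2 := by
  unfold twist; fun_prop

lemma finrank_space : Module.finrank ℝ (Space n) = 2 * n := by
  simp [finrank_euclideanSpace, two_mul]

lemma gaussian_cpow (x : ℂ) : x ^ ((Module.finrank ℝ (Space n) : ℂ) / 2) = x ^ n := by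
  rw [finrank_space]
  push_cast
  rw [mul_div_cancel_left₀ _ two_ne_zero, Complex.cpow_natCast]

lemma integral_gaussian_space {b : ℝ} (hb : 0 < b) :
    ∫ v : Space n, Real.exp (-b * ‖v‖ ^ 2) = (Real.pi / b) ^ n := by
  rw [GaussianFourier.integral_rexp_neg_mul_sq_norm hb, finrank_space]
  push_cast
  rw [mul_div_cancel_left₀ _ two_ne_zero, Real.rpow_natCast]

lemma integrable_gaussian_space {b : ℝ} (hb : 0 < b) :
    Integrable fun v : Space n => Real.exp (-b * ‖v‖ ^ 2) := by
  have h := (GaussianFourier.integrable_cexp_neg_mul_sq_norm_add (V := Space n) (b := b)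
    (by simpa using hb) 0 0).norm
  refine h.congr (Eventually.of_forall fun v => ?_)
  simp only [Complex.norm_exp]
  congr 1
  simp [← Complex.ofReal_pow]

/-! ### The semigroup identity for the heat kernel -/

/-- After completing the square, the integral is the Fourier transform of a Gaussian at a multiple
of `rot z`. It contributes `exp(-λ²|z|²/(16(a+b)))`, and the addition laws `heatA_add` and
`heatC_add` identify the result. -/
theorem integral_heatKernel_mul_heatKernel (ν : Space n) {lam s t : ℝ} (hl : lam ≠ 0) (hs : 0 < s)
    (ht : 0 < t) (z : Space n) :
    ∫ w, heatKernel ν lam t (z - w) * twist lam z w * heatKernel ν lam s w =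
      heatKernel ν lam (t + s) z := by
  have ha := heatA_pos hl ht
  have hb := heatA_pos hl hs
  have hadd := heatA_add hl ht hs
  have hCadd := heatC_add n hl ht hs
  unfold heatKernel
  rw [← hCadd]
  set a := heatA lam t with hadef
  set b := heatA lam s with hbdef
  have hab : 0 < a + b := by positivity
  -- Translation to the centre of the product of the two Gaussians. The centre is a multiple of `z`,
  -- so the twist is unaffected.
  rw [← integral_add_right_eq_self _ ((a / (a + b)) • z)]
  have e : ∀ w : Space n,
      ((heatC n lam t * Real.exp (heatExp ν lam t (z - (w + (a / (a + b)) • z))) : ℝ) : ℂ) *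
      twist lam z (w + (a / (a + b)) • z) *
      ((heatC n lam s * Real.exp (heatExp ν lam s (w + (a / (a + b)) • z)) : ℝ) : ℂ) =
      ((heatC n lam t * heatC n lam s * Real.exp (-(a * b / (a + b)) * ‖z‖ ^ 2 - inner ℝ ν z -
        ‖ν‖ ^ 2 * (t + s)) : ℝ) : ℂ) *
      Complex.exp (-((a + b : ℝ) : ℂ) * (‖w‖ : ℂ) ^ 2 + (lam / 2 * Complex.I) *
        ((inner ℝ (rot z) w : ℝ) : ℂ)) := by
    intro w
    have h1 : twist lam z (w + (a / (a + b)) • z) = twist lam z w := by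
      unfold twist
      rw [inner_add_right, inner_smul_right, inner_rot_self, mul_zero, add_zero]
    have h2 : heatExp ν lam t (z - (w + (a / (a + b)) • z)) +
        heatExp ν lam s (w + (a / (a + b)) • z) = (-(a * b / (a + b)) * ‖z‖ ^ 2 - inner ℝ ν z -
        ‖ν‖ ^ 2 * (t + s)) + -(a + b) * ‖w‖ ^ 2 := by
      have h3 : z - (w + (a / (a + b)) • z) = (b / (a + b)) • z - w := by
        have : z - (a / (a + b)) • z = (b / (a + b)) • z := by
          rw [← one_smul ℝ z, smul_smul, ← sub_smul, smul_smul]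
          congr 1; field_simp; ring
        rw [← this]; abel
      unfold heatExp
      rw [h3, norm_sub_sq_real, norm_add_sq_real, inner_sub_right, inner_add_right, norm_smul,
        norm_smul, real_inner_smul_left, inner_smul_right, inner_smul_right, inner_smul_right,
        ← hadef, ← hbdef, mul_pow, mul_pow, Real.norm_eq_abs, Real.norm_eq_abs, sq_abs, sq_abs,
        real_inner_comm z w]
      field_simp
      ring
    rw [h1]
    unfold twist
    have h4 : Complex.exp (-((a + b : ℝ) : ℂ) * (‖w‖ : ℂ) ^ 2 + (lam / 2 * Complex.I) *
        ((inner ℝ (rot z) w : ℝ) : ℂ)) = ((Real.exp (-(a + b) * ‖w‖ ^ 2) : ℝ) : ℂ) *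
        Complex.exp (((lam / 2 * inner ℝ (rot z) w : ℝ) : ℂ) * Complex.I) := by
      rw [Complex.ofReal_exp, ← Complex.exp_add]
      push_cast; ring_nf
    have h5 := congrArg (fun x : ℝ => ((Real.exp x : ℝ) : ℂ)) h2
    simp only [Real.exp_add, Complex.ofReal_mul] at h5
    rw [h4]
    push_cast at h5 ⊢
    linear_combination ((heatC n lam t : ℂ) * heatC n lam s *
      Complex.exp (lam / 2 * (inner ℝ (rot z) w : ℝ) * Complex.I)) * h5
  simp only [e]
  rw [integral_const_mul, GaussianFourier.integral_cexp_neg_mul_sq_norm_add (by simpa using hab),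
    gaussian_cpow, norm_rot]
  have h6 : Complex.exp ((lam / 2 * Complex.I) ^ 2 * (‖z‖ : ℂ) ^ 2 / (4 * ((a + b : ℝ) : ℂ))) =
      ((Real.exp (-(lam ^ 2 / 16 / (a + b)) * ‖z‖ ^ 2) : ℝ) : ℂ) := by
    rw [Complex.ofReal_exp]
    congr 1
    have : ((a + b : ℝ) : ℂ) ≠ 0 := by exact_mod_cast hab.ne'
    push_cast at this ⊢
    rw [mul_pow, Complex.I_sq]
    field_simp
    ring
  have h7 : heatExp ν lam (t + s) z = (-(a * b / (a + b)) * ‖z‖ ^ 2 - inner ℝ ν z -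
        ‖ν‖ ^ 2 * (t + s)) + -(lam ^ 2 / 16 / (a + b)) * ‖z‖ ^ 2 := by
    unfold heatExp
    rw [← hadd]; field_simp; ring
  rw [h6, h7, Real.exp_add]
  push_cast
  ring

/-- The semigroup identity with arbitrary base points. -/
theorem integral_heatKernel_twist (ν : Space n) {lam s t : ℝ} (hl : lam ≠ 0) (hs : 0 < s)
    (ht : 0 < t) (z v : Space n) :
    ∫ w, heatKernel ν lam t (z - w) * twist lam z w * (heatKernel ν lam s (w - v) * twist lam w v) =
      heatKernel ν lam (t + s) (z - v) * twist lam z v := by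
  rw [← integral_heatKernel_mul_heatKernel ν hl hs ht (z - v), ← integral_mul_const,
    ← integral_add_right_eq_self _ v]
  refine integral_congr_ae (Eventually.of_forall fun w => ?_)
  simp only
  have h1 : z - (w + v) = z - v - w := by abel
  have h2 : twist lam (z - v) w = twist lam z w * twist lam w v := by
    rw [sub_eq_add_neg, twist_add_left, twist_swap lam w (-v), twist_neg_right, Complex.conj_conj]
  rw [h1, h2, add_sub_cancel_right, twist_add_right, twist_add_left, twist_self]
  ring

/-! ### The mass of the heat kernel -/

lemma norm_heatKernel_mul_exp (ν : Space n) {lam t : ℝ} (hl : lam ≠ 0) (ht : 0 < t) (u : Space n) :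
    ‖heatKernel ν lam t u‖ * Real.exp (inner ℝ ν u) =
      heatC n lam t * Real.exp (-(‖ν‖ ^ 2 * t)) * Real.exp (-heatA lam t * ‖u‖ ^ 2) := by
  have := heatC_pos hl ht n
  unfold heatKernel heatExp
  rw [Complex.norm_real, Real.norm_of_nonneg (by positivity), mul_assoc, mul_assoc, ← Real.exp_add,
    ← Real.exp_add]
  ring_nf

/-- The weight `e^{ν·u}` cancels the drift in the exponent, leaving a centred Gaussian of mass
`e^{-|ν|²t} (cosh λt)^{-n}`. -/
theorem lintegral_heatKernel_le (ν : Space n) {lam t : ℝ} (hl : lam ≠ 0) (ht : 0 < t) :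
    ∫⁻ u, ENNReal.ofReal (‖heatKernel ν lam t u‖ * Real.exp (inner ℝ ν u)) ≤
      ENNReal.ofReal (Real.exp (-(‖ν‖ ^ 2 * t))) := by
  have hA := heatA_pos hl ht
  have hC := heatC_pos hl ht n
  simp only [norm_heatKernel_mul_exp ν hl ht]
  rw [← ofReal_integral_eq_lintegral_ofReal ((integrable_gaussian_space hA).const_mul _)
    (Eventually.of_forall fun u => by positivity), integral_const_mul, integral_gaussian_space hA]
  refine ENNReal.ofReal_le_ofReal ?_
  have h1 : heatC n lam t * (Real.pi / heatA lam t) ^ n ≤ 1 := by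
    have hc := Real.cosh_pos (lam * t)
    rw [heatC_eq hl ht, ← mul_pow]
    refine pow_le_one₀ (by positivity) ?_
    have : heatA lam t / (Real.pi * Real.cosh (lam * t)) * (Real.pi / heatA lam t) =
      (Real.cosh (lam * t))⁻¹ := by field_simp
    rw [this]
    exact inv_le_one_of_one_le₀ (Real.one_le_cosh _)
  calc heatC n lam t * Real.exp (-(‖ν‖ ^ 2 * t)) * (Real.pi / heatA lam t) ^ n
      = (heatC n lam t * (Real.pi / heatA lam t) ^ n) * Real.exp (-(‖ν‖ ^ 2 * t)) := by ring
    _ ≤ 1 * Real.exp (-(‖ν‖ ^ 2 * t)) := by gcongr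
    _ = _ := one_mul _

/-! ### The heat kernel is an approximate identity -/

lemma tendsto_mul_heatA {lam : ℝ} (hl : lam ≠ 0) :
    Tendsto (fun t => t * heatA lam t) (𝓝[>] 0) (𝓝 (1 / 4)) := by
  have h1 : Tendsto (fun t : ℝ => 1 / 4 + |lam| / 4 * t) (𝓝[>] 0) (𝓝 (1 / 4)) := by
    have : Tendsto (fun t : ℝ => 1 / 4 + |lam| / 4 * t) (𝓝 0) (𝓝 (1 / 4 + |lam| / 4 * 0)) :=
      Continuous.tendsto (by fun_prop) 0
    rw [mul_zero, add_zero] at this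
    exact this.mono_left nhdsWithin_le_nhds
  refine tendsto_of_tendsto_of_tendsto_of_le_of_le' tendsto_const_nhds h1 ?_ ?_
  · filter_upwards [self_mem_nhdsWithin] with t ht
    linarith [one_le_four_mul_heatA hl ht]
  · filter_upwards [self_mem_nhdsWithin] with t ht
    linarith [four_mul_heatA_le hl ht]

/-- The parabolic substitution `u = √t v` turns the kernels into functions converging to the
Gaussian density `(4π)^{-n} e^{-|v|²/4}`, and dominated convergence applies. -/
theorem tendsto_integral_heatKernel_mul (ν : Space n) {lam : ℝ} (hl : lam ≠ 0) {F : Space n → ℂ}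
    (hF : Continuous F) {C : ℝ} (hC : ∀ u, ‖F u‖ ≤ C) :
    Tendsto (fun t => ∫ u, heatKernel ν lam t u * F u) (𝓝[>] 0) (𝓝 (F 0)) := by
  have hC0 : 0 ≤ C := (norm_nonneg _).trans (hC 0)
  have hscale : ∀ t : ℝ, 0 < t → ∫ u, heatKernel ν lam t u * F u =
      ∫ v, ((t ^ n : ℝ) : ℂ) * heatKernel ν lam t (√t • v) * F (√t • v) := by
    intro t ht
    have hst := Real.sqrt_pos.2 ht
    have h := Measure.integral_comp_smul volume (fun u => heatKernel ν lam t u * F u) √t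
    simp only [mul_assoc]
    rw [integral_const_mul, h, finrank_space, pow_mul, Real.sq_sqrt ht.le, abs_of_pos (by positivity),
      Complex.real_smul, ← mul_assoc, ← Complex.ofReal_mul, mul_inv_cancel₀ (by positivity)]
    simp
  have hev : (fun t => ∫ v, ((t ^ n : ℝ) : ℂ) * heatKernel ν lam t (√t • v) * F (√t • v)) =ᶠ[𝓝[>] 0]
      fun t => ∫ u, heatKernel ν lam t u * F u := by
    filter_upwards [self_mem_nhdsWithin] with t ht using (hscale t ht).symm
  refine Tendsto.congr' hev ?_
  have hker : ∀ t : ℝ, 0 < t → ∀ v : Space n, t ^ n * (heatC n lam t * Real.exp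
      (heatExp ν lam t (√t • v))) = (t * heatA lam t / (Real.pi * Real.cosh (lam * t))) ^ n *
        Real.exp (-(t * heatA lam t) * ‖v‖ ^ 2 - √t * inner ℝ ν v - ‖ν‖ ^ 2 * t) := by
    intro t ht v
    rw [heatC_eq hl ht, ← mul_assoc, ← mul_pow, mul_div_assoc]
    congr 2
    unfold heatExp
    rw [norm_smul, mul_pow, Real.norm_eq_abs, sq_abs, Real.sq_sqrt ht.le, inner_smul_right]
    ring
  have hlim : ∫ v : Space n, (((1 / 4 / (Real.pi * 1)) ^ n * Real.exp (-(1 / 4) * ‖v‖ ^ 2) : ℝ) : ℂ) *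
      F 0 = F 0 := by
    rw [integral_mul_const, integral_complex_ofReal, integral_const_mul,
      integral_gaussian_space (by norm_num), ← mul_pow]
    have : 1 / 4 / (Real.pi * 1) * (Real.pi / (1 / 4)) = 1 := by
      have := Real.pi_ne_zero; field_simp
    rw [this]; simp
  rw [← hlim]
  have hsq : Tendsto (fun t : ℝ => √t) (𝓝[>] 0) (𝓝 0) := by
    have := Real.continuous_sqrt.tendsto 0
    rw [Real.sqrt_zero] at this
    exact this.mono_left nhdsWithin_le_nhds
  have hid : Tendsto (fun t : ℝ => t) (𝓝[>] 0) (𝓝 0) := tendsto_id.mono_left nhdsWithin_le_nhds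
  -- For `t < 1` the exponent is at most `-|v|²/4 + ‖ν‖‖v‖`, and half of the Gaussian absorbs the
  -- linear term at the cost of `e^{2‖ν‖²}`.
  refine tendsto_integral_filter_of_dominated_convergence
    (fun v => (1 + |lam|) ^ n * Real.exp (2 * ‖ν‖ ^ 2) * Real.exp (-(1 / 8) * ‖v‖ ^ 2) * C)
    ?_ ?_ (((integrable_gaussian_space (by norm_num)).const_mul _).mul_const _) ?_
  · refine Eventually.of_forall fun t => Continuous.aestronglyMeasurable ?_
    refine (continuous_const.mul ((contDiff_heatKernel ν lam t).continuous.comp ?_)).mul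
      (hF.comp ?_) <;> fun_prop
  · filter_upwards [self_mem_nhdsWithin, (hid.eventually (gt_mem_nhds zero_lt_one))] with t ht ht1
    have ht : 0 < t := ht
    refine Eventually.of_forall fun v => ?_
    have hA := heatA_pos hl ht
    have hch := Real.one_le_cosh (lam * t)
    rw [heatKernel, ← Complex.ofReal_mul, hker t ht v, norm_mul, Complex.norm_real,
      Real.norm_of_nonneg (by have := Real.cosh_pos (lam * t); positivity)]
    refine mul_le_mul ?_ (hC _) (norm_nonneg _) (by positivity)
    rw [mul_assoc]
    refine mul_le_mul ?_ ?_ (Real.exp_nonneg _) (by positivity)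
    · refine pow_le_pow_left₀ (by have := Real.cosh_pos (lam * t); positivity) ?_ n
      rw [div_le_iff₀ (by have := Real.cosh_pos (lam * t); positivity)]
      have h1 := four_mul_heatA_le hl ht
      have h2 : |lam| * t ≤ |lam| := by nlinarith [abs_nonneg lam]
      have h3 : 1 ≤ Real.pi * Real.cosh (lam * t) := by nlinarith [Real.pi_gt_three]
      have := abs_nonneg lam
      nlinarith
    · rw [← Real.exp_add, Real.exp_le_exp]
      have h1 := one_le_four_mul_heatA hl ht
      have h2 : -inner ℝ ν v ≤ ‖ν‖ * ‖v‖ := by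
        have := abs_real_inner_le_norm ν v
        have := neg_le_abs (inner ℝ ν v)
        linarith
      have h3 : √t ≤ 1 := Real.sqrt_le_one.2 ht1.le
      have h4 : -(√t * inner ℝ ν v) ≤ ‖ν‖ * ‖v‖ := by
        have : √t * (-inner ℝ ν v) ≤ √t * (‖ν‖ * ‖v‖) :=
          mul_le_mul_of_nonneg_left h2 (Real.sqrt_nonneg _)
        have : √t * (‖ν‖ * ‖v‖) ≤ 1 * (‖ν‖ * ‖v‖) :=
          mul_le_mul_of_nonneg_right h3 (by positivity)
        linarith
      have h5 : 0 ≤ ‖ν‖ ^ 2 * t := by positivity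
      have h6 := mul_le_mul_of_nonneg_right h1 (sq_nonneg ‖v‖)
      nlinarith [sq_nonneg (‖v‖ - 4 * ‖ν‖)]
  · refine Eventually.of_forall fun v => ?_
    have hF0 : Tendsto (fun t : ℝ => F (√t • v)) (𝓝[>] 0) (𝓝 (F 0)) := by
      refine (hF.tendsto 0).comp ?_
      have := hsq.smul_const v
      rwa [zero_smul] at this
    refine Tendsto.mul ?_ hF0
    have h1 : (fun t : ℝ => (((t * heatA lam t / (Real.pi * Real.cosh (lam * t))) ^ n *
        Real.exp (-(t * heatA lam t) * ‖v‖ ^ 2 - √t * inner ℝ ν v - ‖ν‖ ^ 2 * t) : ℝ) : ℂ)) =ᶠ[𝓝[>] 0]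
        fun t => ((t ^ n : ℝ) : ℂ) * heatKernel ν lam t (√t • v) := by
      filter_upwards [self_mem_nhdsWithin] with t ht
      rw [heatKernel, ← Complex.ofReal_mul, hker t ht v]
    refine Tendsto.congr' h1 ((Complex.continuous_ofReal.tendsto _).comp ?_)
    have hA := tendsto_mul_heatA hl
    have hcosh : Tendsto (fun t : ℝ => Real.cosh (lam * t)) (𝓝[>] 0) (𝓝 1) := by
      have : Tendsto (fun t : ℝ => Real.cosh (lam * t)) (𝓝 0) (𝓝 (Real.cosh (lam * 0))) :=
        Continuous.tendsto (by fun_prop) 0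
      rw [mul_zero, Real.cosh_zero] at this
      exact this.mono_left nhdsWithin_le_nhds
    refine ((hA.div (hcosh.const_mul _) (by simp [Real.pi_ne_zero])).pow n).mul
      ((Real.continuous_exp.tendsto _).comp ?_)
    have h2 := ((hA.neg.mul_const (‖v‖ ^ 2)).sub (hsq.mul_const (inner ℝ ν v))).sub
      (hid.const_mul (‖ν‖ ^ 2))
    simpa using h2

end

section

variable {n : ℕ}

/-! ### Differentiation under the integral sign -/

lemma fderiv_eq_sum_smulRight (F : Space n → ℂ) (z : Space n) :
    fderiv ℝ F z = ∑ i, ContinuousLinearMap.smulRightL ℝ (Space n) ℂ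
      (EuclideanSpace.proj i : Space n →L[ℝ] ℝ) (partialDeriv i F z) := by
  ext y
  rw [fderiv_apply_eq_sum]
  simp

/-- A partial derivative differs from a field by a multiple of the function that is bounded on
balls, so local domination of the function and its fields dominates the full derivative. -/
theorem field_integral {α : Type*} [MeasurableSpace α] {μ : Measure α} (lam : ℝ)
    {F : α → Space n → ℂ} (hF : ∀ a, Differentiable ℝ (F a))
    (hm : ∀ u, AEStronglyMeasurable (fun a => F a u) μ)
    (hm' : ∀ i u, AEStronglyMeasurable (fun a => field lam i (F a) u) μ)
    (hb : ∀ R : ℝ, ∃ b : α → ℝ, Integrable b μ ∧ ∀ᵐ a ∂μ, ∀ u, ‖u‖ ≤ R →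
      ‖F a u‖ ≤ b a ∧ ∀ i, ‖field lam i (F a) u‖ ≤ b a) :
    Differentiable ℝ (fun u => ∫ a, F a u ∂μ) ∧
      ∀ i u, field lam i (fun u => ∫ a, F a u ∂μ) u = ∫ a, field lam i (F a) u ∂μ := by
  have hint : ∀ u, Integrable (fun a => F a u) μ := fun u => by
    obtain ⟨b, hbi, hbb⟩ := hb ‖u‖
    exact hbi.mono' (hm u) (hbb.mono fun a ha => (ha u le_rfl).1)
  have hint' : ∀ i u, Integrable (fun a => field lam i (F a) u) μ := fun i u => by
    obtain ⟨b, hbi, hbb⟩ := hb ‖u‖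
    exact hbi.mono' (hm' i u) (hbb.mono fun a ha => (ha u le_rfl).2 i)
  have hmp : ∀ i u, AEStronglyMeasurable (fun a => partialDeriv i (F a) u) μ := fun i u => by
    simp only [partialDeriv_eq lam i]
    exact (hm' i u).sub ((hm u).const_mul _)
  have hmf : ∀ u, AEStronglyMeasurable (fun a => fderiv ℝ (F a) u) μ := fun u => by
    simp only [fderiv_eq_sum_smulRight]
    exact Finset.aestronglyMeasurable_fun_sum _ fun i _ =>
      (ContinuousLinearMap.continuous _).comp_aestronglyMeasurable (hmp i u)
  have key : ∀ u, HasFDerivAt (fun u => ∫ a, F a u ∂μ) (∫ a, fderiv ℝ (F a) u ∂μ) u ∧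
      Integrable (fun a => fderiv ℝ (F a) u) μ := by
    intro u
    obtain ⟨b, hbi, hbb⟩ := hb (‖u‖ + 1)
    have hbound : ∀ᵐ a ∂μ, ∀ x ∈ Metric.ball u 1, ‖fderiv ℝ (F a) x‖ ≤
        ∑ _i : Fin n ⊕ Fin n, (1 + |lam| / 2 * (‖u‖ + 1)) * b a := by
      filter_upwards [hbb] with a ha x hx
      have hxn : ‖x‖ ≤ ‖u‖ + 1 := by
        rw [Metric.mem_ball, dist_eq_norm] at hx
        have : ‖x‖ ≤ ‖u‖ + ‖x - u‖ := by simpa using norm_add_le u (x - u)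
        linarith
      obtain ⟨h1, h2⟩ := ha x hxn
      refine (norm_fderiv_le_sum (F a) x).trans (Finset.sum_le_sum fun i _ => ?_)
      rw [partialDeriv_eq lam]
      refine (norm_sub_le _ _).trans ?_
      rw [add_mul, one_mul]
      refine add_le_add (h2 i) ?_
      rw [norm_mul, norm_mul, norm_div, norm_mul, Complex.norm_I, Complex.norm_real,
        Complex.norm_real, one_mul, Complex.norm_ofNat, Real.norm_eq_abs, Real.norm_eq_abs]
      have h3 : |rot x i| ≤ ‖u‖ + 1 := (abs_apply_le_norm _ i).trans (by rwa [norm_rot])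
      gcongr
    have hbi' : Integrable (fun a => ∑ _i : Fin n ⊕ Fin n,
        (1 + |lam| / 2 * (‖u‖ + 1)) * b a) μ :=
      integrable_finsetSum _ fun i _ => hbi.const_mul _
    refine ⟨hasFDerivAt_integral_of_dominated_of_fderiv_le (Metric.ball_mem_nhds u one_pos)
      (Eventually.of_forall hm) (hint u) (hmf u) hbound hbi'
      (Eventually.of_forall fun a x _ => (hF a x).hasFDerivAt), ?_⟩
    exact hbi'.mono' (hmf u) (hbound.mono fun a ha => ha u (Metric.mem_ball_self one_pos))
  refine ⟨fun u => (key u).1.differentiableAt, fun i u => ?_⟩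
  rw [field_eq, partialDeriv, (key u).1.fderiv, ContinuousLinearMap.integral_apply (key u).2,
    ← integral_const_mul, ← integral_add]
  · simp only [field_eq]; rfl
  · have : (fun a => (fderiv ℝ (F a) u) (EuclideanSpace.single i 1)) = fun a =>
        partialDeriv i (F a) u := rfl
    rw [this]
    simp only [partialDeriv_eq lam i]
    exact (hint' i u).sub ((hint u).const_mul _)
  · exact (hint u).const_mul _

/-! ### Kernels with Gaussian bounds -/

/-- Smooth kernels all of whose derivatives along the fields have Gaussian decay. -/
def HasGaussianBounds (ν : Space n) (lam : ℝ) (κ : Space n → ℂ) : Prop :=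
  ContDiff ℝ ∞ κ ∧ ∀ w, ∃ C, 0 < C ∧ ∀ u,
    ‖monomial lam w κ u‖ * Real.exp (2 * ‖ν‖ * ‖u‖) ≤ C * Real.exp (-(|lam| * ‖u‖ ^ 2 / 16))

lemma HasGaussianBounds.monomial {ν : Space n} {lam : ℝ} {κ : Space n → ℂ}
    (h : HasGaussianBounds ν lam κ) (w : List (Fin n ⊕ Fin n)) :
    HasGaussianBounds ν lam (monomial lam w κ) :=
  ⟨contDiff_monomial h.1 lam w, fun v => by rw [← monomial_append]; exact h.2 (v ++ w)⟩

/-- For fixed `ν` and `λ` the comparison of `λ` with `ν` holds with `M = |λ|/(‖ν‖² + 1)`, and `ε`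
removes the singularity at time zero. The constant is not uniform; it serves integrability and
smoothness only. -/
lemma exists_monomial_heatKernel_add_le (hn : 1 ≤ n) (ν : Space n) {lam : ℝ} (hl : lam ≠ 0)
    {ε : ℝ} (hε : 0 < ε) (w : List (Fin n ⊕ Fin n)) :
    ∃ C : ℝ, 0 < C ∧ ∀ t, 0 ≤ t → ∀ u,
      ‖monomial lam w (heatKernel ν lam (t + ε)) u‖ * Real.exp (2 * ‖ν‖ * ‖u‖) ≤
        C * Real.exp (-(|lam| * t / 2)) * Real.exp (-(|lam| * ‖u‖ ^ 2 / 16)) := by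
  have hl' := abs_pos.2 hl
  have hM : 0 < |lam| / (‖ν‖ ^ 2 + 1) := by positivity
  have hν : |lam| / (‖ν‖ ^ 2 + 1) * ‖ν‖ ^ 2 ≤ |lam| := by
    rw [div_mul_eq_mul_div, div_le_iff₀ (by positivity)]
    nlinarith
  obtain ⟨C, hC, hb⟩ := exists_monomial_heatKernel_le hn hM w
  refine ⟨C * (√ε)⁻¹ ^ (2 * n + w.length), by positivity, fun t ht u => ?_⟩
  have htε : 0 < t + ε := by positivity
  refine (hb ν lam (t + ε) hl hν htε u).trans ?_
  have h1 : (√(t + ε))⁻¹ ≤ (√ε)⁻¹ :=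
    inv_anti₀ (Real.sqrt_pos.2 hε) (Real.sqrt_le_sqrt (by linarith))
  have h2 : Real.exp (-(‖u‖ ^ 2 / (16 * (t + ε)))) ≤ 1 :=
    Real.exp_le_one_iff.2 (by simp only [Left.neg_nonpos_iff]; positivity)
  have h3 : Real.exp (-(|lam| * (t + ε) / 2)) ≤ Real.exp (-(|lam| * t / 2)) :=
    Real.exp_le_exp.2 (by nlinarith)
  calc _ ≤ C * (√ε)⁻¹ ^ (2 * n + w.length) * Real.exp (-(|lam| * t / 2)) *
        Real.exp (-(|lam| * ‖u‖ ^ 2 / 16)) * 1 := by gcongr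
    _ = _ := by ring

lemma hasGaussianBounds_heatKernel (hn : 1 ≤ n) (ν : Space n) {lam : ℝ} (hl : lam ≠ 0)
    {ε : ℝ} (hε : 0 < ε) : HasGaussianBounds ν lam (heatKernel ν lam ε) := by
  refine ⟨contDiff_heatKernel ν lam ε, fun w => ?_⟩
  obtain ⟨C, hC, hb⟩ := exists_monomial_heatKernel_add_le hn ν hl hε w
  exact ⟨C, hC, fun u => by simpa using hb 0 le_rfl u⟩

/-! ### The kernels of the negative powers -/

/-- The image under a monomial of the kernel of `(-L)^{-s} e^{ε L}`. -/
def powerKernel (ν : Space n) (lam s ε : ℝ) (w : List (Fin n ⊕ Fin n)) (u : Space n) : ℂ :=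
  ((Real.Gamma s)⁻¹ : ℝ) * ∫ t in Ioi (0 : ℝ),
    ((t ^ (s - 1) : ℝ) : ℂ) * monomial lam w (heatKernel ν lam (t + ε)) u

section PowerKernel

lemma integrableOn_rpow_mul_exp_half {lam s : ℝ} (hl : lam ≠ 0) (hs : 0 < s) :
    IntegrableOn (fun t => t ^ (s - 1) * Real.exp (-(|lam| * t / 2))) (Ioi 0) := by
  have h := integrableOn_rpow_mul_exp_neg_mul_rpow (s := s - 1) (p := 1) (b := |lam| / 2)
    (by linarith) one_pos (by have := abs_pos.2 hl; positivity)
  refine h.congr_fun (fun t ht => ?_) measurableSet_Ioi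
  simp only [Real.rpow_one]
  congr 2; ring

lemma aestronglyMeasurable_monomial_heatKernel (ν : Space n) {lam : ℝ} (hl : lam ≠ 0) (s : ℝ) {ε : ℝ}
    (hε : 0 < ε) (w : List (Fin n ⊕ Fin n)) (u : Space n) :
    AEStronglyMeasurable (fun t : ℝ => ((t ^ (s - 1) : ℝ) : ℂ) *
      monomial lam w (heatKernel ν lam (t + ε)) u) (volume.restrict (Ioi 0)) := by
  refine ContinuousOn.aestronglyMeasurable ?_ measurableSet_Ioi
  refine ContinuousOn.mul ?_ ?_
  · refine Complex.continuous_ofReal.comp_continuousOn fun t ht => ?_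
    exact (Real.continuousAt_rpow_const t _ (Or.inl (ne_of_gt ht))).continuousWithinAt
  · exact (continuousOn_monomial_heatKernel ν hl w).comp (f := fun t : ℝ => (t + ε, u))
      (by fun_prop) fun t ht => ⟨by have : 0 < t := ht; exact mem_Ioi.2 (by positivity), mem_univ _⟩

variable (hn : 1 ≤ n) (ν : Space n) {lam : ℝ} (hl : lam ≠ 0) {s ε : ℝ} (hs : 0 < s) (hε : 0 < ε)
include hn hl hs hε

lemma integrableOn_powerKernel (w : List (Fin n ⊕ Fin n)) (u : Space n) :
    IntegrableOn (fun t : ℝ => ((t ^ (s - 1) : ℝ) : ℂ) *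
      monomial lam w (heatKernel ν lam (t + ε)) u) (Ioi 0) := by
  obtain ⟨C, hC, hb⟩ := exists_monomial_heatKernel_add_le hn ν hl hε w
  refine Integrable.mono' ((integrableOn_rpow_mul_exp_half hl hs).const_mul C)
    (aestronglyMeasurable_monomial_heatKernel ν hl s hε w u) ?_
  refine (ae_restrict_iff' measurableSet_Ioi).2 (Eventually.of_forall fun t ht => ?_)
  have ht : 0 < t := ht
  rw [norm_mul, Complex.norm_real, Real.norm_of_nonneg (by positivity), mul_left_comm]
  refine mul_le_mul_of_nonneg_left ?_ (by positivity)
  have h1 : 1 ≤ Real.exp (2 * ‖ν‖ * ‖u‖) := Real.one_le_exp (by positivity)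
  have h2 : Real.exp (-(|lam| * ‖u‖ ^ 2 / 16)) ≤ 1 :=
    Real.exp_le_one_iff.2 (by simp only [Left.neg_nonpos_iff]; positivity)
  calc _ ≤ ‖monomial lam w (heatKernel ν lam (t + ε)) u‖ * Real.exp (2 * ‖ν‖ * ‖u‖) :=
        le_mul_of_one_le_right (norm_nonneg _) h1
    _ ≤ C * Real.exp (-(|lam| * t / 2)) * Real.exp (-(|lam| * ‖u‖ ^ 2 / 16)) := hb t ht.le u
    _ ≤ C * Real.exp (-(|lam| * t / 2)) * 1 := by gcongr
    _ = _ := mul_one _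

/-- Applying a field prepends a letter to the word: the family of kernels is stable under the
fields, which is what `contDiff_of_field_mem` requires. -/
lemma field_powerKernel (w : List (Fin n ⊕ Fin n)) :
    Differentiable ℝ (powerKernel ν lam s ε w) ∧
      ∀ i, field lam i (powerKernel ν lam s ε w) = powerKernel ν lam s ε (i :: w) := by
  have hd : ∀ (v : List (Fin n ⊕ Fin n)) (t : ℝ),
      Differentiable ℝ (monomial lam v (heatKernel ν lam t)) := fun v t =>
    (contDiff_monomial (contDiff_heatKernel ν lam t) lam v).differentiable (by simp)
  have hfield : ∀ (i : Fin n ⊕ Fin n) (t : ℝ) (u : Space n), field lam i (fun u =>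
      ((t ^ (s - 1) : ℝ) : ℂ) * monomial lam w (heatKernel ν lam (t + ε)) u) u =
      ((t ^ (s - 1) : ℝ) : ℂ) * monomial lam (i :: w) (heatKernel ν lam (t + ε)) u :=
    fun i t u => field_const_mul lam i _ (hd w (t + ε) u)
  choose C hC hb using fun v => exists_monomial_heatKernel_add_le hn ν hl hε v
  have hbound : ∀ v t u, 0 < t → ‖((t ^ (s - 1) : ℝ) : ℂ) *
      monomial lam v (heatKernel ν lam (t + ε)) u‖ ≤
      C v * (t ^ (s - 1) * Real.exp (-(|lam| * t / 2))) := by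
    intro v t u ht
    rw [norm_mul, Complex.norm_real, Real.norm_of_nonneg (by positivity), mul_left_comm]
    refine mul_le_mul_of_nonneg_left ?_ (by positivity)
    have h1 : 1 ≤ Real.exp (2 * ‖ν‖ * ‖u‖) := Real.one_le_exp (by positivity)
    have h2 : Real.exp (-(|lam| * ‖u‖ ^ 2 / 16)) ≤ 1 :=
      Real.exp_le_one_iff.2 (by simp only [Left.neg_nonpos_iff]; positivity)
    have hCv := hC v
    calc _ ≤ ‖monomial lam v (heatKernel ν lam (t + ε)) u‖ * Real.exp (2 * ‖ν‖ * ‖u‖) :=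
          le_mul_of_one_le_right (norm_nonneg _) h1
      _ ≤ C v * Real.exp (-(|lam| * t / 2)) * Real.exp (-(|lam| * ‖u‖ ^ 2 / 16)) := hb v t ht.le u
      _ ≤ C v * Real.exp (-(|lam| * t / 2)) * 1 := by gcongr
      _ = _ := mul_one _
  obtain ⟨h1, h2⟩ := field_integral (μ := volume.restrict (Ioi (0 : ℝ))) lam (F := fun (t : ℝ) u =>
      ((t ^ (s - 1) : ℝ) : ℂ) * monomial lam w (heatKernel ν lam (t + ε)) u)
    (fun t => (hd w _).const_mul _)
    (fun u => aestronglyMeasurable_monomial_heatKernel ν hl s hε w u)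
    (fun i u => by
      simp only [hfield]
      exact aestronglyMeasurable_monomial_heatKernel ν hl s hε (i :: w) u)
    (fun R => ⟨fun t => (C w + ∑ i, C (i :: w)) * (t ^ (s - 1) * Real.exp (-(|lam| * t / 2))),
      (integrableOn_rpow_mul_exp_half hl hs).const_mul _,
      (ae_restrict_iff' measurableSet_Ioi).2 (Eventually.of_forall fun t ht u _ => by
        have ht : 0 < t := ht
        refine ⟨(hbound w t u ht).trans (mul_le_mul_of_nonneg_right ?_ (by positivity)),
          fun i => ?_⟩
        · exact le_add_of_nonneg_right (Finset.sum_nonneg fun i _ => (hC _).le)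
        · rw [hfield]
          refine (hbound (i :: w) t u ht).trans (mul_le_mul_of_nonneg_right ?_ (by positivity))
          have := Finset.single_le_sum (f := fun i => C (i :: w)) (fun i _ => (hC _).le)
            (Finset.mem_univ i)
          have := hC w
          linarith)⟩)
  refine ⟨h1.const_mul _, fun i => funext fun u => ?_⟩
  unfold powerKernel
  rw [field_const_mul lam i _ (h1 u), h2 i u]
  simp only [hfield]

lemma contDiff_powerKernel (w : List (Fin n ⊕ Fin n)) :
    ContDiff ℝ ∞ (powerKernel ν lam s ε w) := by
  refine contDiff_of_field_mem lam (range (powerKernel ν lam s ε)) ?_ ?_ _ ⟨w, rfl⟩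
  · rintro _ ⟨v, rfl⟩; exact (field_powerKernel hn ν hl hs hε v).1
  · rintro _ ⟨v, rfl⟩ i; exact ⟨_, ((field_powerKernel hn ν hl hs hε v).2 i).symm⟩

lemma monomial_powerKernel (v w : List (Fin n ⊕ Fin n)) :
    monomial lam v (powerKernel ν lam s ε w) = powerKernel ν lam s ε (v ++ w) := by
  induction v with
  | nil => rfl
  | cons i v ih =>
    change field lam i (monomial lam v _) = _
    rw [ih, (field_powerKernel hn ν hl hs hε _).2]; rfl

lemma hasGaussianBounds_powerKernel (w : List (Fin n ⊕ Fin n)) :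
    HasGaussianBounds ν lam (powerKernel ν lam s ε w) := by
  refine ⟨contDiff_powerKernel hn ν hl hs hε w, fun v => ?_⟩
  rw [monomial_powerKernel hn ν hl hs hε]
  obtain ⟨C, hC, hb⟩ := exists_monomial_heatKernel_add_le hn ν hl hε (v ++ w)
  have hG := Real.Gamma_pos_of_pos hs
  have hI : 0 ≤ ∫ t in Ioi (0 : ℝ), t ^ (s - 1) * Real.exp (-(|lam| * t / 2)) :=
    setIntegral_nonneg measurableSet_Ioi fun t ht => by
      have : 0 < t := ht
      positivity
  refine ⟨(Real.Gamma s)⁻¹ * C * (∫ t in Ioi (0 : ℝ), t ^ (s - 1) * Real.exp (-(|lam| * t / 2))) + 1,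
    by positivity, fun u => ?_⟩
  have hE := Real.exp_pos (2 * ‖ν‖ * ‖u‖)
  have h1 : ‖∫ t in Ioi (0 : ℝ), ((t ^ (s - 1) : ℝ) : ℂ) *
      monomial lam (v ++ w) (heatKernel ν lam (t + ε)) u‖ ≤ ∫ t in Ioi (0 : ℝ),
        (C * Real.exp (-(|lam| * ‖u‖ ^ 2 / 16)) / Real.exp (2 * ‖ν‖ * ‖u‖)) *
          (t ^ (s - 1) * Real.exp (-(|lam| * t / 2))) := by
    refine norm_integral_le_of_norm_le ((integrableOn_rpow_mul_exp_half hl hs).const_mul _) ?_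
    refine (ae_restrict_iff' measurableSet_Ioi).2 (Eventually.of_forall fun t ht => ?_)
    have ht : 0 < t := ht
    rw [norm_mul, Complex.norm_real, Real.norm_of_nonneg (by positivity), mul_left_comm]
    refine mul_le_mul_of_nonneg_left ?_ (by positivity)
    rw [div_mul_eq_mul_div, le_div_iff₀ hE]
    exact (hb t ht.le u).trans_eq (by ring)
  rw [integral_const_mul] at h1
  unfold powerKernel
  rw [norm_mul, Complex.norm_real, Real.norm_of_nonneg (by positivity)]
  have hG2 := Real.exp_pos (-(|lam| * ‖u‖ ^ 2 / 16))
  calc _ ≤ (Real.Gamma s)⁻¹ * ((C * Real.exp (-(|lam| * ‖u‖ ^ 2 / 16)) /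
        Real.exp (2 * ‖ν‖ * ‖u‖)) * ∫ t in Ioi (0 : ℝ), t ^ (s - 1) *
          Real.exp (-(|lam| * t / 2))) * Real.exp (2 * ‖ν‖ * ‖u‖) := by gcongr
    _ = ((Real.Gamma s)⁻¹ * C * (∫ t in Ioi (0 : ℝ), t ^ (s - 1) * Real.exp (-(|lam| * t / 2)))) *
        Real.exp (-(|lam| * ‖u‖ ^ 2 / 16)) := by field_simp
    _ ≤ _ := by gcongr; linarith

end PowerKernel

/-- The resolvent equation for the kernels. -/
lemma driftLaplacian_powerKernel_one (hn : 1 ≤ n) (ν : Space n) {lam : ℝ} (hl : lam ≠ 0) {ε : ℝ}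
    (hε : 0 < ε) (u : Space n) :
    driftLaplacian ν lam (powerKernel ν lam 1 ε []) u = -heatKernel ν lam ε u := by
  have hp := fun w => (field_powerKernel hn ν hl one_pos hε w).2
  have hint := fun w => integrableOn_powerKernel hn ν hl one_pos hε w u
  simp only [sub_self, Real.rpow_zero, Complex.ofReal_one, one_mul] at hint
  unfold driftLaplacian
  simp only [hp]
  unfold powerKernel
  simp only [sub_self, Real.rpow_zero, Complex.ofReal_one, one_mul, Real.Gamma_one, inv_one]
  rw [← integral_finsetSum _ fun i _ => hint [i, i]]
  simp only [← integral_const_mul]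
  rw [← integral_finsetSum _ fun i _ => (hint [i]).const_mul _, ← integral_const_mul,
    ← integral_add (integrable_finsetSum _ fun i _ => hint [i, i])
      ((integrable_finsetSum _ fun i _ => (hint [i]).const_mul _).const_mul _)]
  -- By the heat equation the integrand is a time derivative, so the integral equals the boundary
  -- term at `t = 0`.
  have hder : ∀ t ∈ Ici (0 : ℝ), HasDerivAt (fun t => heatKernel ν lam (t + ε) u)
      (driftLaplacian ν lam (heatKernel ν lam (t + ε)) u) t := fun t ht => by
    have ht : 0 ≤ t := ht
    exact (hasDerivAt_heatKernel ν hl (by positivity : 0 < t + ε) u).comp_add_const t ε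
  have htend : Tendsto (fun t => heatKernel ν lam (t + ε) u) atTop (𝓝 0) := by
    obtain ⟨C, hC, hb⟩ := exists_monomial_heatKernel_add_le hn ν hl hε []
    have h0 : Tendsto (fun t : ℝ => C * Real.exp (-(|lam| * t / 2))) atTop (𝓝 0) := by
      rw [← mul_zero C]
      refine Tendsto.const_mul C (Real.tendsto_exp_neg_atTop_nhds_zero.comp ?_)
      have : Tendsto (fun t : ℝ => |lam| / 2 * t) atTop atTop :=
        tendsto_id.const_mul_atTop (by have := abs_pos.2 hl; positivity)
      exact this.congr fun t => by ring
    refine squeeze_zero_norm' ?_ h0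
    filter_upwards [eventually_ge_atTop 0] with t ht
    have h1 : 1 ≤ Real.exp (2 * ‖ν‖ * ‖u‖) := Real.one_le_exp (by positivity)
    have h2 : Real.exp (-(|lam| * ‖u‖ ^ 2 / 16)) ≤ 1 :=
      Real.exp_le_one_iff.2 (by simp only [Left.neg_nonpos_iff]; positivity)
    calc _ ≤ ‖heatKernel ν lam (t + ε) u‖ * Real.exp (2 * ‖ν‖ * ‖u‖) :=
          le_mul_of_one_le_right (norm_nonneg _) h1
      _ ≤ C * Real.exp (-(|lam| * t / 2)) * Real.exp (-(|lam| * ‖u‖ ^ 2 / 16)) := hb t ht u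
      _ ≤ C * Real.exp (-(|lam| * t / 2)) * 1 := by gcongr
      _ = _ := mul_one _
  have hi : IntegrableOn (fun t => driftLaplacian ν lam (heatKernel ν lam (t + ε)) u) (Ioi 0) :=
    (integrable_finsetSum _ fun i _ => hint [i, i]).add
      ((integrable_finsetSum _ fun i _ => (hint [i]).const_mul _).const_mul _)
  have h := integral_Ioi_of_hasDerivAt_of_tendsto' hder hi htend
  rw [zero_add, zero_sub] at h
  exact h

end

section

variable {n : ℕ}

/-! ### Twisted convolution on the weighted space -/

lemma lintegral_mul_sq_le {α : Type*} [MeasurableSpace α] {μ : Measure α} {k h : α → ℝ≥0∞}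
    (hk : AEMeasurable k μ) (hh : AEMeasurable h μ) :
    (∫⁻ a, k a * h a ∂μ) ^ 2 ≤ (∫⁻ a, k a ∂μ) * ∫⁻ a, k a * h a ^ 2 ∂μ := by
  have h1 := ENNReal.lintegral_mul_le_Lp_mul_Lq μ Real.HolderConjugate.two_two
    (f := fun a => k a ^ (1 / 2 : ℝ)) (g := fun a => k a ^ (1 / 2 : ℝ) * h a)
    (hk.pow_const _) ((hk.pow_const _).mul hh)
  have hr : ∀ x : ℝ≥0∞, (x ^ (1 / 2 : ℝ)) ^ (2 : ℝ) = x := fun x => by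
    rw [← ENNReal.rpow_mul]; norm_num
  have hsq : ∀ x : ℝ≥0∞, x ^ (1 / 2 : ℝ) * x ^ (1 / 2 : ℝ) = x := fun x => by
    rw [← ENNReal.rpow_add_of_nonneg _ _ (by norm_num) (by norm_num)]; norm_num
  simp only [Pi.mul_apply, ← mul_assoc, hsq, ENNReal.mul_rpow_of_nonneg _ _ zero_le_two, hr] at h1
  have h2 := pow_le_pow_left' h1 2
  refine h2.trans_eq ?_
  rw [mul_pow]
  simp only [← ENNReal.rpow_natCast, ← ENNReal.rpow_mul]
  norm_num

/-- Twisted convolution. -/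
def twConv (lam : ℝ) (κ f : Space n → ℂ) (z : Space n) : ℂ :=
  ∫ w, κ (z - w) * twist lam z w * f w

/-- The weighted mass of a convolution kernel. -/
def mass (ν : Space n) (κ : Space n → ℂ) : ℝ≥0∞ :=
  ∫⁻ u, ENNReal.ofReal (‖κ u‖ * Real.exp (inner ℝ ν u))

/-- Multiplication by `e^{ν·z}`, the square root of the density, turns the weighted problem into an
ordinary convolution on `L²(dx)` with kernel `‖κ‖ e^{ν·u}`. Cauchy–Schwarz with respect to that
kernel and Tonelli then give Young's inequality. -/
lemma lintegral_conv_sq_le (ν : Space n) {κ f : Space n → ℂ} (hκ : Continuous κ)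
    (hf : AEStronglyMeasurable f volume) :
    ∫⁻ z, (∫⁻ w, ‖κ (z - w)‖ₑ * ‖f w‖ₑ) ^ 2 ∂(driftMeasure ν) ≤
      mass ν κ ^ 2 * ∫⁻ w, ‖f w‖ₑ ^ 2 ∂(driftMeasure ν) := by
  set k : Space n → ℝ≥0∞ := fun u => ENNReal.ofReal (‖κ u‖ * Real.exp (inner ℝ ν u)) with hk
  set h : Space n → ℝ≥0∞ := fun w => ENNReal.ofReal (Real.exp (inner ℝ ν w)) * ‖f w‖ₑ with hh
  have hkm : Measurable k := by
    refine Measurable.ennreal_ofReal (Continuous.measurable ?_)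
    fun_prop
  have hhm : AEMeasurable h volume := by
    refine AEMeasurable.mul (Measurable.aemeasurable ?_) hf.enorm
    exact Measurable.ennreal_ofReal (Continuous.measurable (by fun_prop))
  have hdens : ∀ z : Space n, ENNReal.ofReal (dens ν z) =
      ENNReal.ofReal (Real.exp (inner ℝ ν z)) ^ 2 := fun z => by
    rw [← ENNReal.ofReal_pow (Real.exp_nonneg _), ← Real.exp_nat_mul]; rfl
  have e1 : ∀ z, ENNReal.ofReal (dens ν z) * (∫⁻ w, ‖κ (z - w)‖ₑ * ‖f w‖ₑ) ^ 2 =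
      (∫⁻ w, k (z - w) * h w) ^ 2 := fun z => by
    rw [hdens, ← mul_pow, ← lintegral_const_mul' _ _ ENNReal.ofReal_ne_top]
    congr 2
    funext w
    simp only [hk, hh]
    rw [ENNReal.ofReal_mul (norm_nonneg _), ofReal_norm,
      show inner ℝ ν z = inner ℝ ν (z - w) + inner ℝ ν w by rw [← inner_add_right]; simp,
      Real.exp_add, ENNReal.ofReal_mul (Real.exp_nonneg _)]
    ring
  have e2 : ∀ z, ∫⁻ w, k (z - w) = mass ν κ := fun z => lintegral_sub_left_eq_self k z
  have e3 : ∀ w, ∫⁻ z, k (z - w) = mass ν κ := fun w => lintegral_sub_right_eq_self k w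
  rw [lintegral_driftMeasure, lintegral_driftMeasure]
  simp only [e1]
  calc ∫⁻ z, (∫⁻ w, k (z - w) * h w) ^ 2
      ≤ ∫⁻ z, mass ν κ * ∫⁻ w, k (z - w) * h w ^ 2 := by
        refine lintegral_mono fun z => ?_
        rw [← e2 z]
        exact lintegral_mul_sq_le (hkm.comp (measurable_const.sub measurable_id)).aemeasurable hhm
    _ = mass ν κ * ∫⁻ z, ∫⁻ w, k (z - w) * h w ^ 2 := by
        refine lintegral_const_mul'' _ ?_
        refine AEMeasurable.lintegral_prod_right' (f := fun p : Space n × Space n =>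
          k (p.1 - p.2) * h p.2 ^ 2) ?_
        exact (hkm.comp (measurable_fst.sub measurable_snd)).aemeasurable.mul
          (hhm.comp_snd.pow_const 2)
    _ = mass ν κ * ∫⁻ w, ∫⁻ z, k (z - w) * h w ^ 2 := by
        rw [lintegral_lintegral_swap]
        exact (hkm.comp (measurable_fst.sub measurable_snd)).aemeasurable.mul
          (hhm.comp_snd.pow_const 2)
    _ = mass ν κ * (mass ν κ * ∫⁻ w, h w ^ 2) := by
        congr 1
        rw [← lintegral_const_mul'' _ (hhm.pow_const 2)]
        refine lintegral_congr fun w => ?_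
        have hkw : Measurable fun z => k (z - w) := hkm.comp (measurable_sub_const w)
        rw [lintegral_mul_const _ hkw, e3]
    _ = _ := by
        rw [← mul_assoc, ← sq]
        congr 1
        refine lintegral_congr fun w => ?_
        simp only [hh]
        rw [mul_pow, hdens]

section Operator

variable {ν : Space n} {lam : ℝ} {κ f : Space n → ℂ}

lemma lintegral_enorm_sq_lt_top (hf : MemLp f 2 (driftMeasure ν)) :
    ∫⁻ w, ‖f w‖ₑ ^ 2 ∂(driftMeasure ν) < ⊤ := by
  have h := hf.eLpNorm_lt_top
  rw [eLpNorm_lt_top_iff_lintegral_rpow_enorm_lt_top two_ne_zero ENNReal.ofNat_ne_top] at h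
  simpa using h

lemma memLp_two_of_lintegral (hm : AEStronglyMeasurable f (driftMeasure ν))
    (hf : ∫⁻ w, ‖f w‖ₑ ^ 2 ∂(driftMeasure ν) < ⊤) : MemLp f 2 (driftMeasure ν) := by
  refine ⟨hm, ?_⟩
  rw [eLpNorm_lt_top_iff_lintegral_rpow_enorm_lt_top two_ne_zero ENNReal.ofNat_ne_top]
  simpa using hf

lemma aestronglyMeasurable_twKernel (hκ : Continuous κ) (lam : ℝ)
    (hf : AEStronglyMeasurable f volume) :
    AEStronglyMeasurable (fun p : Space n × Space n => κ (p.1 - p.2) * twist lam p.1 p.2 * f p.2)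
      (volume.prod volume) := by
  refine AEStronglyMeasurable.mul (Continuous.aestronglyMeasurable ?_) hf.comp_snd
  exact (hκ.comp (continuous_fst.sub continuous_snd)).mul (continuous_twist lam)

lemma aemeasurable_lintegral_conv (hκ : Continuous κ) (hf : AEStronglyMeasurable f volume) :
    AEMeasurable (fun z => ∫⁻ w, ‖κ (z - w)‖ₑ * ‖f w‖ₑ) volume := by
  refine AEMeasurable.lintegral_prod_right' (f := fun p : Space n × Space n =>
    ‖κ (p.1 - p.2)‖ₑ * ‖f p.2‖ₑ) ?_
  have h1 : Measurable fun p : Space n × Space n => ‖κ (p.1 - p.2)‖ₑ :=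
    (hκ.comp (continuous_fst.sub continuous_snd)).enorm.measurable
  exact h1.aemeasurable.mul hf.enorm.comp_snd

lemma continuous_twist_right (lam : ℝ) (z : Space n) : Continuous (twist lam z) := by
  unfold twist; fun_prop

lemma integrable_twKernel_of_lintegral (hκ : Continuous κ) (lam : ℝ)
    (hf : AEStronglyMeasurable f volume) {z : Space n} (hz : ∫⁻ w, ‖κ (z - w)‖ₑ * ‖f w‖ₑ < ⊤) :
    Integrable fun w => κ (z - w) * twist lam z w * f w := by
  have hc : Continuous fun w => κ (z - w) * twist lam z w :=
    (hκ.comp (continuous_const.sub continuous_id)).mul (continuous_twist_right lam z)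
  have hmeas : AEStronglyMeasurable (fun w => κ (z - w) * twist lam z w * f w) volume :=
    hc.aestronglyMeasurable.fun_mul hf
  refine ⟨hmeas, ?_⟩
  rw [hasFiniteIntegral_iff_enorm]
  refine lt_of_le_of_lt (lintegral_mono fun w => ?_) hz
  rw [enorm_mul, enorm_mul, ← ofReal_norm (twist lam z w), norm_twist]
  simp

lemma ae_integrable_twConv (hκ : Continuous κ) (hm : mass ν κ ≠ ⊤) (lam : ℝ)
    (hf : MemLp f 2 (driftMeasure ν)) :
    ∀ᵐ z, Integrable fun w => κ (z - w) * twist lam z w * f w := by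
  have hfm : AEStronglyMeasurable f volume :=
    (aestronglyMeasurable_driftMeasure_iff ν).1 hf.aestronglyMeasurable
  have h1 := lintegral_conv_sq_le ν hκ hfm
  have h2 : ∫⁻ z, (∫⁻ w, ‖κ (z - w)‖ₑ * ‖f w‖ₑ) ^ 2 ∂(driftMeasure ν) ≠ ⊤ :=
    (h1.trans_lt (ENNReal.mul_lt_top (ENNReal.pow_lt_top hm.lt_top)
      (lintegral_enorm_sq_lt_top hf))).ne
  have h3 : AEMeasurable (fun z => (∫⁻ w, ‖κ (z - w)‖ₑ * ‖f w‖ₑ) ^ 2) (driftMeasure ν) :=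
    ((aemeasurable_lintegral_conv hκ hfm).pow_const 2).mono_ac (driftMeasure_ac ν)
  have h4 := (ae_driftMeasure_iff ν).1 (ae_lt_top' h3 h2)
  refine h4.mono fun z hz => integrable_twKernel_of_lintegral hκ lam hfm ?_
  exact (ENNReal.pow_lt_top_iff.1 hz).resolve_right two_ne_zero

lemma enorm_twConv_le (lam : ℝ) (κ f : Space n → ℂ) (z : Space n) :
    ‖twConv lam κ f z‖ₑ ≤ ∫⁻ w, ‖κ (z - w)‖ₑ * ‖f w‖ₑ := by
  refine (enorm_integral_le_lintegral_enorm _).trans (lintegral_mono fun w => ?_)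
  rw [enorm_mul, enorm_mul, ← ofReal_norm (twist lam z w), norm_twist]
  simp

lemma lintegral_twConv_sq_le (hκ : Continuous κ) (lam : ℝ) (hf : MemLp f 2 (driftMeasure ν)) :
    ∫⁻ z, ‖twConv lam κ f z‖ₑ ^ 2 ∂(driftMeasure ν) ≤
      mass ν κ ^ 2 * ∫⁻ w, ‖f w‖ₑ ^ 2 ∂(driftMeasure ν) := by
  refine (lintegral_mono fun z => ?_).trans (lintegral_conv_sq_le ν hκ
    ((aestronglyMeasurable_driftMeasure_iff ν).1 hf.aestronglyMeasurable))
  exact pow_le_pow_left' (enorm_twConv_le lam κ f z) 2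

lemma memLp_twConv (hκ : Continuous κ) (hm : mass ν κ ≠ ⊤) (lam : ℝ)
    (hf : MemLp f 2 (driftMeasure ν)) : MemLp (twConv lam κ f) 2 (driftMeasure ν) := by
  refine memLp_two_of_lintegral ?_ ((lintegral_twConv_sq_le hκ lam hf).trans_lt
    (ENNReal.mul_lt_top (ENNReal.pow_lt_top hm.lt_top) (lintegral_enorm_sq_lt_top hf)))
  rw [aestronglyMeasurable_driftMeasure_iff]
  exact (aestronglyMeasurable_twKernel hκ lam
    ((aestronglyMeasurable_driftMeasure_iff ν).1 hf.aestronglyMeasurable)).integral_prod_right'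

lemma norm_sq_eq_lintegral (x : L2 ν) :
    ENNReal.ofReal (‖x‖ ^ 2) = ∫⁻ z, ‖x z‖ₑ ^ 2 ∂(driftMeasure ν) := by
  rw [Lp.norm_def, ENNReal.ofReal_pow ENNReal.toReal_nonneg,
    ENNReal.ofReal_toReal (Lp.eLpNorm_ne_top x),
    eLpNorm_eq_lintegral_rpow_enorm_toReal two_ne_zero ENNReal.ofNat_ne_top]
  simp only [ENNReal.toReal_ofNat, ENNReal.rpow_ofNat]
  rw [← ENNReal.rpow_natCast, ← ENNReal.rpow_mul]
  norm_num

lemma twConv_congr {g : Space n → ℂ} (h : f =ᵐ[volume] g) (lam : ℝ) (κ : Space n → ℂ) :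
    twConv lam κ f = twConv lam κ g := funext fun z =>
  integral_congr_ae (h.mono fun w hw => by simp only [hw])

variable (ν lam κ)

/-- Twisted convolution operators as bounded operators. -/
theorem exists_twOp (hκ : Continuous κ) (hm : mass ν κ ≠ ⊤) :
    ∃ T : L2 ν →L[ℂ] L2 ν, ‖T‖ ≤ (mass ν κ).toReal ∧ ∀ f, T f =ᵐ[volume] twConv lam κ f := by
  have hsp : ∀ f : L2 ν, (memLp_twConv hκ hm lam (Lp.memLp f)).toLp _ =ᵐ[volume]
      twConv lam κ f := fun f => by
    rw [EventuallyEq, ← ae_driftMeasure_eq ν]; exact MemLp.coeFn_toLp _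
  let T₀ : L2 ν →ₗ[ℂ] L2 ν :=
    { toFun := fun f => (memLp_twConv hκ hm lam (Lp.memLp f)).toLp _
      map_add' := fun f g => by
        apply Lp.ext
        rw [ae_driftMeasure_eq]
        have hc := Lp.coeFn_add f g
        have hc2 := Lp.coeFn_add ((memLp_twConv hκ hm lam (Lp.memLp f)).toLp _)
          ((memLp_twConv hκ hm lam (Lp.memLp g)).toLp _)
        rw [ae_driftMeasure_eq] at hc hc2
        filter_upwards [hsp (f + g), hsp f, hsp g, hc2,
          ae_integrable_twConv hκ hm lam (Lp.memLp f),
          ae_integrable_twConv hκ hm lam (Lp.memLp g)] with z h1 h2 h3 h4 h5 h6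
        rw [h1, h4, Pi.add_apply, h2, h3, twConv_congr hc]
        unfold twConv
        rw [← integral_add h5 h6]
        simp only [Pi.add_apply, mul_add]
      map_smul' := fun c f => by
        apply Lp.ext
        rw [ae_driftMeasure_eq]
        have hc := Lp.coeFn_smul c f
        have hc2 := Lp.coeFn_smul c ((memLp_twConv hκ hm lam (Lp.memLp f)).toLp _)
        rw [ae_driftMeasure_eq] at hc hc2
        filter_upwards [hsp (c • f), hsp f, hc2] with z h1 h2 h4
        rw [h1, RingHom.id_apply, h4, Pi.smul_apply, h2, twConv_congr hc]
        unfold twConv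
        rw [← integral_smul]
        simp only [Pi.smul_apply, smul_eq_mul]
        congr 1; funext w; ring }
  refine ⟨T₀.mkContinuous (mass ν κ).toReal fun f => ?_, LinearMap.mkContinuous_norm_le _
    ENNReal.toReal_nonneg _, hsp⟩
  have h1 := lintegral_twConv_sq_le hκ lam (Lp.memLp f)
  have h2 : ∫⁻ z, ‖T₀ f z‖ₑ ^ 2 ∂(driftMeasure ν) =
      ∫⁻ z, ‖twConv lam κ f z‖ₑ ^ 2 ∂(driftMeasure ν) := by
    refine lintegral_congr_ae ?_
    filter_upwards [(ae_driftMeasure_iff ν).2 (hsp f)] with z hz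
    rw [← hz]; rfl
  rw [← h2, ← norm_sq_eq_lintegral, ← norm_sq_eq_lintegral, ← ENNReal.ofReal_toReal hm,
    ← ENNReal.ofReal_pow ENNReal.toReal_nonneg, ← ENNReal.ofReal_mul (by positivity),
    ENNReal.ofReal_le_ofReal_iff (by positivity), ← mul_pow] at h1
  exact le_of_sq_le_sq h1 (by positivity)

open Classical in
/-- The twisted convolution operator with a given kernel; zero for kernels of infinite mass. -/
def twOp : L2 ν →L[ℂ] L2 ν :=
  if h : Continuous κ ∧ mass ν κ ≠ ⊤ then (exists_twOp ν lam κ h.1 h.2).choose else 0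

variable {κ}

lemma norm_twOp_le (hκ : Continuous κ) (hm : mass ν κ ≠ ⊤) :
    ‖twOp ν lam κ‖ ≤ (mass ν κ).toReal := by
  rw [twOp, dif_pos ⟨hκ, hm⟩]; exact (exists_twOp ν lam κ hκ hm).choose_spec.1

lemma twOp_ae_eq (hκ : Continuous κ) (hm : mass ν κ ≠ ⊤) (f : L2 ν) :
    twOp ν lam κ f =ᵐ[volume] twConv lam κ f := by
  rw [twOp, dif_pos ⟨hκ, hm⟩]; exact (exists_twOp ν lam κ hκ hm).choose_spec.2 f

end Operator

lemma HasGaussianBounds.continuous {ν : Space n} {lam : ℝ} {κ : Space n → ℂ}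
    (h : HasGaussianBounds ν lam κ) : Continuous κ := h.1.continuous

lemma HasGaussianBounds.exists_norm_le {ν : Space n} {lam : ℝ} {κ : Space n → ℂ}
    (h : HasGaussianBounds ν lam κ) : ∃ C, 0 < C ∧ ∀ u, ‖κ u‖ * Real.exp (2 * ‖ν‖ * ‖u‖) ≤
      C * Real.exp (-(|lam| * ‖u‖ ^ 2 / 16)) := h.2 []

lemma HasGaussianBounds.exists_bound {ν : Space n} {lam : ℝ} {κ : Space n → ℂ}
    (h : HasGaussianBounds ν lam κ) : ∃ C, 0 < C ∧ ∀ u, ‖κ u‖ ≤ C := by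
  obtain ⟨C, hC, hb⟩ := h.exists_norm_le
  refine ⟨C, hC, fun u => ?_⟩
  have h1 : 1 ≤ Real.exp (2 * ‖ν‖ * ‖u‖) := Real.one_le_exp (by positivity)
  have h2 : Real.exp (-(|lam| * ‖u‖ ^ 2 / 16)) ≤ 1 :=
    Real.exp_le_one_iff.2 (by simp only [Left.neg_nonpos_iff]; positivity)
  calc ‖κ u‖ ≤ ‖κ u‖ * Real.exp (2 * ‖ν‖ * ‖u‖) := le_mul_of_one_le_right (norm_nonneg _) h1
    _ ≤ _ := hb u
    _ ≤ C * 1 := by gcongr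
    _ = C := mul_one C

lemma HasGaussianBounds.integrable_norm_mul_exp {ν : Space n} {lam : ℝ} {κ : Space n → ℂ}
    (h : HasGaussianBounds ν lam κ) (hl : lam ≠ 0) :
    Integrable fun u => ‖κ u‖ * Real.exp (2 * ‖ν‖ * ‖u‖) := by
  obtain ⟨C, hC, hb⟩ := h.exists_norm_le
  have hc := h.continuous
  have hl' := abs_pos.2 hl
  refine Integrable.mono' ((integrable_gaussian_space (b := |lam| / 16) (by positivity)).const_mul C)
    (Continuous.aestronglyMeasurable (by fun_prop)) (Eventually.of_forall fun u => ?_)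
  rw [Real.norm_of_nonneg (by positivity)]
  refine (hb u).trans_eq ?_
  congr 2; ring

lemma HasGaussianBounds.integrable {ν : Space n} {lam : ℝ} {κ : Space n → ℂ}
    (h : HasGaussianBounds ν lam κ) (hl : lam ≠ 0) : Integrable κ := by
  refine Integrable.mono' (h.integrable_norm_mul_exp hl) h.continuous.aestronglyMeasurable
    (Eventually.of_forall fun u => le_mul_of_one_le_right (norm_nonneg _)
      (Real.one_le_exp (by positivity)))

lemma HasGaussianBounds.mass_ne_top {ν : Space n} {lam : ℝ} {κ : Space n → ℂ}
    (h : HasGaussianBounds ν lam κ) (hl : lam ≠ 0) : mass ν κ ≠ ⊤ := by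
  have h1 := (h.integrable_norm_mul_exp hl).lintegral_lt_top
  refine (lt_of_le_of_lt (lintegral_mono fun u => ENNReal.ofReal_le_ofReal ?_) h1).ne
  refine mul_le_mul_of_nonneg_left (Real.exp_le_exp.2 ?_) (norm_nonneg _)
  have := real_inner_le_norm ν u
  have : 0 ≤ ‖ν‖ * ‖u‖ := by positivity
  linarith

end

section

variable {n : ℕ}

/-! ### Test functions -/

section Test

variable {φ ψ : Space n → ℂ}

lemma IsTestFunction.continuous (h : IsTestFunction φ) : Continuous φ := h.1.continuous

lemma IsTestFunction.memLp (h : IsTestFunction φ) (p : ℝ≥0∞) (μ : Measure (Space n))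
    [IsFiniteMeasureOnCompacts μ] : MemLp φ p μ :=
  h.continuous.memLp_of_hasCompactSupport h.2

lemma IsTestFunction.integrable (h : IsTestFunction φ) (μ : Measure (Space n))
    [IsFiniteMeasureOnCompacts μ] : Integrable φ μ :=
  h.continuous.integrable_of_hasCompactSupport h.2

lemma IsTestFunction.add (h : IsTestFunction φ) (h' : IsTestFunction ψ) :
    IsTestFunction (φ + ψ) := ⟨h.1.add h'.1, h.2.add h'.2⟩

lemma IsTestFunction.smul (c : ℂ) (h : IsTestFunction φ) : IsTestFunction (c • φ) :=
  ⟨contDiff_const.smul h.1, h.2.smul_left⟩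

lemma isTestFunction_zero : IsTestFunction (0 : Space n → ℂ) :=
  ⟨contDiff_const, HasCompactSupport.zero⟩

/-- The class of a test function. -/
def IsTestFunction.toL2 (h : IsTestFunction φ) (ν : Space n) : L2 ν :=
  (h.memLp 2 (driftMeasure ν)).toLp φ

lemma IsTestFunction.toL2_ae_eq (h : IsTestFunction φ) (ν : Space n) :
    h.toL2 ν =ᵐ[volume] φ := by
  have := (h.memLp 2 (driftMeasure ν)).coeFn_toLp
  rwa [ae_driftMeasure_eq] at this

end Test

lemma inner_eq_integral {ν : Space n} {x y : L2 ν} {f g : Space n → ℂ} (hx : x =ᵐ[volume] f)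
    (hy : y =ᵐ[volume] g) : inner ℂ x y = ∫ z, (dens ν z : ℂ) * (g z * conj (f z)) := by
  rw [L2.inner_def, integral_driftMeasure]
  refine integral_congr_ae ?_
  filter_upwards [hx, hy] with z h1 h2
  rw [h1, h2, RCLike.inner_apply]

/-- The space of classes of test functions. -/
def testSpace (ν : Space n) : Submodule ℂ (L2 ν) where
  carrier := {x | ∃ φ, ∃ h : IsTestFunction φ, h.toL2 ν = x}
  add_mem' := by
    rintro _ _ ⟨φ, h, rfl⟩ ⟨ψ, h', rfl⟩
    exact ⟨_, h.add h', rfl⟩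
  zero_mem' := ⟨_, isTestFunction_zero, rfl⟩
  smul_mem' := by
    rintro c _ ⟨φ, h, rfl⟩
    exact ⟨_, h.smul c, rfl⟩

/-- A vector orthogonal to all test functions is annihilated by integration against real smooth
functions of compact support, hence vanishes almost everywhere. -/
theorem dense_testSpace (ν : Space n) : Dense (testSpace ν : Set (L2 ν)) := by
  rw [Submodule.dense_iff_topologicalClosure_eq_top, Submodule.topologicalClosure_eq_top_iff,
    Submodule.eq_bot_iff]
  intro x hx
  rw [Submodule.mem_orthogonal] at hx
  have h1 : ∀ᵐ z ∂(driftMeasure ν), x z = 0 := by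
    refine ae_eq_zero_of_integral_contDiff_smul_eq_zero
      ((Lp.memLp x).locallyIntegrable one_le_two) fun g hg hgs => ?_
    have hφ : IsTestFunction fun z => (g z : ℂ) :=
      ⟨Complex.ofRealCLM.contDiff.comp hg, hgs.comp_left Complex.ofReal_zero⟩
    have h2 := hx _ ⟨_, hφ, rfl⟩
    rw [inner_eq_integral (hφ.toL2_ae_eq ν) (ae_eq_refl x)] at h2
    rw [integral_driftMeasure, ← h2]
    refine integral_congr_ae (Eventually.of_forall fun z => ?_)
    simp only [Complex.conj_ofReal, Complex.real_smul]
    ring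
  apply Lp.ext
  filter_upwards [h1, Lp.coeFn_zero ℂ 2 (driftMeasure ν)] with z h2 h3
  rw [h2, h3]; rfl

lemma ext_test {ν : Space n} {x y : L2 ν}
    (h : ∀ φ (hφ : IsTestFunction φ), inner ℂ (hφ.toL2 ν) x = inner ℂ (hφ.toL2 ν) y) : x = y := by
  refine (dense_testSpace ν).eq_of_inner_right ℂ ?_
  rintro _ ⟨φ, hφ, rfl⟩
  exact h φ hφ

lemma clm_ext_test {ν : Space n} {S T : L2 ν →L[ℂ] L2 ν}
    (h : ∀ φ (hφ : IsTestFunction φ), S (hφ.toL2 ν) = T (hφ.toL2 ν)) : S = T := by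
  refine ContinuousLinearMap.ext_on (s := (testSpace ν : Set (L2 ν))) ?_ ?_
  · rw [Submodule.span_eq]; exact dense_testSpace ν
  · rintro _ ⟨φ, hφ, rfl⟩
    exact h φ hφ

/-! ### Twisted convolution with test functions -/

lemma partialDeriv_twist (lam : ℝ) (i : Fin n ⊕ Fin n) (z w : Space n) :
    DifferentiableAt ℝ (fun z => twist lam z w) z ∧ partialDeriv i (fun z => twist lam z w) z =
      -(Complex.I * lam / 2 * (rot w i : ℂ)) * twist lam z w := by
  have h1 : HasFDerivAt (fun z : Space n => lam / 2 * inner ℝ w (rot z))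
      ((lam / 2) • ((innerSL ℝ w).comp rot)) z :=
    (((innerSL ℝ w).comp rot).hasFDerivAt (x := z)).const_mul (lam / 2)
  have h2 := ((Complex.ofRealCLM.hasFDerivAt.comp z h1).mul_const Complex.I).cexp
  have e : (fun z => twist lam z w) = fun z : Space n =>
      Complex.exp ((Complex.ofRealCLM ∘ fun z : Space n => lam / 2 * inner ℝ w (rot z)) z *
        Complex.I) := by
    funext z; simp only [twist, real_inner_comm w]; rfl
  rw [← e] at h2
  refine ⟨h2.differentiableAt, ?_⟩
  rw [partialDeriv, h2.fderiv]
  have h3 : inner ℝ w (rot (basisVec i)) = -rot w i := by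
    rw [real_inner_comm, inner_rot_basisVec]
  have h4 : Complex.exp ((Complex.ofRealCLM ∘ fun z : Space n => lam / 2 * inner ℝ w (rot z)) z *
      Complex.I) = twist lam z w := (congrFun e z).symm
  rw [h4]
  simp only [_root_.smul_apply, ContinuousLinearMap.comp_apply, innerSL_apply_apply, smul_eq_mul,
    Complex.ofRealCLM_apply]
  rw [h3]
  push_cast
  ring

lemma partialDeriv_comp_sub (i : Fin n ⊕ Fin n) (κ : Space n → ℂ) (z w : Space n) :
    partialDeriv i (fun z => κ (z - w)) z = partialDeriv i κ (z - w) := by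
  unfold partialDeriv
  simp only [sub_eq_add_neg, fderiv_comp_add_right]

/-- The derivative of the twist contributes `-(iλ/2)(rot w)_i`, which changes the coefficient `(rot
z)_i` of the field into `(rot (z - w))_i`. Hence the fields act on a twisted convolution through its
kernel alone. -/
lemma field_twKernel {κ : Space n → ℂ} (hκ : Differentiable ℝ κ) (lam : ℝ) (i : Fin n ⊕ Fin n)
    (w : Space n) (c : ℂ) (z : Space n) :
    field lam i (fun z => κ (z - w) * twist lam z w * c) z =
      field lam i κ (z - w) * twist lam z w * c := by
  obtain ⟨h1, h2⟩ := partialDeriv_twist lam i z w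
  have h3 : DifferentiableAt ℝ (fun z => κ (z - w)) z :=
    (hκ (z - w)).comp z (differentiableAt_id.sub_const w)
  rw [field_eq, field_eq, partialDeriv_mul i (h3.fun_mul h1) (differentiableAt_const c),
    partialDeriv_mul i h3 h1, h2, partialDeriv_const, partialDeriv_comp_sub]
  simp only [map_sub, PiLp.sub_apply, Complex.ofReal_sub]
  ring

lemma differentiable_twKernel {κ : Space n → ℂ} (hκ : Differentiable ℝ κ) (lam : ℝ)
    (w : Space n) (c : ℂ) :
    Differentiable ℝ (fun z => κ (z - w) * twist lam z w * c) := fun z => by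
  have h3 : DifferentiableAt ℝ (fun z => κ (z - w)) z :=
    (hκ (z - w)).comp z (differentiableAt_id.sub_const w)
  rcases isEmpty_or_nonempty (Fin n ⊕ Fin n) with he | ⟨⟨i⟩⟩
  · exact (hasFDerivAt_of_subsingleton _ z).differentiableAt
  · exact (h3.fun_mul (partialDeriv_twist lam i z w).1).mul_const c

section Smooth

variable {ν : Space n} {lam : ℝ} {κ f : Space n → ℂ}

lemma field_twConv (hκ : HasGaussianBounds ν lam κ) (hf : IsTestFunction f) :
    Differentiable ℝ (twConv lam κ f) ∧
      ∀ i, field lam i (twConv lam κ f) = twConv lam (field lam i κ) f := by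
  have hd : Differentiable ℝ κ := hκ.1.differentiable (by simp)
  obtain ⟨C, hC, hb⟩ := hκ.exists_bound
  choose C' hC' hb' using fun i => (hκ.monomial [i]).exists_bound
  have hm : ∀ κ' : Space n → ℂ, Continuous κ' → ∀ z, AEStronglyMeasurable
      (fun w => κ' (z - w) * twist lam z w * f w) volume := fun κ' hκ' z =>
    Continuous.aestronglyMeasurable (((hκ'.comp (continuous_const.sub continuous_id)).mul
      (continuous_twist_right lam z)).mul hf.continuous)
  have hnorm : ∀ (κ' : Space n → ℂ) (B : ℝ), (∀ u, ‖κ' u‖ ≤ B) → ∀ z w,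
      ‖κ' (z - w) * twist lam z w * f w‖ ≤ B * ‖f w‖ := fun κ' B hB z w => by
    rw [norm_mul, norm_mul, norm_twist, mul_one]
    exact mul_le_mul_of_nonneg_right (hB _) (norm_nonneg _)
  obtain ⟨h1, h2⟩ := field_integral (μ := (volume : Measure (Space n))) lam
    (F := fun w z => κ (z - w) * twist lam z w * f w)
    (fun w => differentiable_twKernel hd lam w (f w)) (fun z => hm κ hκ.continuous z)
    (fun i z => by
      simp only [field_twKernel hd]
      exact hm _ (contDiff_field hκ.1 lam i).continuous z)
    (fun R => ⟨fun w => (C + ∑ i, C' i) * ‖f w‖, (hf.integrable volume).norm.const_mul _,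
      Eventually.of_forall fun w z _ => by
        refine ⟨(hnorm κ C hb z w).trans (mul_le_mul_of_nonneg_right ?_ (norm_nonneg _)),
          fun i => ?_⟩
        · exact le_add_of_nonneg_right (Finset.sum_nonneg fun i _ => (hC' i).le)
        · rw [field_twKernel hd]
          refine (hnorm _ (C' i) (hb' i) z w).trans (mul_le_mul_of_nonneg_right ?_ (norm_nonneg _))
          have := Finset.single_le_sum (f := C') (fun i _ => (hC' i).le) (Finset.mem_univ i)
          linarith⟩)
  refine ⟨h1, fun i => funext fun z => ?_⟩
  have h3 := h2 i z
  simp only [field_twKernel hd] at h3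
  exact h3

lemma monomial_twConv (hκ : HasGaussianBounds ν lam κ) (hf : IsTestFunction f)
    (w : List (Fin n ⊕ Fin n)) :
    monomial lam w (twConv lam κ f) = twConv lam (monomial lam w κ) f := by
  induction w with
  | nil => rfl
  | cons i w ih =>
    change field lam i (monomial lam w (twConv lam κ f)) = _
    rw [ih, (field_twConv (hκ.monomial w) hf).2 i]
    rfl

lemma contDiff_twConv (hκ : HasGaussianBounds ν lam κ) (hf : IsTestFunction f) :
    ContDiff ℝ ∞ (twConv lam κ f) := by
  refine contDiff_of_field_mem lam (range fun w => twConv lam (monomial lam w κ) f) ?_ ?_ _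
    ⟨[], rfl⟩
  · rintro _ ⟨w, rfl⟩; exact (field_twConv (hκ.monomial w) hf).1
  · rintro _ ⟨w, rfl⟩ i; exact ⟨i :: w, ((field_twConv (hκ.monomial w) hf).2 i).symm⟩

end Smooth

/-! ### The space of smooth functions with square integrable derivatives -/

lemma monomial_add (lam : ℝ) (w : List (Fin n ⊕ Fin n)) {F G : Space n → ℂ} (hF : ContDiff ℝ ∞ F)
    (hG : ContDiff ℝ ∞ G) : monomial lam w (F + G) = monomial lam w F + monomial lam w G := by
  induction w with
  | nil => rfl
  | cons i w ih =>
    change field lam i (monomial lam w (F + G)) = field lam i _ + field lam i _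
    rw [ih]
    funext z
    exact field_add lam i ((contDiff_monomial hF lam w).differentiable (by simp) z)
      ((contDiff_monomial hG lam w).differentiable (by simp) z)

lemma monomial_smul (lam : ℝ) (w : List (Fin n ⊕ Fin n)) (c : ℂ) {F : Space n → ℂ}
    (hF : ContDiff ℝ ∞ F) : monomial lam w (c • F) = c • monomial lam w F := by
  induction w with
  | nil => rfl
  | cons i w ih =>
    change field lam i (monomial lam w (c • F)) = c • field lam i _
    rw [ih]
    funext z
    exact field_const_mul lam i c ((contDiff_monomial hF lam w).differentiable (by simp) z)

/-- The smooth functions all of whose derivatives along the fields are square integrable. -/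
def sobolev (ν : Space n) (lam : ℝ) : Submodule ℂ (Space n → ℂ) where
  carrier := {u | ContDiff ℝ ∞ u ∧ ∀ w, MemLp (monomial lam w u) 2 (driftMeasure ν)}
  add_mem' := by
    rintro u v ⟨hu, hu'⟩ ⟨hv, hv'⟩
    refine ⟨hu.add hv, fun w => ?_⟩
    rw [monomial_add lam w hu hv]
    exact (hu' w).add (hv' w)
  zero_mem' := by
    refine ⟨contDiff_const, fun w => ?_⟩
    have h := monomial_smul lam w 0 (contDiff_const (c := (0 : ℂ)) (E := Space n) (𝕜 := ℝ) (n := ∞))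
    simp only [zero_smul] at h
    rw [h]
    exact MemLp.zero
  smul_mem' := by
    rintro c u ⟨hu, hu'⟩
    refine ⟨contDiff_const.smul hu, fun w => ?_⟩
    rw [monomial_smul lam w c hu]
    exact (hu' w).const_smul c

section Sobolev

variable {ν : Space n} {lam : ℝ}

lemma field_mem_sobolev {u : Space n → ℂ} (hu : u ∈ sobolev ν lam) (i : Fin n ⊕ Fin n) :
    field lam i u ∈ sobolev ν lam :=
  ⟨contDiff_field hu.1 lam i, fun w => by
    have := hu.2 (w ++ [i])
    rwa [monomial_append] at this⟩

lemma monomial_mem_sobolev {u : Space n → ℂ} (hu : u ∈ sobolev ν lam) (w : List (Fin n ⊕ Fin n)) :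
    monomial lam w u ∈ sobolev ν lam := by
  induction w with
  | nil => exact hu
  | cons i w ih => exact field_mem_sobolev ih i

lemma IsTestFunction.mem_sobolev {φ : Space n → ℂ} (h : IsTestFunction φ) : φ ∈ sobolev ν lam :=
  ⟨h.1, fun w => (h.monomial lam w).memLp 2 _⟩

lemma twConv_mem_sobolev {κ f : Space n → ℂ} (hl : lam ≠ 0) (hκ : HasGaussianBounds ν lam κ)
    (hf : IsTestFunction f) : twConv lam κ f ∈ sobolev ν lam := by
  refine ⟨contDiff_twConv hκ hf, fun w => ?_⟩
  rw [monomial_twConv hκ hf]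
  exact memLp_twConv (hκ.monomial w).continuous ((hκ.monomial w).mass_ne_top hl) lam
    (hf.memLp 2 _)

variable (ν lam)

/-- The inclusion into the Hilbert space. -/
def sobolevEmb : sobolev ν lam →ₗ[ℂ] L2 ν where
  toFun u := (u.2.2 []).toLp _
  map_add' _ _ := rfl
  map_smul' _ _ := rfl

/-- The fields `X_i + ν_i`, which are skew-symmetric on the weighted space. -/
def skewField (i : Fin n ⊕ Fin n) : Module.End ℂ (sobolev ν lam) where
  toFun u := ⟨field lam i u, field_mem_sobolev u.2 i⟩ + (ν i : ℂ) • u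
  map_add' u v := by
    ext z
    have := field_add lam i (u.2.1.differentiable (by simp) z) (v.2.1.differentiable (by simp) z)
    simp only [Submodule.coe_add, Submodule.coe_smul, Pi.add_apply, Pi.smul_apply, smul_eq_mul]
    change field lam i (fun z => (u : Space n → ℂ) z + (v : Space n → ℂ) z) z + _ = _
    rw [this]; ring
  map_smul' c u := by
    ext z
    have := field_const_mul lam i c (u.2.1.differentiable (by simp) z)
    simp only [Submodule.coe_add, Submodule.coe_smul, Pi.add_apply, Pi.smul_apply, smul_eq_mul,
      RingHom.id_apply]
    change field lam i (fun z => c * (u : Space n → ℂ) z) z + _ = _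
    rw [this]; ring

variable {ν lam}

lemma sobolevEmb_ae_eq (u : sobolev ν lam) : sobolevEmb ν lam u =ᵐ[volume] (u : Space n → ℂ) := by
  have := (u.2.2 []).coeFn_toLp
  rwa [ae_driftMeasure_eq] at this

lemma skewField_apply (i : Fin n ⊕ Fin n) (u : sobolev ν lam) (z : Space n) :
    (skewField ν lam i u : Space n → ℂ) z = field lam i u z + ν i * (u : Space n → ℂ) z := rfl

lemma integrable_dens_mul_conj {u v : Space n → ℂ} (hu : MemLp u 2 (driftMeasure ν))
    (hv : MemLp v 2 (driftMeasure ν)) :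
    Integrable fun z => (dens ν z : ℂ) * (v z * conj (u z)) := by
  rw [← integrable_driftMeasure_iff]
  have h := hv.integrable_mul (q := 2) (MemLp.star hu)
  exact h

lemma partialDeriv_dens (ν : Space n) (i : Fin n ⊕ Fin n) (z : Space n) :
    DifferentiableAt ℝ (fun z => (dens ν z : ℂ)) z ∧
      partialDeriv i (fun z => (dens ν z : ℂ)) z = 2 * ν i * dens ν z := by
  have h1 : HasFDerivAt (fun z : Space n => 2 * inner ℝ ν z) ((2 : ℝ) • innerSL ℝ ν) z :=
    ((innerSL ℝ ν).hasFDerivAt (x := z)).const_mul 2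
  have h2 := Complex.ofRealCLM.hasFDerivAt.comp z h1.exp
  have h2 : HasFDerivAt (fun z => (dens ν z : ℂ)) _ z := h2
  refine ⟨h2.differentiableAt, ?_⟩
  rw [partialDeriv, h2.fderiv]
  have h3 : inner ℝ ν (basisVec i) = ν i := inner_basisVec ν i
  simp only [_root_.smul_apply, ContinuousLinearMap.comp_apply, innerSL_apply_apply, smul_eq_mul,
    Complex.ofRealCLM_apply]
  rw [h3, dens]
  push_cast
  ring

/-- Integration by parts against `dens · v`: the derivative of the density produces `2 ν_i`, and the
shift by `ν_i` divides it equally between the two sides. -/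
lemma inner_skewField (i : Fin n ⊕ Fin n) (u v : sobolev ν lam) :
    inner ℂ (sobolevEmb ν lam (skewField ν lam i u)) (sobolevEmb ν lam v) =
      -inner ℂ (sobolevEmb ν lam u) (sobolevEmb ν lam (skewField ν lam i v)) := by
  rw [inner_eq_integral (sobolevEmb_ae_eq _) (sobolevEmb_ae_eq _),
    inner_eq_integral (sobolevEmb_ae_eq _) (sobolevEmb_ae_eq _)]
  simp only [skewField_apply]
  have hud : Differentiable ℝ (u : Space n → ℂ) := u.2.1.differentiable (by simp)
  have hvd : Differentiable ℝ (v : Space n → ℂ) := v.2.1.differentiable (by simp)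
  have hdd : Differentiable ℝ fun z => (dens ν z : ℂ) := fun z => (partialDeriv_dens ν i z).1
  have hu : MemLp (u : Space n → ℂ) 2 (driftMeasure ν) := u.2.2 []
  have hv : MemLp (v : Space n → ℂ) 2 (driftMeasure ν) := v.2.2 []
  have hu' := u.2.2 [i]
  have hv' := v.2.2 [i]
  have e1 : ∀ z, field lam i (fun z => (dens ν z : ℂ) * (v : Space n → ℂ) z) z =
      dens ν z * (2 * ν i * (v : Space n → ℂ) z + field lam i v z) := fun z => by
    rw [field_mul_left lam i (hdd z) (hvd z), (partialDeriv_dens ν i z).2]; ring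
  have i1 := integrable_dens_mul_conj hu hv
  have i2 : Integrable fun z => (dens ν z : ℂ) * (field lam i v z * conj ((u : Space n → ℂ) z)) :=
    integrable_dens_mul_conj hu hv'
  have i3 : Integrable fun z => (dens ν z : ℂ) * ((v : Space n → ℂ) z * conj (field lam i u z)) :=
    integrable_dens_mul_conj hu' hv
  have key := integral_field_mul_conj lam i (hdd.fun_mul hvd) hud
    (by
      simp only [e1]
      refine ((i1.const_mul (2 * ν i : ℂ)).add i2).congr (Eventually.of_forall fun z => ?_)
      simp only [Pi.add_apply]; ring)
    (by
      refine i3.congr (Eventually.of_forall fun z => ?_)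
      simp only; ring)
    (by
      refine i1.congr (Eventually.of_forall fun z => ?_)
      simp only; ring)
  simp only [e1] at key
  have e2 : ∫ z, (dens ν z : ℂ) * (2 * ν i * (v : Space n → ℂ) z + field lam i v z) *
      conj ((u : Space n → ℂ) z) = (∫ z, (dens ν z : ℂ) *
        ((field lam i v z + ν i * (v : Space n → ℂ) z) * conj ((u : Space n → ℂ) z))) +
        ν i * ∫ z, (dens ν z : ℂ) * ((v : Space n → ℂ) z * conj ((u : Space n → ℂ) z)) := by
    rw [← integral_const_mul, ← integral_add _ (i1.const_mul _)]
    · congr 1; funext z; ring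
    · refine (i2.add (i1.const_mul (ν i : ℂ))).congr (Eventually.of_forall fun z => ?_)
      simp only [Pi.add_apply]; ring
  have e3 : ∫ z, (dens ν z : ℂ) * ((v : Space n → ℂ) z * conj (field lam i u z +
      ν i * (u : Space n → ℂ) z)) = (∫ z, (dens ν z : ℂ) * (v : Space n → ℂ) z *
        conj (field lam i u z)) +
        ν i * ∫ z, (dens ν z : ℂ) * ((v : Space n → ℂ) z * conj ((u : Space n → ℂ) z)) := by
    rw [← integral_const_mul, ← integral_add _ (i1.const_mul _)]
    · congr 1; funext z
      simp only [map_add, map_mul, Complex.conj_ofReal]; ring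
    · refine i3.congr (Eventually.of_forall fun z => ?_)
      simp only; ring
  rw [e2] at key
  rw [e3]
  linear_combination key

lemma skewField_comm (i j : Fin n ⊕ Fin n) :
    skewField ν lam i * skewField ν lam j - skewField ν lam j * skewField ν lam i =
      (Complex.I * lam * (rot (basisVec i) j : ℂ)) • (1 : Module.End ℂ (sobolev ν lam)) := by
  ext u z
  have key := field_comm u.2.1 lam i j z
  have hd : ∀ z, DifferentiableAt ℝ (u : Space n → ℂ) z := fun z =>
    u.2.1.differentiable (by simp) z
  have hfd : ∀ i z, DifferentiableAt ℝ (field lam i (u : Space n → ℂ)) z := fun i z =>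
    (contDiff_field u.2.1 lam i).differentiable (by simp) z
  have e : ∀ i j, field lam i (skewField ν lam j u) z = field lam i (field lam j u) z +
      ν j * field lam i u z := fun i j => by
    change field lam i (fun z => field lam j u z + ν j * (u : Space n → ℂ) z) z = _
    rw [field_add lam i (hfd j z) ((hd z).const_mul _), field_const_mul lam i _ (hd z)]
  simp only [LinearMap.sub_apply, Module.End.mul_apply, LinearMap.smul_apply, Module.End.one_apply,
    Submodule.coe_sub, Submodule.coe_smul, Pi.sub_apply, Pi.smul_apply, smul_eq_mul, skewField_apply,
    e]
  linear_combination key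

theorem isSkewSystem_skewField : IsSkewSystem (sobolevEmb ν lam) (skewField ν lam) lam where
  skew := inner_skewField
  comm_inl j k := by
    have h := skewField_comm (ν := ν) (lam := lam) (Sum.inl j) (Sum.inl k)
    have h0 : rot (basisVec (Sum.inl j)) (Sum.inl k) = 0 := by simp [basisVec]
    rw [h0, Complex.ofReal_zero, mul_zero, zero_smul] at h
    exact sub_eq_zero.1 h
  comm_inr j k := by
    have h := skewField_comm (ν := ν) (lam := lam) (Sum.inr j) (Sum.inr k)
    have h0 : rot (basisVec (Sum.inr j)) (Sum.inr k) = 0 := by simp [basisVec]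
    rw [h0, Complex.ofReal_zero, mul_zero, zero_smul] at h
    exact sub_eq_zero.1 h
  comm_ne j k hjk := by
    have h := skewField_comm (ν := ν) (lam := lam) (Sum.inl j) (Sum.inr k)
    have h0 : rot (basisVec (Sum.inl j)) (Sum.inr k) = 0 := by
      simp [basisVec, hjk.symm]
    rw [h0, Complex.ofReal_zero, mul_zero, zero_smul] at h
    exact sub_eq_zero.1 h
  comm_self j := by
    rw [skewField_comm]
    congr 1
    simp [basisVec]

/-- Completion of the square, `∑ (X_i + ν_i)² = L + |ν|²`; it makes the abstract energy estimates
available for `-L`. -/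
lemma hamiltonian_skewField_apply (u : sobolev ν lam) (z : Space n) :
    (hamiltonian (skewField ν lam) (‖ν‖ ^ 2) u : Space n → ℂ) z = -driftLaplacian ν lam u z := by
  have hd : ∀ z, DifferentiableAt ℝ (u : Space n → ℂ) z := fun z =>
    u.2.1.differentiable (by simp) z
  have hfd : ∀ i z, DifferentiableAt ℝ (field lam i (u : Space n → ℂ)) z := fun i z =>
    (contDiff_field u.2.1 lam i).differentiable (by simp) z
  have e : ∀ i, (skewField ν lam i (skewField ν lam i u) : Space n → ℂ) z =
      field lam i (field lam i u) z + 2 * (ν i * field lam i u z) +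
        ((ν i * ν i : ℝ) : ℂ) * (u : Space n → ℂ) z := fun i => by
    rw [skewField_apply]
    change field lam i (fun z => field lam i u z + ν i * (u : Space n → ℂ) z) z + _ = _
    rw [field_add lam i (hfd i z) ((hd z).const_mul _), field_const_mul lam i _ (hd z),
      skewField_apply]
    push_cast; ring
  have s : ∑ i, ν i * ν i = ‖ν‖ ^ 2 := by rw [← inner_eq_sum, real_inner_self_eq_norm_sq]
  unfold hamiltonian driftLaplacian
  simp only [LinearMap.add_apply, LinearMap.neg_apply, LinearMap.sum_apply, Module.End.mul_apply,
    LinearMap.smul_apply, Module.End.one_apply, Submodule.coe_add, Submodule.coe_neg,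
    Submodule.coe_sum, Submodule.coe_smul, Pi.add_apply, Pi.neg_apply, Finset.sum_apply,
    Pi.smul_apply, smul_eq_mul, e]
  rw [Finset.sum_add_distrib, Finset.sum_add_distrib, ← Finset.mul_sum, ← Finset.sum_mul,
    ← Complex.ofReal_sum, s]
  ring

end Sobolev

end

section

variable {n : ℕ}

/-! ### Matrix elements of twisted convolution operators -/

/-- The density of the matrix element between two test functions. -/
def pairing (ν : Space n) (lam : ℝ) (φ ψ : Space n → ℂ) (p : Space n × Space n) : ℂ :=
  dens ν p.1 * twist lam p.1 p.2 * ψ p.2 * conj (φ p.1)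

section Pairing

variable {ν : Space n} {lam : ℝ} {φ ψ : Space n → ℂ}

lemma continuous_pairing (hφ : IsTestFunction φ) (hψ : IsTestFunction ψ) :
    Continuous (pairing ν lam φ ψ) := by
  have h1 := hφ.continuous
  have h2 := hψ.continuous
  have h3 := continuous_dens ν
  have h4 := continuous_twist (n := n) lam
  unfold pairing
  exact (((Complex.continuous_ofReal.comp (h3.comp continuous_fst)).mul h4).mul
    (h2.comp continuous_snd)).mul (Complex.continuous_conj.comp (h1.comp continuous_fst))

lemma hasCompactSupport_pairing (hφ : IsTestFunction φ) (hψ : IsTestFunction ψ) :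
    HasCompactSupport (pairing ν lam φ ψ) := by
  refine HasCompactSupport.intro (hφ.2.isCompact.prod hψ.2.isCompact) fun p hp => ?_
  rw [mem_prod, not_and_or] at hp
  unfold pairing
  rcases hp with h | h
  · rw [image_eq_zero_of_notMem_tsupport h]; simp
  · rw [image_eq_zero_of_notMem_tsupport h]; simp

lemma integrable_mul_pairing (hφ : IsTestFunction φ) (hψ : IsTestFunction ψ) {κ : Space n → ℂ}
    (hκ : Continuous κ) :
    Integrable (fun p : Space n × Space n => κ (p.1 - p.2) * pairing ν lam φ ψ p)
      (volume.prod volume) := by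
  refine Continuous.integrable_of_hasCompactSupport
    ((hκ.comp (continuous_fst.sub continuous_snd)).mul (continuous_pairing hφ hψ)) ?_
  exact (hasCompactSupport_pairing hφ hψ).mul_left

lemma inner_twOp {κ : Space n → ℂ} (hκ : Continuous κ) (hm : mass ν κ ≠ ⊤)
    (hφ : IsTestFunction φ) (hψ : IsTestFunction ψ) :
    inner ℂ (hφ.toL2 ν) (twOp ν lam κ (hψ.toL2 ν)) =
      ∫ p : Space n × Space n, κ (p.1 - p.2) * pairing ν lam φ ψ p ∂(volume.prod volume) := by
  rw [inner_eq_integral (hφ.toL2_ae_eq ν) (twOp_ae_eq ν lam hκ hm _),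
    integral_prod _ (integrable_mul_pairing hφ hψ hκ), twConv_congr (hψ.toL2_ae_eq ν)]
  refine integral_congr_ae (Eventually.of_forall fun z => ?_)
  simp only [twConv, pairing]
  rw [← integral_mul_const, ← integral_const_mul]
  congr 1; funext w; ring

end Pairing

/-! ### The heat semigroup -/

/-- The operators of the heat semigroup. -/
def heatOp (ν : Space n) (lam t : ℝ) : L2 ν →L[ℂ] L2 ν := twOp ν lam (heatKernel ν lam t)

section HeatOp

variable (ν : Space n) {lam : ℝ}

lemma continuous_heatKernel (lam t : ℝ) : Continuous (heatKernel ν lam t) :=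
  (contDiff_heatKernel ν lam t).continuous

lemma mass_heatKernel_ne_top (hl : lam ≠ 0) {t : ℝ} (ht : 0 < t) :
    mass ν (heatKernel ν lam t) ≠ ⊤ :=
  ((lintegral_heatKernel_le ν hl ht).trans_lt ENNReal.ofReal_lt_top).ne

lemma norm_heatOp_le (hl : lam ≠ 0) {t : ℝ} (ht : 0 < t) :
    ‖heatOp ν lam t‖ ≤ Real.exp (-‖ν‖ ^ 2 * t) := by
  refine (norm_twOp_le ν lam (continuous_heatKernel ν lam t)
    (mass_heatKernel_ne_top ν hl ht)).trans ?_
  refine ENNReal.toReal_le_of_le_ofReal (Real.exp_nonneg _) ?_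
  rw [neg_mul]
  exact lintegral_heatKernel_le ν hl ht

/-- Detailed balance: the factor `e^{-ν·u}` of the kernel compensates the density. With `twist_swap`
this gives self-adjointness on the weighted space. -/
lemma heatKernel_neg (lam t : ℝ) (z w : Space n) :
    (dens ν z : ℂ) * heatKernel ν lam t (z - w) = dens ν w * heatKernel ν lam t (w - z) := by
  unfold dens heatKernel heatExp
  rw [← Complex.ofReal_mul, ← Complex.ofReal_mul, norm_sub_rev w z, inner_sub_right,
    inner_sub_right, mul_left_comm, mul_left_comm (Real.exp (2 * inner ℝ ν w)), ← Real.exp_add,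
    ← Real.exp_add]
  congr 3; ring

lemma conj_heatKernel (lam t : ℝ) (u : Space n) :
    conj (heatKernel ν lam t u) = heatKernel ν lam t u := Complex.conj_ofReal _

lemma adjoint_heatOp (hl : lam ≠ 0) {t : ℝ} (ht : 0 < t) :
    ContinuousLinearMap.adjoint (heatOp ν lam t) = heatOp ν lam t := by
  refine clm_ext_test fun ψ hψ => ext_test fun φ hφ => ?_
  have hc := continuous_heatKernel ν lam t
  have hm := mass_heatKernel_ne_top ν hl ht
  rw [ContinuousLinearMap.adjoint_inner_right, ← inner_conj_symm]
  unfold heatOp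
  rw [inner_twOp hc hm hψ hφ, inner_twOp hc hm hφ hψ, ← integral_conj, ← integral_prod_swap]
  refine integral_congr_ae (Eventually.of_forall fun p => ?_)
  simp only [Prod.fst_swap, Prod.snd_swap, pairing, map_mul, Complex.conj_conj, conj_heatKernel,
    Complex.conj_ofReal]
  rw [← twist_swap]
  linear_combination (-twist lam p.1 p.2 * ψ p.2 * conj (φ p.1)) * heatKernel_neg ν lam t p.1 p.2

lemma inner_heatOp (hl : lam ≠ 0) {t : ℝ} (ht : 0 < t) (x y : L2 ν) :
    inner ℂ (heatOp ν lam t x) y = inner ℂ x (heatOp ν lam t y) := by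
  rw [← ContinuousLinearMap.adjoint_inner_right, adjoint_heatOp ν hl ht]

lemma twConv_twConv_heatKernel (hn : 1 ≤ n) (hl : lam ≠ 0) {s t : ℝ} (hs : 0 < s) (ht : 0 < t)
    {f : Space n → ℂ} (hf : IsTestFunction f) :
    twConv lam (heatKernel ν lam s) (twConv lam (heatKernel ν lam t) f) =
      twConv lam (heatKernel ν lam (s + t)) f := by
  funext z
  obtain ⟨C, hC, hb⟩ := (hasGaussianBounds_heatKernel hn ν hl ht).exists_bound
  have hi := (hasGaussianBounds_heatKernel hn ν hl hs).integrable hl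
  have hi' : Integrable fun w => heatKernel ν lam s (z - w) := hi.comp_sub_left z
  have hcs := continuous_heatKernel ν lam s
  have hct := continuous_heatKernel ν lam t
  have hint : Integrable (Function.uncurry fun w v => heatKernel ν lam s (z - w) * twist lam z w *
      (heatKernel ν lam t (w - v) * twist lam w v * f v)) (volume.prod volume) := by
    refine Integrable.mono' ((hi'.norm.mul_prod ((hf.integrable volume).norm)).const_mul C) ?_
      (Eventually.of_forall fun p => ?_)
    · refine Continuous.aestronglyMeasurable ?_
      exact ((hcs.comp (continuous_const.sub continuous_fst)).mul
        ((continuous_twist_right lam z).comp continuous_fst)).mul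
        (((hct.comp (continuous_fst.sub continuous_snd)).mul (continuous_twist lam)).mul
          (hf.continuous.comp continuous_snd))
    · simp only [Function.uncurry]
      rw [norm_mul, norm_mul, norm_mul, norm_mul, norm_twist, norm_twist, mul_one, mul_one]
      have := mul_le_mul_of_nonneg_right (hb (p.1 - p.2))
        (mul_nonneg (norm_nonneg (heatKernel ν lam s (z - p.1))) (norm_nonneg (f p.2)))
      linarith
  unfold twConv
  calc ∫ w, heatKernel ν lam s (z - w) * twist lam z w *
        ∫ v, heatKernel ν lam t (w - v) * twist lam w v * f v
      = ∫ w, ∫ v, heatKernel ν lam s (z - w) * twist lam z w *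
          (heatKernel ν lam t (w - v) * twist lam w v * f v) := by
        simp only [integral_const_mul]
    _ = ∫ v, ∫ w, heatKernel ν lam s (z - w) * twist lam z w *
          (heatKernel ν lam t (w - v) * twist lam w v * f v) := integral_integral_swap hint
    _ = _ := by
        refine integral_congr_ae (Eventually.of_forall fun v => ?_)
        simp only
        rw [← integral_heatKernel_twist ν hl ht hs z v, ← integral_mul_const]
        congr 1; funext w; ring

lemma heatOp_toL2 (hl : lam ≠ 0) {t : ℝ} (ht : 0 < t) {f : Space n → ℂ} (hf : IsTestFunction f) :
    heatOp ν lam t (hf.toL2 ν) =ᵐ[volume] twConv lam (heatKernel ν lam t) f := by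
  rw [← twConv_congr (hf.toL2_ae_eq ν)]
  exact twOp_ae_eq ν lam (continuous_heatKernel ν lam t) (mass_heatKernel_ne_top ν hl ht) _

lemma heatOp_add (hn : 1 ≤ n) (hl : lam ≠ 0) {s t : ℝ} (hs : 0 < s) (ht : 0 < t) :
    heatOp ν lam (s + t) = heatOp ν lam s * heatOp ν lam t := by
  refine clm_ext_test fun f hf => Lp.ext ?_
  rw [ae_driftMeasure_eq, mul_apply_eq_comp]
  refine (heatOp_toL2 ν hl (add_pos hs ht) hf).trans ?_
  refine EventuallyEq.symm ((twOp_ae_eq ν lam (continuous_heatKernel ν lam s)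
    (mass_heatKernel_ne_top ν hl hs) _).trans ?_)
  rw [twConv_congr (heatOp_toL2 ν hl ht hf), twConv_twConv_heatKernel ν hn hl hs ht hf]

lemma tendsto_twConv_heatKernel (hl : lam ≠ 0) {f : Space n → ℂ} (hf : IsTestFunction f)
    (z : Space n) :
    Tendsto (fun t => twConv lam (heatKernel ν lam t) f z) (𝓝[>] 0) (𝓝 (f z)) := by
  obtain ⟨C, hC⟩ := hf.2.exists_bound_of_continuous hf.continuous
  have h := tendsto_integral_heatKernel_mul ν hl (F := fun u => twist lam z (z - u) * f (z - u))
    (((continuous_twist_right lam z).comp (continuous_const.sub continuous_id)).mul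
      (hf.continuous.comp (continuous_const.sub continuous_id))) (C := C) (fun u => by
      rw [norm_mul, norm_twist, one_mul]; exact hC _)
  simp only [sub_zero, twist_self, one_mul] at h
  refine h.congr fun t => ?_
  unfold twConv
  rw [← integral_sub_left_eq_self (fun w => heatKernel ν lam t (z - w) * twist lam z w * f w) volume z]
  simp only [sub_sub_cancel, mul_assoc]

/-- The weighted supremum norm does not increase because the weighted mass of the kernel is at most
one. Being uniform in `t`, the bound provides the domination for the limit of matrix elements. -/
lemma norm_twConv_heatKernel_le (hl : lam ≠ 0) {f : Space n → ℂ} {B : ℝ}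
    (hB : ∀ w, Real.exp (inner ℝ ν w) * ‖f w‖ ≤ B) {t : ℝ} (ht : 0 < t) (z : Space n) :
    Real.exp (inner ℝ ν z) * ‖twConv lam (heatKernel ν lam t) f z‖ ≤ B := by
  have hB0 : 0 ≤ B := le_trans (by positivity) (hB 0)
  have hA := heatA_pos hl ht
  have hi : Integrable fun u => ‖heatKernel ν lam t u‖ * Real.exp (inner ℝ ν u) := by
    simp only [norm_heatKernel_mul_exp ν hl ht]
    exact (integrable_gaussian_space hA).const_mul _
  have hmass : ∫ u, ‖heatKernel ν lam t u‖ * Real.exp (inner ℝ ν u) ≤ 1 := by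
    rw [integral_eq_lintegral_of_nonneg_ae (Eventually.of_forall fun u => by positivity)
      hi.aestronglyMeasurable]
    refine ENNReal.toReal_le_of_le_ofReal zero_le_one
      ((lintegral_heatKernel_le ν hl ht).trans (ENNReal.ofReal_le_ofReal ?_))
    exact Real.exp_le_one_iff.2 (by simp only [Left.neg_nonpos_iff]; positivity)
  have hE := Real.exp_pos (inner ℝ ν z)
  have h1 : ‖twConv lam (heatKernel ν lam t) f z‖ ≤ ∫ w, (Real.exp (inner ℝ ν z))⁻¹ * B *
      (‖heatKernel ν lam t (z - w)‖ * Real.exp (inner ℝ ν (z - w))) := by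
    refine norm_integral_le_of_norm_le ((hi.comp_sub_left z).const_mul _)
      (Eventually.of_forall fun w => ?_)
    rw [norm_mul, norm_mul, norm_twist, mul_one]
    have hE2 : Real.exp (inner ℝ ν (z - w)) =
        Real.exp (inner ℝ ν z) * (Real.exp (inner ℝ ν w))⁻¹ := by
      rw [← Real.exp_neg, ← Real.exp_add, inner_sub_right, sub_eq_add_neg]
    have hEw := Real.exp_pos (inner ℝ ν w)
    rw [hE2]
    have h2 : ‖f w‖ ≤ B * (Real.exp (inner ℝ ν w))⁻¹ := by
      rw [← div_eq_mul_inv, le_div_iff₀ hEw, mul_comm]; exact hB w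
    calc ‖heatKernel ν lam t (z - w)‖ * ‖f w‖
        ≤ ‖heatKernel ν lam t (z - w)‖ * (B * (Real.exp (inner ℝ ν w))⁻¹) := by gcongr
      _ = _ := by field_simp
  rw [integral_const_mul, integral_sub_left_eq_self
    (fun u => ‖heatKernel ν lam t u‖ * Real.exp (inner ℝ ν u)) volume z] at h1
  calc Real.exp (inner ℝ ν z) * ‖twConv lam (heatKernel ν lam t) f z‖
      ≤ Real.exp (inner ℝ ν z) * ((Real.exp (inner ℝ ν z))⁻¹ * B * 1) := by
        refine mul_le_mul_of_nonneg_left (h1.trans ?_) hE.le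
        exact mul_le_mul_of_nonneg_left hmass (by positivity)
    _ = B := by field_simp

lemma tendsto_inner_heatOp (hn : 1 ≤ n) (hl : lam ≠ 0) {f : Space n → ℂ} (hf : IsTestFunction f) :
    Tendsto (fun t => inner ℂ (hf.toL2 ν) (heatOp ν lam t (hf.toL2 ν))) (𝓝[>] 0)
      (𝓝 (inner ℂ (hf.toL2 ν) (hf.toL2 ν))) := by
  have hEc : Continuous fun w : Space n => Real.exp (inner ℝ ν w) := by fun_prop
  obtain ⟨B, hB⟩ : ∃ B, ∀ w, Real.exp (inner ℝ ν w) * ‖f w‖ ≤ B := by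
    obtain ⟨B, hB⟩ := (hf.2.norm.mul_left (f := fun w => Real.exp (inner ℝ ν w))
      ).exists_bound_of_continuous (hEc.mul hf.continuous.norm)
    exact ⟨B, fun w => (le_abs_self _).trans (hB w)⟩
  have hev : (fun t => ∫ z, (dens ν z : ℂ) * (twConv lam (heatKernel ν lam t) f z * conj (f z)))
      =ᶠ[𝓝[>] 0] fun t => inner ℂ (hf.toL2 ν) (heatOp ν lam t (hf.toL2 ν)) := by
    filter_upwards [self_mem_nhdsWithin] with t ht
    rw [inner_eq_integral (hf.toL2_ae_eq ν) (heatOp_toL2 ν hl ht hf)]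
  refine Tendsto.congr' hev ?_
  rw [inner_eq_integral (hf.toL2_ae_eq ν) (hf.toL2_ae_eq ν)]
  refine tendsto_integral_filter_of_dominated_convergence
    (fun z => B * (Real.exp (inner ℝ ν z) * ‖f z‖)) ?_ ?_ ?_ ?_
  · filter_upwards [self_mem_nhdsWithin] with t ht
    refine Continuous.aestronglyMeasurable ?_
    exact (Complex.continuous_ofReal.comp (continuous_dens ν)).mul
      ((contDiff_twConv (hasGaussianBounds_heatKernel hn ν hl ht) hf).continuous.mul
        (Complex.continuous_conj.comp hf.continuous))
  · filter_upwards [self_mem_nhdsWithin] with t ht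
    refine Eventually.of_forall fun z => ?_
    have h1 := norm_twConv_heatKernel_le ν hl hB ht z
    rw [norm_mul, norm_mul, RCLike.norm_conj, Complex.norm_real,
      Real.norm_of_nonneg (dens_pos ν z).le]
    have h2 : dens ν z = Real.exp (inner ℝ ν z) * Real.exp (inner ℝ ν z) := by
      rw [dens, two_mul, Real.exp_add]
    rw [h2]
    have := mul_le_mul_of_nonneg_right h1
      (mul_nonneg (Real.exp_nonneg (inner ℝ ν z)) (norm_nonneg (f z)))
    linarith
  · refine Integrable.const_mul ?_ B
    exact (hEc.mul hf.continuous.norm).integrable_of_hasCompactSupport hf.2.norm.mul_left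
  · exact Eventually.of_forall fun z =>
      ((tendsto_twConv_heatKernel ν hl hf z).mul_const _).const_mul _

/-- On test functions, convergence of the diagonal matrix elements is enough for contractions;
density and contractivity give the general case. -/
lemma tendsto_heatOp (hn : 1 ≤ n) (hl : lam ≠ 0) (x : L2 ν) :
    Tendsto (fun t => heatOp ν lam t x) (𝓝[>] 0) (𝓝 x) := by
  have hcontr : ∀ t, 0 < t → ∀ y, ‖heatOp ν lam t y‖ ≤ ‖y‖ := fun t ht y => by
    refine ((heatOp ν lam t).le_of_opNorm_le (norm_heatOp_le ν hl ht) y).trans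
      (mul_le_of_le_one_left (norm_nonneg _) (Real.exp_le_one_iff.2 ?_))
    have : 0 ≤ ‖ν‖ ^ 2 * t := by positivity
    linarith
  have htest : ∀ y ∈ testSpace ν, Tendsto (fun t => heatOp ν lam t y) (𝓝[>] 0) (𝓝 y) := by
    rintro _ ⟨f, hf, rfl⟩
    set y := hf.toL2 ν with hy
    rw [tendsto_iff_norm_sub_tendsto_zero]
    have h1 := (Complex.continuous_re.tendsto _).comp (tendsto_inner_heatOp ν hn hl hf)
    have h2 : Tendsto (fun t => 2 * (‖y‖ ^ 2 - (inner ℂ y (heatOp ν lam t y)).re)) (𝓝[>] 0)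
        (𝓝 0) := by
      have h3 := (h1.const_sub (‖y‖ ^ 2)).const_mul 2
      have h4 : (inner ℂ y y).re = ‖y‖ ^ 2 := inner_self_eq_norm_sq (𝕜 := ℂ) y
      rw [← hy, h4, sub_self, mul_zero] at h3
      exact h3
    -- For a symmetric contraction, `‖T y - y‖² ≤ 2 (‖y‖² - Re ⟪y, T y⟫)`.
    have h5 : Tendsto (fun t => ‖heatOp ν lam t y - y‖ ^ 2) (𝓝[>] 0) (𝓝 0) := by
      refine squeeze_zero' (Eventually.of_forall fun t => by positivity) ?_ h2
      filter_upwards [self_mem_nhdsWithin] with t ht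
      have h6 := norm_sub_sq (𝕜 := ℂ) (heatOp ν lam t y) y
      have h7 : RCLike.re (inner ℂ (heatOp ν lam t y) y) = (inner ℂ y (heatOp ν lam t y)).re := by
        rw [inner_heatOp ν hl ht]; rfl
      rw [h6, h7]
      have h8 := hcontr t ht y
      have := norm_nonneg (heatOp ν lam t y)
      nlinarith
    have h9 := (Real.continuous_sqrt.tendsto 0).comp h5
    rw [Real.sqrt_zero] at h9
    refine h9.congr fun t => ?_
    simp only [Function.comp_apply]
    rw [Real.sqrt_sq (norm_nonneg _)]
  rw [Metric.tendsto_nhds]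
  intro ε hε
  obtain ⟨y, hy, hxy⟩ := Metric.mem_closure_iff.1 (dense_testSpace ν x) (ε / 3) (by positivity)
  filter_upwards [Metric.tendsto_nhds.1 (htest y hy) (ε / 3) (by positivity),
    self_mem_nhdsWithin] with t h1 ht
  calc dist (heatOp ν lam t x) x
      ≤ dist (heatOp ν lam t x) (heatOp ν lam t y) + dist (heatOp ν lam t y) y + dist y x :=
        dist_triangle4 _ _ _ _
    _ < ε / 3 + ε / 3 + ε / 3 := by
        have h2 : dist (heatOp ν lam t x) (heatOp ν lam t y) ≤ dist x y := by
          rw [dist_eq_norm, dist_eq_norm, ← map_sub]; exact hcontr t ht _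
        rw [dist_comm y x]
        linarith
    _ = ε := by ring

theorem isSymmSemigroup_heatOp (hn : 1 ≤ n) (hν : ν ≠ 0) (hl : lam ≠ 0) :
    IsSymmSemigroup (heatOp ν lam) (‖ν‖ ^ 2) where
  pos := by have := norm_pos_iff.2 hν; positivity
  add s t hs ht x := by rw [heatOp_add ν hn hl hs ht, mul_apply_eq_comp]
  symm t ht x y := inner_heatOp ν hl ht x y
  norm_le t ht := norm_heatOp_le ν hl ht
  tendsto := tendsto_heatOp ν hn hl

/-! ### The kernels of the negative powers -/

/-- Matrix elements between test functions are compared by Fubini. The pairing has compact support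
and the kernels at times `t + ε` are bounded with exponential decay in `t`, so the interchange is
absolutely convergent. -/
theorem negPower_heatOp (hn : 1 ≤ n) (hν : ν ≠ 0) (hl : lam ≠ 0) {s ε : ℝ} (hs : 0 < s)
    (hε : 0 < ε) (x : L2 ν) :
    negPower (isSymmSemigroup_heatOp ν hn hν hl) s hs (heatOp ν lam ε x) =
      twOp ν lam (powerKernel ν lam s ε []) x := by
  suffices h : negPower (isSymmSemigroup_heatOp ν hn hν hl) s hs * heatOp ν lam ε =
      twOp ν lam (powerKernel ν lam s ε []) by
    rw [← h, mul_apply_eq_comp]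
  refine clm_ext_test fun ψ hψ => ext_test fun φ hφ => ?_
  have hG := hasGaussianBounds_powerKernel hn ν hl hs hε []
  rw [mul_apply_eq_comp, negPower_comp_eq _ hs hε,
    inner_twOp hG.continuous (hG.mass_ne_top hl) hφ hψ]
  have e1 : ∀ t ∈ Ioi (0 : ℝ), ((t ^ (s - 1) : ℝ) : ℂ) *
      inner ℂ (hφ.toL2 ν) (heatOp ν lam (t + ε) (hψ.toL2 ν)) =
      ∫ p : Space n × Space n, ((t ^ (s - 1) : ℝ) : ℂ) * heatKernel ν lam (t + ε) (p.1 - p.2) *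
        pairing ν lam φ ψ p ∂(volume.prod volume) := fun t ht => by
    have htε : 0 < t + ε := add_pos ht hε
    rw [heatOp, inner_twOp (continuous_heatKernel ν lam _) (mass_heatKernel_ne_top ν hl htε) hφ hψ,
      ← integral_const_mul]
    simp only [mul_assoc]
  have e2 : ∫ t in Ioi (0 : ℝ), ((t ^ (s - 1) : ℝ) : ℂ) *
      inner ℂ (hφ.toL2 ν) (heatOp ν lam (t + ε) (hψ.toL2 ν)) =
      ∫ t in Ioi (0 : ℝ), ∫ p : Space n × Space n, ((t ^ (s - 1) : ℝ) : ℂ) *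
        heatKernel ν lam (t + ε) (p.1 - p.2) * pairing ν lam φ ψ p ∂(volume.prod volume) :=
    setIntegral_congr_fun measurableSet_Ioi e1
  obtain ⟨C, hC, hb⟩ := exists_monomial_heatKernel_add_le hn ν hl hε []
  have hint : Integrable (Function.uncurry fun (t : ℝ) (p : Space n × Space n) =>
      ((t ^ (s - 1) : ℝ) : ℂ) * heatKernel ν lam (t + ε) (p.1 - p.2) * pairing ν lam φ ψ p)
      ((volume.restrict (Ioi (0 : ℝ))).prod (volume.prod volume)) := by
    have hP : Integrable (pairing ν lam φ ψ) (volume.prod volume) :=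
      (continuous_pairing hφ hψ).integrable_of_hasCompactSupport (hasCompactSupport_pairing hφ hψ)
    have hmeq : (volume.restrict (Ioi (0 : ℝ))).prod
        ((volume : Measure (Space n)).prod (volume : Measure (Space n))) =
        ((volume : Measure ℝ).prod (volume.prod volume)).restrict (Ioi 0 ×ˢ univ) := by
      rw [← Measure.prod_restrict, Measure.restrict_univ]
    have hdom := ((integrableOn_rpow_mul_exp_half hl hs).const_mul C).mul_prod hP.norm
    rw [hmeq] at hdom ⊢
    refine Integrable.mono' hdom ?_ ?_
    · refine ContinuousOn.aestronglyMeasurable ?_ (measurableSet_Ioi.prod MeasurableSet.univ)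
      refine ContinuousOn.mul (ContinuousOn.mul ?_ ?_)
        ((continuous_pairing hφ hψ).comp continuous_snd).continuousOn
      · refine Complex.continuous_ofReal.comp_continuousOn fun p hp => ?_
        have hp1 : (0 : ℝ) < p.1 := hp.1
        exact ((Real.continuousAt_rpow_const p.1 _ (Or.inl hp1.ne')).comp
          (x := p) continuousAt_fst).continuousWithinAt
      · exact (continuousOn_monomial_heatKernel ν hl []).comp
          (f := fun q : ℝ × Space n × Space n => (q.1 + ε, q.2.1 - q.2.2)) (by fun_prop)
          fun q hq => ⟨by have : (0 : ℝ) < q.1 := hq.1; exact mem_Ioi.2 (by positivity), mem_univ _⟩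
    · refine (ae_restrict_iff' (measurableSet_Ioi.prod MeasurableSet.univ)).2
        (Eventually.of_forall fun q hq => ?_)
      have ht : (0 : ℝ) < q.1 := hq.1
      simp only [Function.uncurry]
      rw [norm_mul, norm_mul, Complex.norm_real, Real.norm_of_nonneg (by positivity)]
      refine mul_le_mul_of_nonneg_right ?_ (norm_nonneg _)
      rw [mul_left_comm]
      refine mul_le_mul_of_nonneg_left ?_ (by positivity)
      have h1 : 1 ≤ Real.exp (2 * ‖ν‖ * ‖q.2.1 - q.2.2‖) := Real.one_le_exp (by positivity)
      have h2 : Real.exp (-(|lam| * ‖q.2.1 - q.2.2‖ ^ 2 / 16)) ≤ 1 :=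
        Real.exp_le_one_iff.2 (by simp only [Left.neg_nonpos_iff]; positivity)
      calc _ ≤ ‖heatKernel ν lam (q.1 + ε) (q.2.1 - q.2.2)‖ *
            Real.exp (2 * ‖ν‖ * ‖q.2.1 - q.2.2‖) := le_mul_of_one_le_right (norm_nonneg _) h1
        _ ≤ C * Real.exp (-(|lam| * q.1 / 2)) * Real.exp (-(|lam| * ‖q.2.1 - q.2.2‖ ^ 2 / 16)) :=
          hb q.1 ht.le _
        _ ≤ C * Real.exp (-(|lam| * q.1 / 2)) * 1 := by gcongr
        _ = _ := mul_one _
  rw [e2, integral_integral_swap hint, ← integral_const_mul]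
  refine integral_congr_ae (Eventually.of_forall fun p => ?_)
  simp only [powerKernel]
  rw [integral_mul_const, ← mul_assoc]
  rfl

end HeatOp

end

section

variable {n : ℕ}

/-! ### The resolvent identity -/

section Resolvent

variable {ν : Space n} {lam : ℝ}

lemma integrable_twKernel {κ f : Space n → ℂ} (hκ : Continuous κ) (hf : IsTestFunction f)
    (lam : ℝ) (z : Space n) : Integrable fun w => κ (z - w) * twist lam z w * f w := by
  refine Continuous.integrable_of_hasCompactSupport
    (((hκ.comp (continuous_const.sub continuous_id)).mul (continuous_twist_right lam z)).mul
      hf.continuous) hf.2.mul_left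

lemma driftLaplacian_twConv {κ f : Space n → ℂ} (hκ : HasGaussianBounds ν lam κ)
    (hf : IsTestFunction f) (z : Space n) :
    driftLaplacian ν lam (twConv lam κ f) z = twConv lam (driftLaplacian ν lam κ) f z := by
  have h1 : ∀ i, field lam i (twConv lam κ f) = twConv lam (field lam i κ) f :=
    fun i => monomial_twConv hκ hf [i]
  have h2 : ∀ i, field lam i (twConv lam (field lam i κ) f) =
      twConv lam (field lam i (field lam i κ)) f :=
    fun i => monomial_twConv (hκ.monomial [i]) hf [i]
  have i1 : ∀ i, Integrable fun w => field lam i κ (z - w) * twist lam z w * f w := fun i =>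
    integrable_twKernel (hκ.monomial [i]).continuous hf lam z
  have i2 : ∀ i, Integrable fun w => field lam i (field lam i κ) (z - w) * twist lam z w * f w :=
    fun i => integrable_twKernel (hκ.monomial [i, i]).continuous hf lam z
  simp only [driftLaplacian, h1, h2]
  unfold twConv
  rw [← integral_finsetSum _ fun i _ => i2 i]
  simp only [← integral_const_mul]
  rw [← integral_finsetSum _ fun i _ => (i1 i).const_mul _, ← integral_const_mul,
    ← integral_add (integrable_finsetSum _ fun i _ => i2 i)
      ((integrable_finsetSum _ fun i _ => (i1 i).const_mul _).const_mul _)]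
  congr 1
  funext w
  simp only [driftLaplacian, add_mul, Finset.sum_mul, Finset.mul_sum, mul_assoc]

/-- The operator `-L` on the smooth domain. -/
abbrev sobolevLaplacian (ν : Space n) (lam : ℝ) : Module.End ℂ (sobolev ν lam) :=
  hamiltonian (skewField ν lam) (‖ν‖ ^ 2)

/-- The convolution of a kernel and a test function as a smooth vector. -/
def sobolevConv (hl : lam ≠ 0) {κ f : Space n → ℂ} (hκ : HasGaussianBounds ν lam κ)
    (hf : IsTestFunction f) : sobolev ν lam := ⟨_, twConv_mem_sobolev hl hκ hf⟩

lemma sobolevEmb_sobolevConv (hl : lam ≠ 0) {κ f : Space n → ℂ} (hκ : HasGaussianBounds ν lam κ)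
    (hf : IsTestFunction f) :
    sobolevEmb ν lam (sobolevConv hl hκ hf) = twOp ν lam κ (hf.toL2 ν) := by
  apply Lp.ext
  rw [ae_driftMeasure_eq]
  refine (sobolevEmb_ae_eq _).trans (EventuallyEq.symm ?_)
  refine (twOp_ae_eq ν lam hκ.continuous (hκ.mass_ne_top hl) _).trans ?_
  rw [twConv_congr (hf.toL2_ae_eq ν)]
  rfl

/-- The regularized form of `H H⁻¹ = 1`: on smooth vectors, `H` applied to `H⁻¹ T_ε f` is `T_ε f`,
by the resolvent equation for the kernels. -/
lemma sobolevLaplacian_resolvent (hn : 1 ≤ n) (hl : lam ≠ 0) {ε : ℝ} (hε : 0 < ε)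
    {f : Space n → ℂ} (hf : IsTestFunction f) :
    sobolevEmb ν lam (sobolevLaplacian ν lam (sobolevConv hl
      (hasGaussianBounds_powerKernel hn ν hl one_pos hε []) hf)) = heatOp ν lam ε (hf.toL2 ν) := by
  apply Lp.ext
  rw [ae_driftMeasure_eq]
  refine (sobolevEmb_ae_eq _).trans (EventuallyEq.symm ?_)
  refine (heatOp_toL2 ν hl hε hf).trans (Eventually.of_forall fun z => ?_)
  rw [hamiltonian_skewField_apply]
  change _ = -driftLaplacian ν lam (twConv lam (powerKernel ν lam 1 ε []) f) z
  rw [driftLaplacian_twConv (hasGaussianBounds_powerKernel hn ν hl one_pos hε []) hf]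
  unfold twConv
  rw [← integral_neg]
  congr 1
  funext w
  rw [driftLaplacian_powerKernel_one hn ν hl hε]
  ring

variable (hn : 1 ≤ n) (hν : ν ≠ 0) (hl : lam ≠ 0)

/-- The inverse of `-L`. -/
abbrev laplaceInv : L2 ν →L[ℂ] L2 ν :=
  negPower (isSymmSemigroup_heatOp ν hn hν hl) 1 one_pos

include hn hν hl

/-- Tested against `T_ε f`, both `H⁻¹` and `H` can be moved to the left by symmetry, where they
cancel by the regularized resolvent identity; then `ε → 0`. -/
lemma laplaceInv_sobolevLaplacian (u : sobolev ν lam) :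
    laplaceInv hn hν hl (sobolevEmb ν lam (sobolevLaplacian ν lam u)) = sobolevEmb ν lam u := by
  have hS := isSymmSemigroup_heatOp ν hn hν hl
  refine ext_test fun f hf => ?_
  have h1 : ∀ y : L2 ν, Tendsto (fun ε => inner ℂ (heatOp ν lam ε (hf.toL2 ν)) y) (𝓝[>] 0)
      (𝓝 (inner ℂ (hf.toL2 ν) y)) := fun y =>
    (hS.tendsto (hf.toL2 ν)).inner tendsto_const_nhds
  refine tendsto_nhds_unique (h1 _) (Tendsto.congr' ?_ (h1 _))
  filter_upwards [self_mem_nhdsWithin] with ε hε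
  have hG := hasGaussianBounds_powerKernel hn ν hl one_pos hε []
  rw [← negPower_symm, negPower_heatOp ν hn hν hl one_pos hε, ← sobolevEmb_sobolevConv hl hG hf,
    ← isSkewSystem_skewField.isSymm_hamiltonian, sobolevLaplacian_resolvent hn hl hε hf]

end Resolvent

/-! ### Cutoffs -/

lemma tendsto_toLp_of_dominated {μ : Measure (Space n)} {F : ℕ → Space n → ℂ} {f : Space n → ℂ}
    {G : Space n → ℝ} (hF : ∀ m, MemLp (F m) 2 μ) (hf : MemLp f 2 μ) (hG : MemLp G 2 μ)
    (hb : ∀ m z, ‖F m z‖ ≤ G z) (hlim : ∀ z, Tendsto (fun m => F m z) atTop (𝓝 (f z))) :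
    Tendsto (fun m => (hF m).toLp (F m)) atTop (𝓝 (hf.toLp f)) := by
  have hfb : ∀ z, ‖f z‖ ≤ G z := fun z =>
    le_of_tendsto (hlim z).norm (Eventually.of_forall fun m => hb m z)
  rw [Lp.tendsto_Lp_iff_tendsto_eLpNorm'' _ hF _ hf]
  have h1 : Tendsto (fun m => ∫⁻ z, ‖F m z - f z‖ₑ ^ (2 : ℝ) ∂μ) atTop (𝓝 (∫⁻ _z, 0 ∂μ)) := by
    refine tendsto_lintegral_of_dominated_convergence' (fun z => (2 * ‖G z‖ₑ) ^ (2 : ℝ))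
      (fun m => (((hF m).1.sub hf.1).enorm).pow_const _) (fun m => Eventually.of_forall fun z => ?_)
      ?_ (Eventually.of_forall fun z => ?_)
    · refine ENNReal.rpow_le_rpow ?_ zero_le_two
      have h2 : ‖F m z - f z‖ ≤ 2 * ‖G z‖ := by
        have := le_abs_self (G z)
        rw [Real.norm_eq_abs]
        linarith [norm_sub_le (F m z) (f z), hb m z, hfb z]
      rw [← ofReal_norm, ← ofReal_norm, ← ENNReal.ofReal_ofNat, ← ENNReal.ofReal_mul zero_le_two]
      exact ENNReal.ofReal_le_ofReal h2
    · have h3 := hG.eLpNorm_lt_top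
      rw [eLpNorm_lt_top_iff_lintegral_rpow_enorm_lt_top two_ne_zero ENNReal.ofNat_ne_top] at h3
      simp only [ENNReal.mul_rpow_of_nonneg _ _ zero_le_two]
      rw [lintegral_const_mul' _ _ (by simp)]
      exact (ENNReal.mul_lt_top (by simp) (by simpa using h3)).ne
    · have h4 := ((hlim z).sub_const (f z)).enorm
      rw [sub_self, enorm_zero] at h4
      have h5 := (ENNReal.continuous_rpow_const (y := 2)).tendsto (0 : ℝ≥0∞) |>.comp h4
      rwa [ENNReal.zero_rpow_of_pos two_pos] at h5
  simp only [lintegral_zero] at h1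
  have h6 := (ENNReal.continuous_rpow_const (y := 1 / 2)).tendsto (0 : ℝ≥0∞) |>.comp h1
  rw [ENNReal.zero_rpow_of_pos (by norm_num)] at h6
  refine h6.congr fun m => ?_
  rw [eLpNorm_eq_lintegral_rpow_enorm_toReal two_ne_zero ENNReal.ofNat_ne_top]
  simp only [ENNReal.toReal_ofNat, Function.comp_apply, Pi.sub_apply]

/-- The first order error is grouped with `X_i u + ν_i u`, the square integrable skew field of `u`.
-/
lemma driftLaplacian_mul (ν : Space n) (lam : ℝ) {c u : Space n → ℂ} (hc : ContDiff ℝ ∞ c)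
    (hu : ContDiff ℝ ∞ u) (z : Space n) :
    driftLaplacian ν lam (fun z => c z * u z) z = c z * driftLaplacian ν lam u z +
      ∑ i, (partialDeriv i (partialDeriv i c) z * u z +
        2 * (partialDeriv i c z * (field lam i u z + ν i * u z))) := by
  have hd : ∀ {F : Space n → ℂ}, ContDiff ℝ ∞ F → ∀ z, DifferentiableAt ℝ F z := fun hF z =>
    hF.differentiable (by simp) z
  have e1 : ∀ i, field lam i (fun z => c z * u z) =
      fun z => partialDeriv i c z * u z + c z * field lam i u z := fun i =>
    funext fun z => field_mul_left lam i (hd hc z) (hd hu z)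
  have e2 : ∀ i, field lam i (field lam i (fun z => c z * u z)) z =
      partialDeriv i (partialDeriv i c) z * u z + 2 * (partialDeriv i c z * field lam i u z) +
        c z * field lam i (field lam i u) z := fun i => by
    have hp := contDiff_partialDeriv hc i
    have hf := contDiff_field hu lam i
    rw [e1, field_add lam i ((hd hp z).fun_mul (hd hu z)) ((hd hc z).fun_mul (hd hf z)),
      field_mul_left lam i (hd hp z) (hd hu z), field_mul_left lam i (hd hc z) (hd hf z)]
    ring
  unfold driftLaplacian
  simp only [e2]
  simp only [e1, Finset.mul_sum, mul_add, ← Finset.sum_add_distrib]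
  refine Finset.sum_congr rfl fun i _ => ?_
  ring

/-- A smooth function with compact support which equals one at the origin. -/
lemma exists_cutoff (n : ℕ) : ∃ c : Space n → ℂ, IsTestFunction c ∧ c 0 = 1 := by
  let b : ContDiffBump (0 : Space n) := ⟨1, 2, one_pos, one_lt_two⟩
  refine ⟨fun z => (b z : ℂ), ⟨Complex.ofRealCLM.contDiff.comp b.contDiff,
    b.hasCompactSupport.comp_left Complex.ofReal_zero⟩, ?_⟩
  have : b 0 = 1 := b.one_of_mem_closedBall (by simp [b])
  simp [this]

lemma IsTestFunction.partialDeriv {c : Space n → ℂ} (hc : IsTestFunction c) (i : Fin n ⊕ Fin n) :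
    IsTestFunction (partialDeriv i c) := by
  have h : TwistedDrift.partialDeriv i c = TwistedDrift.field 0 i c := by
    funext z; rw [field_eq]; simp
  rw [h]; exact IsTestFunction.field hc 0 i

lemma IsTestFunction.comp_smul {c : Space n → ℂ} (hc : IsTestFunction c) {r : ℝ} (hr : r ≠ 0) :
    IsTestFunction fun z => c (r • z) :=
  ⟨hc.1.comp (by fun_prop), hc.2.comp_smul hr⟩

lemma IsTestFunction.exists_bound {c : Space n → ℂ} (hc : IsTestFunction c) :
    ∃ K, ∀ z, ‖c z‖ ≤ K := hc.2.exists_bound_of_continuous hc.continuous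

/-! ### The inverse of the closure of `-L` on test functions. -/

section Inverse

variable {ν : Space n} {lam : ℝ}

lemma driftLaplacian_memLp (u : sobolev ν lam) :
    MemLp (fun z => -driftLaplacian ν lam u z) 2 (driftMeasure ν) := by
  have h := (sobolevLaplacian ν lam u).2.2 []
  refine h.congr_norm ?_ (Eventually.of_forall fun z => ?_)
  · have : (fun z => -driftLaplacian ν lam u z) = (sobolevLaplacian ν lam u : Space n → ℂ) :=
      funext fun z => (hamiltonian_skewField_apply u z).symm
    rw [this]; exact h.1
  · rw [← hamiltonian_skewField_apply]; rfl

/-- Cutoffs `c(r z)` with `r = 1/(m+1)`: every derivative falling on the cutoff brings a factor `r`,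
so `L` of the truncated function converges to `L u` in `L²`. Thus test functions form a core for
`-L` on the smooth domain. -/
theorem mem_closure_inverseGraph (u : sobolev ν lam) :
    (sobolevEmb ν lam (sobolevLaplacian ν lam u), sobolevEmb ν lam u) ∈
      closure (inverseGraph ν lam) := by
  obtain ⟨c, hc, hc0⟩ := exists_cutoff n
  obtain ⟨K₀, hK₀⟩ := hc.exists_bound
  choose K₁ hK₁ using fun i => (hc.partialDeriv i).exists_bound
  choose K₂ hK₂ using fun i => ((hc.partialDeriv i).partialDeriv i).exists_bound
  set r : ℕ → ℝ := fun m => 1 / ((m : ℝ) + 1) with hr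
  have hr0 : ∀ m, r m ≠ 0 := fun m => by simp only [hr]; positivity
  have hrpos : ∀ m, 0 ≤ r m := fun m => by simp only [hr]; positivity
  have hr1 : ∀ m, r m ≤ 1 := fun m => by
    simp only [hr]; rw [div_le_one (by positivity)]; linarith [(Nat.cast_nonneg m : (0 : ℝ) ≤ m)]
  have hrt : Tendsto r atTop (𝓝 0) := tendsto_one_div_add_atTop_nhds_zero_nat
  have hcs : ∀ m, IsTestFunction fun z => c (r m • z) := fun m => hc.comp_smul (hr0 m)
  have hut : ∀ m, IsTestFunction fun z => c (r m • z) * (u : Space n → ℂ) z := fun m =>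
    ⟨(hcs m).1.mul u.2.1, (hcs m).2.mul_right⟩
  have p1 : ∀ m i, partialDeriv i (fun z => c (r m • z)) =
      fun z => (r m : ℂ) * partialDeriv i c (r m • z) := fun m i => funext fun z =>
    partialDeriv_comp_smul (hc.1.differentiable (by simp)) i (r m) z
  have p2 : ∀ m i z, partialDeriv i (partialDeriv i (fun z => c (r m • z))) z =
      (r m : ℂ) * ((r m : ℂ) * partialDeriv i (partialDeriv i c) (r m • z)) := fun m i z => by
    rw [p1, partialDeriv_const_mul _ i ((((hc.partialDeriv i).comp_smul (hr0 m)).1.differentiable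
      (by simp)) z), partialDeriv_comp_smul ((hc.partialDeriv i).1.differentiable (by simp))]
  have hsm : ∀ z : Space n, Tendsto (fun m => r m • z) atTop (𝓝 0) := fun z => by
    have := hrt.smul_const z
    rwa [zero_smul] at this
  have hrc : Tendsto (fun m => (r m : ℂ)) atTop (𝓝 0) := by
    have := (Complex.continuous_ofReal.tendsto 0).comp hrt
    rwa [Complex.ofReal_zero] at this
  have hcz : ∀ z : Space n, Tendsto (fun m => c (r m • z)) atTop (𝓝 1) := fun z => by
    have := (hc.continuous.tendsto 0).comp (hsm z)
    rwa [hc0] at this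
  have hp1z : ∀ i z, Tendsto (fun m => (r m : ℂ) * partialDeriv i c (r m • z)) atTop (𝓝 0) :=
    fun i z => by
      have := hrc.mul (((hc.partialDeriv i).continuous.tendsto 0).comp (hsm z))
      rwa [zero_mul] at this
  have hp2z : ∀ i z, Tendsto (fun m => (r m : ℂ) * ((r m : ℂ) *
      partialDeriv i (partialDeriv i c) (r m • z))) atTop (𝓝 0) := fun i z => by
    have := hrc.mul (hrc.mul ((((hc.partialDeriv i).partialDeriv i).continuous.tendsto 0).comp
      (hsm z)))
    rwa [zero_mul] at this
  have e : ∀ m z, -driftLaplacian ν lam (fun z => c (r m • z) * (u : Space n → ℂ) z) z =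
      -(c (r m • z) * driftLaplacian ν lam u z + ∑ i, ((r m : ℂ) * ((r m : ℂ) *
        partialDeriv i (partialDeriv i c) (r m • z)) * (u : Space n → ℂ) z +
        2 * ((r m : ℂ) * partialDeriv i c (r m • z) *
          (field lam i u z + ν i * (u : Space n → ℂ) z)))) := fun m z => by
    rw [driftLaplacian_mul ν lam (hcs m).1 u.2.1]
    simp only [p2]
    simp only [p1]
  have hu0 : MemLp (u : Space n → ℂ) 2 (driftMeasure ν) := u.2.2 []
  have hsk : ∀ i, MemLp (fun z => field lam i u z + ν i * (u : Space n → ℂ) z) 2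
      (driftMeasure ν) := fun i => (skewField ν lam i u).2.2 []
  have hL := driftLaplacian_memLp u
  have hlap := fun m => driftLaplacian_memLp (⟨_, (hut m).mem_sobolev⟩ : sobolev ν lam)
  have t1 := tendsto_toLp_of_dominated (F := fun m z => -driftLaplacian ν lam
      (fun z => c (r m • z) * (u : Space n → ℂ) z) z) hlap hL
    (G := fun z => K₀ * ‖-driftLaplacian ν lam u z‖ + ∑ i, (K₂ i * ‖(u : Space n → ℂ) z‖ +
      2 * K₁ i * ‖field lam i u z + ν i * (u : Space n → ℂ) z‖))
    ((hL.norm.const_mul K₀).add (memLp_finsetSum _ fun i _ =>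
      (hu0.norm.const_mul (K₂ i)).add ((hsk i).norm.const_mul (2 * K₁ i))))
    (fun m z => by
      have hn1 : ‖(r m : ℂ)‖ ≤ 1 := by
        rw [Complex.norm_real, Real.norm_of_nonneg (hrpos m)]; exact hr1 m
      rw [e, norm_neg, norm_neg]
      refine (norm_add_le _ _).trans (add_le_add ?_ ((norm_sum_le _ _).trans
        (Finset.sum_le_sum fun i _ => (norm_add_le _ _).trans (add_le_add ?_ ?_))))
      · rw [norm_mul]; exact mul_le_mul_of_nonneg_right (hK₀ _) (norm_nonneg _)
      · rw [norm_mul]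
        refine mul_le_mul_of_nonneg_right ?_ (norm_nonneg _)
        rw [norm_mul, norm_mul]
        calc ‖(r m : ℂ)‖ * (‖(r m : ℂ)‖ * ‖partialDeriv i (partialDeriv i c) (r m • z)‖)
            ≤ 1 * (1 * ‖partialDeriv i (partialDeriv i c) (r m • z)‖) := by gcongr
          _ ≤ K₂ i := by simpa using hK₂ i _
      · rw [norm_mul, norm_mul, ← mul_assoc]
        refine mul_le_mul_of_nonneg_right ?_ (norm_nonneg _)
        rw [norm_mul, Complex.norm_ofNat]
        refine mul_le_mul_of_nonneg_left ?_ zero_le_two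
        calc ‖(r m : ℂ)‖ * ‖partialDeriv i c (r m • z)‖
            ≤ 1 * ‖partialDeriv i c (r m • z)‖ := by gcongr
          _ ≤ K₁ i := by simpa using hK₁ i _)
    (fun z => by
      simp only [e]
      have h1 := ((hcz z).mul_const (driftLaplacian ν lam u z)).add
        (tendsto_finsetSum (s := (Finset.univ : Finset (Fin n ⊕ Fin n))) fun i _ =>
          ((hp2z i z).mul_const ((u : Space n → ℂ) z)).add
          (((hp1z i z).mul_const (field lam i u z + ν i * (u : Space n → ℂ) z)).const_mul 2))
      have h2 := h1.neg
      simpa using h2)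
  have t2 := tendsto_toLp_of_dominated (F := fun m z => c (r m • z) * (u : Space n → ℂ) z)
    (fun m => (hut m).memLp 2 (driftMeasure ν)) hu0
    (G := fun z => K₀ * ‖(u : Space n → ℂ) z‖) (hu0.norm.const_mul K₀)
    (fun m z => by rw [norm_mul]; exact mul_le_mul_of_nonneg_right (hK₀ _) (norm_nonneg _))
    (fun z => by simpa using (hcz z).mul_const ((u : Space n → ℂ) z))
  have e1 : sobolevEmb ν lam (sobolevLaplacian ν lam u) = hL.toLp _ := by
    apply Lp.ext
    rw [ae_driftMeasure_eq]
    have h3 := hL.coeFn_toLp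
    rw [ae_driftMeasure_eq] at h3
    refine (sobolevEmb_ae_eq _).trans (EventuallyEq.trans ?_ h3.symm)
    exact Eventually.of_forall fun z => hamiltonian_skewField_apply u z
  have e2 : sobolevEmb ν lam u = hu0.toLp _ := rfl
  rw [e1, e2]
  refine mem_closure_of_tendsto (t1.prodMk_nhds t2) (Eventually.of_forall fun m => ?_)
  exact ⟨_, hut m, (hlap m).coeFn_toLp, ((hut m).memLp 2 (driftMeasure ν)).coeFn_toLp⟩

variable (hn : 1 ≤ n) (hν : ν ≠ 0) (hl : lam ≠ 0)
include hn hν hl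

theorem isInverse_laplaceInv : IsInverse ν lam (laplaceInv hn hν hl) where
  isPositive := negPower_isPositive _ one_pos
  graph_eq := by
    apply Subset.antisymm
    · rintro ⟨x, y⟩ hxy
      rw [mem_ofPred_eq] at hxy
      simp only at hxy
      subst hxy
      have hS := isSymmSemigroup_heatOp ν hn hν hl
      -- The condition is closed in `x`, so it is enough to verify it for `T_ε f` with `f` a test
      -- function, where `H⁻¹ T_ε f` is a smooth vector.
      have hclosed : IsClosed {x : L2 ν | (x, laplaceInv hn hν hl x) ∈
          closure (inverseGraph ν lam)} :=
        isClosed_closure.preimage (continuous_id.prodMk (laplaceInv hn hν hl).continuous)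
      have htest : (testSpace ν : Set (L2 ν)) ⊆ {x : L2 ν | (x, laplaceInv hn hν hl x) ∈
          closure (inverseGraph ν lam)} := by
        rintro _ ⟨f, hf, rfl⟩
        refine hclosed.mem_of_tendsto (hS.tendsto (hf.toL2 ν)) ?_
        filter_upwards [self_mem_nhdsWithin] with ε hε
        have hG := hasGaussianBounds_powerKernel hn ν hl one_pos hε []
        have h1 := mem_closure_inverseGraph (sobolevConv hl hG hf)
        rw [sobolevLaplacian_resolvent hn hl hε hf, sobolevEmb_sobolevConv hl hG hf,
          ← negPower_heatOp ν hn hν hl one_pos hε] at h1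
        exact h1
      exact hclosed.closure_subset_iff.2 htest (dense_testSpace ν x)
    · refine closure_minimal ?_ (isClosed_eq ((laplaceInv hn hν hl).continuous.comp continuous_fst)
        continuous_snd)
      rintro ⟨x, y⟩ ⟨φ, hφ, h1, h2⟩
      have h3 := laplaceInv_sobolevLaplacian hn hν hl (⟨φ, hφ.mem_sobolev⟩ : sobolev ν lam)
      rw [ae_driftMeasure_eq] at h1 h2
      have h4 : sobolevEmb ν lam (sobolevLaplacian ν lam ⟨φ, hφ.mem_sobolev⟩) = x := by
        apply Lp.ext
        rw [ae_driftMeasure_eq]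
        refine (sobolevEmb_ae_eq _).trans (EventuallyEq.trans ?_ h1.symm)
        exact Eventually.of_forall fun z => hamiltonian_skewField_apply _ z
      have h5 : sobolevEmb ν lam ⟨φ, hφ.mem_sobolev⟩ = y := by
        apply Lp.ext
        rw [ae_driftMeasure_eq]
        exact (sobolevEmb_ae_eq _).trans h2.symm
      rw [h4, h5] at h3
      exact h3

end Inverse

end

section

variable {n : ℕ}

/-! ### Square function bounds for the regularized Riesz transforms -/

section Riesz

variable {ν : Space n} {lam : ℝ}

/-- Subtracting `ν_i` from the skew field recovers the original field, so the words in the energy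
estimate are the monomials `P_k`. -/
lemma foldr_skewField (w : List (Fin n ⊕ Fin n)) (u : sobolev ν lam) :
    w.foldr (fun i v => skewField ν lam i v - (ν i : ℂ) • v) u =
      ⟨monomial lam w u, monomial_mem_sobolev u.2 w⟩ := by
  induction w with
  | nil => rfl
  | cons i w ih =>
    rw [List.foldr_cons, ih]
    ext z
    simp only [Submodule.coe_sub, Submodule.coe_smul, Pi.sub_apply, Pi.smul_apply, smul_eq_mul,
      skewField_apply]
    rw [add_sub_cancel_right]
    rfl

section Energy

variable (hn : 1 ≤ n) (hν : ν ≠ 0) (hl : lam ≠ 0)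
include hn hν hl

lemma laplaceInv_pow_sobolevLaplacian (m : ℕ) (u : sobolev ν lam) :
    (laplaceInv hn hν hl ^ m) (sobolevEmb ν lam ((sobolevLaplacian ν lam ^ m) u)) =
      sobolevEmb ν lam u := by
  induction m with
  | zero => rfl
  | succ m ih =>
    rw [pow_succ, pow_succ', mul_apply_eq_comp, Module.End.mul_apply,
      laplaceInv_sobolevLaplacian, ih]

/-- The inverse is symmetric and its range contains the dense space of test functions. -/
lemma laplaceInv_injective : Function.Injective (laplaceInv hn hν hl) := by
  rw [injective_iff_map_eq_zero]
  intro x hx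
  refine ext_test fun φ hφ => ?_
  have h1 := laplaceInv_sobolevLaplacian hn hν hl (⟨φ, hφ.mem_sobolev⟩ : sobolev ν lam)
  have h2 : sobolevEmb ν lam ⟨φ, hφ.mem_sobolev⟩ = hφ.toL2 ν := rfl
  rw [← h2, ← h1, negPower_symm, hx, inner_zero_right, inner_zero_right]

lemma negPower_injective (k : ℕ) (hk : 0 < (k : ℝ) / 2) :
    Function.Injective (negPower (isSymmSemigroup_heatOp ν hn hν hl) ((k : ℝ) / 2) hk) := by
  rw [injective_iff_map_eq_zero]
  intro x hx
  have hk' : 0 < k := by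
    rcases Nat.eq_zero_or_pos k with rfl | h; · simp at hk
    exact h
  have h1 : (laplaceInv hn hν hl ^ k) x = 0 := by
    have h2 : negPower (isSymmSemigroup_heatOp ν hn hν hl) ((k : ℝ) / 2) hk *
        negPower (isSymmSemigroup_heatOp ν hn hν hl) ((k : ℝ) / 2) hk = laplaceInv hn hν hl ^ k := by
      rw [negPower_mul, negPower_pow _ k hk']
      congr 1; ring
    rw [← h2, mul_apply_eq_comp, hx, map_zero]
  have h3 : ∀ m : ℕ, (laplaceInv hn hν hl ^ m) x = 0 → x = 0 := by
    intro m
    induction m with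
    | zero => intro h; simpa using h
    | succ m ih =>
      intro h
      rw [pow_succ', mul_apply_eq_comp] at h
      exact ih (laplaceInv_injective hn hν hl (h.trans (map_zero _).symm))
  exact h3 k h1

/-- With `u = H^{-k/2} T_ε f`, the energy estimate bounds `‖P u‖²` by a constant times `⟨u, H^k u⟩`,
which equals `‖T_ε f‖²`. -/
lemma norm_twOp_powerKernel_toL2_le (w : List (Fin n ⊕ Fin n)) (hw : 0 < (w.length : ℝ) / 2)
    {ε : ℝ} (hε : 0 < ε) {f : Space n → ℂ} (hf : IsTestFunction f) :
    ‖twOp ν lam (powerKernel ν lam (w.length / 2) ε w) (hf.toL2 ν)‖ ^ 2 ≤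
      wordConst n 0 w.length * ‖hf.toL2 ν‖ ^ 2 := by
  have hS := isSymmSemigroup_heatOp ν hn hν hl
  have hG := hasGaussianBounds_powerKernel hn ν hl hw hε []
  have hGw := hasGaussianBounds_powerKernel hn ν hl hw hε w
  set u := sobolevConv hl hG hf with hu
  have hk' : 0 < w.length := by
    rcases Nat.eq_zero_or_pos w.length with h | h; · rw [h] at hw; simp at hw
    exact h
  have h1 : sobolevEmb ν lam ⟨monomial lam w u, monomial_mem_sobolev u.2 w⟩ =
      twOp ν lam (powerKernel ν lam (w.length / 2) ε w) (hf.toL2 ν) := by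
    rw [← sobolevEmb_sobolevConv hl hGw hf]
    congr 1
    refine Subtype.ext ?_
    change monomial lam w (twConv lam (powerKernel ν lam (w.length / 2) ε []) f) =
      twConv lam (powerKernel ν lam (w.length / 2) ε w) f
    rw [monomial_twConv hG hf, monomial_powerKernel hn ν hl hw hε, List.append_nil]
  have h2 := isSkewSystem_skewField.norm_word_sq_le (e := sobolevEmb ν lam)
    (D := skewField ν lam) (lam := lam) hn (‖ν‖ ^ 2) (by positivity)
    (fun i => ν i) (fun i => by
      rw [← sq_abs]; exact pow_le_pow_left₀ (abs_nonneg _) (abs_apply_le_norm ν i) 2) w u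
  rw [foldr_skewField, h1] at h2
  refine h2.trans (mul_le_mul_of_nonneg_left ?_ (wordConst_pos _ _ _).le)
  set v := sobolevEmb ν lam ((sobolevLaplacian ν lam ^ w.length) u) with hv
  have h3 : sobolevEmb ν lam u = negPower hS (w.length / 2) hw (heatOp ν lam ε (hf.toL2 ν)) := by
    rw [negPower_heatOp ν hn hν hl hw hε, hu, sobolevEmb_sobolevConv]
  -- Here `v = H^k u`, and the claim is that `H^{-k/2} v = T_ε f`. It is verified after a further
  -- application of the injective operator `H^{-k/2}`, where it becomes `H^{-k} H^k u = u`.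
  have h4 : negPower hS (w.length / 2) hw v = heatOp ν lam ε (hf.toL2 ν) := by
    apply negPower_injective hn hν hl w.length hw
    rw [← h3, ← laplaceInv_pow_sobolevLaplacian hn hν hl w.length u, ← hv, ← mul_apply_eq_comp,
      negPower_mul, negPower_pow _ w.length hk']
    congr 2; ring
  have h5 : qform (sobolevEmb ν lam) (sobolevLaplacian ν lam ^ w.length) u =
      ‖heatOp ν lam ε (hf.toL2 ν)‖ ^ 2 := by
    unfold qform
    rw [← hv, h3, negPower_symm, h4]
    exact inner_self_eq_norm_sq (𝕜 := ℂ) _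
  change qform (sobolevEmb ν lam) (sobolevLaplacian ν lam ^ w.length) u ≤ _
  rw [h5]
  exact pow_le_pow_left₀ (norm_nonneg _) (hS.norm_apply_le' hε _) 2

theorem norm_twOp_powerKernel_le (w : List (Fin n ⊕ Fin n)) (hw : 0 < (w.length : ℝ) / 2)
    {ε : ℝ} (hε : 0 < ε) (x : L2 ν) :
    ‖twOp ν lam (powerKernel ν lam (w.length / 2) ε w) x‖ ^ 2 ≤
      wordConst n 0 w.length * ‖x‖ ^ 2 := by
  have hclosed : IsClosed {x : L2 ν | ‖twOp ν lam (powerKernel ν lam (w.length / 2) ε w) x‖ ^ 2 ≤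
      wordConst n 0 w.length * ‖x‖ ^ 2} := isClosed_le (by fun_prop) (by fun_prop)
  refine hclosed.closure_subset_iff.2 ?_ (dense_testSpace ν x)
  rintro _ ⟨f, hf, rfl⟩
  exact norm_twOp_powerKernel_toL2_le hn hν hl w hw hε hf

end Energy

/-! ### The distributional identity -/

lemma integral_monomial_mul_conj (lam : ℝ) {u φ : Space n → ℂ} (hu : ContDiff ℝ ∞ u)
    (hφ : IsTestFunction φ) (w : List (Fin n ⊕ Fin n)) :
    ∫ z, monomial lam w u z * conj (φ z) =
      (-1) ^ w.length * ∫ z, u z * conj (monomial lam w.reverse φ z) := by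
  have hint : ∀ {a b : Space n → ℂ}, ContDiff ℝ ∞ a → IsTestFunction b →
      Integrable fun z => a z * conj (b z) := fun ha hb =>
    (ha.continuous.mul (Complex.continuous_conj.comp hb.continuous)).integrable_of_hasCompactSupport
      (hb.2.comp_left (map_zero _)).mul_left
  induction w generalizing φ with
  | nil => simp [monomial]
  | cons i w ih =>
    have hm := contDiff_monomial hu lam w
    have h1 : ∫ z, monomial lam (i :: w) u z * conj (φ z) =
        -∫ z, monomial lam w u z * conj (field lam i φ z) :=
      integral_field_mul_conj lam i (hm.differentiable (by simp)) (hφ.1.differentiable (by simp))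
        (hint (contDiff_field hm lam i) hφ) (hint hm (hφ.field lam i)) (hint hm hφ)
    rw [h1, ih (hφ.field lam i), List.reverse_cons, monomial_append, List.length_cons, pow_succ]
    simp only [monomial, List.foldr_cons, List.foldr_nil]
    ring

lemma contDiff_dens (ν : Space n) : ContDiff ℝ ∞ (dens ν) := by
  unfold dens
  exact Real.contDiff_exp.comp (contDiff_const.mul (innerSL ℝ ν).contDiff)

lemma IsTestFunction.dens_mul {φ : Space n → ℂ} (hφ : IsTestFunction φ) (ν : Space n) :
    IsTestFunction fun z => (dens ν z : ℂ) * φ z :=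
  ⟨(Complex.ofRealCLM.contDiff.comp (contDiff_dens ν)).mul hφ.1, hφ.2.mul_left⟩

lemma IsTestFunction.inv_dens_mul {φ : Space n → ℂ} (hφ : IsTestFunction φ) (ν : Space n) :
    IsTestFunction fun z => ((dens ν z)⁻¹ : ℂ) * φ z := by
  refine ⟨ContDiff.mul ?_ hφ.1, hφ.2.mul_left⟩
  have h : ContDiff ℝ ∞ fun z => (((dens ν z)⁻¹ : ℝ) : ℂ) :=
    Complex.ofRealCLM.contDiff.comp ((contDiff_dens ν).inv fun z => (dens_pos ν z).ne')
  simpa using h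

/-- Dividing the test function by the density converts the weighted inner product into the
unweighted distributional pairing. -/
lemma inner_inv_dens {φ : Space n → ℂ} (hφ : IsTestFunction φ) {x : L2 ν} {g : Space n → ℂ}
    (hx : x =ᵐ[volume] g) :
    inner ℂ ((hφ.inv_dens_mul ν).toL2 ν) x = ∫ z, g z * conj (φ z) := by
  rw [inner_eq_integral ((hφ.inv_dens_mul ν).toL2_ae_eq ν) hx]
  congr 1; funext z
  have : (dens ν z : ℂ) ≠ 0 := by exact_mod_cast (dens_pos ν z).ne'
  simp only [map_mul, map_inv₀, Complex.conj_ofReal]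
  field_simp

/-! ### Removal of the regularization in `L²`. -/

section Limit

variable (hn : 1 ≤ n) (hν : ν ≠ 0) (hl : lam ≠ 0)
include hn hν hl

/-- Both sides are continuous in `x`. For test functions everything is smooth and the identity is
integration by parts, one letter at a time. -/
lemma inner_twOp_powerKernel (w : List (Fin n ⊕ Fin n)) {s ε : ℝ} (hs : 0 < s) (hε : 0 < ε)
    {φ : Space n → ℂ} (hφ : IsTestFunction φ) (x : L2 ν) :
    inner ℂ ((hφ.inv_dens_mul ν).toL2 ν) (twOp ν lam (powerKernel ν lam s ε w) x) =
      (-1) ^ w.length * inner ℂ (((hφ.monomial lam w.reverse).inv_dens_mul ν).toL2 ν)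
        (negPower (isSymmSemigroup_heatOp ν hn hν hl) s hs (heatOp ν lam ε x)) := by
  have hG := hasGaussianBounds_powerKernel hn ν hl hs hε []
  have hGw := hasGaussianBounds_powerKernel hn ν hl hs hε w
  rw [negPower_heatOp ν hn hν hl hs hε]
  have hcont : ∀ (y : L2 ν) (T : L2 ν →L[ℂ] L2 ν), Continuous fun x => inner ℂ y (T x) :=
    fun y T => continuous_const.inner T.continuous
  refine congrFun (Continuous.ext_on (dense_testSpace ν) (hcont _ _)
    (continuous_const.mul (hcont _ _)) ?_) x
  rintro _ ⟨f, hf, rfl⟩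
  simp only [Pi.mul_apply]
  rw [← sobolevEmb_sobolevConv hl hG hf, ← sobolevEmb_sobolevConv hl hGw hf,
    inner_inv_dens hφ (sobolevEmb_ae_eq _),
    inner_inv_dens (hφ.monomial lam w.reverse) (sobolevEmb_ae_eq _),
    ← integral_monomial_mul_conj lam (sobolevConv hl hG hf).2.1 hφ w]
  change _ = ∫ z, monomial lam w (twConv lam (powerKernel ν lam s ε []) f) z * conj (φ z)
  rw [monomial_twConv hG hf, monomial_powerKernel hn ν hl hs hε, List.append_nil]
  rfl

/-- Both sides have the same matrix elements as `P H^{-s} T_{ε+δ}`. The identity exchanges the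
regularization `ε` for a fixed `δ`, for which the operator does not vary. -/
lemma twOp_powerKernel_comm (w : List (Fin n ⊕ Fin n)) {s ε δ : ℝ} (hs : 0 < s) (hε : 0 < ε)
    (hδ : 0 < δ) (x : L2 ν) :
    twOp ν lam (powerKernel ν lam s ε w) (heatOp ν lam δ x) =
      twOp ν lam (powerKernel ν lam s δ w) (heatOp ν lam ε x) := by
  have hS := isSymmSemigroup_heatOp ν hn hν hl
  refine ext_test fun χ hχ => ?_
  have e : hχ.toL2 ν = ((hχ.dens_mul ν).inv_dens_mul ν).toL2 ν := by
    apply Lp.ext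
    rw [ae_driftMeasure_eq]
    refine (hχ.toL2_ae_eq ν).trans (EventuallyEq.trans ?_
      (((hχ.dens_mul ν).inv_dens_mul ν).toL2_ae_eq ν).symm)
    refine Eventually.of_forall fun z => ?_
    have : (dens ν z : ℂ) ≠ 0 := by exact_mod_cast (dens_pos ν z).ne'
    simp only
    rw [inv_mul_cancel_left₀ this]
  rw [e, inner_twOp_powerKernel hn hν hl w hs hε (hχ.dens_mul ν),
    inner_twOp_powerKernel hn hν hl w hs hδ (hχ.dens_mul ν),
    ← hS.add ε δ hε hδ, ← hS.add δ ε hδ hε, add_comm]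

/-- The Riesz transform on the Hilbert space as a limit of regularized operators. -/
theorem exists_rieszOp (w : List (Fin n ⊕ Fin n)) (hw : 0 < (w.length : ℝ) / 2) :
    ∃ R : L2 ν →L[ℂ] L2 ν, (∀ x, Tendsto (fun m : ℕ =>
      twOp ν lam (powerKernel ν lam (w.length / 2) (1 / ((m : ℝ) + 1)) w) x) atTop (𝓝 (R x))) ∧
      ∀ (x : L2 ν) (g : Space n → ℂ), g =ᵐ[volume] R x → IsRieszTransform ν lam w x g := by
  have hS := isSymmSemigroup_heatOp ν hn hν hl
  set Rm : ℕ → L2 ν →L[ℂ] L2 ν := fun m =>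
    twOp ν lam (powerKernel ν lam (w.length / 2) (1 / ((m : ℝ) + 1)) w) with hRm
  have hεpos : ∀ m : ℕ, (0 : ℝ) < 1 / ((m : ℝ) + 1) := fun m => by positivity
  have hε0 : Tendsto (fun m : ℕ => 1 / ((m : ℝ) + 1)) atTop (𝓝[>] 0) :=
    tendsto_nhdsWithin_iff.2 ⟨tendsto_one_div_add_atTop_nhds_zero_nat,
      Eventually.of_forall fun m => hεpos m⟩
  set K := √(wordConst n 0 w.length) with hK
  have hbound : ∀ m x, ‖Rm m x‖ ≤ K * ‖x‖ := fun m x => by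
    have h1 := norm_twOp_powerKernel_le hn hν hl w hw (hεpos m) x
    rw [hK]
    refine le_of_sq_le_sq ?_ (by positivity)
    rw [mul_pow, Real.sq_sqrt (wordConst_pos _ _ _).le]
    exact h1
  have hT : ∀ x, Tendsto (fun m : ℕ => heatOp ν lam (1 / ((m : ℝ) + 1)) x) atTop (𝓝 x) :=
    fun x => (hS.tendsto x).comp hε0
  -- On vectors `T_δ x` the regularized operators converge by the commutation identity. Since `T_δ
  -- x` is close to `x` and the operators are uniformly bounded, they converge at `x`.
  have hcauchy : ∀ x, CauchySeq fun m => Rm m x := by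
    intro x
    rw [Metric.cauchySeq_iff]
    intro η hη
    have hK0 : 0 ≤ K := Real.sqrt_nonneg _
    obtain ⟨d, hd⟩ := ((Metric.tendsto_atTop.1 (hT x)) (η / (4 * (K + 1))) (by positivity))
    have hd := hd d le_rfl
    set δ := 1 / ((d : ℝ) + 1) with hδ
    have hconv : CauchySeq fun m => Rm m (heatOp ν lam δ x) := by
      have h1 : (fun m => Rm m (heatOp ν lam δ x)) = fun m : ℕ =>
          twOp ν lam (powerKernel ν lam (w.length / 2) δ w)
            (heatOp ν lam (1 / ((m : ℝ) + 1)) x) := funext fun m =>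
        twOp_powerKernel_comm hn hν hl w hw (hεpos m) (hεpos d) x
      rw [h1]
      exact ((ContinuousLinearMap.continuous _).tendsto _ |>.comp (hT x)).cauchySeq
    obtain ⟨N, hN⟩ := (Metric.cauchySeq_iff.1 hconv) (η / 2) (by positivity)
    refine ⟨N, fun a ha b hb => ?_⟩
    have h2 : ∀ m, dist (Rm m x) (Rm m (heatOp ν lam δ x)) ≤ η / 4 := fun m => by
      rw [dist_eq_norm, ← map_sub]
      refine (hbound m _).trans ?_
      rw [dist_comm, dist_eq_norm] at hd
      calc K * ‖x - heatOp ν lam δ x‖ ≤ (K + 1) * (η / (4 * (K + 1))) := by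
            refine mul_le_mul (by linarith) hd.le (norm_nonneg _) (by positivity)
        _ = η / 4 := by field_simp
    have h3 := dist_triangle4 (Rm a x) (Rm a (heatOp ν lam δ x)) (Rm b (heatOp ν lam δ x)) (Rm b x)
    have h4 := h2 a
    have h5 := h2 b
    rw [dist_comm] at h5
    have h6 := hN a ha b hb
    linarith
  choose R₀ hR₀ using fun x => cauchySeq_tendsto_of_complete (hcauchy x)
  let R : L2 ν →L[ℂ] L2 ν := continuousLinearMapOfTendsto Rm (f := R₀) (l := atTop)
    (tendsto_pi_nhds.2 hR₀)
  have hR : ∀ x, Tendsto (fun m => Rm m x) atTop (𝓝 (R x)) := hR₀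
  refine ⟨R, hR, fun x g hg => ?_⟩
  refine ⟨negPower hS (w.length / 2) hw, ⟨laplaceInv hn hν hl, isInverse_laplaceInv hn hν hl,
    negPower_half hS w.length hw⟩, ?_, ?_, fun φ hφ => ?_⟩
  · exact locallyIntegrable_of_memLp one_le_two (Lp.memLp _)
  · refine locallyIntegrable_of_memLp (ν := ν) one_le_two ((Lp.memLp (R x)).ae_eq ?_)
    rw [ae_driftMeasure_eq]; exact hg.symm
  · rw [← inner_inv_dens (ν := ν) hφ hg.symm,
      ← inner_inv_dens (ν := ν) (hφ.monomial lam w.reverse) (ae_eq_refl _)]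
    have h1 : Tendsto (fun m => inner ℂ ((hφ.inv_dens_mul ν).toL2 ν) (Rm m x)) atTop
        (𝓝 (inner ℂ ((hφ.inv_dens_mul ν).toL2 ν) (R x))) := tendsto_const_nhds.inner (hR x)
    refine tendsto_nhds_unique h1 ?_
    simp only [hRm, inner_twOp_powerKernel hn hν hl w hw (hεpos _) hφ]
    refine Tendsto.const_mul _ (tendsto_const_nhds.inner ?_)
    exact ((ContinuousLinearMap.continuous _).tendsto _).comp (hT x)

end Limit

end Riesz

end

section

variable {n : ℕ}

/-! ### Size of the Riesz kernels -/

/-- The substitution `t ↦ 1/t` reduces this to the Gamma integral. -/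
lemma integrableOn_rpow_mul_exp_neg_div {b q : ℝ} (hb : 0 < b) (hq : 0 < q) :
    IntegrableOn (fun t : ℝ => t ^ (-q - 1) * Real.exp (-(b / t))) (Ioi 0) ∧
      ∫ t in Ioi (0 : ℝ), t ^ (-q - 1) * Real.exp (-(b / t)) = (1 / b) ^ q * Real.Gamma q := by
  have hcongr : EqOn (fun t : ℝ => (|(-1 : ℝ)| * t ^ ((-1 : ℝ) - 1)) •
      ((t ^ (-1 : ℝ)) ^ (q - 1) * Real.exp (-(b * t ^ (-1 : ℝ)))))
      (fun t : ℝ => t ^ (-q - 1) * Real.exp (-(b / t))) (Ioi 0) := fun t ht => by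
    have ht : 0 < t := ht
    simp only [abs_neg, abs_one, one_mul, smul_eq_mul]
    rw [← mul_assoc, ← Real.rpow_mul ht.le, ← Real.rpow_add ht, Real.rpow_neg_one, div_eq_mul_inv]
    congr 2; ring
  have hp : (-1 : ℝ) ≠ 0 := by norm_num
  constructor
  · refine ((integrableOn_Ioi_comp_rpow_iff
      (fun y : ℝ => y ^ (q - 1) * Real.exp (-(b * y))) hp).2 ?_).congr_fun hcongr measurableSet_Ioi
    refine (integrableOn_rpow_mul_exp_neg_mul_rpow (s := q - 1) (p := 1) (b := b)
      (by linarith) one_pos hb).congr_fun (fun t ht => ?_) measurableSet_Ioi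
    simp only [Real.rpow_one, neg_mul]
  · rw [← setIntegral_congr_fun measurableSet_Ioi hcongr,
      integral_comp_rpow_Ioi (fun y : ℝ => y ^ (q - 1) * Real.exp (-(b * y))) hp,
      Real.integral_rpow_mul_exp_neg_mul_Ioi hq hb]

lemma lintegral_comp_add_le {ε : ℝ} (hε : 0 < ε) (g : ℝ → ℝ≥0∞) :
    ∫⁻ t in Ioi (0 : ℝ), g (t + ε) ≤ ∫⁻ t in Ioi (0 : ℝ), g t := by
  rw [← lintegral_indicator measurableSet_Ioi, ← lintegral_indicator measurableSet_Ioi,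
    ← lintegral_add_right_eq_self (fun t => (Ioi (0 : ℝ)).indicator g t) ε]
  refine lintegral_mono fun t => ?_
  by_cases ht : t ∈ Ioi (0 : ℝ)
  · have ht' : t + ε ∈ Ioi (0 : ℝ) := add_pos ht hε
    simp only [indicator_of_mem ht, indicator_of_mem ht']
    exact le_rfl
  · simp [indicator_of_notMem ht]

lemma inv_sqrt_pow {t : ℝ} (ht : 0 < t) (m : ℕ) : (√t)⁻¹ ^ m = t ^ (-((m : ℝ) / 2)) := by
  rw [Real.sqrt_eq_rpow, ← Real.rpow_neg ht.le, ← Real.rpow_natCast, ← Real.rpow_mul ht.le]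
  congr 1; ring

/-- Size of the regularized Riesz kernels and their derivatives, uniformly in the regularization. -/
theorem exists_powerKernel_le (hn : 1 ≤ n) {M : ℝ} (hM : 0 < M) (w : List (Fin n ⊕ Fin n))
    {s : ℝ} (hs : 1 ≤ s) {j : ℕ} (hj : (w.length : ℝ) = 2 * s + j) :
    ∃ C : ℝ, 0 < C ∧ ∀ (ν : Space n) (lam ε : ℝ), lam ≠ 0 → M * ‖ν‖ ^ 2 ≤ |lam| → 0 < ε →
      ∀ u : Space n, u ≠ 0 → ‖powerKernel ν lam s ε w u‖ * Real.exp (2 * ‖ν‖ * ‖u‖) ≤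
        C * ‖u‖⁻¹ ^ (2 * n + j) * Real.exp (-(|lam| * ‖u‖ ^ 2 / 16)) := by
  obtain ⟨C, hC, hb⟩ := exists_monomial_heatKernel_le hn hM w
  -- Counting powers: `t^{s-1}` times `t^{-(2n + |w|)/2}` is `t^{-q-1}`, and the time integral then
  -- gives `‖u‖^{-2q} = ‖u‖^{-(2n+j)}`.
  set q : ℝ := n + j / 2 with hq_def
  have hn' : (1 : ℝ) ≤ n := by exact_mod_cast hn
  have hq : 0 < q := by positivity
  have hG := Real.Gamma_pos_of_pos (show 0 < s by linarith)
  have hGq := Real.Gamma_pos_of_pos hq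
  refine ⟨(Real.Gamma s)⁻¹ * C * Real.Gamma q * 4 ^ (2 * n + j), by positivity,
    fun ν lam ε hl hν hε u hu => ?_⟩
  have hu' : 0 < ‖u‖ := norm_pos_iff.2 hu
  set E := Real.exp (2 * ‖ν‖ * ‖u‖) with hE_def
  have hE : 0 < E := Real.exp_pos _
  set e := Real.exp (-(|lam| * ‖u‖ ^ 2 / 16)) with he_def
  have he : 0 < e := Real.exp_pos _
  set D := C * e / E with hD
  have hD0 : 0 < D := by positivity
  set b := ‖u‖ ^ 2 / 16 with hb_def
  have hb0 : 0 < b := by positivity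
  obtain ⟨hi1, hi2⟩ := integrableOn_rpow_mul_exp_neg_div hb0 hq
  have hpt : ∀ t : ℝ, 0 < t →
      ‖((t ^ (s - 1) : ℝ) : ℂ) * monomial lam w (heatKernel ν lam (t + ε)) u‖ₑ ≤
        ENNReal.ofReal (D * ((t + ε) ^ (-q - 1) * Real.exp (-(b / (t + ε))))) := by
    intro t ht
    rw [← ofReal_norm]
    refine ENNReal.ofReal_le_ofReal ?_
    have htε : 0 < t + ε := by positivity
    have h1 := hb ν lam (t + ε) hl hν htε u
    have h2 : Real.exp (-(|lam| * (t + ε) / 2)) ≤ 1 :=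
      Real.exp_le_one_iff.2 (by simp only [Left.neg_nonpos_iff]; positivity)
    have h3 : Real.exp (-(‖u‖ ^ 2 / (16 * (t + ε)))) = Real.exp (-(b / (t + ε))) := by
      rw [hb_def]; congr 2; field_simp
    rw [h3, inv_sqrt_pow htε] at h1
    -- For `s ≥ 1` the majorant depends on `t + ε` only, so shifting the variable makes the bound
    -- uniform in `ε`.
    have h4 : t ^ (s - 1) ≤ (t + ε) ^ (s - 1) :=
      Real.rpow_le_rpow ht.le (by linarith) (by linarith)
    rw [norm_mul, Complex.norm_real, Real.norm_of_nonneg (by positivity), hD, div_mul_eq_mul_div,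
      le_div_iff₀ hE, mul_assoc]
    calc t ^ (s - 1) * (‖monomial lam w (heatKernel ν lam (t + ε)) u‖ * E) ≤
        (t + ε) ^ (s - 1) * (C * (t + ε) ^ (-(((2 * n + w.length : ℕ) : ℝ) / 2)) * 1 * e *
          Real.exp (-(b / (t + ε)))) := by
          refine mul_le_mul h4 (h1.trans ?_) (by positivity) (by positivity)
          gcongr
      _ = C * e * ((t + ε) ^ (s - 1) * (t + ε) ^ (-(((2 * n + w.length : ℕ) : ℝ) / 2)) *
          Real.exp (-(b / (t + ε)))) := by ring
      _ = C * e * ((t + ε) ^ (-q - 1) * Real.exp (-(b / (t + ε)))) := by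
          rw [← Real.rpow_add htε]
          congr 3
          push_cast
          rw [hj, hq_def]; ring
  have hint : ‖∫ t in Ioi (0 : ℝ), ((t ^ (s - 1) : ℝ) : ℂ) *
      monomial lam w (heatKernel ν lam (t + ε)) u‖ ≤ D * ((1 / b) ^ q * Real.Gamma q) := by
    rw [← ENNReal.ofReal_le_ofReal_iff (by positivity), ofReal_norm]
    refine (enorm_integral_le_lintegral_enorm _).trans ?_
    refine (setLIntegral_mono' measurableSet_Ioi fun t ht => hpt t ht).trans ?_
    refine (lintegral_comp_add_le hε fun t =>
      ENNReal.ofReal (D * (t ^ (-q - 1) * Real.exp (-(b / t))))).trans ?_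
    rw [← ofReal_integral_eq_lintegral_ofReal (hi1.const_mul D), integral_const_mul, hi2]
    refine (ae_restrict_iff' measurableSet_Ioi).2 (Eventually.of_forall fun t ht => ?_)
    have ht : 0 < t := ht
    positivity
  have hpow : (1 / b) ^ q = 4 ^ (2 * n + j) * ‖u‖⁻¹ ^ (2 * n + j) := by
    have h1 : 1 / b = (4 * ‖u‖⁻¹) ^ (2 : ℝ) := by
      rw [hb_def, Real.rpow_ofNat]; field_simp; norm_num
    rw [h1, ← Real.rpow_mul (by positivity), ← mul_pow, ← Real.rpow_natCast]
    congr 1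
    push_cast
    rw [hq_def]; ring
  unfold powerKernel
  rw [norm_mul, Complex.norm_real, Real.norm_of_nonneg (by positivity)]
  calc _ ≤ (Real.Gamma s)⁻¹ * (D * ((1 / b) ^ q * Real.Gamma q)) * E := by gcongr
    _ = _ := by
      rw [hpow, hD]
      field_simp

end

section

variable {n : ℕ}

/-! ### Local Calderón–Zygmund estimates for twisted convolution kernels -/

lemma setLIntegral_enorm_driftMeasure_le {ν : Space n} {S : Set (Space n)} (hS : MeasurableSet S)
    {F : Space n → ℂ} {g : Space n → ℝ} (hg : Integrable g) (hg0 : ∀ u, 0 ≤ g u) (a : Space n)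
    {D : ℝ} (hD : 0 ≤ D) (h : ∀ z ∈ S, dens ν z * ‖F z‖ ≤ D * g (z - a)) :
    ∫⁻ z in S, ‖F z‖ₑ ∂(driftMeasure ν) ≤ ENNReal.ofReal (D * ∫ u, g u) := by
  rw [setLIntegral_driftMeasure ν hS]
  calc _ ≤ ∫⁻ z in S, ENNReal.ofReal (D * g (z - a)) := by
        refine setLIntegral_mono' hS fun z hz => ?_
        rw [← ofReal_norm, ← ENNReal.ofReal_mul (dens_pos ν z).le]
        exact ENNReal.ofReal_le_ofReal (h z hz)
    _ ≤ ∫⁻ z, ENNReal.ofReal (D * g (z - a)) := setLIntegral_le_lintegral _ _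
    _ = ∫⁻ z, ENNReal.ofReal (D * g z) :=
        lintegral_sub_right_eq_self (fun z => ENNReal.ofReal (D * g z)) a
    _ = _ := by
        rw [← integral_const_mul, ofReal_integral_eq_lintegral_ofReal (hg.const_mul D)]
        exact Eventually.of_forall fun z => mul_nonneg hD (hg0 z)

/-- Size and smoothness of the convolution kernel of a Riesz transform. -/
structure IsRieszKernel (ν : Space n) (lam C : ℝ) (κ : Space n → ℂ) : Prop where
  differentiable : Differentiable ℝ κ
  size : ∀ u, u ≠ 0 → ‖κ u‖ * Real.exp (2 * ‖ν‖ * ‖u‖) ≤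
    C * ‖u‖⁻¹ ^ (2 * n) * Real.exp (-(|lam| * ‖u‖ ^ 2 / 16))
  size_field : ∀ i u, u ≠ 0 → ‖field lam i κ u‖ * Real.exp (2 * ‖ν‖ * ‖u‖) ≤
    C * ‖u‖⁻¹ ^ (2 * n + 1) * Real.exp (-(|lam| * ‖u‖ ^ 2 / 16))

section RieszKernel

variable {ν : Space n} {lam C : ℝ} {κ : Space n → ℂ}

/-- The twist completes the ordinary derivative along `h` to a combination of the fields, leaving
only a zeroth order term with coefficient `iλ ⟨rot (u - θh), h⟩`. -/
lemma hasDerivAt_mul_twist (lam : ℝ) (hκ : Differentiable ℝ κ) (u h : Space n) (θ : ℝ) :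
    HasDerivAt (fun θ : ℝ => κ (u - θ • h) * twist lam u (θ • h))
      (twist lam u (θ • h) * (Complex.I * lam * (inner ℝ (rot (u - θ • h)) h : ℝ) * κ (u - θ • h) -
        ∑ i, (h i : ℂ) * field lam i κ (u - θ • h))) θ := by
  have h1 : HasDerivAt (fun θ : ℝ => u - θ • h) (-h) θ := by
    simpa using ((hasDerivAt_id θ).smul_const h).const_sub u
  have h2 := (hκ (u - θ • h)).hasFDerivAt.comp_hasDerivAt θ h1
  have h3 : HasDerivAt (fun θ : ℝ => twist lam u (θ • h))
      (twist lam u (θ • h) * (((lam / 2 * inner ℝ (rot u) h : ℝ) : ℂ) * Complex.I)) θ := by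
    have h4 : HasDerivAt (fun θ : ℝ => lam / 2 * inner ℝ (rot u) (θ • h))
        (lam / 2 * inner ℝ (rot u) h) θ := by
      simp only [inner_smul_right]
      simpa using ((hasDerivAt_id θ).mul_const (inner ℝ (rot u) h)).const_mul (lam / 2)
    exact (h4.ofReal_comp.mul_const Complex.I).cexp
  have h5 : inner ℝ (rot u) h = inner ℝ (rot (u - θ • h)) h := by
    rw [map_sub, map_smul, inner_sub_left, inner_smul_left, inner_rot_self]; simp
  have h6 : ∑ i, (h i : ℂ) * field lam i κ (u - θ • h) = fderiv ℝ κ (u - θ • h) h +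
      Complex.I * lam / 2 * (inner ℝ (rot (u - θ • h)) h : ℝ) * κ (u - θ • h) := by
    rw [fderiv_apply_eq_sum, inner_eq_sum, Complex.ofReal_sum, Finset.mul_sum, Finset.sum_mul,
      ← Finset.sum_add_distrib]
    refine Finset.sum_congr rfl fun i _ => ?_
    rw [field_eq, Complex.real_smul]
    push_cast; ring
  refine (h2.mul h3).congr_deriv ?_
  rw [h6, h5, map_neg]
  simp only [Function.comp_apply]
  push_cast; ring

lemma mul_exp_neg_div_le (x : ℝ) : x * Real.exp (-(x / 16)) ≤ 16 := by
  have h := Real.add_one_le_exp (x / 16)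
  rw [Real.exp_neg, ← div_eq_mul_inv, div_le_iff₀ (Real.exp_pos _)]
  linarith

/-- Mean value inequality on the segment, along which the argument has norm at least `‖u‖/2`. The
zeroth order term carries the factor `|λ|‖v‖`; the Gaussian bounds `|λ|‖v‖²` by `16`, so this term
is no larger than a derivative of the kernel. -/
lemma IsRieszKernel.norm_sub_le (hκ : IsRieszKernel ν lam C κ) (hC : 0 ≤ C) {K r : ℝ}
    {u h : Space n} (hh : ‖h‖ ≤ r) (hr : 0 < r) (hu : 2 * r ≤ ‖u‖) (hK : ‖ν‖ * r ≤ K) :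
    ‖κ (u - h) * twist lam u h - κ u‖ * Real.exp (2 * ‖ν‖ * ‖u‖) ≤
      C * (2 * n + 16) * 2 ^ (2 * n + 1) * Real.exp (2 * K) * r * ‖u‖⁻¹ ^ (2 * n + 1) := by
  have hu0 : 0 < ‖u‖ := by linarith
  set E := Real.exp (2 * ‖ν‖ * ‖u‖) with hE_def
  have hE : 0 < E := Real.exp_pos _
  have key := norm_image_sub_le_of_norm_deriv_le_segment_01'
    (C := (C * (2 * n + 16) * 2 ^ (2 * n + 1) * Real.exp (2 * K) * r * ‖u‖⁻¹ ^ (2 * n + 1)) / E)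
    (fun θ _ => (hasDerivAt_mul_twist lam hκ.differentiable u h θ).hasDerivWithinAt) ?_
  · simp only [one_smul, zero_smul, sub_zero, twist_zero_right, mul_one] at key
    rwa [le_div_iff₀ hE] at key
  intro θ hθ
  set v := u - θ • h with hv_def
  have hθh : ‖θ • h‖ ≤ r := by
    rw [norm_smul, Real.norm_of_nonneg hθ.1]
    exact (mul_le_of_le_one_left (norm_nonneg _) hθ.2.le).trans hh
  have huv : ‖u‖ ≤ ‖v‖ + r := by
    have : ‖u‖ ≤ ‖v‖ + ‖θ • h‖ := by simpa [hv_def] using norm_add_le v (θ • h)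
    linarith
  have hv : ‖u‖ / 2 ≤ ‖v‖ := by linarith
  have hv0 : 0 < ‖v‖ := by linarith
  have hvne : v ≠ 0 := norm_pos_iff.1 hv0
  -- Moving the argument by at most `r` changes the exponential weight by a factor of at most
  -- `e^{2K}`.
  have hEv : E ≤ Real.exp (2 * K) * Real.exp (2 * ‖ν‖ * ‖v‖) := by
    rw [hE_def, ← Real.exp_add, Real.exp_le_exp]
    have := mul_le_mul_of_nonneg_left huv (norm_nonneg ν)
    linarith
  have hinv : ‖v‖⁻¹ ^ (2 * n + 1) ≤ 2 ^ (2 * n + 1) * ‖u‖⁻¹ ^ (2 * n + 1) := by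
    rw [← mul_pow]
    refine pow_le_pow_left₀ (by positivity) ?_ _
    rw [← div_eq_mul_inv, inv_le_comm₀ hv0 (by positivity), inv_div]
    exact hv
  set e := Real.exp (-(|lam| * ‖v‖ ^ 2 / 16)) with he_def
  have he1 : e ≤ 1 := Real.exp_le_one_iff.2 (by simp only [Left.neg_nonpos_iff]; positivity)
  have hsum : ‖∑ i, (h i : ℂ) * field lam i κ v‖ * Real.exp (2 * ‖ν‖ * ‖v‖) ≤
      2 * n * (r * (C * ‖v‖⁻¹ ^ (2 * n + 1))) := by
    calc _ ≤ (∑ i, ‖(h i : ℂ) * field lam i κ v‖) * Real.exp (2 * ‖ν‖ * ‖v‖) := by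
          gcongr; exact norm_sum_le _ _
      _ ≤ ∑ _i : Fin n ⊕ Fin n, r * (C * ‖v‖⁻¹ ^ (2 * n + 1)) := by
          rw [Finset.sum_mul]
          refine Finset.sum_le_sum fun i _ => ?_
          rw [norm_mul, Complex.norm_real, Real.norm_eq_abs, mul_assoc]
          refine mul_le_mul ((abs_apply_le_norm h i).trans hh)
            ((hκ.size_field i v hvne).trans ?_) (by positivity) hr.le
          exact mul_le_of_le_one_right (by positivity) he1
      _ = _ := by
          rw [Finset.sum_const, Finset.card_univ, Fintype.card_sum, Fintype.card_fin, nsmul_eq_mul]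
          push_cast; ring
  have hzero : ‖Complex.I * lam * (inner ℝ (rot v) h : ℝ) * κ v‖ * Real.exp (2 * ‖ν‖ * ‖v‖) ≤
      16 * (r * (C * ‖v‖⁻¹ ^ (2 * n + 1))) := by
    rw [norm_mul, norm_mul, norm_mul, Complex.norm_I, Complex.norm_real, Complex.norm_real, one_mul,
      Real.norm_eq_abs, Real.norm_eq_abs, mul_assoc]
    have h1 : |inner ℝ (rot v) h| ≤ ‖v‖ * r :=
      (abs_inner_rot_le v h).trans (mul_le_mul_of_nonneg_left hh (norm_nonneg _))
    calc _ ≤ |lam| * (‖v‖ * r) * (C * ‖v‖⁻¹ ^ (2 * n) * e) := by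
          exact mul_le_mul (mul_le_mul_of_nonneg_left h1 (abs_nonneg _)) (hκ.size v hvne)
            (by positivity) (by positivity)
      _ = (|lam| * ‖v‖ ^ 2 * e) * (r * (C * ‖v‖⁻¹ ^ (2 * n + 1))) := by
          rw [pow_succ ‖v‖⁻¹, sq]
          have : ‖v‖ * ‖v‖⁻¹ = 1 := mul_inv_cancel₀ hv0.ne'
          linear_combination -(|lam| * ‖v‖ * r * C * ‖v‖⁻¹ ^ (2 * n) * e) * this
      _ ≤ _ := by
          gcongr
          exact mul_exp_neg_div_le _
  rw [le_div_iff₀ hE, norm_mul, norm_twist, one_mul]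
  calc _ ≤ (‖Complex.I * lam * (inner ℝ (rot v) h : ℝ) * κ v‖ + ‖∑ i, (h i : ℂ) * field lam i κ v‖) *
        (Real.exp (2 * K) * Real.exp (2 * ‖ν‖ * ‖v‖)) := by
        gcongr
        exact _root_.norm_sub_le _ _
    _ = Real.exp (2 * K) * (‖Complex.I * lam * (inner ℝ (rot v) h : ℝ) * κ v‖ *
          Real.exp (2 * ‖ν‖ * ‖v‖) +
        ‖∑ i, (h i : ℂ) * field lam i κ v‖ * Real.exp (2 * ‖ν‖ * ‖v‖)) := by ring
    _ ≤ Real.exp (2 * K) * (16 * (r * (C * ‖v‖⁻¹ ^ (2 * n + 1))) +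
        2 * n * (r * (C * ‖v‖⁻¹ ^ (2 * n + 1)))) := by gcongr
    _ ≤ Real.exp (2 * K) * (16 * (r * (C * (2 ^ (2 * n + 1) * ‖u‖⁻¹ ^ (2 * n + 1)))) +
        2 * n * (r * (C * (2 ^ (2 * n + 1) * ‖u‖⁻¹ ^ (2 * n + 1))))) := by gcongr
    _ = _ := by ring

lemma integrable_one_add_norm_space :
    Integrable fun u : Space n => (1 + ‖u‖)⁻¹ ^ (2 * n + 1) := by
  have h := integrable_one_add_norm (E := Space n) (μ := volume) (r := 2 * n + 1)
    (by rw [finrank_space]; push_cast; linarith)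
  refine h.congr (Eventually.of_forall fun u => ?_)
  simp only
  rw [Real.rpow_neg (by positivity), inv_pow]
  congr 1
  exact_mod_cast Real.rpow_natCast (1 + ‖u‖) (2 * n + 1)

/-- The integral of `(1 + |u|)^{-2n-1}`. -/
def decayConst (n : ℕ) : ℝ := ∫ u : Space n, (1 + ‖u‖)⁻¹ ^ (2 * n + 1)

lemma decayConst_nonneg : 0 ≤ decayConst n := integral_nonneg fun u => by positivity

/-- Covariance of the twisted convolution: after correction by the phase `conj (twist lam c w)`, the
difference at base point `c` is, up to a unimodular factor, the difference with base point zero. -/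
lemma twKernel_sub (lam : ℝ) (κ : Space n → ℂ) (z w c : Space n) :
    κ (z - w) * twist lam z w * conj (twist lam c w) - κ (z - c) * twist lam z c =
      twist lam (z - c) c *
        (κ (z - c - (w - c)) * twist lam (z - c) (w - c) - κ (z - c)) := by
  have h1 : twist lam z w * conj (twist lam c w) = twist lam (z - c) c * twist lam (z - c) (w - c) := by
    have : twist lam z w = twist lam (z - c) w * twist lam c w := by
      rw [← twist_add_left, sub_add_cancel]
    rw [this, mul_assoc, mul_comm (twist lam c w), conj_twist_mul_self, mul_one, ← twist_add_right,
      add_sub_cancel]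
  have h2 : twist lam z c = twist lam (z - c) c := by
    have : twist lam z c = twist lam (z - c) c * twist lam c c := by
      rw [← twist_add_left, sub_add_cancel]
    rw [this, twist_self, mul_one]
  rw [mul_assoc, h1, h2, sub_sub_sub_cancel_right]
  ring

lemma dens_mul_le (ν z c : Space n) :
    dens ν z ≤ dens ν c * Real.exp (2 * ‖ν‖ * ‖z - c‖) := by
  have := dens_le (ν := ν) (z := z) (w := c) le_rfl
  rw [mul_comm, ← mul_assoc] at this
  exact this

/-- The Calderón–Zygmund constant of a twisted convolution kernel. -/
def czConst (n : ℕ) (C K : ℝ) : ℝ :=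
  C * (8 * Real.pi) ^ n + C * (2 * n + 16) * 2 ^ (2 * n + 1) * Real.exp (2 * K) * Real.exp (2 * K) *
    2 ^ (2 * n + 1) * decayConst n

theorem IsRieszKernel.isLocalCZKernel (hκ : IsRieszKernel ν lam C κ) (hn : 1 ≤ n) (hl : lam ≠ 0)
    (hC : 0 ≤ C) {K : ℝ} (hK : ‖ν‖ * rad n (√|lam|)⁻¹ 0 ≤ K) :
    IsLocalCZKernel ν (√|lam|)⁻¹ (czConst n C K) (fun z w => κ (z - w) * twist lam z w)
      (fun c w => conj (twist lam c w)) := by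
  have hl' := abs_pos.2 hl
  have hn' : (1 : ℝ) ≤ n := by exact_mod_cast hn
  have hrpos : ∀ j, 0 < rad n (√|lam|)⁻¹ j := fun j => by unfold rad; positivity
  have hd0 := decayConst_nonneg (n := n)
  have hpi := Real.pi_pos
  refine ⟨?_, fun c => ?_, fun c w => ?_, fun c w hw => ?_, fun c w j hw => ?_⟩
  · exact ((hκ.differentiable.continuous.comp (continuous_fst.sub continuous_snd)).mul
      (continuous_twist lam)).measurable
  · exact (Complex.continuous_conj.comp (continuous_twist_right lam c)).measurable
  · rw [RCLike.norm_conj, norm_twist]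
  · set r := rad n (√|lam|)⁻¹ 0 with hr_def
    have hr : 0 < r := hrpos 0
    -- At the largest scale the Gaussian integral `(16π/|λ|)^n` times `r^{-2n}` is `(8π/n)^n`, which
    -- is free of `λ`.
    have hr2 : r ^ 2 = 2 * n / |lam| := by
      rw [hr_def, rad, pow_zero, div_one, mul_pow, inv_pow, Real.sq_sqrt (by positivity),
        Real.sq_sqrt hl'.le, div_eq_mul_inv]
    have hb : 0 < |lam| / 16 := by positivity
    refine (setLIntegral_enorm_driftMeasure_le (measurableSet_le measurable_const (by fun_prop))
      (integrable_gaussian_space hb) (fun u => (Real.exp_pos _).le) w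
      (D := C * r⁻¹ ^ (2 * n) * dens ν w)
      (mul_nonneg (by positivity) (dens_pos ν w).le) fun z hz => ?_).trans ?_
    · have hz : 2 * r ≤ ‖z - c‖ := hz
      have h1 : r ≤ ‖z - w‖ := by
        have : ‖z - c‖ ≤ ‖z - w‖ + ‖w - c‖ := by simpa using norm_add_le (z - w) (w - c)
        linarith
      have h0 : z - w ≠ 0 := norm_pos_iff.1 (hr.trans_le h1)
      have h2 := hκ.size _ h0
      have hdw := dens_pos ν w
      rw [norm_mul, norm_twist, mul_one]
      calc _ ≤ dens ν w * Real.exp (2 * ‖ν‖ * ‖z - w‖) * ‖κ (z - w)‖ := by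
            gcongr; exact dens_mul_le ν z w
        _ = dens ν w * (‖κ (z - w)‖ * Real.exp (2 * ‖ν‖ * ‖z - w‖)) := by ring
        _ ≤ dens ν w * (C * ‖z - w‖⁻¹ ^ (2 * n) * Real.exp (-(|lam| * ‖z - w‖ ^ 2 / 16))) := by
            gcongr
        _ ≤ dens ν w * (C * r⁻¹ ^ (2 * n) * Real.exp (-(|lam| * ‖z - w‖ ^ 2 / 16))) := by
            gcongr
        _ = _ := by
            rw [show -(|lam| * ‖z - w‖ ^ 2 / 16) = -(|lam| / 16) * ‖z - w‖ ^ 2 by ring]; ring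
    · refine ENNReal.ofReal_le_ofReal ?_
      rw [integral_gaussian_space hb]
      have h1 : r⁻¹ ^ (2 * n) * (Real.pi / (|lam| / 16)) ^ n ≤ (8 * Real.pi) ^ n := by
        rw [pow_mul, inv_pow, hr2, ← mul_pow]
        refine pow_le_pow_left₀ (by positivity) ?_ n
        rw [show (2 * n / |lam|)⁻¹ * (Real.pi / (|lam| / 16)) = 8 * Real.pi / n by
          field_simp; norm_num]
        exact div_le_self (by positivity) hn'
      have hdw := dens_pos ν w
      calc _ = C * (r⁻¹ ^ (2 * n) * (Real.pi / (|lam| / 16)) ^ n) * dens ν w := by ring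
        _ ≤ C * (8 * Real.pi) ^ n * dens ν w := by gcongr
        _ ≤ _ := by
          unfold czConst
          gcongr
          exact le_add_of_nonneg_right (by positivity)
  · set r := rad n (√|lam|)⁻¹ j with hr_def
    have hr : 0 < r := hrpos j
    have hrj : r ≤ rad n (√|lam|)⁻¹ 0 := by
      rw [hr_def]; unfold rad
      gcongr
      · norm_num
      · omega
    have hKr : ‖ν‖ * r ≤ K := (mul_le_mul_of_nonneg_left hrj (norm_nonneg _)).trans hK
    set B := C * (2 * n + 16) * 2 ^ (2 * n + 1) * Real.exp (2 * K) with hB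
    have hB0 : 0 ≤ B := by positivity
    have hdw := dens_pos ν w
    have hdc := dens_pos ν c
    refine (setLIntegral_enorm_driftMeasure_le (measurableSet_le measurable_const (by fun_prop))
      (g := fun u => (1 + ‖r⁻¹ • u‖)⁻¹ ^ (2 * n + 1))
      ((integrable_comp_smul_iff volume _ (inv_ne_zero hr.ne')).2 integrable_one_add_norm_space)
      (fun u => by positivity) c
      (D := dens ν c * (B * r * (2 ^ (2 * n + 1) * r⁻¹ ^ (2 * n + 1))))
      (mul_nonneg hdc.le (by positivity)) fun z hz => ?_).trans ?_
    · have hz : 2 * r ≤ ‖z - c‖ := hz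
      have h1 := hκ.norm_sub_le hC hw hr hz hKr
      have hzpos : 0 < ‖z - c‖ := by linarith
      -- Since `‖z - c‖ ≥ r`, the kernel is dominated by a rescaled integrable profile. Its integral
      -- restores `r^{2n}`, and the powers of `r` cancel.
      have h2 : ‖z - c‖⁻¹ ^ (2 * n + 1) ≤
          2 ^ (2 * n + 1) * r⁻¹ ^ (2 * n + 1) * (1 + ‖r⁻¹ • (z - c)‖)⁻¹ ^ (2 * n + 1) := by
        rw [← mul_pow, ← mul_pow]
        refine pow_le_pow_left₀ (by positivity) ?_ _
        rw [norm_smul, norm_inv, Real.norm_of_nonneg hr.le]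
        rw [show 2 * r⁻¹ * (1 + r⁻¹ * ‖z - c‖)⁻¹ = ((r + ‖z - c‖) / 2)⁻¹ by field_simp]
        refine inv_anti₀ (by positivity) ?_
        linarith
      rw [twKernel_sub, norm_mul, norm_twist, one_mul]
      set d := ‖κ (z - c - (w - c)) * twist lam (z - c) (w - c) - κ (z - c)‖
      calc _ ≤ dens ν c * Real.exp (2 * ‖ν‖ * ‖z - c‖) * d := by
            gcongr; exact dens_mul_le ν z c
        _ = dens ν c * (d * Real.exp (2 * ‖ν‖ * ‖z - c‖)) := by ring
        _ ≤ dens ν c * (B * r * ‖z - c‖⁻¹ ^ (2 * n + 1)) := by gcongr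
        _ ≤ dens ν c * (B * r * (2 ^ (2 * n + 1) * r⁻¹ ^ (2 * n + 1) *
              (1 + ‖r⁻¹ • (z - c)‖)⁻¹ ^ (2 * n + 1))) := by gcongr
        _ = _ := by ring
    · refine ENNReal.ofReal_le_ofReal ?_
      rw [Measure.integral_comp_inv_smul_of_nonneg volume
        (fun u : Space n => (1 + ‖u‖)⁻¹ ^ (2 * n + 1)) hr.le, finrank_space, smul_eq_mul]
      change _ * (r ^ (2 * n) * decayConst n) ≤ _
      have h1 : dens ν c ≤ Real.exp (2 * K) * dens ν w := dens_le (by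
        rw [norm_sub_rev]
        exact (mul_le_mul_of_nonneg_left hw (norm_nonneg _)).trans hKr)
      have h2 : r * r⁻¹ ^ (2 * n + 1) * r ^ (2 * n) = 1 := by
        rw [inv_pow, pow_succ]; field_simp
      calc _ = dens ν c * (B * 2 ^ (2 * n + 1) * decayConst n) *
            (r * r⁻¹ ^ (2 * n + 1) * r ^ (2 * n)) := by ring
        _ = dens ν c * (B * 2 ^ (2 * n + 1) * decayConst n) := by rw [h2, mul_one]
        _ ≤ Real.exp (2 * K) * dens ν w * (B * 2 ^ (2 * n + 1) * decayConst n) := by gcongr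
        _ = B * Real.exp (2 * K) * 2 ^ (2 * n + 1) * decayConst n * dens ν w := by ring
        _ ≤ _ := by
          unfold czConst
          gcongr
          exact le_add_of_nonneg_left (by positivity)

end RieszKernel

end

section

variable {n : ℕ}

/-! ### Weak type estimates for the Riesz transforms -/

/-- Words of length `2s` have homogeneity `-2n`, and one further letter gives the gradient bound of
homogeneity `-2n - 1`. -/
theorem exists_isRieszKernel (hn : 1 ≤ n) {M : ℝ} (hM : 0 < M) (w : List (Fin n ⊕ Fin n))
    (hw : 2 ≤ w.length) :
    ∃ C : ℝ, 0 < C ∧ ∀ (ν : Space n) (lam ε : ℝ), lam ≠ 0 → M * ‖ν‖ ^ 2 ≤ |lam| → 0 < ε →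
      IsRieszKernel ν lam C (powerKernel ν lam (w.length / 2) ε w) := by
  have hw' : (2 : ℝ) ≤ w.length := by exact_mod_cast hw
  have hs : (1 : ℝ) ≤ w.length / 2 := by linarith
  obtain ⟨C₀, hC₀, h₀⟩ := exists_powerKernel_le hn hM w (j := 0) hs (by simp; ring)
  choose C₁ hC₁ h₁ using fun i => exists_powerKernel_le hn hM (i :: w) (j := 1) hs
    (by simp; ring)
  have hsum : 0 ≤ ∑ i, C₁ i := Finset.sum_nonneg fun i _ => (hC₁ i).le
  refine ⟨C₀ + ∑ i, C₁ i, by positivity, fun ν lam ε hl hν hε => ?_⟩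
  obtain ⟨hd, hf⟩ := field_powerKernel hn ν hl (zero_lt_one.trans_le hs) hε w
  refine ⟨hd, fun u hu => (h₀ ν lam ε hl hν hε u hu).trans ?_, fun i u hu => ?_⟩
  · rw [add_zero]
    gcongr
    linarith
  · rw [hf i]
    refine (h₁ i ν lam ε hl hν hε u hu).trans ?_
    gcongr
    have := Finset.single_le_sum (fun i _ => (hC₁ i).le) (Finset.mem_univ i)
    linarith

lemma czConst_nonneg {C K : ℝ} (hC : 0 ≤ C) : 0 ≤ czConst n C K := by
  have := decayConst_nonneg (n := n)
  have := Real.pi_pos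
  unfold czConst
  positivity

lemma IsLocalCZKernel.mono {ν : Space n} {s A A' : ℝ} {N m : Space n → Space n → ℂ}
    (h : IsLocalCZKernel ν s A N m) (hA : A ≤ A') : IsLocalCZKernel ν s A' N m where
  meas := h.meas
  meas_mod := h.meas_mod
  norm_mod := h.norm_mod
  far c w hw := (h.far c w hw).trans
    (ENNReal.ofReal_le_ofReal (mul_le_mul_of_nonneg_right hA (dens_pos ν w).le))
  near c w j hw := (h.near c w j hw).trans
    (ENNReal.ofReal_le_ofReal (mul_le_mul_of_nonneg_right hA (dens_pos ν w).le))

/-- At the scale `|λ|^{-1/2}` the oscillation of the exponent of the density is bounded in terms of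
`M` and `n` alone. -/
lemma norm_mul_rad_le {ν : Space n} {lam M : ℝ} (hM : 0 < M) (hl : lam ≠ 0)
    (hν : M * ‖ν‖ ^ 2 ≤ |lam|) : ‖ν‖ * rad n (√|lam|)⁻¹ 0 ≤ √(2 * n) * (√M)⁻¹ := by
  have hl' := abs_pos.2 hl
  have h1 : √M * ‖ν‖ ≤ √|lam| := by
    refine Real.le_sqrt_of_sq_le ?_
    rwa [mul_pow, Real.sq_sqrt hM.le]
  have h2 : ‖ν‖ * (√|lam|)⁻¹ ≤ (√M)⁻¹ := by
    have hsM := Real.sqrt_pos.2 hM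
    have hsl := Real.sqrt_pos.2 hl'
    rw [← div_eq_mul_inv, div_le_iff₀ hsl, inv_mul_eq_div, le_div_iff₀ hsM]
    linarith
  unfold rad
  rw [pow_zero, div_one]
  calc _ = √(2 * n) * (‖ν‖ * (√|lam|)⁻¹) := by ring
    _ ≤ _ := by gcongr

lemma twOp_toLp_ae_eq {ν : Space n} {lam : ℝ} {κ : Space n → ℂ} (hl : lam ≠ 0)
    (hκ : HasGaussianBounds ν lam κ) {f : Space n → ℂ} (hf : MemLp f 2 (driftMeasure ν)) :
    twOp ν lam κ (hf.toLp f) =ᵐ[driftMeasure ν] twConv lam κ f := by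
  have h1 := hf.coeFn_toLp
  rw [ae_driftMeasure_eq] at h1 ⊢
  rw [← twConv_congr h1]
  exact twOp_ae_eq ν lam hκ.continuous (hκ.mass_ne_top hl) _

theorem exists_weakType_powerKernel (hn : 1 ≤ n) {M : ℝ} (hM : 0 < M) (w : List (Fin n ⊕ Fin n))
    (hw : 2 ≤ w.length) :
    ∃ C : ℝ, 0 < C ∧ ∀ (ν : Space n) (lam ε : ℝ), ν ≠ 0 → lam ≠ 0 → M * ‖ν‖ ^ 2 ≤ |lam| → 0 < ε →
      ∀ (f : Space n → ℂ) (_ : MemLp f 1 (driftMeasure ν)) (hf : MemLp f 2 (driftMeasure ν)) (a : ℝ),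
        0 < a → ENNReal.ofReal a * driftMeasure ν
          {z | a < ‖twOp ν lam (powerKernel ν lam (w.length / 2) ε w) (hf.toLp f) z‖} ≤
            ENNReal.ofReal C * ∫⁻ z, ‖f z‖ₑ ∂(driftMeasure ν) := by
  obtain ⟨C, hC, hK⟩ := exists_isRieszKernel hn hM w hw
  have hw0 : 0 < (w.length : ℝ) / 2 := by
    have : (2 : ℝ) ≤ w.length := by exact_mod_cast hw
    linarith
  set K := √(2 * n) * (√M)⁻¹ with hK_def
  have hK0 : 0 ≤ K := by positivity
  have hwc := wordConst_pos n 0 w.length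
  have hcz := czConst_nonneg (n := n) (K := K) hC.le
  set A := czConst n C K + wordConst n 0 w.length with hA
  have hA0 : 0 < A := by positivity
  refine ⟨4 * A * 2 ^ (2 * n) * Real.exp (4 * K) +
    Real.exp (6 * K) * (2 * √(2 * n)) ^ (2 * n) * volume.real (Metric.ball (0 : Space n) 1) +
    2 * A * (1 + Real.exp (4 * K)), by positivity, fun ν lam ε hν0 hl hν hε f hf1 hf2 a ha => ?_⟩
  set κ := powerKernel ν lam (w.length / 2) ε w with hκ_def
  have hrad := norm_mul_rad_le hM hl hν
  have hG : HasGaussianBounds ν lam κ := hasGaussianBounds_powerKernel hn ν hl hw0 hε w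
  have hN := ((hK ν lam ε hl hν hε).isLocalCZKernel hn hl hC.le hrad).mono
    (show czConst n C K ≤ A by linarith)
  have hs : 0 < (√|lam|)⁻¹ := by have := abs_pos.2 hl; positivity
  have hset : driftMeasure ν {z | a < ‖twOp ν lam κ (hf2.toLp f) z‖} =
      driftMeasure ν {z | a < ‖∫ w, κ (z - w) * twist lam z w * f w‖} := by
    refine measure_congr ?_
    filter_upwards [twOp_toLp_ae_eq hl hG hf2] with z hz
    change (a < ‖twOp ν lam κ (hf2.toLp f) z‖) = (a < ‖twConv lam κ f z‖)
    rw [hz]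
  rw [hset]
  refine hN.weakType hn hs hA0.le hrad hK0 (fun h hh => ?_) (fun h hh => ?_) hf1 hf2 ha
  · rw [ae_driftMeasure_eq]
    exact ae_integrable_twConv hG.continuous (hG.mass_ne_top hl) lam hh
  · have h1 : ∫⁻ z, ‖twConv lam κ h z‖ₑ ^ 2 ∂(driftMeasure ν) =
        ENNReal.ofReal (‖twOp ν lam κ (hh.toLp h)‖ ^ 2) := by
      rw [norm_sq_eq_lintegral]
      exact lintegral_congr_ae ((twOp_toLp_ae_eq hl hG hh).mono fun z hz => by simp only [hz])
    have h2 : ∫⁻ z, ‖h z‖ₑ ^ 2 ∂(driftMeasure ν) = ENNReal.ofReal (‖hh.toLp h‖ ^ 2) := by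
      rw [norm_sq_eq_lintegral]
      exact lintegral_congr_ae (hh.coeFn_toLp.mono fun z hz => by simp only [hz])
    change ∫⁻ z, ‖twConv lam κ h z‖ₑ ^ 2 ∂(driftMeasure ν) ≤ _
    rw [h1, h2, ← ENNReal.ofReal_mul hA0.le]
    refine ENNReal.ofReal_le_ofReal ((norm_twOp_powerKernel_le hn hν0 hl w hw0 hε _).trans ?_)
    gcongr
    linarith

/-- The intersection of `L¹` and `L²`, as a subspace of `L¹`. -/
def integrableL2 (ν : Space n) : Submodule ℂ (Lp ℂ 1 (driftMeasure ν)) where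
  carrier := {f | MemLp f 2 (driftMeasure ν)}
  add_mem' {f g} hf hg := (hf.add hg).ae_eq (Lp.coeFn_add f g).symm
  zero_mem' := (MemLp.zero : MemLp (0 : Space n → ℂ) 2 (driftMeasure ν)).ae_eq (Lp.coeFn_zero _ _ _).symm
  smul_mem' c f hf := (MemLp.const_smul hf c).ae_eq (Lp.coeFn_smul c f).symm

lemma dense_integrableL2 (ν : Space n) :
    Dense (integrableL2 ν : Set (Lp ℂ 1 (driftMeasure ν))) := by
  refine (Lp.simpleFunc.denseRange (E := ℂ) (μ := driftMeasure ν) ENNReal.one_ne_top).mono ?_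
  rintro _ ⟨f, rfl⟩
  have h1 := Lp.simpleFunc.memLp f
  rw [SimpleFunc.memLp_iff one_ne_zero ENNReal.one_ne_top] at h1
  exact ((SimpleFunc.memLp_iff two_ne_zero ENNReal.ofNat_ne_top).2 h1).ae_eq
    (Lp.simpleFunc.toSimpleFunc_eq_toFun f)

lemma memLp_two_of_integrableL2 {ν : Space n} (d : integrableL2 ν) :
    MemLp (d : Lp ℂ 1 (driftMeasure ν)) 2 (driftMeasure ν) := d.2

/-- The inclusion of `L¹ ∩ L²` into `L²`. -/
def integrableL2Incl (ν : Space n) : integrableL2 ν →ₗ[ℂ] L2 ν where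
  toFun d := (memLp_two_of_integrableL2 d).toLp _
  map_add' d e := (MemLp.toLp_congr _
    ((memLp_two_of_integrableL2 d).add (memLp_two_of_integrableL2 e)) (Lp.coeFn_add _ _)).trans
      (MemLp.toLp_add _ _)
  map_smul' c d := (MemLp.toLp_congr _ ((memLp_two_of_integrableL2 d).const_smul c)
    (Lp.coeFn_smul _ _)).trans (MemLp.toLp_const_smul _ _)

/-- The restriction of an operator on `L²` to `L¹ ∩ L²`. -/
def restrictIntegrable {ν : Space n} (T : L2 ν →L[ℂ] L2 ν) :
    integrableL2 ν →ₗ[ℂ] (Space n →ₘ[driftMeasure ν] ℂ) where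
  toFun d := (T (integrableL2Incl ν d) : L2 ν)
  map_add' d e := by rw [map_add, map_add]; rfl
  map_smul' c d := by rw [map_smul, map_smul]; rfl

lemma ofReal_norm_L1 {ν : Space n} (f : Lp ℂ 1 (driftMeasure ν)) :
    ENNReal.ofReal ‖f‖ = ∫⁻ z, ‖f z‖ₑ ∂(driftMeasure ν) := by
  rw [Lp.norm_def, ENNReal.ofReal_toReal (Lp.eLpNorm_ne_top f), eLpNorm_one_eq_lintegral_enorm]

/-- The Riesz transforms are of weak type `(1, 1)`. -/
theorem exists_weakType_riesz (hn : 1 ≤ n) {M : ℝ} (hM : 0 < M) (w : List (Fin n ⊕ Fin n))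
    (hw : 2 ≤ w.length) :
    ∃ C : ℝ, 0 < C ∧ ∀ (lam : ℝ) (ν : Space n), ν ≠ 0 → lam ≠ 0 → M * ‖ν‖ ^ 2 ≤ |lam| →
      ∃ R : Lp ℂ 1 (driftMeasure ν) →ₗ[ℂ] (Space n →ₘ[driftMeasure ν] ℂ),
        (∀ (f : Space n → ℂ) (hf₁ : MemLp f 1 (driftMeasure ν)) (hf₂ : MemLp f 2 (driftMeasure ν)),
          IsRieszTransform ν lam w (hf₂.toLp f) (R (hf₁.toLp f))) ∧
        ∀ (f : Lp ℂ 1 (driftMeasure ν)) (a : ℝ), 0 < a →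
          ENNReal.ofReal a * driftMeasure ν {z | a < ‖R f z‖} ≤
            ENNReal.ofReal C * ∫⁻ z, ‖f z‖ₑ ∂(driftMeasure ν) := by
  obtain ⟨C, hC, hweak⟩ := exists_weakType_powerKernel hn hM w hw
  have hw0 : 0 < (w.length : ℝ) / 2 := by
    have : (2 : ℝ) ≤ w.length := by exact_mod_cast hw
    linarith
  refine ⟨C, hC, fun lam ν hν0 hl hν => ?_⟩
  obtain ⟨T, hT, hTR⟩ := exists_rieszOp hn hν0 hl w hw0
  obtain ⟨R, hR1, hR2⟩ := exists_extension_of_weakType (R₀ := restrictIntegrable T) (C := C)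
    (dense_integrableL2 ν) hC.le (fun d a ha => by
      -- Convergence in `L²` gives a subsequence converging almost everywhere, along which the
      -- uniform weak bound passes to the limit.
      obtain ⟨ns, -, hns⟩ := (tendstoInMeasure_of_tendsto_Lp
        (hT (integrableL2Incl ν d))).exists_seq_tendsto_ae
      change ENNReal.ofReal a * driftMeasure ν {z | a < ‖T (integrableL2Incl ν d) z‖} ≤ _
      have ha0 : ENNReal.ofReal a ≠ 0 := (ENNReal.ofReal_pos.2 ha).ne'
      rw [mul_comm, ← ENNReal.le_div_iff_mul_le (Or.inl ha0) (Or.inl ENNReal.ofReal_ne_top)]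
      refine measure_lt_norm_le_of_tendsto hns tendsto_const_nhds fun j => ?_
      rw [ENNReal.le_div_iff_mul_le (Or.inl ha0) (Or.inl ENNReal.ofReal_ne_top), mul_comm,
        ENNReal.ofReal_mul hC.le, Submodule.coe_norm, ofReal_norm_L1]
      exact hweak ν lam _ hν0 hl hν (by positivity) _ (Lp.memLp _) d.2 a ha)
  refine ⟨R, fun f hf₁ hf₂ => hTR _ _ ?_, fun f a ha => (hR2 f a ha).trans_eq ?_⟩
  · have h1 : MemLp (hf₁.toLp f) 2 (driftMeasure ν) := hf₂.ae_eq hf₁.coeFn_toLp.symm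
    have h2 : R (hf₁.toLp f) = restrictIntegrable T ⟨hf₁.toLp f, h1⟩ := hR1 ⟨hf₁.toLp f, h1⟩
    have h3 : h1.toLp (hf₁.toLp f) = hf₂.toLp f := MemLp.toLp_congr _ _ hf₁.coeFn_toLp
    rw [h2]
    change (T (h1.toLp (hf₁.toLp f)) : Space n → ℂ) =ᵐ[volume] _
    rw [h3]
  · rw [ENNReal.ofReal_mul hC.le, ofReal_norm_L1]

end

end TwistedDrift

end

/-! ### The theorem, with a constant common to all words of length `k`. -/

theorem theorem1p8 (n k : ℕ) (hk : 3 ≤ k) (M : ℝ) (hM : 0 < M) :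
    ∃ C : ℝ, 0 < C ∧
      ∀ (lam : ℝ) (ν : TwistedDrift.Space n), ν ≠ 0 → M ≤ |lam| / ‖ν‖ ^ 2 →
      ∀ w : List (Fin n ⊕ Fin n), w.length = k →
        ∃ R : Lp ℂ 1 (TwistedDrift.driftMeasure ν) →ₗ[ℂ]
            (TwistedDrift.Space n →ₘ[TwistedDrift.driftMeasure ν] ℂ),
          (∀ (f : TwistedDrift.Space n → ℂ)
            (hf₁ : MemLp f 1 (TwistedDrift.driftMeasure ν))
            (hf₂ : MemLp f 2 (TwistedDrift.driftMeasure ν)),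
            TwistedDrift.IsRieszTransform ν lam w (hf₂.toLp f) (R (hf₁.toLp f))) ∧
          ∀ (f : Lp ℂ 1 (TwistedDrift.driftMeasure ν)) (α : ℝ), 0 < α →
            ENNReal.ofReal α * TwistedDrift.driftMeasure ν {z | α < ‖R f z‖} ≤
              ENNReal.ofReal C * ∫⁻ z, ‖f z‖ₑ ∂(TwistedDrift.driftMeasure ν) := by
  rcases Nat.eq_zero_or_pos n with rfl | hn
  · exact ⟨1, one_pos, fun lam ν hν => absurd (Subsingleton.elim ν 0) hν⟩
  have hfin : {w : List (Fin n ⊕ Fin n) | w.length = k}.Finite := List.finite_length_eq _ k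
  -- There are finitely many words of length `k`; the sum of their constants serves for all of them.
  -- Words of other lengths receive the dummy value `1` so that the choice is total.
  have hword : ∀ w : List (Fin n ⊕ Fin n), ∃ C : ℝ, 0 < C ∧ (w.length = k → _) := fun w =>
    if hw : w.length = k then
      (TwistedDrift.exists_weakType_riesz hn hM w (by omega)).imp fun C hC => ⟨hC.1, fun _ => hC.2⟩
    else ⟨1, one_pos, fun h => absurd h hw⟩
  choose C hC h using hword
  have hsum : 0 ≤ ∑ w ∈ hfin.toFinset, C w := Finset.sum_nonneg fun w _ => (hC w).le
  refine ⟨1 + ∑ w ∈ hfin.toFinset, C w, by positivity, fun lam ν hν hl w hw => ?_⟩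
  have hν' : 0 < ‖ν‖ ^ 2 := by have := norm_pos_iff.2 hν; positivity
  rw [le_div_iff₀ hν'] at hl
  -- The lower bound on `|λ|` forces `λ ≠ 0`, so the inverse exists.
  have hl0 : lam ≠ 0 := abs_pos.1 ((mul_pos hM hν').trans_le hl)
  obtain ⟨R, hR1, hR2⟩ := h w hw lam ν hν hl0 hl
  refine ⟨R, hR1, fun f α hα => (hR2 f α hα).trans ?_⟩
  gcongr
  have := Finset.single_le_sum (f := C) (fun w _ => (hC w).le) (hfin.mem_toFinset.2 hw)
  linarith
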